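/- Let $d\in\mathbb N$, $d\ge 1$, $\Omega=(0,1)^d$, $N\in\mathbb N_0$. Let $\psi_0,\psi_1\in C^N(\mathbb R)$ be compactly supported (complex-valued) functions with $\int x^k\psi_1(x)\,dx=0$ for $k=0,\dots,N$ such that, with $\psi_{0,m}(x)=\psi_0(x-m)$ and $\psi_{j,m}(x)=\sqrt{1/2}\,\psi_1(2^{j-1}x-m)$ for $j\ge 1$, the system $\{2^{j/2}\psi_{j,m}: j\in\mathbb N_0,\ m\in\mathbb Z\}$ is an orthonormal basis of $L_2(\mathbb R)$. For $\nu\in\mathbb N_0^d$, $m\in\mathbb Z^d$ put $|\nu|_1=\nu_1+\dots+\nu_d$, $\Psi_{\nu,m}(x)=\prod_{l=1}^d\psi_{\nu_l,m_l}(x_l)$, $A_\nu^\Omega=\{m\in\mathbb Z^d:\operatorname{supp}\Psi_{\nu,m}\cap\Omega\ne\emptyset\}$, and let $\chi_{\nu,m}$ be the characteristic function of $\prod_{l}\big(2^{-\nu_l}m_l,\,2^{-\nu_l}(m_l+1)\big)$. For complex families $\lambda=(\lambda_{\nu,m})_{\nu\in\mathbb N_0^d,\,m\in A^\Omega_\nu}$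 and $t\in\mathbb R$ let $s^{t,\Omega}_{p,q}b$ ($0<p,q\le\infty$) and $s^{t,\Omega}_{p,q}f$ ($0<p<\infty$, $0<q\le\infty$) be the quasi-normed spaces of all $\lambda$ for which $$\|\lambda|s^{t,\Omega}_{p,q}b\|=\Big(\sum_{\nu}2^{|\nu|_1(t-\frac1p)q}\Big(\sum_{m\in A^\Omega_\nu}|\lambda_{\nu,m}|^p\Big)^{q/p}\Big)^{1/q},\qquad \|\lambda|s^{t,\Omega}_{p,q}f\|=\Big\|\Big(\sum_{\nu}\sum_{m\in A^\Omega_\nu}|2^{|\nu|_1t}\lambda_{\nu,m}\chi_{\nu,m}(\cdot)|^q\Big)^{1/q}\Big|L_p(\mathbb R^d)\Big\|,$$ respectively, is finite (suprema replace sums if $p$ or $q$ is $\infty$; $1/\infty=0$). For a bounded linear operator $T:X\to Y$ between quasi-normed spaces and $n\ge1$ let $a_n(T)=\inf\{\|T-A\|: A\in\mathcal L(X,Y),\ \operatorname{rank}A<n\}$ and let $x_n(T)=\sup\{a_n(TA): A\in\mathcal L(\ell_2,X),\ \|A\|\le1\}$ be the $n$-th Weyl number. Let $0<p_0\le\infty$,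 $0<p<\infty$, $t\in\mathbb R$. In each of the cases below the identity $id^*:s^{t,\Omega}_{p_0,p_0}b\to s^{0,\Omega}_{p,2}f$ is well defined and bounded, and its Weyl numbers satisfy the stated two-sided estimate, where $\asymp$ means equality up to positive constants not depending on $n$. 1. If $p_0\le2\le p$ and $t>\frac1{p_0}-\frac1p$, then $x_n(id^*)\asymp n^{-t+\frac12-\frac1p}(\log n)^{(d-1)(t+\frac1p-\frac1{p_0})}$, $n\ge2$. 2. If $2\le p_0\le p$ and $t>\frac1{p_0}-\frac1p$, then $x_n(id^*)\asymp n^{-t+\frac1{p_0}-\frac1p}(\log n)^{(d-1)(t+\frac1p-\frac1{p_0})}$, $n\ge2$. 3. If $2\le p<p_0\le\infty$ and $t>\frac{1/p-1/p_0}{p_0/2-1}$ (read as $t>0$ if $p_0=\infty$), then $x_n(id^*)\asymp n^{-t+\frac1{p_0}-\frac1p}(\log n)^{(d-1)(t+\frac1p-\frac1{p_0})}$, $n\ge2$. 4. If $2\le p<p_0<\infty$ and $0<t<\frac{1/p-1/p_0}{p_0/2-1}$, then $x_n(id^*)\asymp n^{-\frac{tp_0}2}(\log n)^{(d-1)(t+\frac12-\frac1{p_0})}$,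 $n\ge2$. 5. Let $p_0,p\le2$ and $t>\max\big(\frac1{p_0}-\frac1p,0\big)$. (i) If $t>\frac1{p_0}-\frac12$, then $x_n(id^*)\asymp n^{-t}(\log n)^{(d-1)(t+\frac12-\frac1{p_0})}$, $n\ge2$. (ii) If $t<\frac1{p_0}-\frac12$, then $x_n(id^*)\asymp n^{-t}$, $n\ge1$. 6. If $p\le2<p_0\le\infty$ and $t>\frac1{p_0}$, then $x_n(id^*)\asymp n^{-t+\frac1{p_0}-\frac12}(\log n)^{(d-1)(t+\frac12-\frac1{p_0})}$, $n\ge2$. 7. If $p\le2<p_0<\infty$ and $0<t<\frac1{p_0}$, then $x_n(id^*)\asymp n^{-\frac{tp_0}2}(\log n)^{(d-1)(t+\frac12-\frac1{p_0})}$, $n\ge2$. -/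

import Mathlib

open MeasureTheory Set
open scoped ENNReal NNReal

noncomputable section

namespace MixedWeyl

/-! ### Quasi-norms, approximation numbers and Weyl numbers -/

/-- A quasi-norm on a complex vector space. -/
structure QuasiNorm (X : Type*) [AddCommGroup X] [Module ℂ X] where
  toFun : X → ℝ≥0
  eq_zero_of_toFun_eq_zero : ∀ x, toFun x = 0 → x = 0
  smul : ∀ (c : ℂ) (x : X), toFun (c • x) = ‖c‖₊ * toFun x
  add_le : ∃ K : ℝ≥0, ∀ x y, toFun (x + y) ≤ K * (toFun x + toFun y)

/-- The quasi-norm given by the norm of a normed space. -/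
def normQuasiNorm (X : Type*) [NormedAddCommGroup X] [NormedSpace ℂ X] : QuasiNorm X where
  toFun x := ‖x‖₊
  eq_zero_of_toFun_eq_zero x h := by simpa using h
  smul c x := nnnorm_smul c x
  add_le := ⟨1, fun x y => by simpa using nnnorm_add_le x y⟩

/-- The operator quasi-norm `sup {‖T x‖ : ‖x‖ ≤ 1}`; it is `∞` exactly for the linear operators
that are not continuous. -/
def opNorm {X Y : Type*} [AddCommGroup X] [Module ℂ X] [AddCommGroup Y] [Module ℂ Y]
    (NX : QuasiNorm X) (NY : QuasiNorm Y) (T : X →ₗ[ℂ] Y) : ℝ≥0∞ :=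
  ⨆ (x : X) (_ : NX.toFun x ≤ 1), (NY.toFun (T x) : ℝ≥0∞)

/-- The `n`-th approximation number (`n ≥ 1`):
`a_n(T) = inf {‖T - A‖ : A ∈ L(X,Y), rank A < n}`. -/
def approxNumber {X Y : Type*} [AddCommGroup X] [Module ℂ X] [AddCommGroup Y] [Module ℂ Y]
    (NX : QuasiNorm X) (NY : QuasiNorm Y) (T : X →ₗ[ℂ] Y) (n : ℕ) : ℝ≥0∞ :=
  ⨅ (A : X →ₗ[ℂ] Y) (_ : opNorm NX NY A < ∞) (_ : A.rank < (n : Cardinal)), opNorm NX NY (T - A)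

/-- The Hilbert space `ℓ₂` of complex sequences. -/
abbrev ell2 : Type := lp (fun _ : ℕ => ℂ) 2

/-- The `n`-th Weyl number (`n ≥ 1`):
`x_n(T) = sup {a_n(T A) : A ∈ L(ℓ₂, X), ‖A‖ ≤ 1}`. -/
def weylNumber {X Y : Type*} [AddCommGroup X] [Module ℂ X] [AddCommGroup Y] [Module ℂ Y]
    (NX : QuasiNorm X) (NY : QuasiNorm Y) (T : X →ₗ[ℂ] Y) (n : ℕ) : ℝ≥0∞ :=
  ⨆ (A : ell2 →ₗ[ℂ] X) (_ : opNorm (normQuasiNorm ell2) NX A ≤ 1),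
    approxNumber (normQuasiNorm ell2) NY (T ∘ₗ A) n

/-! ### Wavelets and index sets -/

/-- `ψ_{0,m}(x) = ψ₀(x - m)` and `ψ_{j,m}(x) = √(1/2) ψ₁(2^{j-1} x - m)` for `j ≥ 1`. -/
def wavelet (ψ₀ ψ₁ : ℝ → ℂ) : ℕ → ℤ → ℝ → ℂ
  | 0, m, x => ψ₀ (x - m)
  | j + 1, m, x => (Real.sqrt (1 / 2) : ℂ) * ψ₁ (2 ^ j * x - m)

/-- `ψ₀, ψ₁ ∈ C^N(ℝ)` are compactly supported, `ψ₁` has vanishing moments of orders `0, …, N`, and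
`{2^{j/2} ψ_{j,m} : j ∈ ℕ₀, m ∈ ℤ}` is an orthonormal basis of `L₂(ℝ)`. -/
structure IsWaveletPair (N : ℕ) (ψ₀ ψ₁ : ℝ → ℂ) : Prop where
  contDiff_zero : ContDiff ℝ N ψ₀
  contDiff_one : ContDiff ℝ N ψ₁
  hasCompactSupport_zero : HasCompactSupport ψ₀
  hasCompactSupport_one : HasCompactSupport ψ₁
  moments : ∀ k : ℕ, k ≤ N → ∫ x : ℝ, (x : ℂ) ^ k * ψ₁ x = 0
  orthonormalBasis : ∃ b : HilbertBasis (ℕ × ℤ) ℂ (Lp ℂ 2 (volume : Measure ℝ)),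
    ∀ (j : ℕ) (m : ℤ), b (j, m) =ᵐ[volume]
      fun x => (((2 : ℝ) ^ ((j : ℝ) / 2) : ℝ) : ℂ) * wavelet ψ₀ ψ₁ j m x

variable {d : ℕ}

/-- The tensor product wavelet `Ψ_{ν,m}`. -/
def tensorWavelet (ψ₀ ψ₁ : ℝ → ℂ) (ν : Fin d → ℕ) (m : Fin d → ℤ) (x : Fin d → ℝ) : ℂ :=
  ∏ l, wavelet ψ₀ ψ₁ (ν l) (m l) (x l)

/-- The open unit cube `Ω = (0,1)^d`. -/
def unitCube (d : ℕ) : Set (Fin d → ℝ) := {x | ∀ l, 0 < x l ∧ x l < 1}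

/-- `A_ν^Ω = {m ∈ ℤ^d : supp Ψ_{ν,m} ∩ Ω ≠ ∅}`. -/
def omegaIndex (ψ₀ ψ₁ : ℝ → ℂ) (ν : Fin d → ℕ) : Set (Fin d → ℤ) :=
  {m | (tsupport (tensorWavelet ψ₀ ψ₁ ν m) ∩ unitCube d).Nonempty}

/-- The open dyadic rectangle `Q_{ν,m}`. -/
def dyadicCube (ν : Fin d → ℕ) (m : Fin d → ℤ) : Set (Fin d → ℝ) :=
  {x | ∀ l, (2 : ℝ) ^ (-(ν l : ℝ)) * m l < x l ∧ x l < (2 : ℝ) ^ (-(ν l : ℝ)) * (m l + 1)}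

/-- `|ν|₁ = ν_1 + … + ν_d`. -/
def levelSum (ν : Fin d → ℕ) : ℕ := ∑ l, ν l

/-- `1/p ∈ [0,∞)` for `p ∈ (0,∞]`, with `1/∞ = 0`. -/
def recip (p : ℝ≥0∞) : ℝ := (p⁻¹).toReal

/-! ### Elementary facts on `ℓ_q` quasi-norms -/

/-- The `ℓ_q` quasi-norm of a nonnegative family, with the supremum for `q = ∞`. -/
def lqNorm {ι : Type*} (q : ℝ≥0∞) (a : ι → ℝ≥0∞) : ℝ≥0∞ :=
  if q = ∞ then ⨆ i, a i else (∑' i, a i ^ q.toReal) ^ (1 / q.toReal)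

theorem add_rpow_le_two (r : ℝ) (hr : 0 ≤ r) (b c : ℝ≥0∞) :
    (b + c) ^ r ≤ 2 ^ r * (b ^ r + c ^ r) := by
  have h : b + c ≤ 2 * max b c := by
    rw [two_mul]; exact add_le_add (le_max_left _ _) (le_max_right _ _)
  calc (b + c) ^ r ≤ (2 * max b c) ^ r := ENNReal.rpow_le_rpow h hr
    _ = 2 ^ r * (max b c) ^ r := ENNReal.mul_rpow_of_nonneg _ _ hr
    _ ≤ 2 ^ r * (b ^ r + c ^ r) := by
        gcongr
        rcases le_total b c with h | h
        · rw [max_eq_right h]; exact le_add_self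
        · rw [max_eq_left h]; exact le_self_add

theorem lqNorm_mono {ι : Type*} (q : ℝ≥0∞) {a b : ι → ℝ≥0∞} (h : ∀ i, a i ≤ b i) :
    lqNorm q a ≤ lqNorm q b := by
  unfold lqNorm
  split_ifs
  · exact iSup_mono h
  · exact ENNReal.rpow_le_rpow
      (ENNReal.tsum_le_tsum fun i => ENNReal.rpow_le_rpow (h i) ENNReal.toReal_nonneg) (by positivity)

theorem lqNorm_add (q : ℝ≥0∞) : ∃ K : ℝ≥0, ∀ {ι : Type*} (a b : ι → ℝ≥0∞),
    lqNorm q (fun i => a i + b i) ≤ K * (lqNorm q a + lqNorm q b) := by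
  by_cases hq : q = ∞
  · refine ⟨1, fun a b => ?_⟩
    simp only [lqNorm, hq, if_true, ENNReal.coe_one, one_mul]
    exact iSup_le fun i => add_le_add (le_iSup a i) (le_iSup b i)
  · set r := q.toReal with hr
    have hr0 : 0 ≤ r := ENNReal.toReal_nonneg
    have hs0 : 0 ≤ 1 / r := by positivity
    have hK : ((2 : ℝ≥0∞) ^ r) ^ (1 / r) * 2 ^ (1 / r) ≠ ∞ :=
      ENNReal.mul_ne_top
        (ENNReal.rpow_ne_top_of_nonneg hs0 (ENNReal.rpow_ne_top_of_nonneg hr0 (by simp)))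
        (ENNReal.rpow_ne_top_of_nonneg hs0 (by simp))
    refine ⟨(((2 : ℝ≥0∞) ^ r) ^ (1 / r) * 2 ^ (1 / r)).toNNReal, fun a b => ?_⟩
    rw [ENNReal.coe_toNNReal hK]
    simp only [lqNorm, hq, if_false, ← hr]
    calc (∑' i, (a i + b i) ^ r) ^ (1 / r)
        ≤ (∑' i, 2 ^ r * (a i ^ r + b i ^ r)) ^ (1 / r) :=
          ENNReal.rpow_le_rpow (ENNReal.tsum_le_tsum fun i => add_rpow_le_two r hr0 _ _) hs0
      _ = (2 ^ r) ^ (1 / r) * (∑' i, a i ^ r + ∑' i, b i ^ r) ^ (1 / r) := by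
          rw [ENNReal.tsum_mul_left, ENNReal.tsum_add, ENNReal.mul_rpow_of_nonneg _ _ hs0]
      _ ≤ (2 ^ r) ^ (1 / r) *
            (2 ^ (1 / r) * ((∑' i, a i ^ r) ^ (1 / r) + (∑' i, b i ^ r) ^ (1 / r))) := by
          gcongr; exact add_rpow_le_two _ hs0 _ _
      _ = _ := by rw [mul_assoc]

theorem lqNorm_const_mul {ι : Type*} {q : ℝ≥0∞} (hq : 0 < q) (c : ℝ≥0∞) (a : ι → ℝ≥0∞) :
    lqNorm q (fun i => c * a i) = c * lqNorm q a := by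
  unfold lqNorm
  split_ifs with h
  · rw [ENNReal.mul_iSup]
  · have hr : 0 < q.toReal := ENNReal.toReal_pos hq.ne' h
    simp only [ENNReal.mul_rpow_of_nonneg _ _ hr.le]
    rw [ENNReal.tsum_mul_left, ENNReal.mul_rpow_of_nonneg _ _ (by positivity), ← ENNReal.rpow_mul,
      mul_one_div_cancel hr.ne', ENNReal.rpow_one]

theorem lqNorm_eq_zero {ι : Type*} {q : ℝ≥0∞} (hq : 0 < q) (a : ι → ℝ≥0∞) (h : lqNorm q a = 0)
    (i : ι) : a i = 0 := by
  unfold lqNorm at h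
  split_ifs at h with h'
  · exact (ENNReal.iSup_eq_zero.1 h) i
  · have hr : 0 < q.toReal := ENNReal.toReal_pos hq.ne' h'
    rw [ENNReal.rpow_eq_zero_iff_of_pos (by positivity), ENNReal.tsum_eq_zero] at h
    exact (ENNReal.rpow_eq_zero_iff_of_pos hr).1 (h i)

theorem lqNorm_zero {ι : Type*} {q : ℝ≥0∞} (hq : 0 < q) :
    lqNorm q (fun _ : ι => (0 : ℝ≥0∞)) = 0 := by
  simpa using lqNorm_const_mul (ι := ι) hq 0 (fun _ => 0)

theorem measurable_lqNorm {ι α : Type*} [Countable ι] [MeasurableSpace α] (q : ℝ≥0∞)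
    (a : α → ι → ℝ≥0∞) (h : ∀ i, Measurable fun x => a x i) :
    Measurable fun x => lqNorm q (a x) := by
  unfold lqNorm
  split_ifs
  · exact Measurable.iSup h
  · exact (Measurable.tsum fun i => (h i).pow_const _).pow_const _

/-! ### The sequence spaces -/

/-- Complex families `λ = (λ_{ν,m})`, `ν ∈ ℕ₀^d`, `m ∈ A_ν^Ω`. -/
abbrev SeqFamily (d : ℕ) (ψ₀ ψ₁ : ℝ → ℂ) : Type :=
  (ν : Fin d → ℕ) → omegaIndex ψ₀ ψ₁ ν → ℂ

variable {ψ₀ ψ₁ : ℝ → ℂ}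

/-- `‖λ | s^{t,Ω}_{p,q} b‖ = (∑_ν 2^{|ν|₁(t-1/p)q} (∑_m |λ_{ν,m}|^p)^{q/p})^{1/q}`, in `[0,∞]`. -/
def bENorm (t : ℝ) (p q : ℝ≥0∞) (a : SeqFamily d ψ₀ ψ₁) : ℝ≥0∞ :=
  lqNorm q fun ν : Fin d → ℕ =>
    (2 : ℝ≥0∞) ^ ((levelSum ν : ℝ) * (t - recip p)) * lqNorm p fun m => ‖a ν m‖ₑ

/-- `x ↦ (∑_{ν,m} |2^{|ν|₁ t} λ_{ν,m} χ_{ν,m}(x)|^q)^{1/q}`. -/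
def fSquareFun (t : ℝ) (q : ℝ≥0∞) (a : SeqFamily d ψ₀ ψ₁) (x : Fin d → ℝ) : ℝ≥0∞ :=
  lqNorm q fun k : (Σ ν : Fin d → ℕ, omegaIndex ψ₀ ψ₁ ν) =>
    (2 : ℝ≥0∞) ^ ((levelSum k.1 : ℝ) * t) * ‖a k.1 k.2‖ₑ *
      (dyadicCube k.1 k.2.1).indicator (fun _ => 1) x

/-- `‖λ | s^{t,Ω}_{p,q} f‖`: the `L_p(ℝ^d)` quasi-norm of `fSquareFun`, in `[0,∞]`. -/
def fENorm (t : ℝ) (p q : ℝ≥0∞) (a : SeqFamily d ψ₀ ψ₁) : ℝ≥0∞ :=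
  eLpNorm (fSquareFun t q a) p volume

theorem bENorm_add (t : ℝ) (p q : ℝ≥0∞) : ∃ K : ℝ≥0, ∀ a b : SeqFamily d ψ₀ ψ₁,
    bENorm t p q (a + b) ≤ K * (bENorm t p q a + bENorm t p q b) := by
  obtain ⟨K₁, h₁⟩ := lqNorm_add p
  obtain ⟨K₂, h₂⟩ := lqNorm_add q
  rcases eq_or_ne q 0 with rfl | hq
  · refine ⟨1, fun a b => ?_⟩
    simp [bENorm, lqNorm]
  refine ⟨K₁ * K₂, fun a b => ?_⟩
  unfold bENorm
  calc _ ≤ lqNorm q fun ν : Fin d → ℕ => (K₁ : ℝ≥0∞) *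
          ((2 : ℝ≥0∞) ^ ((levelSum ν : ℝ) * (t - recip p)) * lqNorm p (fun m => ‖a ν m‖ₑ) +
          (2 : ℝ≥0∞) ^ ((levelSum ν : ℝ) * (t - recip p)) * lqNorm p (fun m => ‖b ν m‖ₑ)) := by
        refine lqNorm_mono q fun ν => ?_
        rw [← mul_add, mul_left_comm]
        gcongr
        exact (lqNorm_mono p fun m => enorm_add_le (a ν m) (b ν m)).trans (h₁ _ _)
    _ ≤ _ := by
        rw [lqNorm_const_mul (pos_iff_ne_zero.2 hq), ENNReal.coe_mul, mul_assoc]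
        gcongr
        exact h₂ _ _

theorem bENorm_smul (t : ℝ) {p q : ℝ≥0∞} (hp : 0 < p) (hq : 0 < q) (c : ℂ)
    (a : SeqFamily d ψ₀ ψ₁) : bENorm t p q (c • a) = ‖c‖ₑ * bENorm t p q a := by
  unfold bENorm
  rw [← lqNorm_const_mul hq]
  congr 1
  funext ν
  rw [mul_left_comm, ← lqNorm_const_mul hp ‖c‖ₑ]
  simp only [Pi.smul_apply, enorm_smul]

theorem bENorm_eq_zero (t : ℝ) {p q : ℝ≥0∞} (hp : 0 < p) (hq : 0 < q)
    (a : SeqFamily d ψ₀ ψ₁) (h : bENorm t p q a = 0) : a = 0 := by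
  funext ν m
  have h1 := lqNorm_eq_zero hq _ h ν
  rcases mul_eq_zero.1 h1 with h2 | h2
  · exact absurd h2 (ENNReal.rpow_pos (by simp) (by simp)).ne'
  · simpa using lqNorm_eq_zero hp _ h2 m

theorem isOpen_dyadicCube (ν : Fin d → ℕ) (m : Fin d → ℤ) : IsOpen (dyadicCube ν m) := by
  have : dyadicCube ν m = ⋂ l, ({x : Fin d → ℝ | (2 : ℝ) ^ (-(ν l : ℝ)) * m l < x l} ∩
      {x : Fin d → ℝ | x l < (2 : ℝ) ^ (-(ν l : ℝ)) * (m l + 1)}) := by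
    ext x; simp [dyadicCube]
  rw [this]
  exact isOpen_iInter_of_finite fun l =>
    (isOpen_lt continuous_const (continuous_apply l)).inter
      (isOpen_lt (continuous_apply l) continuous_const)

theorem dyadicCube_nonempty (ν : Fin d → ℕ) (m : Fin d → ℤ) : (dyadicCube ν m).Nonempty := by
  refine ⟨fun l => (2 : ℝ) ^ (-(ν l : ℝ)) * (m l + 1 / 2), fun l => ?_⟩
  have : (0 : ℝ) < (2 : ℝ) ^ (-(ν l : ℝ)) := by positivity
  exact ⟨mul_lt_mul_of_pos_left (by linarith) this, mul_lt_mul_of_pos_left (by linarith) this⟩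

theorem measurable_fSquareFun (t : ℝ) (q : ℝ≥0∞) (a : SeqFamily d ψ₀ ψ₁) :
    Measurable (fSquareFun t q a) :=
  measurable_lqNorm q _ fun _ =>
    (measurable_const.indicator (isOpen_dyadicCube _ _).measurableSet).const_mul _

theorem fSquareFun_add (t : ℝ) (q : ℝ≥0∞) : ∃ K : ℝ≥0, ∀ (a b : SeqFamily d ψ₀ ψ₁) (x : Fin d → ℝ),
    fSquareFun t q (a + b) x ≤ K * (fSquareFun t q a x + fSquareFun t q b x) := by
  obtain ⟨K, hK⟩ := lqNorm_add q
  refine ⟨K, fun a b x => (lqNorm_mono q fun k => ?_).trans (hK _ _)⟩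
  rw [← add_mul, ← mul_add]
  gcongr
  exact enorm_add_le (a k.1 k.2) (b k.1 k.2)

theorem eLpNorm_const_mul_enn {α : Type*} [MeasurableSpace α] {μ : Measure α} (p c : ℝ≥0∞)
    (hc : c ≠ ∞) (g : α → ℝ≥0∞) :
    eLpNorm (fun x => c * g x) p μ = c * eLpNorm g p μ := by
  rcases eq_or_ne p 0 with rfl | hp
  · simp
  rcases eq_or_ne p ∞ with rfl | hp'
  · simp only [eLpNorm_exponent_top, eLpNormEssSup_eq_essSup_enorm, enorm_eq_self]
    exact ENNReal.essSup_const_mul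
  · have hr : 0 < p.toReal := ENNReal.toReal_pos hp hp'
    simp only [eLpNorm_eq_lintegral_rpow_enorm_toReal hp hp', enorm_eq_self,
      ENNReal.mul_rpow_of_nonneg _ _ hr.le]
    rw [lintegral_const_mul' _ _ (ENNReal.rpow_ne_top_of_nonneg hr.le hc),
      ENNReal.mul_rpow_of_nonneg _ _ (by positivity), ← ENNReal.rpow_mul,
      mul_one_div_cancel hr.ne', ENNReal.rpow_one]

theorem fENorm_add (t : ℝ) (p q : ℝ≥0∞) : ∃ K : ℝ≥0, ∀ a b : SeqFamily d ψ₀ ψ₁,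
    fENorm t p q (a + b) ≤ K * (fENorm t p q a + fENorm t p q b) := by
  obtain ⟨K, hK⟩ := fSquareFun_add (d := d) (ψ₀ := ψ₀) (ψ₁ := ψ₁) t q
  have hL : ENNReal.LpAddConst p ≠ ∞ := (ENNReal.LpAddConst_lt_top p).ne
  refine ⟨K * (ENNReal.LpAddConst p).toNNReal, fun a b => ?_⟩
  rw [ENNReal.coe_mul, ENNReal.coe_toNNReal hL, mul_assoc]
  calc fENorm t p q (a + b)
      ≤ eLpNorm (fun x => (K : ℝ≥0∞) * (fSquareFun t q a + fSquareFun t q b) x) p volume :=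
        eLpNorm_mono_enorm fun x => hK a b x
    _ = K * eLpNorm (fSquareFun t q a + fSquareFun t q b) p volume :=
        eLpNorm_const_mul_enn p _ (by simp) _
    _ ≤ _ := by
        gcongr
        exact eLpNorm_add_le' (measurable_fSquareFun t q a).aestronglyMeasurable
          (measurable_fSquareFun t q b).aestronglyMeasurable p

theorem fENorm_smul (t : ℝ) (p : ℝ≥0∞) {q : ℝ≥0∞} (hq : 0 < q) (c : ℂ)
    (a : SeqFamily d ψ₀ ψ₁) : fENorm t p q (c • a) = ‖c‖ₑ * fENorm t p q a := by
  unfold fENorm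
  rw [← eLpNorm_const_mul_enn p _ (by simp)]
  congr 1
  funext x
  unfold fSquareFun
  rw [← lqNorm_const_mul hq]
  simp only [Pi.smul_apply, enorm_smul, mul_assoc, mul_left_comm]

theorem fENorm_eq_zero (t : ℝ) {p q : ℝ≥0∞} (hp : 0 < p) (hq : 0 < q)
    (a : SeqFamily d ψ₀ ψ₁) (h : fENorm t p q a = 0) : a = 0 := by
  funext ν m
  have h1 := (eLpNorm_eq_zero_iff (measurable_fSquareFun t q a).aestronglyMeasurable hp.ne').1 h
  have h2 := (isOpen_dyadicCube ν m.1).measure_pos volume (dyadicCube_nonempty ν m.1)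
  obtain ⟨x, hx, hx0⟩ : ∃ x ∈ dyadicCube ν m.1, fSquareFun t q a x = 0 := by
    by_contra! hcon
    exact h2.ne' (measure_mono_null (fun x hx => hcon x hx) (ae_iff.1 h1))
  have h3 := lqNorm_eq_zero hq _ hx0 ⟨ν, m⟩
  simp only [indicator_of_mem hx, mul_one] at h3
  rcases mul_eq_zero.1 h3 with h2 | h2
  · exact absurd h2 (ENNReal.rpow_pos (by simp) (by simp)).ne'
  · simpa using h2

/-- The sequence space `s^{t,Ω}_{p,q} b`, `0 < p, q ≤ ∞`. -/
def bSpace (d : ℕ) (ψ₀ ψ₁ : ℝ → ℂ) (t : ℝ) {p q : ℝ≥0∞} (hp : 0 < p) (hq : 0 < q) :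
    Submodule ℂ (SeqFamily d ψ₀ ψ₁) where
  carrier := {a | bENorm t p q a < ∞}
  zero_mem' := by
    have := bENorm_smul t hp hq 0 (0 : SeqFamily d ψ₀ ψ₁)
    simp only [smul_zero, enorm_zero, zero_mul] at this
    simp [this]
  add_mem' {a b} ha hb := by
    obtain ⟨K, hK⟩ := bENorm_add (d := d) (ψ₀ := ψ₀) (ψ₁ := ψ₁) t p q
    exact (hK a b).trans_lt (ENNReal.mul_lt_top (by simp) (ENNReal.add_lt_top.2 ⟨ha, hb⟩))
  smul_mem' c a ha := by
    simp only [mem_ofPred_eq, bENorm_smul t hp hq]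
    exact ENNReal.mul_lt_top (by simp) ha

/-- The sequence space `s^{t,Ω}_{p,q} f`, `0 < p < ∞`, `0 < q ≤ ∞`. -/
def fSpace (d : ℕ) (ψ₀ ψ₁ : ℝ → ℂ) (t : ℝ) {p q : ℝ≥0∞} (_hp : 0 < p) (hq : 0 < q) :
    Submodule ℂ (SeqFamily d ψ₀ ψ₁) where
  carrier := {a | fENorm t p q a < ∞}
  zero_mem' := by
    have := fENorm_smul t p hq 0 (0 : SeqFamily d ψ₀ ψ₁)
    simp only [smul_zero, enorm_zero, zero_mul] at this
    simp [this]
  add_mem' {a b} ha hb := by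
    obtain ⟨K, hK⟩ := fENorm_add (d := d) (ψ₀ := ψ₀) (ψ₁ := ψ₁) t p q
    exact (hK a b).trans_lt (ENNReal.mul_lt_top (by simp) (ENNReal.add_lt_top.2 ⟨ha, hb⟩))
  smul_mem' c a ha := by
    simp only [mem_ofPred_eq, fENorm_smul t p hq]
    exact ENNReal.mul_lt_top (by simp) ha

/-- The quasi-norm of `s^{t,Ω}_{p,q} b`. -/
def bQuasiNorm (d : ℕ) (ψ₀ ψ₁ : ℝ → ℂ) (t : ℝ) {p q : ℝ≥0∞} (hp : 0 < p) (hq : 0 < q) :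
    QuasiNorm (bSpace d ψ₀ ψ₁ t hp hq) where
  toFun a := (bENorm t p q a.1).toNNReal
  eq_zero_of_toFun_eq_zero a h := by
    rcases (ENNReal.toNNReal_eq_zero_iff _).1 h with h | h
    · exact Subtype.ext (bENorm_eq_zero t hp hq _ h)
    · exact absurd h (ne_of_lt a.2)
  smul c a := by
    rw [Submodule.coe_smul, bENorm_smul t hp hq, ENNReal.toNNReal_mul]
    simp
  add_le := by
    obtain ⟨K, hK⟩ := bENorm_add (d := d) (ψ₀ := ψ₀) (ψ₁ := ψ₁) t p q
    refine ⟨K, fun a b => ?_⟩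
    have ha : bENorm t p q a.1 ≠ ∞ := ne_of_lt a.2
    have hb : bENorm t p q b.1 ≠ ∞ := ne_of_lt b.2
    have hab : bENorm t p q (a + b).1 ≠ ∞ := ne_of_lt (a + b).2
    rw [← ENNReal.coe_le_coe, ENNReal.coe_toNNReal hab, ENNReal.coe_mul, ENNReal.coe_add,
      ENNReal.coe_toNNReal ha, ENNReal.coe_toNNReal hb]
    exact hK a.1 b.1

/-- The quasi-norm of `s^{t,Ω}_{p,q} f`. -/
def fQuasiNorm (d : ℕ) (ψ₀ ψ₁ : ℝ → ℂ) (t : ℝ) {p q : ℝ≥0∞} (hp : 0 < p) (hq : 0 < q) :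
    QuasiNorm (fSpace d ψ₀ ψ₁ t hp hq) where
  toFun a := (fENorm t p q a.1).toNNReal
  eq_zero_of_toFun_eq_zero a h := by
    rcases (ENNReal.toNNReal_eq_zero_iff _).1 h with h | h
    · exact Subtype.ext (fENorm_eq_zero t hp hq _ h)
    · exact absurd h (ne_of_lt a.2)
  smul c a := by
    rw [Submodule.coe_smul, fENorm_smul t p hq, ENNReal.toNNReal_mul]
    simp
  add_le := by
    obtain ⟨K, hK⟩ := fENorm_add (d := d) (ψ₀ := ψ₀) (ψ₁ := ψ₁) t p q
    refine ⟨K, fun a b => ?_⟩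
    have ha : fENorm t p q a.1 ≠ ∞ := ne_of_lt a.2
    have hb : fENorm t p q b.1 ≠ ∞ := ne_of_lt b.2
    have hab : fENorm t p q (a + b).1 ≠ ∞ := ne_of_lt (a + b).2
    rw [← ENNReal.coe_le_coe, ENNReal.coe_toNNReal hab, ENNReal.coe_mul, ENNReal.coe_add,
      ENNReal.coe_toNNReal ha, ENNReal.coe_toNNReal hb]
    exact hK a.1 b.1

/-- The identity `id* : s^{t,Ω}_{p₀,p₀} b → s^{0,Ω}_{p,2} f` is well defined and continuous, and
`x_n(id*) ≍ φ(n)` for all `n ≥ n₀`, with positive constants independent of `n`. -/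
def WeylOrder (d : ℕ) (ψ₀ ψ₁ : ℝ → ℂ) {p₀ p : ℝ≥0∞} (hp₀ : 0 < p₀) (hp : 0 < p) (t : ℝ)
    (n₀ : ℕ) (φ : ℕ → ℝ) : Prop :=
  ∃ h : bSpace d ψ₀ ψ₁ t hp₀ hp₀ ≤ fSpace d ψ₀ ψ₁ 0 hp (zero_lt_two : (0 : ℝ≥0∞) < 2),
    opNorm (bQuasiNorm d ψ₀ ψ₁ t hp₀ hp₀) (fQuasiNorm d ψ₀ ψ₁ 0 hp zero_lt_two)
      (Submodule.inclusion h) < ∞ ∧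
    ∃ c C : ℝ, 0 < c ∧ 0 < C ∧ ∀ n : ℕ, n₀ ≤ n →
      ENNReal.ofReal (c * φ n) ≤
          weylNumber (bQuasiNorm d ψ₀ ψ₁ t hp₀ hp₀) (fQuasiNorm d ψ₀ ψ₁ 0 hp zero_lt_two)
            (Submodule.inclusion h) n ∧
        weylNumber (bQuasiNorm d ψ₀ ψ₁ t hp₀ hp₀) (fQuasiNorm d ψ₀ ψ₁ 0 hp zero_lt_two)
            (Submodule.inclusion h) n ≤ ENNReal.ofReal (C * φ n)

/-- `n^{-α} (log n)^{(d-1)β}`. -/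
def polyLog (d : ℕ) (α β : ℝ) (n : ℕ) : ℝ :=
  (n : ℝ) ^ (-α) * Real.log n ^ (((d : ℝ) - 1) * β)

/-- `(1/p - 1/p₀) / (p₀/2 - 1)`, which is `0` for `p₀ = ∞`. -/
def smoothnessThreshold (p₀ p : ℝ≥0∞) : ℝ :=
  if p₀ = ∞ then 0 else (recip p - recip p₀) / (p₀.toReal / 2 - 1)

end MixedWeyl

end

/-! Since the inner operator `A` of a Weyl number starts from `ℓ₂`, orthogonal projections turn
approximation into a question on subspaces. From above, it is enough that `id* ∘ A` is small on the
orthogonal complement of some `V` with `dim V < n` (`UpperEst`). From below, one needs an operator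
from a finite-dimensional Hilbert space that is large somewhere on every subspace of codimension
less than `n` (`LowerEst`). The case `n = 1` of the upper estimate is the boundedness of `id*`
itself.

For the upper bounds the family `A x` is cut into blocks `|ν|₁ = μ`, each with about `2^μ
(μ+1)^(d-1)` coordinates, every one of them an inner product with a vector of `ℓ₂`. Two mechanisms
make the `ℓ₂` norm of a block small on a subspace of codimension `2c`. One is a Hilbert–Schmidt
count (`exists_codim_coeffSq_le_card`), used for `p₀ > 2`. The other, for `p₀ ≤ 2`, combines
Khinchine's inequality with the removal of the few large coordinates
(`exists_codim_coeffSq_le_rpow`). Interpolation with the trivial `ℓ_{p₀}` bound produces a family of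
intermediate estimates. The passage to the `L_p` norm of the square function uses the disjointness
of rectangles of one shape, Hölder's inequality, and, where a logarithmic loss must be avoided, a
Jawerth–Franke type embedding (`lintegral_blockFun_rpow_le_embedding`), which rests on the small
overlap of rectangles of different shapes.

Each block estimate has the form `2^(-μα) (μ+1)^β (c+1)^(-γ)`. Codimensions decaying geometrically
away from a critical level `J` make all errors geometrically summable. If one estimate with `α > 0`
suffices, all blocks below `J` are annihilated and `2^J (J+1)^(d-1)` is of order `n`. For small
smoothness one estimate with `α < 0` serves the blocks below `J` and another with `α > 0` those
above. The two then balance at `2^J (J+1)^(d-1)` of order `n^(p₀/2)`, or at `2^J` of order `n` in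
the case without logarithm.

The lower bounds live on one level, or on a single layer in the case without logarithm. A subspace
of half the dimension contains a vector with one large coordinate (`lowerEst_of_card`); for `p ≤ 2`
a random combination of an orthonormal basis spreads over all rectangles
(`lowerEst_of_card_of_le_two`). The rate `n^(-t p₀/2)` comes from a random sign matrix with `D` rows
and about `D^(2/p₀)` columns, whose norm from `ℓ₂` to `ℓ_{p₀}` is only of order `D^(1/p₀)`
(`exists_sign_matrix`). All rectangles lie in one bounded box, so upper estimates pass to smaller
`p` and lower estimates to larger `p`; several cases are thus reduced to `p = 2`. -/

namespace MixedWeyl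

/-! ### Rademacher averages -/

/-- The sign `±1` encoded by a Boolean. -/
def sgn (b : Bool) : ℝ := if b then 1 else -1

@[simp] theorem sgn_true : sgn true = 1 := rfl

@[simp] theorem sgn_false : sgn false = -1 := rfl

theorem sgn_mul_self (b : Bool) : sgn b * sgn b = 1 := by cases b <;> simp

theorem sum_signs_succ {M : Type*} [AddCommMonoid M] {n : ℕ} (f : (Fin (n + 1) → Bool) → M) :
    ∑ σ, f σ = ∑ τ : Fin n → Bool, (f (Fin.cons true τ) + f (Fin.cons false τ)) := by
  rw [← (Fin.consEquiv fun _ : Fin (n + 1) => Bool).sum_comp, Fintype.sum_prod_type,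
    Fintype.sum_bool, ← Finset.sum_add_distrib]
  rfl

section Moments

variable {E : Type*} [NormedAddCommGroup E] [InnerProductSpace ℂ E]

/-- The signed sum `∑ ± a_i`. -/
def signedSum {n : ℕ} (a : Fin n → E) (σ : Fin n → Bool) : E := ∑ i, (sgn (σ i) : ℂ) • a i

theorem signedSum_cons {n : ℕ} (a : Fin (n + 1) → E) (b : Bool) (τ : Fin n → Bool) :
    signedSum a (Fin.cons b τ) = (sgn b : ℂ) • a 0 + signedSum (fun i => a i.succ) τ := by
  simp [signedSum, Fin.sum_univ_succ]

/-- Orthogonality of the Rademacher functions; the parallelogram law averages out one sign at a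
time. -/
theorem sum_signedSum_sq {n : ℕ} (a : Fin n → E) :
    ∑ σ, ‖signedSum a σ‖ ^ 2 = 2 ^ n * ∑ i, ‖a i‖ ^ 2 := by
  induction n with
  | zero => simp [signedSum]
  | succ n ih =>
    have key : ∀ v : E, ‖a 0 + v‖ ^ 2 + ‖-a 0 + v‖ ^ 2 = 2 * ‖a 0‖ ^ 2 + 2 * ‖v‖ ^ 2 := by
      intro v
      have h := parallelogram_law_with_norm ℂ v (a 0)
      rw [show -a 0 + v = v - a 0 by abel, add_comm (a 0) v]
      nlinarith
    rw [sum_signs_succ]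
    simp only [signedSum_cons, sgn_true, sgn_false, Complex.ofReal_one, Complex.ofReal_neg,
      neg_smul, one_smul, key, Finset.sum_add_distrib, ← Finset.mul_sum, ih, Fin.sum_univ_succ]
    simp [pow_succ]
    ring

/-- The squares of `‖v ± u‖²` add up to `2 (‖v‖² + ‖u‖²)² + 8 (Re ⟨v, u⟩)²`, and Cauchy–Schwarz
bounds the last term. -/
theorem norm_add_pow_four_le (u v : E) :
    ‖u + v‖ ^ 4 + ‖-u + v‖ ^ 4 ≤ 2 * ‖v‖ ^ 4 + 12 * ‖u‖ ^ 2 * ‖v‖ ^ 2 + 2 * ‖u‖ ^ 4 := by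
  have h1 := norm_add_sq (𝕜 := ℂ) v u
  have h2 := norm_sub_sq (𝕜 := ℂ) v u
  have h3 : |RCLike.re (inner ℂ v u)| ≤ ‖v‖ * ‖u‖ :=
    (RCLike.abs_re_le_norm _).trans (norm_inner_le_norm _ _)
  have h4 : (RCLike.re (inner ℂ v u)) ^ 2 ≤ (‖v‖ * ‖u‖) ^ 2 := by
    rw [← sq_abs]; gcongr
  rw [show -u + v = v - u by abel, add_comm u v,
    show ‖v + u‖ ^ 4 = (‖v + u‖ ^ 2) ^ 2 by ring, show ‖v - u‖ ^ 4 = (‖v - u‖ ^ 2) ^ 2 by ring,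
    h1, h2]
  nlinarith

theorem sum_signedSum_pow_four {n : ℕ} (a : Fin n → E) :
    ∑ σ, ‖signedSum a σ‖ ^ 4 ≤ 2 ^ n * (3 * (∑ i, ‖a i‖ ^ 2) ^ 2) := by
  induction n with
  | zero => simp [signedSum]
  | succ n ih =>
    rw [sum_signs_succ]
    simp only [signedSum_cons, sgn_true, sgn_false, Complex.ofReal_one, Complex.ofReal_neg,
      neg_smul, one_smul]
    calc _ ≤ ∑ τ : Fin n → Bool, (2 * ‖signedSum (fun i => a i.succ) τ‖ ^ 4 +
          12 * ‖a 0‖ ^ 2 * ‖signedSum (fun i => a i.succ) τ‖ ^ 2 + 2 * ‖a 0‖ ^ 4) :=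
          Finset.sum_le_sum fun τ _ => norm_add_pow_four_le _ _
      _ ≤ 2 * (2 ^ n * (3 * (∑ i : Fin n, ‖a i.succ‖ ^ 2) ^ 2)) +
          12 * ‖a 0‖ ^ 2 * (2 ^ n * ∑ i : Fin n, ‖a i.succ‖ ^ 2) + 2 ^ n * (2 * ‖a 0‖ ^ 4) := by
          rw [Finset.sum_add_distrib, Finset.sum_add_distrib, ← Finset.mul_sum, ← Finset.mul_sum,
            sum_signedSum_sq]
          have := ih fun i => a i.succ
          have h : ∑ _τ : Fin n → Bool, 2 * ‖a 0‖ ^ 4 = 2 ^ n * (2 * ‖a 0‖ ^ 4) := by simp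
          rw [h]
          linarith
      _ ≤ _ := by
          rw [Fin.sum_univ_succ]
          have : 0 ≤ (2 : ℝ) ^ n * ‖a 0‖ ^ 4 := by positivity
          rw [pow_succ (2 : ℝ) n]
          nlinarith

/-- A quadratic minorant of `v^(q/2)` valid for all `q ∈ (0, 2]` at once, so that Khinchine's
inequality needs only the second and fourth moments. For `v ≥ 1` it holds because the parabola has
its maximum `1` at `v = 3`. -/
theorem khinchine_pointwise {q v : ℝ} (hq : 0 < q) (hq2 : q ≤ 2) (hv : 0 ≤ v) :
    2 / 3 * (v - v ^ 2 / 6) ≤ v ^ (q / 2) := by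
  rcases le_total v 1 with h | h
  · have : v ≤ v ^ (q / 2) := by
      rcases hv.eq_or_lt with rfl | hv
      · positivity
      · calc v = v ^ (1 : ℝ) := (Real.rpow_one v).symm
          _ ≤ v ^ (q / 2) := Real.rpow_le_rpow_of_exponent_ge hv h (by linarith)
    nlinarith
  · have : 1 ≤ v ^ (q / 2) := Real.one_le_rpow h (by positivity)
    nlinarith [sq_nonneg (v - 3)]

/-- The lower Khinchine inequality for exponents `0 < q ≤ 2`, with values in a Hilbert space. -/
theorem khinchine_lower {n : ℕ} (a : Fin n → E) {q : ℝ} (hq : 0 < q) (hq2 : q ≤ 2) :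
    2 ^ n * ((∑ i, ‖a i‖ ^ 2) ^ (q / 2) / 3) ≤ ∑ σ, ‖signedSum a σ‖ ^ q := by
  set s := ∑ i, ‖a i‖ ^ 2 with hs
  have hs0 : 0 ≤ s := Finset.sum_nonneg fun i _ => by positivity
  rcases hs0.eq_or_lt with h | h
  · rw [← h, Real.zero_rpow (by positivity)]
    simp only [zero_div, mul_zero]
    exact Finset.sum_nonneg fun i _ => by positivity
  -- The minorant is applied to `‖signedSum a σ‖² / s`, which has mean `1` and second moment at most
  -- `3`; this gives the factor `2/3 · (1 - 3/6) = 1/3`.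
  have h1 : ∀ σ, s ^ (q / 2) * (2 / 3 * (‖signedSum a σ‖ ^ 2 / s -
      (‖signedSum a σ‖ ^ 2 / s) ^ 2 / 6)) ≤ ‖signedSum a σ‖ ^ q := by
    intro σ
    calc _ ≤ s ^ (q / 2) * (‖signedSum a σ‖ ^ 2 / s) ^ (q / 2) := by
          gcongr
          exact khinchine_pointwise hq hq2 (by positivity)
      _ = _ := by
          rw [← Real.mul_rpow h.le (by positivity), mul_div_cancel₀ _ h.ne',
            ← Real.rpow_natCast, ← Real.rpow_mul (norm_nonneg _)]
          congr 1
          push_cast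
          ring
  refine le_trans ?_ (Finset.sum_le_sum fun σ _ => h1 σ)
  rw [← Finset.mul_sum, ← Finset.mul_sum, Finset.sum_sub_distrib, ← Finset.sum_div,
    ← Finset.sum_div, sum_signedSum_sq]
  simp only [div_pow, ← Finset.sum_div, ← pow_mul]
  have h4 := sum_signedSum_pow_four a
  rw [← hs] at h4 ⊢
  have h5 : (∑ σ, ‖signedSum a σ‖ ^ (2 * 2)) / s ^ 2 ≤ 2 ^ n * 3 := by
    rw [div_le_iff₀ (by positivity)]
    norm_num
    linarith
  have h6 : 2 ^ n * s / s = 2 ^ n := by field_simp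
  rw [h6]
  have h7 : 0 < s ^ (q / 2) := by positivity
  have : (2 : ℝ) ^ n * (1 / 3) ≤
      2 / 3 * (2 ^ n - (∑ σ, ‖signedSum a σ‖ ^ (2 * 2)) / s ^ 2 / 6) := by linarith
  nlinarith

end Moments

/-- Exponential square integrability of Rademacher sums. -/
theorem sum_signs_exp_sq_le {n : ℕ} (b : Fin n → ℝ) {a : ℝ} (h : 2 * ∑ i, b i ^ 2 < a) :
    ∑ σ : Fin n → Bool, Real.exp ((∑ i, b i * sgn (σ i)) ^ 2 / a) ≤
      2 ^ n * Real.exp ((∑ i, b i ^ 2) / (a - 2 * ∑ i, b i ^ 2)) := by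
  induction n generalizing a with
  | zero => simp
  | succ n ih =>
    rw [Fin.sum_univ_succ] at h
    have hs0 : 0 ≤ ∑ i : Fin n, b i.succ ^ 2 := Finset.sum_nonneg fun i _ => by positivity
    set s := ∑ i : Fin n, b i.succ ^ 2 with hs
    set c := b 0 with hc
    have hc0 : 0 ≤ c ^ 2 := by positivity
    have ha : 0 < a := by linarith
    have ha2 : 0 < a - 2 * c ^ 2 := by linarith
    -- Averaging over the first sign costs a factor `exp (c²/a)` and, through `cosh y ≤ exp (y²/2)`,
    -- lowers the denominator from `a` to `a - 2c²`; the induction therefore runs over all `a`.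
    have key : ∀ z : ℝ, Real.exp ((c * 1 + z) ^ 2 / a) + Real.exp ((c * -1 + z) ^ 2 / a) ≤
        2 * Real.exp (c ^ 2 / a) * Real.exp (z ^ 2 / (a - 2 * c ^ 2)) := by
      intro z
      have e1 : (c * 1 + z) ^ 2 / a = (c ^ 2 + z ^ 2) / a + 2 * c * z / a := by ring
      have e2 : (c * -1 + z) ^ 2 / a = (c ^ 2 + z ^ 2) / a + -(2 * c * z / a) := by ring
      have e3 := Real.cosh_le_exp_half_sq (2 * c * z / a)
      rw [Real.cosh_eq] at e3
      rw [e1, e2, Real.exp_add, Real.exp_add, ← mul_add]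
      have e4 : z ^ 2 / a + (2 * c * z / a) ^ 2 / 2 ≤ z ^ 2 / (a - 2 * c ^ 2) := by
        rw [show z ^ 2 / a + (2 * c * z / a) ^ 2 / 2 = z ^ 2 * ((a + 2 * c ^ 2) / a ^ 2) by
          field_simp, div_eq_mul_inv (z ^ 2)]
        gcongr
        rw [inv_eq_one_div, div_le_div_iff₀ (by positivity) ha2]
        nlinarith [sq_nonneg (c ^ 2)]
      calc _ ≤ Real.exp ((c ^ 2 + z ^ 2) / a) * (2 * Real.exp ((2 * c * z / a) ^ 2 / 2)) := by
            gcongr; linarith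
        _ = 2 * Real.exp (c ^ 2 / a) * Real.exp (z ^ 2 / a + (2 * c * z / a) ^ 2 / 2) := by
            rw [add_div, Real.exp_add, Real.exp_add]; ring
        _ ≤ _ := by gcongr
    rw [sum_signs_succ]
    simp only [Fin.sum_univ_succ, Fin.cons_zero, Fin.cons_succ, sgn_true, sgn_false]
    calc _ ≤ ∑ τ : Fin n → Bool, 2 * Real.exp (c ^ 2 / a) *
          Real.exp ((∑ i : Fin n, b i.succ * sgn (τ i)) ^ 2 / (a - 2 * c ^ 2)) :=
          Finset.sum_le_sum fun τ _ => key _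
      _ ≤ 2 * Real.exp (c ^ 2 / a) * (2 ^ n * Real.exp (s / (a - 2 * c ^ 2 - 2 * s))) := by
          rw [← Finset.mul_sum]
          gcongr
          exact ih _ (by linarith)
      _ = 2 ^ (n + 1) * Real.exp (c ^ 2 / a + s / (a - 2 * c ^ 2 - 2 * s)) := by
          rw [Real.exp_add]; ring
      _ ≤ _ := by
          gcongr
          rw [add_div, show a - 2 * c ^ 2 - 2 * s = a - 2 * (c ^ 2 + s) by ring]
          gcongr
          · linarith

end MixedWeyl

/-! ### Finite families of functionals on a Hilbert space, restricted to subspaces of small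
codimension. -/

namespace MixedWeyl

/-! ### Subspaces of small codimension in a Hilbert space -/

section Codim

variable {H : Type*} [NormedAddCommGroup H] [InnerProductSpace ℂ H]

local notation "⟪" x ", " y "⟫" => inner ℂ x y

/-- A greedy choice replacing the singular vectors of an operator. The next vector avoids each
earlier `e j` together with `G (e j)`, hence at most `2c` directions when at most `c` vectors are
already there. -/
theorem exists_orthonormal_of_forall_codim (c : ℕ) (G : H → H) (Q : H → Prop)
    (h : ∀ V : Submodule ℂ H, FiniteDimensional ℂ V → Module.finrank ℂ V ≤ 2 * c →
      ∃ x ∈ Vᗮ, ‖x‖ = 1 ∧ Q x) :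
    ∃ e : Fin (c + 1) → H, Orthonormal ℂ e ∧ (∀ i, Q (e i)) ∧ ∀ i j, j < i → ⟪e i, G (e j)⟫ = 0 := by
  suffices H' : ∀ m ≤ c + 1, ∃ e : Fin m → H, (∀ i, ‖e i‖ = 1) ∧ (∀ i, Q (e i)) ∧
      ∀ i j, j < i → ⟪e i, e j⟫ = 0 ∧ ⟪e i, G (e j)⟫ = 0 by
    obtain ⟨e, h1, h2, h3⟩ := H' (c + 1) le_rfl
    refine ⟨e, ⟨h1, fun i j hij => ?_⟩, h2, fun i j hij => (h3 i j hij).2⟩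
    rcases lt_or_gt_of_ne hij with h | h
    · exact inner_eq_zero_symm.1 (h3 j i h).1
    · exact (h3 i j h).1
  intro m
  induction m with
  | zero => exact fun _ => ⟨Fin.elim0, fun i => i.elim0, fun i => i.elim0, fun i => i.elim0⟩
  | succ m ih =>
    intro hm
    obtain ⟨e, h1, h2, h3⟩ := ih (by omega)
    let u : Fin m ⊕ Fin m → H := Sum.elim e (G ∘ e)
    obtain ⟨x, hx, hx1, hxQ⟩ := h (Submodule.span ℂ (range u))
        (FiniteDimensional.span_of_finite ℂ (finite_range u)) <| by
      refine (finrank_range_le_card u).trans ?_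
      simp
      omega
    have hxu : ∀ j, ⟪x, u j⟫ = 0 := fun j =>
      (Submodule.mem_orthogonal' _ _).1 hx _ (Submodule.subset_span (mem_range_self j))
    refine ⟨Fin.snoc (α := fun _ => H) e x, ?_, ?_, ?_⟩
    · intro i
      refine Fin.lastCases ?_ (fun i => ?_) i
      · simpa using hx1
      · simpa using h1 i
    · intro i
      refine Fin.lastCases ?_ (fun i => ?_) i
      · simpa using hxQ
      · simpa using h2 i
    · intro i j hij
      induction i using Fin.lastCases with
      | last =>
        induction j using Fin.lastCases with
        | last => exact absurd hij (lt_irrefl _)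
        | cast j => simpa using ⟨hxu (Sum.inl j), hxu (Sum.inr j)⟩
      | cast i =>
        induction j using Fin.lastCases with
        | last => exact absurd hij (not_lt.2 (Fin.le_last _))
        | cast j => simpa using h3 i j (by simpa using hij)

variable {ι : Type*} [Fintype ι]

/-- The squared `ℓ₂` norm of the coefficients of `x` against a finite family. -/
noncomputable def coeffSq (r : ι → H) (x : H) : ℝ := ∑ k, ‖⟪r k, x⟫‖ ^ 2

theorem coeffSq_smul (r : ι → H) (c : ℂ) (x : H) : coeffSq r (c • x) = ‖c‖ ^ 2 * coeffSq r x := by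
  simp only [coeffSq, inner_smul_right, norm_mul, mul_pow, Finset.mul_sum]

/-- If every subspace fails, the greedy choice with the Gram operator `x ↦ ∑ ⟪r k, x⟫ r k` yields `c
+ 1` orthonormal vectors with large and mutually orthogonal coefficient vectors. Upper estimates are
then proved by refuting such a system. -/
theorem exists_codim_coeffSq_le (r : ι → H) (c : ℕ) (B : ℝ)
    (h : ∀ e : Fin (c + 1) → H, Orthonormal ℂ e → (∀ i, B < coeffSq r (e i)) →
      (∀ i j, i ≠ j → ∑ k, (starRingEnd ℂ) ⟪r k, e i⟫ * ⟪r k, e j⟫ = 0) → False) :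
    ∃ V : Submodule ℂ H, FiniteDimensional ℂ V ∧ Module.finrank ℂ V ≤ 2 * c ∧
      ∀ x ∈ Vᗮ, coeffSq r x ≤ B * ‖x‖ ^ 2 := by
  by_contra! hcon
  obtain ⟨e, h1, h2, h3⟩ := exists_orthonormal_of_forall_codim c
    (fun x => ∑ k, ⟪r k, x⟫ • r k) (fun x => B < coeffSq r x) fun V hV hc => by
      obtain ⟨x, hx, hlt⟩ := hcon V hV hc
      have hx0 : x ≠ 0 := by
        rintro rfl
        simp [coeffSq] at hlt
      have hn : 0 < ‖x‖ := norm_pos_iff.2 hx0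
      refine ⟨((‖x‖⁻¹ : ℝ) : ℂ) • x, Vᗮ.smul_mem _ hx, ?_, ?_⟩
      · rw [norm_smul]
        simp [hn.ne']
      · rw [coeffSq_smul]
        simp only [Complex.norm_real, norm_inv, norm_norm]
        rw [inv_pow, inv_mul_eq_div, lt_div_iff₀ (by positivity)]
        exact hlt
  have h4 : ∀ i j, ⟪e i, ∑ k, ⟪r k, e j⟫ • r k⟫ =
      ∑ k, (starRingEnd ℂ) ⟪r k, e i⟫ * ⟪r k, e j⟫ := by
    intro i j
    rw [inner_sum]
    refine Finset.sum_congr rfl fun k _ => ?_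
    rw [inner_smul_right, inner_conj_symm, mul_comm]
  refine h e h1 h2 fun i j hij => ?_
  rcases lt_or_gt_of_ne hij with h' | h'
  · have := h3 j i h'
    rw [h4] at this
    have h5 := congrArg (starRingEnd ℂ) this
    simpa [map_sum, mul_comm] using h5
  · rw [← h4]
    exact h3 i j h'

/-- Hilbert–Schmidt argument: by Bessel's inequality for each `r k`, the values of `coeffSq` on an
orthonormal system add up to at most `card ι · w²`, so `c + 1` of them cannot all exceed the
average. -/
theorem exists_codim_coeffSq_le_card (r : ι → H) {w : ℝ} (hw : ∀ k, ‖r k‖ ≤ w) (c : ℕ) :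
    ∃ V : Submodule ℂ H, FiniteDimensional ℂ V ∧ Module.finrank ℂ V ≤ 2 * c ∧
      ∀ x ∈ Vᗮ, coeffSq r x ≤ (Fintype.card ι / ((c : ℝ) + 1) * w ^ 2) * ‖x‖ ^ 2 := by
  refine exists_codim_coeffSq_le r c _ fun e he hB _ => ?_
  have h1 : ∑ i, coeffSq r (e i) ≤ Fintype.card ι * w ^ 2 := by
    unfold coeffSq
    rw [Finset.sum_comm]
    calc _ ≤ ∑ _k : ι, w ^ 2 := by
          refine Finset.sum_le_sum fun k _ => ?_
          refine le_trans ?_ (pow_le_pow_left₀ (norm_nonneg _) (hw k) 2)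
          simpa only [norm_inner_symm] using he.sum_inner_products_le (r k) (s := Finset.univ)
      _ = _ := by simp
  have h2 : ∑ _i : Fin (c + 1), (Fintype.card ι / ((c : ℝ) + 1) * w ^ 2) < ∑ i, coeffSq r (e i) :=
    Finset.sum_lt_sum_of_nonempty Finset.univ_nonempty fun i _ => hB i
  simp only [Finset.sum_const, Finset.card_univ, Fintype.card_fin, nsmul_eq_mul] at h2
  have h3 : ((c + 1 : ℕ) : ℝ) * (Fintype.card ι / ((c : ℝ) + 1) * w ^ 2) =
      Fintype.card ι * w ^ 2 := by
    push_cast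
    field_simp
  linarith

theorem coeffSq_sum_of_orthogonal (r : ι → H) {m : ℕ} (e : Fin m → H)
    (h : ∀ i j, i ≠ j → ∑ k, (starRingEnd ℂ) ⟪r k, e i⟫ * ⟪r k, e j⟫ = 0) (a : Fin m → ℂ) :
    coeffSq r (∑ i, a i • e i) = ∑ i, ‖a i‖ ^ 2 * coeffSq r (e i) := by
  have key : ∀ x, ((coeffSq r x : ℝ) : ℂ) = ∑ k, (starRingEnd ℂ) ⟪r k, x⟫ * ⟪r k, x⟫ := by
    intro x
    simp only [coeffSq, Complex.conj_mul', Complex.ofReal_sum, Complex.ofReal_pow]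
  apply Complex.ofReal_injective
  rw [key]
  simp only [inner_sum, inner_smul_right, map_sum, map_mul, Finset.sum_mul_sum]
  rw [Finset.sum_comm]
  push_cast
  refine Finset.sum_congr rfl fun i _ => ?_
  rw [Finset.sum_comm, Finset.sum_eq_single i]
  · rw [key, Finset.mul_sum, ← Complex.conj_mul']
    exact Finset.sum_congr rfl fun k _ => by ring
  · intro j _ hj
    have := h i j hj.symm
    calc _ = ∑ k, (starRingEnd ℂ) (a i) * a j * ((starRingEnd ℂ) ⟪r k, e i⟫ * ⟪r k, e j⟫) :=
          Finset.sum_congr rfl fun k _ => by ring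
      _ = 0 := by rw [← Finset.mul_sum, this, mul_zero]
  · simp

theorem norm_sq_sum_smul {m : ℕ} {e : Fin m → H} (he : Orthonormal ℂ e) (a : Fin m → ℂ) :
    ‖∑ i, a i • e i‖ ^ 2 = ∑ i, ‖a i‖ ^ 2 := by
  apply Complex.ofReal_injective
  have h := inner_self_eq_norm_sq_to_K (𝕜 := ℂ) (∑ i, a i • e i)
  rw [he.inner_sum] at h
  simp only [Complex.conj_mul'] at h
  push_cast
  exact h.symm

/-- On the span of `e` the functional of `r` is that of its projection `u`, and Bessel's inequality
is applied to `u`. -/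
theorem sum_inner_le_of_mem_span {m : ℕ} {e : Fin m → H} (he : Orthonormal ℂ e) {κ : Type*}
    [Fintype κ] {f : κ → H} (hf : Orthonormal ℂ f)
    (hfe : ∀ j, f j ∈ Submodule.span ℂ (range e)) (r : H) :
    ∑ j, ‖⟪r, f j⟫‖ ^ 2 ≤ ∑ i, ‖⟪r, e i⟫‖ ^ 2 := by
  set u : H := ∑ i, ⟪e i, r⟫ • e i with hu
  have h1 : ∀ x ∈ Submodule.span ℂ (range e), ⟪r, x⟫ = ⟪u, x⟫ := by
    intro x hx
    induction hx using Submodule.span_induction with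
    | mem x hx =>
      obtain ⟨i, rfl⟩ := hx
      rw [hu, he.inner_left_fintype, inner_conj_symm]
    | zero => simp
    | add x y _ _ hx hy => rw [inner_add_right, inner_add_right, hx, hy]
    | smul a x _ hx => rw [inner_smul_right, inner_smul_right, hx]
  have h2 : ‖u‖ ^ 2 = ∑ i, ‖⟪r, e i⟫‖ ^ 2 := by
    rw [hu, norm_sq_sum_smul he]
    exact Finset.sum_congr rfl fun i _ => by rw [norm_inner_symm]
  rw [← h2]
  calc ∑ j, ‖⟪r, f j⟫‖ ^ 2 = ∑ j, ‖⟪f j, u⟫‖ ^ 2 :=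
        Finset.sum_congr rfl fun j _ => by rw [h1 _ (hfe j), norm_inner_symm]
    _ ≤ ‖u‖ ^ 2 := hf.sum_inner_products_le u (s := Finset.univ)

/-- Weyl numbers of `ℓ_q → ℓ₂` for `q ≤ 2`. Given a bad system of `M = c + 1` vectors, Khinchine's
inequality bounds `∑ R k^(q/2)`, where `R k` is the square sum of the `k`-th coefficients over the
system. Hence at most `M/2` coordinates have `R k > τ²`. A subspace of the span of dimension at
least `M/2` kills these coordinates, and computing the square sum over an orthonormal basis of it in
two ways gives a contradiction. -/
theorem exists_codim_coeffSq_le_rpow (r : ι → H) {q w : ℝ} (hq : 0 < q) (hq2 : q ≤ 2) (hw : 0 < w)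
    (h : ∀ x, ∑ k, ‖⟪r k, x⟫‖ ^ q ≤ (w * ‖x‖) ^ q) (c : ℕ) :
    ∃ V : Submodule ℂ H, FiniteDimensional ℂ V ∧ Module.finrank ℂ V ≤ 2 * c ∧
      ∀ x ∈ Vᗮ, coeffSq r x ≤ (6 ^ (1 / q) * w * ((c : ℝ) + 1) ^ (1 / 2 - 1 / q)) ^ 2 * ‖x‖ ^ 2 := by
  classical
  set M : ℝ := (c : ℝ) + 1 with hM
  have hM0 : 0 < M := by positivity
  -- The `6` is the Khinchine constant `3` times the `2` that makes the exceptional set have at most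
  -- `M/2` elements.
  set τ : ℝ := 6 ^ (1 / q) * w * M ^ (1 / 2 - 1 / q) with hτ
  have hτ0 : 0 < τ := by positivity
  have hτq : τ ^ q = 6 * w ^ q * M ^ (q / 2 - 1) := by
    rw [hτ, Real.mul_rpow (by positivity) (by positivity), Real.mul_rpow (by positivity) hw.le,
      ← Real.rpow_mul (by norm_num), ← Real.rpow_mul hM0.le, one_div_mul_cancel hq.ne',
      Real.rpow_one]
    congr 2
    field_simp
  refine exists_codim_coeffSq_le r c _ fun e he hB horth => ?_
  set R : ι → ℝ := fun k => ∑ i, ‖⟪r k, e i⟫‖ ^ 2 with hR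
  have hR0 : ∀ k, 0 ≤ R k := fun k => Finset.sum_nonneg fun i _ => by positivity
  have hsum : ∑ k, R k ^ (q / 2) ≤ 3 * (w ^ q * M ^ (q / 2)) := by
    have h1 : ∀ σ, ∑ k, ‖signedSum (fun i => ⟪r k, e i⟫) σ‖ ^ q ≤ w ^ q * M ^ (q / 2) := by
      intro σ
      have h2 : ‖signedSum e σ‖ ^ 2 = M := by
        rw [signedSum, norm_sq_sum_smul he]
        have : ∀ i, ‖((sgn (σ i) : ℝ) : ℂ)‖ ^ 2 = 1 := fun i => by
          rw [Complex.norm_real, Real.norm_eq_abs, sq_abs, sq, sgn_mul_self]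
        simp only [this, Finset.sum_const, Finset.card_univ, Fintype.card_fin, nsmul_eq_mul, mul_one]
        push_cast
        rfl
      have h3 := h (signedSum e σ)
      have h4 : ‖signedSum e σ‖ = M ^ (1 / 2 : ℝ) := by
        rw [← h2, ← Real.sqrt_eq_rpow, Real.sqrt_sq (norm_nonneg _)]
      rw [h4, Real.mul_rpow hw.le (by positivity), ← Real.rpow_mul hM0.le] at h3
      refine le_trans (le_of_eq (Finset.sum_congr rfl fun k _ => ?_)) (h3.trans_eq ?_)
      · congr 2
        simp only [signedSum, inner_sum, inner_smul_right, smul_eq_mul]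
      · congr 2
        ring
    have h5 : ∑ k, (2 : ℝ) ^ (c + 1) * (R k ^ (q / 2) / 3) ≤
        ∑ _σ : Fin (c + 1) → Bool, w ^ q * M ^ (q / 2) := by
      refine (Finset.sum_le_sum fun k _ => khinchine_lower _ hq hq2).trans ?_
      rw [Finset.sum_comm]
      exact Finset.sum_le_sum fun σ _ => h1 σ
    rw [← Finset.mul_sum, ← Finset.sum_div] at h5
    simp only [Finset.sum_const, Finset.card_univ, Fintype.card_fun, Fintype.card_bool,
      Fintype.card_fin, nsmul_eq_mul, Nat.cast_pow, Nat.cast_ofNat] at h5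
    have := le_of_mul_le_mul_left h5 (by positivity)
    linarith
  have hMq : M ^ (q / 2) = M ^ (q / 2 - 1) * M := by
    rw [← Real.rpow_add_one hM0.ne']; congr 1; ring
  have hsum' : ∑ k, R k ^ (q / 2) ≤ M / 2 * τ ^ q := by
    rw [hτq]
    refine hsum.trans_eq ?_
    rw [hMq]
    ring
  -- The exceptional coordinates, counted by Markov's inequality.
  set K : Finset ι := Finset.univ.filter fun k => τ ^ 2 < R k with hK
  have hKc : (K.card : ℝ) ≤ M / 2 := by
    have h1 : (K.card : ℝ) * τ ^ q ≤ ∑ k, R k ^ (q / 2) := by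
      rw [← nsmul_eq_mul]
      refine le_trans (Finset.card_nsmul_le_sum K (fun k => R k ^ (q / 2)) _ fun k hk => ?_)
        (Finset.sum_le_univ_sum_of_nonneg fun k => Real.rpow_nonneg (hR0 k) _)
      have h2 : τ ^ 2 ≤ R k := (Finset.mem_filter.1 hk).2.le
      calc τ ^ q = (τ ^ 2) ^ (q / 2) := by
            rw [← Real.rpow_natCast, ← Real.rpow_mul hτ0.le]; congr 1; push_cast; ring
        _ ≤ _ := by gcongr
    exact le_of_mul_le_mul_right (h1.trans hsum') (by positivity)
  -- The kernel of `φ` consists of the coefficient vectors of those combinations of the `e i` that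
  -- vanish at all coordinates in `K`.
  let φ : EuclideanSpace ℂ (Fin (c + 1)) →ₗ[ℂ] (K → ℂ) :=
    { toFun := fun a k => ∑ i, a i * ⟪r k, e i⟫
      map_add' := fun a b => by
        funext k
        simp [add_mul, Finset.sum_add_distrib]
      map_smul' := fun s a => by
        funext k
        simp [Finset.mul_sum, mul_assoc] }
  have hdim : c + 1 ≤ K.card + Module.finrank ℂ (LinearMap.ker φ) := by
    have h1 := LinearMap.finrank_range_add_finrank_ker φ
    have h2 := Submodule.finrank_le (LinearMap.range φ)
    simp only [finrank_euclideanSpace, Fintype.card_fin, Module.finrank_fintype_fun_eq_card,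
      Fintype.card_coe] at h1 h2
    omega
  let b := stdOrthonormalBasis ℂ (LinearMap.ker φ)
  set N := Module.finrank ℂ (LinearMap.ker φ) with hN
  let f : Fin N → H := fun j => ∑ i, (b j).1 i • e i
  have hb1 : ∀ j, ∑ i, ‖(b j).1 i‖ ^ 2 = 1 := by
    intro j
    have h1 : ‖(b j).1‖ = 1 := b.orthonormal.1 j
    rw [← EuclideanSpace.norm_sq_eq, h1, one_pow]
  have hf : Orthonormal ℂ f := by
    refine ⟨fun j => ?_, fun i j hij => ?_⟩
    · have : ‖f j‖ ^ 2 = 1 := by rw [norm_sq_sum_smul he, hb1]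
      nlinarith [norm_nonneg (f j)]
    · have h1 : ⟪(b i).1, (b j).1⟫ = 0 := b.orthonormal.2 hij
      rw [PiLp.inner_apply] at h1
      show ⟪f i, f j⟫ = 0
      rw [he.inner_sum, ← h1]
      exact Finset.sum_congr rfl fun k _ => by simp [mul_comm]
  have hfe : ∀ j, f j ∈ Submodule.span ℂ (range e) := fun j =>
    Submodule.sum_mem _ fun i _ => Submodule.smul_mem _ _ (Submodule.subset_span (mem_range_self i))
  have hfK : ∀ j, ∀ k ∈ K, ⟪r k, f j⟫ = 0 := by
    intro j k hk
    have h1 := congrFun (LinearMap.mem_ker.1 (b j).2) ⟨k, hk⟩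
    simp only [f, inner_sum, inner_smul_right]
    exact h1
  -- By orthogonality of the coefficient vectors, `coeffSq` of a unit combination is an average of
  -- the values `coeffSq r (e i) > τ²`.
  have hlow : ∑ _j : Fin N, τ ^ 2 < ∑ j, coeffSq r (f j) := by
    have hNpos : 0 < N := by
      have h1 : ((c + 1 : ℕ) : ℝ) ≤ K.card + N := by exact_mod_cast hdim
      push_cast at h1
      have : (0 : ℝ) < N := by linarith
      exact_mod_cast this
    have : Nonempty (Fin N) := ⟨⟨0, hNpos⟩⟩
    refine Finset.sum_lt_sum_of_nonempty Finset.univ_nonempty fun j _ => ?_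
    rw [coeffSq_sum_of_orthogonal r e horth]
    have h1 : τ ^ 2 = ∑ i, ‖(b j).1 i‖ ^ 2 * τ ^ 2 := by rw [← Finset.sum_mul, hb1, one_mul]
    rw [h1]
    refine Finset.sum_lt_sum (fun i _ => by gcongr; exact (hB i).le) ?_
    by_contra! hcon
    have h2 : ∀ i, ‖(b j).1 i‖ ^ 2 = 0 := by
      intro i
      by_contra h3
      have h4 : 0 < ‖(b j).1 i‖ ^ 2 := lt_of_le_of_ne (by positivity) (Ne.symm h3)
      exact absurd (le_of_mul_le_mul_left (hcon i (Finset.mem_univ i)) h4) (not_le.2 (hB i))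
    have := hb1 j
    simp [h2] at this
  -- Coordinates in `K` contribute nothing; for the others `R k ≤ τ²`, so `R k ≤ τ^(2-q) R k^(q/2)`.
  have hup : ∑ j, coeffSq r (f j) ≤ M / 2 * τ ^ 2 := by
    unfold coeffSq
    rw [Finset.sum_comm]
    calc ∑ k, ∑ j, ‖⟪r k, f j⟫‖ ^ 2 ≤ ∑ k, (τ ^ 2) ^ (1 - q / 2) * R k ^ (q / 2) := by
          refine Finset.sum_le_sum fun k _ => ?_
          by_cases hk : k ∈ K
          · have : ∑ j, ‖⟪r k, f j⟫‖ ^ 2 = 0 :=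
              Finset.sum_eq_zero fun j _ => by simp [hfK j k hk]
            rw [this]
            exact mul_nonneg (by positivity) (Real.rpow_nonneg (hR0 k) _)
          · refine (sum_inner_le_of_mem_span he hf hfe (r k)).trans ?_
            have h1 : R k ≤ τ ^ 2 := by simpa [hK] using hk
            show R k ≤ _
            rcases (hR0 k).eq_or_lt with h2 | h2
            · rw [← h2]
              positivity
            · calc R k = R k ^ (1 - q / 2) * R k ^ (q / 2) := by
                    rw [← Real.rpow_add h2]; simp
                _ ≤ _ := by
                    gcongr
                    linarith
      _ ≤ (τ ^ 2) ^ (1 - q / 2) * (M / 2 * τ ^ q) := by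
          rw [← Finset.mul_sum]
          gcongr
      _ = M / 2 * τ ^ 2 := by
          have : (τ ^ 2) ^ (1 - q / 2) * τ ^ q = τ ^ 2 := by
            rw [← Real.rpow_natCast, ← Real.rpow_mul hτ0.le, ← Real.rpow_add hτ0]
            congr 1
            push_cast
            ring
          calc _ = M / 2 * ((τ ^ 2) ^ (1 - q / 2) * τ ^ q) := by ring
            _ = _ := by rw [this]
  have hNM : M / 2 ≤ N := by
    have h1 : ((c + 1 : ℕ) : ℝ) ≤ K.card + N := by exact_mod_cast hdim
    push_cast at h1
    linarith
  simp only [Finset.sum_const, Finset.card_univ, Fintype.card_fin, nsmul_eq_mul] at hlow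
  have : M / 2 * τ ^ 2 ≤ N * τ ^ 2 := by gcongr
  linarith

end Codim

/-! ### Interpolation of finite sums -/

theorem sum_rpow_le_interpolate {ι : Type*} [Fintype ι] (y : ι → ℝ) (hy : ∀ k, 0 ≤ y k)
    {a b s t : ℝ} (ha : 0 < a) (hb : 0 < b) (hab : a + b = 1) (hs : 0 < s) (ht : 0 < t) :
    ∑ k, y k ^ (s * a + t * b) ≤ (∑ k, y k ^ s) ^ a * (∑ k, y k ^ t) ^ b := by
  have h := Real.inner_le_Lp_mul_Lq_of_nonneg Finset.univ (f := fun k => y k ^ (s * a))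
    (g := fun k => y k ^ (t * b)) (p := 1 / a) (q := 1 / b)
    (Real.holderConjugate_iff.2 ⟨(one_lt_div ha).2 (by linarith), by simpa using hab⟩)
    (fun k _ => Real.rpow_nonneg (hy k) _) (fun k _ => Real.rpow_nonneg (hy k) _)
  calc _ = ∑ k, y k ^ (s * a) * y k ^ (t * b) :=
        Finset.sum_congr rfl fun k _ => Real.rpow_add_of_nonneg (hy k) (by positivity) (by positivity)
    _ ≤ _ := h
    _ = _ := by
        simp only [one_div_one_div]
        congr 2 <;>
        · refine Finset.sum_congr rfl fun k _ => ?_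
          rw [← Real.rpow_mul (hy k)]
          congr 1
          field_simp

end MixedWeyl

/-! ### Geometry of levels, dyadic rectangles and wavelet index sets. -/

namespace MixedWeyl

/-! ### Geometric sums -/

theorem sum_range_rpow_abs_le {x : ℝ} (hx0 : 0 < x) (hx1 : x < 1) (a n : ℕ) :
    ∑ j ∈ Finset.range n, x ^ |(a : ℝ) - j| ≤ 2 / (1 - x) := by
  have hg : ∀ n : ℕ, ∑ j ∈ Finset.range n, x ^ j ≤ 1 / (1 - x) := fun n => by
    rw [one_div, ← tsum_geometric_of_lt_one hx0.le hx1]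
    exact (summable_geometric_of_lt_one hx0.le hx1).sum_le_tsum _ fun i _ => by positivity
  calc _ ≤ ∑ j ∈ Finset.range (a + n), x ^ |(a : ℝ) - j| :=
        Finset.sum_le_sum_of_subset_of_nonneg
          (Finset.range_subset_range.2 (by omega)) fun _ _ _ => by positivity
    _ = ∑ j ∈ Finset.range a, x ^ |(a : ℝ) - j| + ∑ j ∈ Finset.range n, x ^ j := by
        rw [Finset.sum_range_add]
        congr 1
        refine Finset.sum_congr rfl fun j _ => ?_
        push_cast
        rw [show (a : ℝ) - (a + j) = -j by ring, abs_neg, Nat.abs_cast, Real.rpow_natCast]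
    _ ≤ ∑ j ∈ Finset.range a, x ^ j + ∑ j ∈ Finset.range n, x ^ j := by
        gcongr ?_ + _
        rw [← Finset.sum_range_reflect (fun j => x ^ j)]
        refine Finset.sum_le_sum fun j hj => ?_
        have hj := Finset.mem_range.1 hj
        rw [← Real.rpow_natCast]
        refine Real.rpow_le_rpow_of_exponent_ge hx0 hx1.le (le_trans ?_ (le_abs_self _))
        rw [Nat.sub_sub, Nat.cast_sub (by omega)]
        push_cast
        linarith
    _ ≤ 1 / (1 - x) + 1 / (1 - x) := add_le_add (hg a) (hg n)
    _ = 2 / (1 - x) := by ring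

/-! ### Levels -/

section Level

variable {d : ℕ}

/-- The multi-indices `ν` with `|ν|₁ = μ`. -/
def level (d μ : ℕ) : Finset (Fin d → ℕ) :=
  (Fintype.piFinset fun _ => Finset.range (μ + 1)).filter fun ν => levelSum ν = μ

theorem mem_level {μ : ℕ} {ν : Fin d → ℕ} : ν ∈ level d μ ↔ levelSum ν = μ := by
  simp only [level, Finset.mem_filter, Fintype.mem_piFinset, Finset.mem_range, and_iff_right_iff_imp]
  rintro rfl l
  exact Nat.lt_succ_of_le (Finset.single_le_sum (fun _ _ => Nat.zero_le _) (Finset.mem_univ l))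

theorem card_level_le (hd : 1 ≤ d) (μ : ℕ) : (level d μ).card ≤ (μ + 1) ^ (d - 1) := by
  obtain ⟨e, rfl⟩ : ∃ e, d = e + 1 := ⟨d - 1, by omega⟩
  have h : (level (e + 1) μ).card ≤
      (Fintype.piFinset fun _ : Fin e => Finset.range (μ + 1)).card := by
    refine Finset.card_le_card_of_injOn (fun ν => Fin.tail ν) (fun ν hν => ?_) fun ν hν ν' hν' h => ?_
    · have := (Finset.mem_filter.1 hν).1
      simp only [Fintype.mem_piFinset, SetLike.mem_coe] at this ⊢
      exact fun l => this l.succ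
    · have h1 := mem_level.1 hν
      have h2 := mem_level.1 hν'
      have h3 : ∀ l : Fin e, ν l.succ = ν' l.succ := fun l => congrFun h l
      simp only [levelSum, Fin.sum_univ_succ, h3] at h1 h2
      funext l
      refine Fin.cases (by omega) h3 l
  simpa using h

/-- The components of index at least one may be chosen freely up to `μ / d`; the remaining component
then completes the sum to `μ`. -/
theorem le_card_level (hd : 1 ≤ d) (μ : ℕ) : (μ + 1) ^ (d - 1) ≤ d ^ (d - 1) * (level d μ).card := by
  obtain ⟨e, rfl⟩ : ∃ e, d = e + 1 := ⟨d - 1, by omega⟩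
  have h : (Fintype.piFinset fun _ : Fin e => Finset.range (μ / (e + 1) + 1)).card ≤
      (level (e + 1) μ).card := by
    refine Finset.card_le_card_of_injOn
      (fun g => (Fin.cons (μ - ∑ l, g l) g : Fin (e + 1) → ℕ)) (fun g hg => ?_)
      fun g _ g' _ h => ?_
    · simp only [SetLike.mem_coe, Fintype.mem_piFinset, Finset.mem_range] at hg
      rw [SetLike.mem_coe, mem_level, levelSum, Fin.sum_univ_succ]
      simp only [Fin.cons_zero, Fin.cons_succ]
      have h1 : ∑ l, g l ≤ ∑ _l : Fin e, μ / (e + 1) :=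
        Finset.sum_le_sum fun l _ => Nat.lt_succ_iff.1 (hg l)
      simp only [Finset.sum_const, Finset.card_univ, Fintype.card_fin, smul_eq_mul] at h1
      have h2 : e * (μ / (e + 1)) ≤ (e + 1) * (μ / (e + 1)) := Nat.mul_le_mul_right _ (by omega)
      have h3 := Nat.mul_div_le μ (e + 1)
      omega
    · exact (Fin.cons_injective2 h).2
  simp only [Fintype.card_piFinset, Finset.card_range, Finset.prod_const, Finset.card_univ,
    Fintype.card_fin] at h
  simp only [Nat.add_sub_cancel]
  calc (μ + 1) ^ e ≤ ((e + 1) * (μ / (e + 1) + 1)) ^ e := by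
        gcongr
        have := Nat.lt_mul_div_succ μ (Nat.succ_pos e)
        exact this
    _ = (e + 1) ^ e * (μ / (e + 1) + 1) ^ e := mul_pow _ _ _
    _ ≤ _ := by gcongr

/-- The `ℓ₁` distance of multi-indices. -/
def levelDist (ν ν' : Fin d → ℕ) : ℝ := ∑ l, |(ν l : ℝ) - ν' l|

theorem levelDist_comm (ν ν' : Fin d → ℕ) : levelDist ν ν' = levelDist ν' ν :=
  Finset.sum_congr rfl fun _ _ => abs_sub_comm _ _

/-- Enlarging the level to a box turns the sum into a product of `d` two-sided geometric series, so
the bound does not depend on `μ`, although the number of terms grows with `μ` for `d ≥ 2`. -/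
theorem exists_sum_level_le (d : ℕ) {δ : ℝ} (hδ : 0 < δ) :
    ∃ C : ℝ, 0 < C ∧ ∀ (μ : ℕ) (ν : Fin d → ℕ),
      ∑ ν' ∈ level d μ, (2 : ℝ) ^ (-(δ * levelDist ν ν')) ≤ C := by
  have hx : (2 : ℝ) ^ (-δ) < 1 := Real.rpow_lt_one_of_one_lt_of_neg (by norm_num) (by linarith)
  have hx' : 0 < 1 - (2 : ℝ) ^ (-δ) := by linarith
  refine ⟨(2 / (1 - (2 : ℝ) ^ (-δ))) ^ d, by positivity, fun μ ν => ?_⟩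
  calc _ ≤ ∑ ν' ∈ Fintype.piFinset fun _ : Fin d => Finset.range (μ + 1),
          ∏ l, ((2 : ℝ) ^ (-δ)) ^ |(ν l : ℝ) - ν' l| := by
        refine le_trans (le_of_eq (Finset.sum_congr rfl fun ν' _ => ?_))
          (Finset.sum_le_sum_of_subset_of_nonneg (Finset.filter_subset _ _)
            fun _ _ _ => Finset.prod_nonneg fun _ _ => by positivity)
        simp only [← Real.rpow_mul (zero_le_two : (0 : ℝ) ≤ 2)]
        rw [← Real.rpow_sum_of_pos (by norm_num)]
        simp only [levelDist, Finset.mul_sum, ← Finset.sum_neg_distrib, neg_mul]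
    _ = ∏ l, ∑ j ∈ Finset.range (μ + 1), ((2 : ℝ) ^ (-δ)) ^ |(ν l : ℝ) - j| := by
        rw [Finset.prod_univ_sum]
    _ ≤ ∏ _l : Fin d, (2 / (1 - (2 : ℝ) ^ (-δ))) :=
        Finset.prod_le_prod (fun l _ => Finset.sum_nonneg fun _ _ => by positivity) fun l _ =>
          sum_range_rpow_abs_le (by positivity) hx _ _
    _ = _ := by simp [div_pow]

end Level

/-! ### Dyadic rectangles -/

section Cubes

variable {d : ℕ}

theorem dyadicCube_eq_pi (ν : Fin d → ℕ) (m : Fin d → ℤ) : dyadicCube ν m =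
    Set.pi univ fun l => Ioo ((2 : ℝ) ^ (-(ν l : ℝ)) * m l) ((2 : ℝ) ^ (-(ν l : ℝ)) * (m l + 1)) := by
  ext x
  simp [dyadicCube]

theorem volume_dyadicCube (ν : Fin d → ℕ) (m : Fin d → ℤ) :
    volume (dyadicCube ν m) = ENNReal.ofReal ((2 : ℝ) ^ (-(levelSum ν : ℝ))) := by
  rw [dyadicCube_eq_pi, Real.volume_pi_Ioo, ← ENNReal.ofReal_prod_of_nonneg]
  · congr 1
    simp only [levelSum, Nat.cast_sum, ← Finset.sum_neg_distrib]
    rw [Real.rpow_sum_of_pos (by norm_num)]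
    exact Finset.prod_congr rfl fun l _ => by ring
  · intro l _
    have : (0 : ℝ) < (2 : ℝ) ^ (-(ν l : ℝ)) := by positivity
    nlinarith

/-- In each direction the intersection is no longer than the shorter side, and `max (ν l) (ν' l)`
equals `(ν l + ν' l + |ν l - ν' l|) / 2`. The decay in `levelDist` is what later sums over pairs of
layers. -/
theorem volume_dyadicCube_inter_le (ν ν' : Fin d → ℕ) (m m' : Fin d → ℤ) :
    volume (dyadicCube ν m ∩ dyadicCube ν' m') ≤
      ENNReal.ofReal ((2 : ℝ) ^ (-((levelSum ν + levelSum ν' + levelDist ν ν') / 2))) := by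
  rw [dyadicCube_eq_pi, dyadicCube_eq_pi, ← Set.pi_inter_distrib, volume_pi_pi]
  have h : ∀ l, volume (Ioo ((2 : ℝ) ^ (-(ν l : ℝ)) * m l) ((2 : ℝ) ^ (-(ν l : ℝ)) * (m l + 1)) ∩
      Ioo ((2 : ℝ) ^ (-(ν' l : ℝ)) * m' l) ((2 : ℝ) ^ (-(ν' l : ℝ)) * (m' l + 1))) ≤
      ENNReal.ofReal ((2 : ℝ) ^ (-(((ν l : ℝ) + ν' l + |(ν l : ℝ) - ν' l|) / 2))) := by
    intro l
    rcases le_total (ν l : ℝ) (ν' l) with h | h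
    · refine (measure_mono inter_subset_right).trans_eq ?_
      rw [Real.volume_Ioo, abs_of_nonpos (by linarith)]
      ring_nf
    · refine (measure_mono inter_subset_left).trans_eq ?_
      rw [Real.volume_Ioo, abs_of_nonneg (by linarith)]
      ring_nf
  refine (Finset.prod_le_prod' fun l _ => h l).trans_eq ?_
  rw [← ENNReal.ofReal_prod_of_nonneg fun _ _ => by positivity,
    ← Real.rpow_sum_of_pos (by norm_num)]
  congr 2
  rw [Finset.sum_neg_distrib, ← Finset.sum_div, Finset.sum_add_distrib, Finset.sum_add_distrib]
  simp [levelSum, levelDist]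

theorem dyadicCube_disjoint {ν : Fin d → ℕ} {m m' : Fin d → ℤ} {x : Fin d → ℝ}
    (h : x ∈ dyadicCube ν m) (h' : x ∈ dyadicCube ν m') : m = m' := by
  funext l
  have hp : (0 : ℝ) < (2 : ℝ) ^ (-(ν l : ℝ)) := by positivity
  obtain ⟨h1, h2⟩ := h l
  obtain ⟨h3, h4⟩ := h' l
  have h5 := lt_of_mul_lt_mul_left (h1.trans h4) hp.le
  have h6 := lt_of_mul_lt_mul_left (h3.trans h2) hp.le
  have h7 : m l < m' l + 1 := by exact_mod_cast h5
  have h8 : m' l < m l + 1 := by exact_mod_cast h6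
  omega

/-- The characteristic function of a dyadic rectangle. -/
noncomputable def chi (ν : Fin d → ℕ) (m : Fin d → ℤ) (x : Fin d → ℝ) : ℝ≥0∞ :=
  (dyadicCube ν m).indicator (fun _ => 1) x

theorem chi_eq_one {ν : Fin d → ℕ} {m : Fin d → ℤ} {x : Fin d → ℝ} (h : x ∈ dyadicCube ν m) :
    chi ν m x = 1 := indicator_of_mem h _

theorem chi_eq_zero {ν : Fin d → ℕ} {m : Fin d → ℤ} {x : Fin d → ℝ} (h : x ∉ dyadicCube ν m) :
    chi ν m x = 0 := indicator_of_notMem h _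

theorem chi_le_one (ν : Fin d → ℕ) (m : Fin d → ℤ) (x : Fin d → ℝ) : chi ν m x ≤ 1 := by
  by_cases h : x ∈ dyadicCube ν m
  · rw [chi_eq_one h]
  · rw [chi_eq_zero h]; exact zero_le_one

theorem measurable_chi (ν : Fin d → ℕ) (m : Fin d → ℤ) : Measurable (chi ν m) :=
  measurable_const.indicator (isOpen_dyadicCube _ _).measurableSet

theorem lintegral_chi (ν : Fin d → ℕ) (m : Fin d → ℤ) :
    ∫⁻ x, chi ν m x = ENNReal.ofReal ((2 : ℝ) ^ (-(levelSum ν : ℝ))) := by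
  unfold chi
  rw [lintegral_indicator_const (isOpen_dyadicCube _ _).measurableSet, one_mul, volume_dyadicCube]

theorem lintegral_chi_mul_chi_le (ν ν' : Fin d → ℕ) (m m' : Fin d → ℤ) :
    ∫⁻ x, chi ν m x * chi ν' m' x ≤
      ENNReal.ofReal ((2 : ℝ) ^ (-((levelSum ν + levelSum ν' + levelDist ν ν') / 2))) := by
  refine le_trans (le_of_eq ?_) (volume_dyadicCube_inter_le ν ν' m m')
  have : ∀ x, chi ν m x * chi ν' m' x =
      (dyadicCube ν m ∩ dyadicCube ν' m').indicator (fun _ => 1) x := by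
    intro x
    by_cases h : x ∈ dyadicCube ν m <;> by_cases h' : x ∈ dyadicCube ν' m' <;>
      simp [chi, h, h']
  simp only [this]
  rw [lintegral_indicator_const
    ((isOpen_dyadicCube _ _).inter (isOpen_dyadicCube _ _)).measurableSet, one_mul]

/-- Rectangles of one shape are disjoint: powers can be taken termwise. -/
theorem rpow_sum_chi {ν : Fin d → ℕ} {I : Set (Fin d → ℤ)} [Fintype I] (b : I → ℝ≥0∞)
    {s : ℝ} (hs : 0 < s) (x : Fin d → ℝ) :
    (∑ m, b m * chi ν m.1 x) ^ s = ∑ m, b m ^ s * chi ν m.1 x := by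
  by_cases h : ∃ m : I, x ∈ dyadicCube ν m.1
  · obtain ⟨m, hm⟩ := h
    have h0 : ∀ m' : I, m' ≠ m → chi ν m'.1 x = 0 := fun m' hm' =>
      chi_eq_zero fun h => hm' (Subtype.ext (dyadicCube_disjoint h hm))
    rw [Finset.sum_eq_single m (fun m' _ hm' => by rw [h0 m' hm', mul_zero]) (by simp),
      Finset.sum_eq_single m (fun m' _ hm' => by rw [h0 m' hm', mul_zero]) (by simp),
      chi_eq_one hm, mul_one, mul_one]
  · push Not at h
    have h0 : ∀ m : I, chi ν m.1 x = 0 := fun m => chi_eq_zero (h m)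
    simp [h0, hs]

end Cubes

end MixedWeyl

namespace MixedWeyl

/-! ### The index sets `A_ν^Ω` -/

variable {d : ℕ} {ψ₀ ψ₁ : ℝ → ℂ}

theorem exists_nat_abs_le_of_ne_zero {ψ : ℝ → ℂ} (h : HasCompactSupport ψ) :
    ∃ R : ℕ, ∀ x, ψ x ≠ 0 → |x| ≤ R := by
  obtain ⟨C, hC⟩ := h.isCompact.isBounded.exists_norm_le
  obtain ⟨R, hR⟩ := exists_nat_ge C
  exact ⟨R, fun x hx => (hC x (subset_tsupport _ hx)).trans hR⟩

theorem exists_index_bound (h₀ : HasCompactSupport ψ₀) (h₁ : HasCompactSupport ψ₁) (d : ℕ) :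
    ∃ R : ℕ, ∀ (ν : Fin d → ℕ), ∀ m ∈ omegaIndex ψ₀ ψ₁ ν, ∀ l,
      -(R : ℤ) ≤ m l ∧ m l ≤ 2 ^ ν l + R := by
  obtain ⟨R₀, hR₀⟩ := exists_nat_abs_le_of_ne_zero h₀
  obtain ⟨R₁, hR₁⟩ := exists_nat_abs_le_of_ne_zero h₁
  refine ⟨max R₀ R₁, fun ν m hm l => ?_⟩
  obtain ⟨x, hx, hx'⟩ := hm
  -- Truncated subtraction makes `2^(j-1)` the dilation factor for both generators: it equals `1`
  -- for `j = 0`.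
  have hw : ∀ (j : ℕ) (k : ℤ) (y : ℝ), wavelet ψ₀ ψ₁ j k y ≠ 0 →
      |(2 : ℝ) ^ (j - 1) * y - k| ≤ (max R₀ R₁ : ℕ) := by
    intro j k y hy
    cases j with
    | zero =>
      have := hR₀ _ hy
      simp only [Nat.zero_sub, pow_zero, one_mul]
      exact this.trans (by exact_mod_cast le_max_left _ _)
    | succ j =>
      simp only [wavelet] at hy
      have := hR₁ _ (right_ne_zero_of_mul hy)
      exact this.trans (by exact_mod_cast le_max_right _ _)
  have hcl : IsClosed {y : Fin d → ℝ | |(2 : ℝ) ^ (ν l - 1) * y l - m l| ≤ (max R₀ R₁ : ℕ)} :=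
    isClosed_le (by fun_prop) continuous_const
  have hsub : tsupport (tensorWavelet ψ₀ ψ₁ ν m) ⊆
      {y : Fin d → ℝ | |(2 : ℝ) ^ (ν l - 1) * y l - m l| ≤ (max R₀ R₁ : ℕ)} := by
    refine closure_minimal (fun y hy => ?_) hcl
    exact hw _ _ _ (Finset.prod_ne_zero_iff.1 hy l (Finset.mem_univ l))
  have h1 : |(2 : ℝ) ^ (ν l - 1) * x l - m l| ≤ (max R₀ R₁ : ℕ) := hsub hx
  obtain ⟨h2, h3⟩ := hx' l
  rw [abs_le] at h1
  have h4 : (2 : ℝ) ^ (ν l - 1) ≤ 2 ^ ν l := pow_le_pow_right₀ (by norm_num) (by omega)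
  have h5 : (0 : ℝ) < 2 ^ (ν l - 1) := by positivity
  have h6 : (2 : ℝ) ^ (ν l - 1) * x l ≤ 2 ^ ν l := by nlinarith
  have h7 : 0 ≤ (2 : ℝ) ^ (ν l - 1) * x l := by positivity
  constructor
  · have : -((max R₀ R₁ : ℕ) : ℝ) ≤ m l := by linarith
    exact_mod_cast this
  · have : (m l : ℝ) ≤ 2 ^ ν l + (max R₀ R₁ : ℕ) := by linarith
    exact_mod_cast this

theorem ne_zero_of_isWaveletPair {N : ℕ} (h : IsWaveletPair N ψ₀ ψ₁) :
    (∃ x, ψ₀ x ≠ 0) ∧ ∃ x, ψ₁ x ≠ 0 := by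
  obtain ⟨b, hb⟩ := h.orthonormalBasis
  have key : ∀ j m, ¬ ∀ x, wavelet ψ₀ ψ₁ j m x = 0 := by
    intro j m h0
    have h1 := hb j m
    simp only [h0, mul_zero] at h1
    have h2 : b (j, m) = 0 := (Lp.eq_zero_iff_ae_eq_zero).2 h1
    exact b.orthonormal.ne_zero _ h2
  constructor
  · by_contra! hcon
    exact key 0 0 fun x => hcon _
  · by_contra! hcon
    exact key 1 0 fun x => by simp [wavelet, hcon]

theorem exists_irrational_ne_zero {ψ : ℝ → ℂ} (hc : Continuous ψ) (h : ∃ x, ψ x ≠ 0) :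
    ∃ x, Irrational x ∧ ψ x ≠ 0 := by
  obtain ⟨x, hx, hx'⟩ := dense_irrational.exists_mem_open (isOpen_ne_fun hc continuous_const) h
  exact ⟨x, hx, hx'⟩

/-- By continuity the generator is nonzero at an irrational point. Its fractional part is strictly
between `0` and `1`, so the `2^(j-1)` shifted and dilated copies of that point all lie in the open
unit interval. -/
theorem exists_wavelet_ne_zero {N : ℕ} (h : IsWaveletPair N ψ₀ ψ₁) (j : ℕ) :
    ∃ k : ℤ, ∀ i : ℕ, i < 2 ^ (j - 1) → ∃ x : ℝ, 0 < x ∧ x < 1 ∧ wavelet ψ₀ ψ₁ j (k + i) x ≠ 0 := by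
  obtain ⟨h0, h1⟩ := ne_zero_of_isWaveletPair h
  have hfr : ∀ x : ℝ, Irrational x → 0 < Int.fract x := fun x hx => by
    refine lt_of_le_of_ne (Int.fract_nonneg x) fun h => ?_
    exact hx ⟨(⌊x⌋ : ℤ), by
      have := Int.floor_add_fract x
      rw [← h, add_zero] at this
      exact_mod_cast this⟩
  cases j with
  | zero =>
    obtain ⟨x, hx, hx'⟩ := exists_irrational_ne_zero h.contDiff_zero.continuous h0
    refine ⟨-⌊x⌋, fun i hi => ⟨Int.fract x, hfr x hx, Int.fract_lt_one x, ?_⟩⟩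
    have hi : i = 0 := by simpa using hi
    subst hi
    simp only [wavelet]
    convert hx' using 2
    have := Int.floor_add_fract x
    push_cast
    linarith
  | succ j =>
    obtain ⟨x, hx, hx'⟩ := exists_irrational_ne_zero h.contDiff_one.continuous h1
    refine ⟨-⌊x⌋, fun i hi => ⟨(Int.fract x + i) / 2 ^ j, by have := hfr x hx; positivity, ?_, ?_⟩⟩
    · rw [div_lt_one (by positivity)]
      have h2 : (i : ℝ) + 1 ≤ 2 ^ j := by exact_mod_cast hi
      linarith [Int.fract_lt_one x]
    · simp only [wavelet]
      refine mul_ne_zero (by simp) ?_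
      convert hx' using 2
      rw [mul_div_cancel₀ _ (by positivity)]
      have := Int.floor_add_fract x
      push_cast
      linarith

theorem exists_injection_omegaIndex {N : ℕ} (h : IsWaveletPair N ψ₀ ψ₁) (ν : Fin d → ℕ) :
    ∃ g : ((l : Fin d) → Fin (2 ^ (ν l - 1))) → omegaIndex ψ₀ ψ₁ ν, Function.Injective g := by
  choose k hk using exists_wavelet_ne_zero h
  refine ⟨fun i => ⟨fun l => k (ν l) + (i l : ℕ), ?_⟩, fun i i' hii' => ?_⟩
  · choose x hx0 hx1 hx using fun l => hk (ν l) (i l) (i l).2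
    exact ⟨x, subset_tsupport _ (Finset.prod_ne_zero_iff.2 fun l _ => hx l),
      fun l => ⟨hx0 l, hx1 l⟩⟩
  · funext l
    have := congrFun (congrArg Subtype.val hii') l
    simp only [add_right_inj, Nat.cast_inj] at this
    exact Fin.ext this

theorem finite_omegaIndex {N : ℕ} (h : IsWaveletPair N ψ₀ ψ₁) (ν : Fin d → ℕ) :
    (omegaIndex ψ₀ ψ₁ ν).Finite := by
  obtain ⟨R, hR⟩ := exists_index_bound h.hasCompactSupport_zero h.hasCompactSupport_one d
  refine (Set.Finite.pi' fun l => Set.finite_Icc (-(R : ℤ)) (2 ^ ν l + R)).subset fun m hm l => ?_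
  exact hR ν m hm l

/-- The quantitative properties of the index sets: sizes and locations. -/
structure IndexGeometry (d : ℕ) (ψ₀ ψ₁ : ℝ → ℂ)
    [∀ ν : Fin d → ℕ, Fintype (omegaIndex ψ₀ ψ₁ ν)] (R : ℝ) : Prop where
  one_le : 1 ≤ R
  card_le : ∀ ν : Fin d → ℕ, (Fintype.card (omegaIndex ψ₀ ψ₁ ν) : ℝ) ≤ R * 2 ^ levelSum ν
  le_card : ∀ ν : Fin d → ℕ, (2 : ℝ) ^ levelSum ν ≤ R * Fintype.card (omegaIndex ψ₀ ψ₁ ν)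
  exists_box : ∃ S : Set (Fin d → ℝ), MeasurableSet S ∧ volume S ≤ ENNReal.ofReal R ∧
    ∀ (ν : Fin d → ℕ), ∀ m ∈ omegaIndex ψ₀ ψ₁ ν, dyadicCube ν m ⊆ S

theorem exists_indexGeometry {N : ℕ} (h : IsWaveletPair N ψ₀ ψ₁)
    [∀ ν : Fin d → ℕ, Fintype (omegaIndex ψ₀ ψ₁ ν)] : ∃ R, IndexGeometry d ψ₀ ψ₁ R := by
  obtain ⟨R, hR⟩ := exists_index_bound h.hasCompactSupport_zero h.hasCompactSupport_one d
  have hR1 : (1 : ℝ) ≤ (2 * R + 2) ^ d := one_le_pow₀ (by have : (0 : ℝ) ≤ R := by positivity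
                                                          linarith)
  have h2R : (2 : ℝ) ^ d ≤ (2 * R + 2) ^ d := by
    gcongr
    have : (0 : ℝ) ≤ R := by positivity
    linarith
  refine ⟨(2 * R + 2) ^ d, hR1, fun ν => ?_, fun ν => ?_,
    Set.pi univ fun _ => Icc (-(R : ℝ)) (R + 2), ?_, ?_, ?_⟩
  · have h1 : Fintype.card (omegaIndex ψ₀ ψ₁ ν) ≤
        (Fintype.piFinset fun l => Finset.Icc (-(R : ℤ)) (2 ^ ν l + R)).card := by
      rw [← Fintype.card_coe]
      refine Fintype.card_le_of_injective (fun m => ⟨m.1, ?_⟩) fun m m' hm => ?_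
      · simpa [Fintype.mem_piFinset] using hR ν m.1 m.2
      · simpa [Subtype.ext_iff] using hm
    rw [Fintype.card_piFinset] at h1
    have h2 : ∀ l, (Finset.Icc (-(R : ℤ)) (2 ^ ν l + R)).card ≤ (2 * R + 2) * 2 ^ ν l := by
      intro l
      rw [Int.card_Icc]
      have : 1 ≤ 2 ^ ν l := Nat.one_le_two_pow
      have h3 : (2 ^ ν l + (R : ℤ) + 1 - -(R : ℤ)).toNat = 2 ^ ν l + R + 1 + R := by
        have : (2 ^ ν l + (R : ℤ) + 1 - -(R : ℤ)) = ((2 ^ ν l + R + 1 + R : ℕ) : ℤ) := by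
          push_cast; ring
        rw [this, Int.toNat_natCast]
      rw [h3]
      nlinarith
    have h4 := h1.trans (Finset.prod_le_prod' fun l _ => h2 l)
    rw [Finset.prod_mul_distrib, Finset.prod_pow_eq_pow_sum] at h4
    simp only [Finset.prod_const, Finset.card_univ, Fintype.card_fin] at h4
    exact_mod_cast h4
  · obtain ⟨g, hg⟩ := exists_injection_omegaIndex h ν
    have h1 := Fintype.card_le_of_injective g hg
    simp only [Fintype.card_pi, Fintype.card_fin] at h1
    -- The translates found number `2^(ν l - 1)` in each direction, at worst a factor `2` below
    -- `2^(ν l)`; this loses `2^d` in total.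
    have h2 : 2 ^ levelSum ν ≤ 2 ^ d * ∏ l, 2 ^ (ν l - 1) := by
      have : (2 : ℕ) ^ d = ∏ _l : Fin d, 2 := by simp
      rw [this, ← Finset.prod_mul_distrib, levelSum, ← Finset.prod_pow_eq_pow_sum]
      refine Finset.prod_le_prod' fun l _ => ?_
      rw [← pow_succ']
      exact Nat.pow_le_pow_right (by norm_num) (by omega)
    have h3 : (2 : ℝ) ^ levelSum ν ≤ 2 ^ d * Fintype.card (omegaIndex ψ₀ ψ₁ ν) := by
      exact_mod_cast h2.trans (Nat.mul_le_mul_left _ h1)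
    exact h3.trans (by gcongr)
  · exact MeasurableSet.univ_pi fun _ => measurableSet_Icc
  · rw [volume_pi_pi]
    simp only [Real.volume_Icc, Finset.prod_const, Finset.card_univ, Fintype.card_fin]
    rw [← ENNReal.ofReal_pow (by have : (0 : ℝ) ≤ R := by positivity
                                 linarith)]
    refine ENNReal.ofReal_le_ofReal (le_of_eq ?_)
    ring
  · intro ν m hm x hx l _
    obtain ⟨h1, h2⟩ := hx l
    obtain ⟨h3, h4⟩ := hR ν m hm l
    have h3' : -(R : ℝ) ≤ m l := by exact_mod_cast h3
    have h4' : (m l : ℝ) ≤ 2 ^ ν l + R := by exact_mod_cast h4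
    rw [Real.rpow_neg zero_le_two, Real.rpow_natCast] at h1 h2
    have hp : (1 : ℝ) ≤ 2 ^ ν l := one_le_pow₀ (by norm_num)
    have hp0 : (0 : ℝ) < 2 ^ ν l := by positivity
    have hR0 : (0 : ℝ) ≤ R := by positivity
    rw [inv_mul_eq_div, div_lt_iff₀ hp0] at h1
    rw [inv_mul_eq_div, lt_div_iff₀ hp0] at h2
    constructor
    · by_contra! hcon
      nlinarith
    · by_contra! hcon
      nlinarith

end MixedWeyl

/-! ### Integral estimates for the square function of one block. -/

namespace MixedWeyl

/-! ### Finite sums of powers in `[0,∞]` -/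

theorem two_rpow_eq_ofReal (x : ℝ) : (2 : ℝ≥0∞) ^ x = ENNReal.ofReal ((2 : ℝ) ^ x) := by
  rw [← ENNReal.ofReal_rpow_of_pos (by norm_num)]
  simp

theorem two_rpow_add (x y : ℝ) : (2 : ℝ≥0∞) ^ (x + y) = 2 ^ x * 2 ^ y :=
  ENNReal.rpow_add _ _ (by simp) (by simp)

theorem rpow_sub_one_mul_self (x : ℝ≥0∞) {s : ℝ} (hs : 1 ≤ s) : x ^ (s - 1) * x = x ^ s := by
  conv_lhs => rw [← ENNReal.rpow_one x, ← ENNReal.rpow_mul, one_mul,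
    ← ENNReal.rpow_add_of_nonneg _ _ (by linarith) zero_le_one, sub_add_cancel]

theorem rpow_finset_sum_le {ι : Type*} (S : Finset ι) (f : ι → ℝ≥0∞) {s : ℝ} (hs : 0 < s)
    (hs1 : s ≤ 1) : (∑ i ∈ S, f i) ^ s ≤ ∑ i ∈ S, f i ^ s := by
  classical
  induction S using Finset.induction_on with
  | empty => simp [hs]
  | insert i S hi ih =>
    rw [Finset.sum_insert hi, Finset.sum_insert hi]
    exact (ENNReal.rpow_add_le_add_rpow _ _ hs.le hs1).trans (add_le_add le_rfl ih)

theorem finset_sum_rpow_le {ι : Type*} (S : Finset ι) (f : ι → ℝ≥0∞) {s : ℝ} (hs : 1 ≤ s) :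
    ∑ i ∈ S, f i ^ s ≤ (∑ i ∈ S, f i) ^ s := by
  classical
  induction S using Finset.induction_on with
  | empty => simp
  | insert i S hi ih =>
    rw [Finset.sum_insert hi, Finset.sum_insert hi]
    exact (add_le_add le_rfl ih).trans (ENNReal.add_rpow_le_rpow_add _ _ hs)

/-- A sum whose terms are compared with weights growing away from the largest term is controlled
by products of pairs of terms. -/
theorem rpow_sum_le_sum_pairs {ι : Type*} (S : Finset ι) (f : ι → ℝ≥0∞) (D : ι → ι → ℝ) {s : ℝ}
    (hs : 0 < s) (C : ℝ≥0∞) (hC : ∀ j ∈ S, ∑ i ∈ S, (2 : ℝ≥0∞) ^ (-D i j) ≤ C) :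
    (∑ i ∈ S, f i) ^ s ≤
      C ^ s * ∑ i ∈ S, ∑ j ∈ S, (2 : ℝ≥0∞) ^ (s * D i j) * (f i * f j) ^ (s / 2) := by
  rcases S.eq_empty_or_nonempty with rfl | hne
  · simp [hs]
  -- `j` carries the largest term and `i` the largest term after weighting by the distance to `j`.
  -- The sum is dominated by a convergent series times the term at `i`, and `f i ≤ f j` allows one
  -- power of `f i` to be exchanged for the product.
  obtain ⟨j, hj, hjmax⟩ := S.exists_max_image f hne
  obtain ⟨i, hi, himax⟩ := S.exists_max_image (fun i => (2 : ℝ≥0∞) ^ (D i j) * f i) hne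
  have h1 : ∑ k ∈ S, f k ≤ C * (2 ^ (D i j) * f i) := by
    calc ∑ k ∈ S, f k = ∑ k ∈ S, (2 : ℝ≥0∞) ^ (-D k j) * (2 ^ (D k j) * f k) := by
          refine Finset.sum_congr rfl fun k _ => ?_
          rw [← mul_assoc, ← two_rpow_add, neg_add_cancel, ENNReal.rpow_zero, one_mul]
      _ ≤ ∑ k ∈ S, (2 : ℝ≥0∞) ^ (-D k j) * (2 ^ (D i j) * f i) :=
          Finset.sum_le_sum fun k hk => mul_le_mul' le_rfl (himax k hk)
      _ ≤ _ := by rw [← Finset.sum_mul]; gcongr; exact hC j hj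
  have h2 : f i ^ s ≤ (f i * f j) ^ (s / 2) := by
    calc f i ^ s = (f i * f i) ^ (s / 2) := by
          rw [← sq, ← ENNReal.rpow_natCast, ← ENNReal.rpow_mul]; congr 1; push_cast; ring
      _ ≤ _ := by
          gcongr
          exact hjmax i hi
  calc (∑ k ∈ S, f k) ^ s ≤ (C * (2 ^ (D i j) * f i)) ^ s := ENNReal.rpow_le_rpow h1 hs.le
    _ = C ^ s * (2 ^ (s * D i j) * f i ^ s) := by
        rw [ENNReal.mul_rpow_of_nonneg _ _ hs.le, ENNReal.mul_rpow_of_nonneg _ _ hs.le,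
          ← ENNReal.rpow_mul, mul_comm s]
    _ ≤ C ^ s * (2 ^ (s * D i j) * (f i * f j) ^ (s / 2)) := by gcongr
    _ ≤ _ := by
        gcongr
        refine le_trans ?_ (Finset.single_le_sum
          (f := fun i => ∑ j ∈ S, (2 : ℝ≥0∞) ^ (s * D i j) * (f i * f j) ^ (s / 2))
          (fun _ _ => zero_le) hi)
        exact Finset.single_le_sum
          (f := fun j => (2 : ℝ≥0∞) ^ (s * D i j) * (f i * f j) ^ (s / 2)) (fun _ _ => zero_le) hj

/-! ### Blocks of the sequence space norms -/

section Blocks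

variable {d : ℕ} {ψ₀ ψ₁ : ℝ → ℂ} [∀ ν : Fin d → ℕ, Fintype (omegaIndex ψ₀ ψ₁ ν)]

/-- `∑_m |a_{ν,m}|^s χ_{ν,m}`. -/
noncomputable def layerFun (ν : Fin d → ℕ) (a : SeqFamily d ψ₀ ψ₁) (s : ℝ) (x : Fin d → ℝ) :
    ℝ≥0∞ := ∑ m, ‖a ν m‖ₑ ^ s * chi ν m.1 x

/-- `∑_m |a_{ν,m}|^s`. -/
noncomputable def layerSum (ν : Fin d → ℕ) (a : SeqFamily d ψ₀ ψ₁) (s : ℝ) : ℝ≥0∞ :=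
  ∑ m, ‖a ν m‖ₑ ^ s

/-- `∑_{|ν|₁ = μ} ∑_m |a_{ν,m}|² χ_{ν,m}`. -/
noncomputable def blockFun (μ : ℕ) (a : SeqFamily d ψ₀ ψ₁) (x : Fin d → ℝ) : ℝ≥0∞ :=
  ∑ ν ∈ level d μ, layerFun ν a 2 x

/-- `∑_{|ν|₁ = μ} ∑_m |a_{ν,m}|^s`. -/
noncomputable def blockSum (μ : ℕ) (a : SeqFamily d ψ₀ ψ₁) (s : ℝ) : ℝ≥0∞ :=
  ∑ ν ∈ level d μ, layerSum ν a s

theorem measurable_layerFun (ν : Fin d → ℕ) (a : SeqFamily d ψ₀ ψ₁) (s : ℝ) :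
    Measurable (layerFun ν a s) :=
  Finset.measurable_sum _ fun m _ => (measurable_chi ν m.1).const_mul _

theorem measurable_blockFun (μ : ℕ) (a : SeqFamily d ψ₀ ψ₁) : Measurable (blockFun μ a) :=
  Finset.measurable_sum _ fun ν _ => measurable_layerFun ν a 2

theorem layerFun_rpow (ν : Fin d → ℕ) (a : SeqFamily d ψ₀ ψ₁) (s : ℝ) {t : ℝ} (ht : 0 < t)
    (x : Fin d → ℝ) : layerFun ν a s x ^ t = layerFun ν a (s * t) x := by
  unfold layerFun
  rw [rpow_sum_chi _ ht]
  simp only [← ENNReal.rpow_mul]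

theorem lintegral_layerFun (ν : Fin d → ℕ) (a : SeqFamily d ψ₀ ψ₁) (s : ℝ) :
    ∫⁻ x, layerFun ν a s x = 2 ^ (-(levelSum ν : ℝ)) * layerSum ν a s := by
  unfold layerFun layerSum
  rw [lintegral_finsetSum _ fun m _ => (measurable_chi ν m.1).const_mul _, Finset.mul_sum]
  refine Finset.sum_congr rfl fun m _ => ?_
  rw [lintegral_const_mul _ (measurable_chi ν m.1), lintegral_chi, two_rpow_eq_ofReal, mul_comm]

theorem lintegral_layerFun_mul_le (ν ν' : Fin d → ℕ) (a : SeqFamily d ψ₀ ψ₁) (s : ℝ) :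
    ∫⁻ x, layerFun ν a s x * layerFun ν' a s x ≤
      2 ^ (-((levelSum ν + levelSum ν' + levelDist ν ν') / 2)) *
        (layerSum ν a s * layerSum ν' a s) := by
  have hm : ∀ (m : omegaIndex ψ₀ ψ₁ ν) (m' : omegaIndex ψ₀ ψ₁ ν'), Measurable fun x =>
      ‖a ν m‖ₑ ^ s * chi ν m.1 x * (‖a ν' m'‖ₑ ^ s * chi ν' m'.1 x) := fun m m' =>
    ((measurable_chi ν m.1).const_mul _).mul ((measurable_chi ν' m'.1).const_mul _)
  unfold layerFun layerSum
  simp only [Finset.sum_mul_sum]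
  rw [lintegral_finsetSum _ fun m _ => Finset.measurable_sum _ fun m' _ => hm m m', Finset.mul_sum]
  refine Finset.sum_le_sum fun m _ => ?_
  rw [lintegral_finsetSum _ fun m' _ => hm m m', Finset.mul_sum]
  refine Finset.sum_le_sum fun m' _ => ?_
  simp only [mul_mul_mul_comm]
  have hm2 : Measurable fun x => chi ν m.1 x * chi ν' m'.1 x :=
    (measurable_chi ν m.1).mul (measurable_chi ν' m'.1)
  rw [lintegral_const_mul _ hm2, mul_comm, two_rpow_eq_ofReal]
  gcongr
  exact lintegral_chi_mul_chi_le _ _ _ _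

theorem lintegral_blockFun (μ : ℕ) (a : SeqFamily d ψ₀ ψ₁) :
    ∫⁻ x, blockFun μ a x = 2 ^ (-(μ : ℝ)) * blockSum μ a 2 := by
  unfold blockFun blockSum
  rw [lintegral_finsetSum _ fun ν _ => measurable_layerFun ν a 2, Finset.mul_sum]
  refine Finset.sum_congr rfl fun ν hν => ?_
  rw [lintegral_layerFun, mem_level.1 hν]

/-- The square function is bounded by the full square sum, so all but one of its powers can be taken
out of the integral. -/
theorem lintegral_blockFun_rpow_le_of_two_le (μ : ℕ) (a : SeqFamily d ψ₀ ψ₁) {s : ℝ}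
    (hs : 1 ≤ s) :
    ∫⁻ x, blockFun μ a x ^ s ≤ 2 ^ (-(μ : ℝ)) * blockSum μ a 2 ^ s := by
  have h : ∀ x, blockFun μ a x ^ s ≤ blockSum μ a 2 ^ (s - 1) * blockFun μ a x := by
    intro x
    have h1 : blockFun μ a x ≤ blockSum μ a 2 := Finset.sum_le_sum fun ν _ =>
      Finset.sum_le_sum fun m _ => mul_le_of_le_one_right' (chi_le_one _ _ _)
    rw [← rpow_sub_one_mul_self _ hs]
    gcongr
  refine (lintegral_mono h).trans_eq ?_
  rw [lintegral_const_mul _ (measurable_blockFun μ a), lintegral_blockFun, mul_left_comm,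
    rpow_sub_one_mul_self _ hs]

/-- For `s ≤ 1` the power is subadditive over the layers and acts termwise inside each layer. -/
theorem lintegral_blockFun_rpow_le_of_le_two (μ : ℕ) (a : SeqFamily d ψ₀ ψ₁) {s : ℝ}
    (hs : 0 < s) (hs1 : s ≤ 1) :
    ∫⁻ x, blockFun μ a x ^ s ≤ 2 ^ (-(μ : ℝ)) * blockSum μ a (2 * s) := by
  have h : ∀ x, blockFun μ a x ^ s ≤ ∑ ν ∈ level d μ, layerFun ν a (2 * s) x := by
    intro x
    refine (rpow_finset_sum_le _ _ hs hs1).trans_eq ?_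
    simp only [layerFun_rpow _ _ _ hs]
  refine (lintegral_mono h).trans_eq ?_
  rw [lintegral_finsetSum _ fun ν _ => measurable_layerFun ν a _, blockSum, Finset.mul_sum]
  refine Finset.sum_congr rfl fun ν hν => ?_
  rw [lintegral_layerFun, mem_level.1 hν]

/-- Power means over the layers of the level; the factor is the source of the logarithm exponents
`1/2 - 1/p₀`. -/
theorem lintegral_blockFun_rpow_le_card (μ : ℕ) (a : SeqFamily d ψ₀ ψ₁) {s : ℝ} (hs : 1 ≤ s) :
    ∫⁻ x, blockFun μ a x ^ s ≤
      ((level d μ).card : ℝ≥0∞) ^ (s - 1) * (2 ^ (-(μ : ℝ)) * blockSum μ a (2 * s)) := by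
  have h : ∀ x, blockFun μ a x ^ s ≤
      ((level d μ).card : ℝ≥0∞) ^ (s - 1) * ∑ ν ∈ level d μ, layerFun ν a (2 * s) x := by
    intro x
    refine (ENNReal.rpow_sum_le_const_mul_sum_rpow (level d μ) (fun ν => layerFun ν a 2 x)
      hs).trans_eq ?_
    simp only [layerFun_rpow _ _ _ (zero_lt_one.trans_le hs)]
  have hm : Measurable fun x => ∑ ν ∈ level d μ, layerFun ν a (2 * s) x :=
    Finset.measurable_sum _ fun ν _ => measurable_layerFun ν a _
  refine (lintegral_mono h).trans_eq ?_
  rw [lintegral_const_mul _ hm,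
    lintegral_finsetSum _ fun ν _ => measurable_layerFun ν a _, blockSum]
  congr 1
  rw [Finset.mul_sum]
  refine Finset.sum_congr rfl fun ν hν => ?_
  rw [lintegral_layerFun, mem_level.1 hν]

/-- Hölder interpolation of the exponent `v` between `1`, where the small overlap of the rectangles
gains `2^(-dist/2)`, and `1/2`, where Cauchy–Schwarz gains nothing. -/
theorem lintegral_layerFun_mul_rpow_le {μ : ℕ} {ν ν' : Fin d → ℕ} (hν : ν ∈ level d μ)
    (hν' : ν' ∈ level d μ) (a : SeqFamily d ψ₀ ψ₁) (r : ℝ) {v : ℝ} (hv : 1 / 2 < v) (hv1 : v ≤ 1) :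
    ∫⁻ x, (layerFun ν a r x * layerFun ν' a r x) ^ v ≤
      2 ^ (-(μ : ℝ)) * 2 ^ (-((v - 1 / 2) * levelDist ν ν')) *
        (layerSum ν a r * layerSum ν' a r) ^ v := by
  set F := layerFun ν a r
  set F' := layerFun ν' a r
  set X := layerSum ν a r
  set X' := layerSum ν' a r
  have hF : Measurable F := measurable_layerFun ν a r
  have hF' : Measurable F' := measurable_layerFun ν' a r
  have h1 : ∀ x, (F x * F' x) ^ v = (F x * F' x) ^ (2 * v - 1) *
      ((F x * F' x) ^ (1 / 2 : ℝ)) ^ (2 - 2 * v) := by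
    intro x
    rw [← ENNReal.rpow_mul, ← ENNReal.rpow_add_of_nonneg _ _ (by linarith) (by nlinarith)]
    congr 1
    ring
  have h2 : ∫⁻ x, F x * F' x ≤ 2 ^ (-((μ : ℝ) + levelDist ν ν' / 2)) * (X * X') := by
    refine (lintegral_layerFun_mul_le ν ν' a r).trans_eq ?_
    rw [mem_level.1 hν, mem_level.1 hν']
    congr 2
    ring
  have h3 : ∫⁻ x, (F x * F' x) ^ (1 / 2 : ℝ) ≤ 2 ^ (-(μ : ℝ)) * (X * X') ^ (1 / 2 : ℝ) := by
    simp only [ENNReal.mul_rpow_of_nonneg _ _ (by norm_num : (0 : ℝ) ≤ 1 / 2)]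
    refine (ENNReal.lintegral_mul_norm_pow_le hF.aemeasurable hF'.aemeasurable
      (by norm_num) (by norm_num) (by norm_num)).trans_eq ?_
    rw [lintegral_layerFun, lintegral_layerFun, mem_level.1 hν, mem_level.1 hν',
      ENNReal.mul_rpow_of_nonneg _ _ (by norm_num : (0 : ℝ) ≤ 1 / 2),
      ENNReal.mul_rpow_of_nonneg _ _ (by norm_num : (0 : ℝ) ≤ 1 / 2), mul_mul_mul_comm,
      ← ENNReal.rpow_mul, ← two_rpow_add]
    congr 2
    ring
  simp only [h1]
  refine (ENNReal.lintegral_mul_norm_pow_le (hF.mul hF').aemeasurable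
    ((hF.mul hF').pow_const _).aemeasurable (by linarith) (by linarith) (by ring)).trans ?_
  calc _ ≤ (2 ^ (-((μ : ℝ) + levelDist ν ν' / 2)) * (X * X')) ^ (2 * v - 1) *
        (2 ^ (-(μ : ℝ)) * (X * X') ^ (1 / 2 : ℝ)) ^ (2 - 2 * v) := by
        exact mul_le_mul' (ENNReal.rpow_le_rpow h2 (by linarith))
          (ENNReal.rpow_le_rpow h3 (by linarith))
    _ = _ := by
        generalize X * X' = Z
        rw [ENNReal.mul_rpow_of_nonneg _ _ (by linarith), ENNReal.mul_rpow_of_nonneg _ _ (by linarith),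
          mul_mul_mul_comm, ← ENNReal.rpow_mul, ← ENNReal.rpow_mul, ← ENNReal.rpow_mul,
          ← two_rpow_add, ← two_rpow_add, ← ENNReal.rpow_add_of_nonneg _ _ (by linarith) (by linarith)]
        congr 2 <;> ring

/-- A Jawerth–Franke type estimate on blocks: for `0 < r < 2 s ≤ 2 r`,
`‖∑ |a|² χ‖_s^s ≤ C 2^{-μ} (∑ |a|^r)^{2s/r}`. -/
theorem lintegral_blockFun_rpow_le_embedding {r s : ℝ} (hr : 0 < r) (hrs : r < 2 * s)
    (hsr : s ≤ r) : ∃ C : ℝ, 0 < C ∧ ∀ (μ : ℕ) (a : SeqFamily d ψ₀ ψ₁),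
      ∫⁻ x, blockFun μ a x ^ s ≤
        ENNReal.ofReal C * (2 ^ (-(μ : ℝ)) * blockSum μ a r ^ (2 * s / r)) := by
  have hs : 0 < s := by linarith
  set v := s / r with hv
  have hv1 : v ≤ 1 := (div_le_one hr).2 hsr
  have hv2 : 1 / 2 < v := by rw [hv, div_lt_div_iff₀ (by norm_num) hr]; linarith
  -- The overlap decays at rate `v - 1/2 = 2δ`: one `δ` pays for the weight introduced by comparing
  -- pairs, the other makes the sum over the level converge.
  set δ := (v - 1 / 2) / 2 with hδ
  have hδ0 : 0 < δ := by rw [hδ]; linarith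
  obtain ⟨C₁, hC₁, h₁⟩ := exists_sum_level_le d (δ := δ / s) (by positivity)
  obtain ⟨C₂, hC₂, h₂⟩ := exists_sum_level_le d hδ0
  refine ⟨C₁ ^ s * (2 * C₂), by positivity, fun μ a => ?_⟩
  -- Pairs of layers at a point: `layerFun` to the exponent `r` appears because disjointness lets
  -- powers pass into a layer, and `s / 2 · 2 / r = v / r · s / v` turns into the exponent `v = s /
  -- r`.
  have hpt : ∀ x, blockFun μ a x ^ s ≤ ENNReal.ofReal C₁ ^ s * ∑ ν ∈ level d μ, ∑ ν' ∈ level d μ,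
      (2 : ℝ≥0∞) ^ (δ * levelDist ν ν') * (layerFun ν a r x * layerFun ν' a r x) ^ v := by
    intro x
    refine (rpow_sum_le_sum_pairs (level d μ) (fun ν => layerFun ν a 2 x)
      (fun ν ν' => δ / s * levelDist ν ν') hs (ENNReal.ofReal C₁) fun ν' hν' => ?_).trans_eq ?_
    · simp only [two_rpow_eq_ofReal]
      rw [← ENNReal.ofReal_sum_of_nonneg fun _ _ => by positivity]
      refine ENNReal.ofReal_le_ofReal ((h₁ μ ν').trans' (le_of_eq ?_))
      exact Finset.sum_congr rfl fun ν _ => by rw [levelDist_comm]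
    · congr 1
      refine Finset.sum_congr rfl fun ν _ => Finset.sum_congr rfl fun ν' _ => ?_
      congr 1
      · congr 1
        field_simp
      · have h3 : ∀ ν : Fin d → ℕ, layerFun ν a r x = layerFun ν a 2 x ^ (r / 2) := fun ν => by
          rw [layerFun_rpow _ _ _ (by positivity)]; congr 1; ring
        rw [h3, h3, ← ENNReal.mul_rpow_of_nonneg _ _ (by positivity), ← ENNReal.rpow_mul]
        congr 1
        rw [hv]
        field_simp
  have hmeas : ∀ ν ν' : Fin d → ℕ,
      Measurable fun x => (layerFun ν a r x * layerFun ν' a r x) ^ v := fun ν ν' =>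
    ((measurable_layerFun ν a r).mul (measurable_layerFun ν' a r)).pow_const _
  have hsum : ∀ ν ∈ level d μ, ∑ ν' ∈ level d μ, (2 : ℝ≥0∞) ^ (-(δ * levelDist ν ν')) ≤
      ENNReal.ofReal C₂ := fun ν _ => by
    simp only [two_rpow_eq_ofReal]
    rw [← ENNReal.ofReal_sum_of_nonneg fun _ _ => by positivity]
    exact ENNReal.ofReal_le_ofReal (h₂ μ ν)
  set X : (Fin d → ℕ) → ℝ≥0∞ := fun ν => layerSum ν a r ^ (2 * v) with hX
  -- After integration a product of two layers is bounded by the sum of the two separate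
  -- contributions, each with the remaining decay `2^(-δ dist)`.
  have hpair : ∀ ν ∈ level d μ, ∀ ν' ∈ level d μ,
      ∫⁻ x, (2 : ℝ≥0∞) ^ (δ * levelDist ν ν') * (layerFun ν a r x * layerFun ν' a r x) ^ v ≤
        2 ^ (-(μ : ℝ)) * (2 ^ (-(δ * levelDist ν ν')) * X ν + 2 ^ (-(δ * levelDist ν ν')) * X ν') := by
    intro ν hν ν' hν'
    rw [lintegral_const_mul _ (hmeas ν ν')]
    calc _ ≤ (2 : ℝ≥0∞) ^ (δ * levelDist ν ν') * (2 ^ (-(μ : ℝ)) *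
          2 ^ (-((v - 1 / 2) * levelDist ν ν')) * (layerSum ν a r * layerSum ν' a r) ^ v) := by
          gcongr
          exact lintegral_layerFun_mul_rpow_le hν hν' a r hv2 hv1
      _ = 2 ^ (-(μ : ℝ)) * (2 ^ (-(δ * levelDist ν ν')) *
          (layerSum ν a r * layerSum ν' a r) ^ v) := by
          rw [mul_assoc, mul_left_comm, ← mul_assoc (2 ^ (δ * levelDist ν ν')), ← two_rpow_add]
          congr 3
          rw [hδ]
          ring
      _ ≤ _ := by
          rw [← mul_add]
          gcongr
          have hvv : ∀ y : ℝ≥0∞, y ^ (2 * v) = (y * y) ^ v := fun y => by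
            rw [ENNReal.mul_rpow_of_nonneg _ _ (by linarith),
              ← ENNReal.rpow_add_of_nonneg _ _ (by linarith) (by linarith), two_mul]
          simp only [hX, hvv]
          rcases le_total (layerSum ν a r) (layerSum ν' a r) with h | h
          · exact le_add_left (ENNReal.rpow_le_rpow (by gcongr) (by linarith))
          · exact le_add_right (ENNReal.rpow_le_rpow (by gcongr) (by linarith))
  calc ∫⁻ x, blockFun μ a x ^ s
      ≤ ENNReal.ofReal C₁ ^ s * ∑ ν ∈ level d μ, ∑ ν' ∈ level d μ, ∫⁻ x,
        (2 : ℝ≥0∞) ^ (δ * levelDist ν ν') * (layerFun ν a r x * layerFun ν' a r x) ^ v := by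
        refine (lintegral_mono hpt).trans_eq ?_
        rw [lintegral_const_mul _ (Finset.measurable_sum _ fun ν _ => Finset.measurable_sum _
          fun ν' _ => (hmeas ν ν').const_mul _),
          lintegral_finsetSum _ fun ν _ => Finset.measurable_sum _
          fun ν' _ => (hmeas ν ν').const_mul _]
        congr 1
        exact Finset.sum_congr rfl fun ν _ =>
          lintegral_finsetSum _ fun ν' _ => (hmeas ν ν').const_mul _
    _ ≤ ENNReal.ofReal C₁ ^ s * ∑ ν ∈ level d μ, ∑ ν' ∈ level d μ, 2 ^ (-(μ : ℝ)) *
          (2 ^ (-(δ * levelDist ν ν')) * X ν + 2 ^ (-(δ * levelDist ν ν')) * X ν') := by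
        gcongr with ν hν ν' hν'
        exact hpair ν hν ν' hν'
    _ = ENNReal.ofReal C₁ ^ s * (2 ^ (-(μ : ℝ)) *
          (∑ ν ∈ level d μ, (∑ ν' ∈ level d μ, 2 ^ (-(δ * levelDist ν ν'))) * X ν +
            ∑ ν ∈ level d μ, (∑ ν' ∈ level d μ, 2 ^ (-(δ * levelDist ν ν'))) * X ν)) := by
        simp only [← Finset.mul_sum, Finset.sum_add_distrib, Finset.sum_mul]
        congr 3
        rw [Finset.sum_comm]
        exact Finset.sum_congr rfl fun ν _ => Finset.sum_congr rfl fun ν' _ => by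
          rw [levelDist_comm]
    _ ≤ ENNReal.ofReal C₁ ^ s * (2 ^ (-(μ : ℝ)) *
          (∑ ν ∈ level d μ, ENNReal.ofReal C₂ * X ν + ∑ ν ∈ level d μ, ENNReal.ofReal C₂ * X ν)) := by
        gcongr with ν hν ν hν
        · exact hsum ν hν
        · exact hsum ν hν
    _ = ENNReal.ofReal (C₁ ^ s * (2 * C₂)) * (2 ^ (-(μ : ℝ)) * ∑ ν ∈ level d μ, X ν) := by
        rw [← Finset.mul_sum, ← two_mul, ENNReal.ofReal_mul (by positivity),
          ENNReal.ofReal_mul (by positivity), ENNReal.ofReal_rpow_of_pos hC₁]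
        simp only [ENNReal.ofReal_ofNat]
        ring
    _ ≤ _ := by
        gcongr
        rw [show 2 * s / r = 2 * v by rw [hv]; ring]
        exact finset_sum_rpow_le _ _ (by linarith)

/-- Lyapunov's inequality on blocks. -/
theorem lintegral_blockFun_rpow_le_interpolate (μ : ℕ) (a : SeqFamily d ψ₀ ψ₁) {u v s : ℝ}
    (hu : 0 ≤ u) (hv : 0 ≤ v) (huv : u + v = 1) (hs : 0 ≤ s) :
    ∫⁻ x, blockFun μ a x ^ (u + s * v) ≤
      (∫⁻ x, blockFun μ a x) ^ u * (∫⁻ x, blockFun μ a x ^ s) ^ v := by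
  refine le_trans (le_of_eq (lintegral_congr fun x => ?_)) (ENNReal.lintegral_mul_norm_pow_le
    (measurable_blockFun μ a).aemeasurable ((measurable_blockFun μ a).pow_const s).aemeasurable
    hu hv huv)
  rw [← ENNReal.rpow_mul, ENNReal.rpow_add_of_nonneg _ _ hu (by positivity)]

theorem lintegral_rpow_le_of_support {S : Set (Fin d → ℝ)} (hS : MeasurableSet S)
    {G : (Fin d → ℝ) → ℝ≥0∞} (hG : Measurable G) (hGS : ∀ x ∉ S, G x = 0) {s s' : ℝ}
    (hs : 0 < s) (hss : s ≤ s') :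
    ∫⁻ x, G x ^ s ≤ (∫⁻ x, G x ^ s') ^ (s / s') * volume S ^ (1 - s / s') := by
  have hs' : 0 < s' := by linarith
  have h1 : s / s' ≤ 1 := (div_le_one hs').2 hss
  have h2 : ∀ x, G x ^ s = (G x ^ s') ^ (s / s') * (S.indicator (fun _ => 1) x) ^ (1 - s / s') := by
    intro x
    rw [← ENNReal.rpow_mul, mul_div_cancel₀ _ hs'.ne']
    by_cases hx : x ∈ S
    · simp [hx]
    · simp [hGS x hx, hs]
  simp only [h2]
  refine (ENNReal.lintegral_mul_norm_pow_le (hG.pow_const _).aemeasurable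
    (measurable_const.indicator hS).aemeasurable (by positivity) (by linarith) (by ring)).trans_eq ?_
  rw [lintegral_indicator_const hS, one_mul]

/-! ### The norm of `s^0_{p,2} f` through blocks -/

theorem tsum_eq_tsum_level (f : (Fin d → ℕ) → ℝ≥0∞) :
    ∑' ν, f ν = ∑' μ, ∑ ν ∈ level d μ, f ν := by
  rw [← (Equiv.sigmaFiberEquiv (levelSum (d := d))).tsum_eq, ENNReal.tsum_sigma']
  refine tsum_congr fun μ => ?_
  rw [← Finset.tsum_subtype]
  have : ∀ ν : Fin d → ℕ, ν ∈ level d μ ↔ levelSum ν = μ := fun ν => mem_level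
  exact (Equiv.subtypeEquivRight this).symm.tsum_eq (fun ν : level d μ => f ν.1)

theorem fSquareFun_eq (a : SeqFamily d ψ₀ ψ₁) (x : Fin d → ℝ) :
    fSquareFun 0 2 a x = (∑' μ, blockFun μ a x) ^ (1 / 2 : ℝ) := by
  have h2 : (2 : ℝ≥0∞) ≠ ∞ := by simp
  unfold fSquareFun lqNorm
  rw [if_neg h2, ENNReal.tsum_sigma']
  simp only [ENNReal.toReal_ofNat]
  congr 1
  unfold blockFun
  rw [← tsum_eq_tsum_level (fun ν => layerFun ν a 2 x)]
  refine tsum_congr fun ν => ?_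
  rw [tsum_fintype]
  refine Finset.sum_congr rfl fun m _ => ?_
  simp only [mul_zero, ENNReal.rpow_zero, one_mul]
  rw [ENNReal.mul_rpow_of_nonneg _ _ (by norm_num)]
  congr 1
  by_cases h : x ∈ dyadicCube ν m.1 <;> simp [chi, h]

theorem fENorm_eq {p : ℝ≥0∞} (hp : 0 < p) (hp' : p < ∞) (a : SeqFamily d ψ₀ ψ₁) :
    fENorm 0 p 2 a =
      (∫⁻ x, (∑' μ, blockFun μ a x) ^ (p.toReal / 2)) ^ (1 / p.toReal) := by
  unfold fENorm
  rw [eLpNorm_eq_lintegral_rpow_enorm_toReal hp.ne' hp'.ne]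
  simp only [enorm_eq_self, fSquareFun_eq, ← ENNReal.rpow_mul]
  congr 3
  funext x
  congr 1
  ring

end Blocks

end MixedWeyl

namespace MixedWeyl

/-! ### Estimates for the quasi-norm of `s^t_{p₀,p₀} b` -/

theorem le_lqNorm {ι : Type*} {q : ℝ≥0∞} (hq : 0 < q) (a : ι → ℝ≥0∞) (i : ι) :
    a i ≤ lqNorm q a := by
  unfold lqNorm
  split_ifs with h
  · exact le_iSup a i
  · have hr : 0 < q.toReal := ENNReal.toReal_pos hq.ne' h
    calc a i = (a i ^ q.toReal) ^ (1 / q.toReal) := by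
          rw [← ENNReal.rpow_mul, mul_one_div_cancel hr.ne', ENNReal.rpow_one]
      _ ≤ _ := ENNReal.rpow_le_rpow (ENNReal.le_tsum i) (by positivity)

theorem lqNorm_rpow {ι : Type*} {q : ℝ≥0∞} (hq : 0 < q) (hq' : q ≠ ∞) (a : ι → ℝ≥0∞) :
    lqNorm q a ^ q.toReal = ∑' i, a i ^ q.toReal := by
  have hr : 0 < q.toReal := ENNReal.toReal_pos hq.ne' hq'
  rw [lqNorm, if_neg hq', ← ENNReal.rpow_mul, one_div_mul_cancel hr.ne', ENNReal.rpow_one]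

section

variable {d : ℕ} {ψ₀ ψ₁ : ℝ → ℂ}

theorem enorm_coord_le (t : ℝ) {p : ℝ≥0∞} (hp : 0 < p) (a : SeqFamily d ψ₀ ψ₁) (ν : Fin d → ℕ)
    (m : omegaIndex ψ₀ ψ₁ ν) :
    ‖a ν m‖ₑ ≤ 2 ^ (-((levelSum ν : ℝ) * (t - recip p))) * bENorm t p p a := by
  have h1 : 2 ^ ((levelSum ν : ℝ) * (t - recip p)) * ‖a ν m‖ₑ ≤ bENorm t p p a := by
    refine le_trans ?_ (le_lqNorm hp _ ν)
    gcongr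
    exact le_lqNorm hp (fun m => ‖a ν m‖ₑ) m
  calc ‖a ν m‖ₑ = 2 ^ (-((levelSum ν : ℝ) * (t - recip p))) *
        (2 ^ ((levelSum ν : ℝ) * (t - recip p)) * ‖a ν m‖ₑ) := by
        rw [← mul_assoc, ← two_rpow_add, neg_add_cancel, ENNReal.rpow_zero, one_mul]
    _ ≤ _ := by gcongr

variable [∀ ν : Fin d → ℕ, Fintype (omegaIndex ψ₀ ψ₁ ν)]

theorem bENorm_rpow (t : ℝ) {p : ℝ≥0∞} (hp : 0 < p) (hp' : p ≠ ∞) (a : SeqFamily d ψ₀ ψ₁) :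
    bENorm t p p a ^ p.toReal = ∑' μ : ℕ, (2 : ℝ≥0∞) ^ ((μ : ℝ) * (t - recip p) * p.toReal) *
      blockSum μ a p.toReal := by
  rw [bENorm, lqNorm_rpow hp hp', tsum_eq_tsum_level]
  refine tsum_congr fun μ => ?_
  rw [blockSum, Finset.mul_sum]
  refine Finset.sum_congr rfl fun ν hν => ?_
  rw [ENNReal.mul_rpow_of_nonneg _ _ ENNReal.toReal_nonneg, lqNorm_rpow hp hp', tsum_fintype,
    ← ENNReal.rpow_mul, mem_level.1 hν, layerSum]

theorem blockSum_le_bENorm (t : ℝ) {p : ℝ≥0∞} (hp : 0 < p) (hp' : p ≠ ∞) (a : SeqFamily d ψ₀ ψ₁)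
    (μ : ℕ) :
    blockSum μ a p.toReal ≤ (2 ^ (-((μ : ℝ) * (t - recip p))) * bENorm t p p a) ^ p.toReal := by
  rw [ENNReal.mul_rpow_of_nonneg _ _ ENNReal.toReal_nonneg, bENorm_rpow t hp hp',
    ← ENNReal.rpow_mul]
  calc blockSum μ a p.toReal = 2 ^ (-((μ : ℝ) * (t - recip p)) * p.toReal) *
        (2 ^ ((μ : ℝ) * (t - recip p) * p.toReal) * blockSum μ a p.toReal) := by
        rw [← mul_assoc, ← two_rpow_add, neg_mul, neg_add_cancel, ENNReal.rpow_zero, one_mul]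
    _ ≤ _ := by
        gcongr
        exact ENNReal.le_tsum (f := fun μ : ℕ => (2 : ℝ≥0∞) ^ ((μ : ℝ) * (t - recip p) * p.toReal) *
          blockSum μ a p.toReal) μ

theorem bENorm_rpow_of_support (t : ℝ) {p : ℝ≥0∞} (hp : 0 < p) (hp' : p ≠ ∞)
    (a : SeqFamily d ψ₀ ψ₁) (μ : ℕ) (ha : ∀ ν, levelSum ν ≠ μ → a ν = 0) :
    bENorm t p p a ^ p.toReal =
      2 ^ ((μ : ℝ) * (t - recip p) * p.toReal) * blockSum μ a p.toReal := by
  rw [bENorm_rpow t hp hp']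
  refine tsum_eq_single μ fun μ' hμ' => ?_
  have hr : 0 < p.toReal := ENNReal.toReal_pos hp.ne' hp'
  have : blockSum μ' a p.toReal = 0 := by
    refine Finset.sum_eq_zero fun ν hν => Finset.sum_eq_zero fun m _ => ?_
    rw [ha ν (by rw [mem_level.1 hν]; exact hμ')]
    simp [hr]
  rw [this, mul_zero]

theorem bENorm_le_of_support_of_two_le (t : ℝ) {p : ℝ≥0∞} (hp : 2 ≤ p)
    (a : SeqFamily d ψ₀ ψ₁) (μ : ℕ) (ha : ∀ ν, levelSum ν ≠ μ → a ν = 0) :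
    bENorm t p p a ≤ 2 ^ ((μ : ℝ) * (t - recip p)) * blockSum μ a 2 ^ (1 / 2 : ℝ) := by
  have hp0 : 0 < p := lt_of_lt_of_le (by norm_num) hp
  by_cases hp' : p = ∞
  · rw [bENorm, lqNorm, if_pos hp']
    refine iSup_le fun ν => ?_
    by_cases hν : levelSum ν = μ
    · rw [hν]
      gcongr
      rw [lqNorm, if_pos hp']
      refine iSup_le fun m => ?_
      calc ‖a ν m‖ₑ = (‖a ν m‖ₑ ^ (2 : ℝ)) ^ (1 / 2 : ℝ) := by
            rw [← ENNReal.rpow_mul]; norm_num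
        _ ≤ _ := by
            gcongr
            calc ‖a ν m‖ₑ ^ (2 : ℝ) ≤ layerSum ν a 2 :=
                  Finset.single_le_sum (f := fun m => ‖a ν m‖ₑ ^ (2 : ℝ)) (fun _ _ => zero_le)
                    (Finset.mem_univ m)
              _ ≤ _ := Finset.single_le_sum (f := fun ν => layerSum ν a 2) (fun _ _ => zero_le)
                    (mem_level.2 hν)
    · rw [ha ν hν]
      simp [lqNorm, hp']
  · have hr : 0 < p.toReal := ENNReal.toReal_pos hp0.ne' hp'
    have hr2 : 2 ≤ p.toReal := by
      have := ENNReal.toReal_mono hp' hp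
      simpa using this
    rw [← ENNReal.rpow_le_rpow_iff hr, bENorm_rpow_of_support t hp0 hp' a μ ha,
      ENNReal.mul_rpow_of_nonneg _ _ hr.le, ← ENNReal.rpow_mul]
    gcongr
    rw [← ENNReal.rpow_mul, blockSum, blockSum]
    have h1 : ∀ (ν : Fin d → ℕ), layerSum ν a p.toReal ≤ layerSum ν a 2 ^ (1 / 2 * p.toReal) := by
      intro ν
      refine le_trans (le_of_eq ?_) (finset_sum_rpow_le _ _ (by linarith))
      refine Finset.sum_congr rfl fun m _ => ?_
      rw [← ENNReal.rpow_mul]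
      congr 1
      ring
    exact (Finset.sum_le_sum fun ν _ => h1 ν).trans (finset_sum_rpow_le _ _ (by linarith))

end

/-! ### Operators between quasi-normed spaces -/

theorem QuasiNorm.toFun_zero {X : Type*} [AddCommGroup X] [Module ℂ X] (N : QuasiNorm X) :
    N.toFun 0 = 0 := by
  simpa using N.smul 0 0

theorem toFun_le_of_opNorm_le {X Y : Type*} [AddCommGroup X] [Module ℂ X] [AddCommGroup Y]
    [Module ℂ Y] {NX : QuasiNorm X} {NY : QuasiNorm Y} {T : X →ₗ[ℂ] Y} {C : ℝ≥0}
    (h : opNorm NX NY T ≤ C) (x : X) : NY.toFun (T x) ≤ C * NX.toFun x := by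
  rcases eq_or_ne (NX.toFun x) 0 with h0 | h0
  · rw [NX.eq_zero_of_toFun_eq_zero x h0, map_zero, NY.toFun_zero]
    exact zero_le
  · set c : ℂ := ((((NX.toFun x)⁻¹ : ℝ≥0) : ℝ) : ℂ) with hc
    have hcn : ‖c‖₊ = (NX.toFun x)⁻¹ := by
      ext
      simp [hc]
    have h1 : NX.toFun (c • x) ≤ 1 := by
      rw [NX.smul, hcn, inv_mul_cancel₀ h0]
    have h2 : (NY.toFun (T (c • x)) : ℝ≥0∞) ≤ C :=
      (le_iSup₂ (f := fun (x : X) (_ : NX.toFun x ≤ 1) => (NY.toFun (T x) : ℝ≥0∞)) _ h1).trans h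
    rw [map_smul, NY.smul, hcn] at h2
    have h3 : (NX.toFun x)⁻¹ * NY.toFun (T x) ≤ C := by exact_mod_cast h2
    rwa [inv_mul_le_iff₀ (pos_iff_ne_zero.2 h0), mul_comm] at h3

section

variable {d : ℕ} {ψ₀ ψ₁ : ℝ → ℂ}

theorem coe_bQuasiNorm (t : ℝ) {p q : ℝ≥0∞} (hp : 0 < p) (hq : 0 < q)
    (a : bSpace d ψ₀ ψ₁ t hp hq) :
    ((bQuasiNorm d ψ₀ ψ₁ t hp hq).toFun a : ℝ≥0∞) = bENorm t p q a.1 :=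
  ENNReal.coe_toNNReal (ne_of_lt a.2)

theorem coe_fQuasiNorm (t : ℝ) {p q : ℝ≥0∞} (hp : 0 < p) (hq : 0 < q)
    (a : fSpace d ψ₀ ψ₁ t hp hq) :
    ((fQuasiNorm d ψ₀ ψ₁ t hp hq).toFun a : ℝ≥0∞) = fENorm t p q a.1 :=
  ENNReal.coe_toNNReal (ne_of_lt a.2)

theorem bENorm_le_enorm {t : ℝ} {p : ℝ≥0∞} {hp : 0 < p}
    {A : ell2 →ₗ[ℂ] bSpace d ψ₀ ψ₁ t hp hp}
    (hA : opNorm (normQuasiNorm ell2) (bQuasiNorm d ψ₀ ψ₁ t hp hp) A ≤ 1) (x : ell2) :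
    bENorm t p p (A x).1 ≤ ‖x‖ₑ := by
  have := toFun_le_of_opNorm_le (C := 1) (by simpa using hA) x
  rw [one_mul, ← ENNReal.coe_le_coe, coe_bQuasiNorm] at this
  exact this

/-- The coordinates of an operator from `ℓ₂` are represented by vectors of `ℓ₂`. -/
theorem exists_rows {t : ℝ} {p : ℝ≥0∞} {hp : 0 < p} {A : ell2 →ₗ[ℂ] bSpace d ψ₀ ψ₁ t hp hp}
    (hA : opNorm (normQuasiNorm ell2) (bQuasiNorm d ψ₀ ψ₁ t hp hp) A ≤ 1) :
    ∃ r : (ν : Fin d → ℕ) → omegaIndex ψ₀ ψ₁ ν → ell2,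
      (∀ ν m x, inner ℂ (r ν m) x = (A x).1 ν m) ∧
      ∀ ν m, ‖r ν m‖ ≤ (2 : ℝ) ^ (-((levelSum ν : ℝ) * (t - recip p))) := by
  have hb : ∀ ν m x, ‖(A x).1 ν m‖ ≤ (2 : ℝ) ^ (-((levelSum ν : ℝ) * (t - recip p))) * ‖x‖ := by
    intro ν m x
    have h1 := (enorm_coord_le t hp (A x).1 ν m).trans
      (mul_le_mul' le_rfl (bENorm_le_enorm hA x))
    rw [two_rpow_eq_ofReal, ← ofReal_norm, ← ofReal_norm, ← ENNReal.ofReal_mul (by positivity)] at h1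
    exact (ENNReal.ofReal_le_ofReal_iff (by positivity)).1 h1
  let φ : (ν : Fin d → ℕ) → omegaIndex ψ₀ ψ₁ ν → (ell2 →L[ℂ] ℂ) := fun ν m =>
    LinearMap.mkContinuous
      { toFun := fun x => (A x).1 ν m
        map_add' := fun x y => by simp
        map_smul' := fun c x => by simp } _ (hb ν m)
  refine ⟨fun ν m => (InnerProductSpace.toDual ℂ ell2).symm (φ ν m), fun ν m x => ?_, fun ν m => ?_⟩
  · rw [InnerProductSpace.toDual_symm_apply]
    rfl
  · rw [LinearIsometryEquiv.norm_map]
    exact LinearMap.mkContinuous_norm_le _ (by positivity) _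

/-- For every operator `A : ℓ₂ → s^t_{p₀,p₀} b` of norm at most one, the quasi-norm of `A x` in
`s^0_{p,2} f` is at most `B` on the unit ball of a subspace of codimension less than `n`. -/
def UpperEst (d : ℕ) (ψ₀ ψ₁ : ℝ → ℂ) {p₀ : ℝ≥0∞} (hp₀ : 0 < p₀) (t : ℝ) (p : ℝ≥0∞) (n : ℕ)
    (B : ℝ) : Prop :=
  ∀ A : ell2 →ₗ[ℂ] bSpace d ψ₀ ψ₁ t hp₀ hp₀,
    opNorm (normQuasiNorm ell2) (bQuasiNorm d ψ₀ ψ₁ t hp₀ hp₀) A ≤ 1 →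
    ∃ V : Submodule ℂ ell2, FiniteDimensional ℂ V ∧ Module.finrank ℂ V < n ∧
      ∀ x ∈ Vᗮ, ‖x‖ ≤ 1 → fENorm 0 p 2 (A x).1 ≤ ENNReal.ofReal B

/-- There is an operator `T : ℓ₂^h → s^t_{p₀,p₀} b` of norm at most one such that each subspace of
codimension less than `n` contains `x` in the unit ball with `‖T x | s^0_{p,2} f‖ ≥ β`. -/
def LowerEst (d : ℕ) (ψ₀ ψ₁ : ℝ → ℂ) (p₀ : ℝ≥0∞) (t : ℝ) (p : ℝ≥0∞) (n : ℕ) (β : ℝ) : Prop :=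
  ∃ (h : ℕ) (T : EuclideanSpace ℂ (Fin h) →ₗ[ℂ] SeqFamily d ψ₀ ψ₁),
    (∀ x, bENorm t p₀ p₀ (T x) ≤ ‖x‖ₑ) ∧
    ∀ M : Submodule ℂ (EuclideanSpace ℂ (Fin h)), h < Module.finrank ℂ M + n →
      ∃ x ∈ M, ‖x‖ ≤ 1 ∧ ENNReal.ofReal β ≤ fENorm 0 p 2 (T x)

variable {p₀ p : ℝ≥0∞} {hp₀ : 0 < p₀} {hp : 0 < p} {t : ℝ}

/-- The approximant is `id* ∘ A` composed with the orthogonal projection onto `V`. Its rank is at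
most `dim V`, and the error only sees the component in `Vᗮ`, which still lies in the unit ball. -/
theorem weylNumber_le_of_upperEst
    {h : bSpace d ψ₀ ψ₁ t hp₀ hp₀ ≤ fSpace d ψ₀ ψ₁ 0 hp (zero_lt_two : (0 : ℝ≥0∞) < 2)}
    (hcont : opNorm (bQuasiNorm d ψ₀ ψ₁ t hp₀ hp₀) (fQuasiNorm d ψ₀ ψ₁ 0 hp zero_lt_two)
      (Submodule.inclusion h) < ∞) {n : ℕ} {B : ℝ} (hU : UpperEst d ψ₀ ψ₁ hp₀ t p n B) :
    weylNumber (bQuasiNorm d ψ₀ ψ₁ t hp₀ hp₀) (fQuasiNorm d ψ₀ ψ₁ 0 hp zero_lt_two)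
      (Submodule.inclusion h) n ≤ ENNReal.ofReal B := by
  refine iSup₂_le fun A hA => ?_
  obtain ⟨V, hV, hVn, hVB⟩ := hU A hA
  have hproj : ∀ x, ‖V.orthogonalProjectionOnto x‖ ≤ ‖x‖ := fun x => V.norm_orthogonalProjectionOnto_apply_le x
  set S := Submodule.inclusion h ∘ₗ A with hS
  let L : ell2 →ₗ[ℂ] fSpace d ψ₀ ψ₁ 0 hp (zero_lt_two : (0 : ℝ≥0∞) < 2) :=
    (S ∘ₗ V.subtype) ∘ₗ (V.orthogonalProjectionOnto : ell2 →ₗ[ℂ] V)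
  have hL : ∀ x, L x = S (V.orthogonalProjectionOnto x : ell2) := fun x => rfl
  have hLnorm : opNorm (normQuasiNorm ell2) (fQuasiNorm d ψ₀ ψ₁ 0 hp zero_lt_two) L < ∞ := by
    obtain ⟨C, hC⟩ := WithTop.ne_top_iff_exists.1 hcont.ne
    refine lt_of_le_of_lt (iSup₂_le fun x hx => ?_) (ENNReal.coe_lt_top (r := C))
    have h1 := toFun_le_of_opNorm_le hC.ge (A (V.orthogonalProjectionOnto x : ell2))
    have h2 := toFun_le_of_opNorm_le (C := 1) (by simpa using hA) (V.orthogonalProjectionOnto x : ell2)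
    have h3 : (normQuasiNorm ell2).toFun (V.orthogonalProjectionOnto x : ell2) ≤ 1 :=
      le_trans (show ‖(V.orthogonalProjectionOnto x : ell2)‖₊ ≤ ‖x‖₊ from hproj x) hx
    rw [hL]
    refine ENNReal.coe_le_coe.2 (h1.trans ?_)
    calc _ ≤ C * (1 * 1) := by gcongr; exact h2.trans (by gcongr)
      _ = C := by simp
  have hLrank : L.rank < (n : Cardinal) := by
    calc L.rank ≤ (S ∘ₗ V.subtype).rank := LinearMap.rank_comp_le_left _ _
      _ ≤ Module.rank ℂ V := LinearMap.rank_le_domain _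
      _ = (Module.finrank ℂ V : Cardinal) := (Module.finrank_eq_rank ℂ V).symm
      _ < n := by exact_mod_cast hVn
  refine (iInf₂_le_of_le L hLnorm (iInf_le_of_le hLrank le_rfl)).trans ?_
  refine iSup₂_le fun x hx => ?_
  have h1 : (S - L) x = S (x - (V.orthogonalProjectionOnto x : ell2)) := by
    rw [LinearMap.sub_apply, hL, map_sub]
  rw [h1, coe_fQuasiNorm]
  refine hVB _ (V.sub_starProjection_mem_orthogonal x) ?_
  have h2 : x - (V.orthogonalProjectionOnto x : ell2) = Vᗮ.orthogonalProjectionOnto x := by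
    rw [Submodule.orthogonalProjectionOnto_orthogonal]
    rfl
  rw [h2]
  exact (Vᗮ.norm_orthogonalProjectionOnto_apply_le x).trans hx

/-- For `n = 1` the subspace is zero; testing with the rank one operator `x ↦ x 0 • a` gives the
embedding inequality for the single family `a`. -/
theorem fENorm_le_of_upperEst_one {B : ℝ} (hU : UpperEst d ψ₀ ψ₁ hp₀ t p 1 B)
    (a : SeqFamily d ψ₀ ψ₁) (ha : bENorm t p₀ p₀ a ≤ 1) : fENorm 0 p 2 a ≤ ENNReal.ofReal B := by
  have hmem : ∀ c : ℂ, c • a ∈ bSpace d ψ₀ ψ₁ t hp₀ hp₀ := fun c =>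
    Submodule.smul_mem _ c (show bENorm t p₀ p₀ a < ∞ from ha.trans_lt (by simp))
  let A : ell2 →ₗ[ℂ] bSpace d ψ₀ ψ₁ t hp₀ hp₀ :=
    { toFun := fun x => ⟨x 0 • a, hmem _⟩
      map_add' := fun x y => Subtype.ext (by simp [add_smul])
      map_smul' := fun c x => Subtype.ext (by simp [mul_smul]) }
  obtain ⟨V, hV, hV1, hVB⟩ := hU A <| by
    refine iSup₂_le fun x hx => ?_
    rw [coe_bQuasiNorm]
    show bENorm t p₀ p₀ (x 0 • a) ≤ 1
    rw [bENorm_smul t hp₀ hp₀]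
    have h1 : ‖x 0‖ ≤ 1 := (lp.norm_apply_le_norm (by norm_num) x 0).trans hx
    have h2 : ‖x 0‖ₑ ≤ 1 := by
      rw [← ofReal_norm, ← ENNReal.ofReal_one]
      exact ENNReal.ofReal_le_ofReal h1
    exact mul_le_one' h2 ha
  have hV0 : V = ⊥ := Submodule.finrank_eq_zero.1 (by omega)
  have h1 := hVB (lp.single 2 0 1) (by rw [hV0, Submodule.bot_orthogonal_eq_top]; trivial)
    (by rw [lp.norm_single (by norm_num)]; simp)
  have h2 : (A (lp.single 2 0 1)).1 = a := by
    show (lp.single 2 (0 : ℕ) (1 : ℂ) : ell2) 0 • a = a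
    simp
  rwa [h2] at h1

theorem bSpace_le_fSpace_of_upperEst {B : ℝ} (hU : UpperEst d ψ₀ ψ₁ hp₀ t p 1 B) :
    bSpace d ψ₀ ψ₁ t hp₀ hp₀ ≤ fSpace d ψ₀ ψ₁ 0 hp (zero_lt_two : (0 : ℝ≥0∞) < 2) := by
  intro a ha
  have ha' : bENorm t p₀ p₀ a ≠ ∞ := ne_of_lt ha
  rcases eq_or_ne (bENorm t p₀ p₀ a) 0 with h0 | h0
  · rw [bENorm_eq_zero t hp₀ hp₀ a h0]
    exact zero_mem _
  · set c : ℝ := (bENorm t p₀ p₀ a).toReal with hc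
    have hc0 : 0 < c := ENNReal.toReal_pos h0 ha'
    have hcc : bENorm t p₀ p₀ a = ENNReal.ofReal c := (ENNReal.ofReal_toReal ha').symm
    have h1 := fENorm_le_of_upperEst_one hU (((c⁻¹ : ℝ) : ℂ) • a) <| by
      rw [bENorm_smul t hp₀ hp₀, hcc, ← ofReal_norm, Complex.norm_real, norm_inv,
        Real.norm_of_nonneg hc0.le, ← ENNReal.ofReal_mul (by positivity),
        inv_mul_cancel₀ hc0.ne', ENNReal.ofReal_one]
    have h2 : (((c⁻¹ : ℝ) : ℂ) • a) ∈
        fSpace d ψ₀ ψ₁ 0 hp (zero_lt_two : (0 : ℝ≥0∞) < 2) := h1.trans_lt (by simp)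
    have h3 := Submodule.smul_mem _ ((c : ℝ) : ℂ) h2
    rwa [smul_smul, ← Complex.ofReal_mul, mul_inv_cancel₀ hc0.ne', Complex.ofReal_one,
      one_smul] at h3

/-- An approximant of rank less than `n`, restricted to the first `k` coordinates of `ℓ₂`, has a
kernel of codimension less than `n`, and there the difference is `T` itself. -/
theorem le_weylNumber_of_lowerEst
    {h : bSpace d ψ₀ ψ₁ t hp₀ hp₀ ≤ fSpace d ψ₀ ψ₁ 0 hp (zero_lt_two : (0 : ℝ≥0∞) < 2)}
    {n : ℕ} {β : ℝ} (hL : LowerEst d ψ₀ ψ₁ p₀ t p n β) :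
    ENNReal.ofReal β ≤
      weylNumber (bQuasiNorm d ψ₀ ψ₁ t hp₀ hp₀) (fQuasiNorm d ψ₀ ψ₁ 0 hp zero_lt_two)
        (Submodule.inclusion h) n := by
  obtain ⟨k, T, hT, hM⟩ := hL
  -- `τ` keeps the first `k` coordinates and `j` puts them back; `j` is isometric and `τ` is a
  -- contraction.
  let τ : ell2 →ₗ[ℂ] EuclideanSpace ℂ (Fin k) :=
    { toFun := fun x => WithLp.toLp 2 fun i => x i
      map_add' := fun x y => by ext i; simp
      map_smul' := fun c x => by ext i; simp }
  have hτ : ∀ x, ‖τ x‖ ≤ ‖x‖ := by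
    intro x
    have h1 := lp.sum_rpow_le_norm_rpow (p := 2) (by norm_num) x (Finset.range k)
    rw [Finset.sum_range] at h1
    have h2 : ‖τ x‖ ^ 2 ≤ ‖x‖ ^ 2 := by
      rw [EuclideanSpace.norm_sq_eq]
      simpa [τ] using h1
    exact le_of_sq_le_sq h2 (norm_nonneg _)
  let j : EuclideanSpace ℂ (Fin k) →ₗ[ℂ] ell2 :=
    { toFun := fun x => ∑ i : Fin k, lp.single 2 (i : ℕ) (x i)
      map_add' := fun x y => by
        rw [← Finset.sum_add_distrib]
        exact Finset.sum_congr rfl fun i _ => by simp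
      map_smul' := fun c x => by
        rw [Finset.smul_sum]
        exact Finset.sum_congr rfl fun i _ => by rw [PiLp.smul_apply, lp.single_smul]; rfl }
  have hj : ∀ (x : EuclideanSpace ℂ (Fin k)) (i : Fin k), (j x : ℕ → ℂ) i = x i := by
    intro x i
    show ((∑ i : Fin k, lp.single 2 (i : ℕ) (x i) : ell2) : ℕ → ℂ) i = x i
    rw [lp.coeFn_sum, Finset.sum_apply, Finset.sum_eq_single i]
    · simp
    · intro b _ hb
      rw [lp.single_apply, Pi.single_apply, if_neg]
      exact fun h => hb (Fin.ext h.symm)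
    · simp
  have hτj : ∀ x, τ (j x) = x := by
    intro x
    ext i
    exact hj x i
  have hjn : ∀ x, ‖j x‖ = ‖x‖ := by
    intro x
    refine le_antisymm ?_ (by simpa [hτj] using hτ (j x))
    have h1 : ‖j x‖ ^ 2 ≤ ‖x‖ ^ 2 := by
      let f : ℕ → ℂ := fun i => if hi : i < k then x ⟨i, hi⟩ else 0
      have h2 := lp.norm_sum_single (E := fun _ : ℕ => ℂ) (p := 2) (by norm_num) f (Finset.range k)
      have h3 : ∑ i ∈ Finset.range k, lp.single 2 i (f i) = j x := by
        rw [Finset.sum_range]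
        show _ = ∑ i : Fin k, (lp.single 2 (i : ℕ) (x i) : ell2)
        exact Finset.sum_congr rfl fun i _ => by simp [f]
      rw [h3, Finset.sum_range] at h2
      rw [EuclideanSpace.norm_sq_eq]
      simp only [ENNReal.toReal_ofNat, Real.rpow_two] at h2
      rw [h2]
      exact le_of_eq (Finset.sum_congr rfl fun i _ => by simp [f])
    exact le_of_sq_le_sq h1 (norm_nonneg _)
  have hTτ : ∀ x, bENorm t p₀ p₀ (T (τ x)) ≤ ‖x‖ₑ := fun x => (hT _).trans <| by
    rw [← ofReal_norm, ← ofReal_norm]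
    exact ENNReal.ofReal_le_ofReal (hτ x)
  let A : ell2 →ₗ[ℂ] bSpace d ψ₀ ψ₁ t hp₀ hp₀ :=
    LinearMap.codRestrict _ (T ∘ₗ τ) fun x => (hTτ x).trans_lt (by simp)
  have hA : opNorm (normQuasiNorm ell2) (bQuasiNorm d ψ₀ ψ₁ t hp₀ hp₀) A ≤ 1 := by
    refine iSup₂_le fun x hx => ?_
    rw [coe_bQuasiNorm]
    refine (hTτ x).trans ?_
    exact ENNReal.coe_le_coe.2 (show ‖x‖₊ ≤ 1 from hx)
  refine le_trans ?_ (le_iSup₂ (f := fun (A : ell2 →ₗ[ℂ] bSpace d ψ₀ ψ₁ t hp₀ hp₀)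
    (_ : opNorm (normQuasiNorm ell2) (bQuasiNorm d ψ₀ ψ₁ t hp₀ hp₀) A ≤ 1) =>
    approxNumber (normQuasiNorm ell2) (fQuasiNorm d ψ₀ ψ₁ 0 hp zero_lt_two)
      (Submodule.inclusion h ∘ₗ A) n) A hA)
  refine le_iInf₂ fun L _ => le_iInf fun hLr => ?_
  have hker : k < Module.finrank ℂ (LinearMap.ker (L ∘ₗ j)) + n := by
    have h1 := LinearMap.finrank_range_add_finrank_ker (L ∘ₗ j)
    have h2 : (L ∘ₗ j).rank < (n : Cardinal) := (LinearMap.rank_comp_le_left _ _).trans_lt hLr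
    rw [LinearMap.rank, ← Module.finrank_eq_rank] at h2
    have h3 : Module.finrank ℂ (LinearMap.range (L ∘ₗ j)) < n := by exact_mod_cast h2
    rw [finrank_euclideanSpace, Fintype.card_fin] at h1
    omega
  obtain ⟨x, hx, hx1, hxβ⟩ := hM _ hker
  refine hxβ.trans ?_
  refine le_trans (le_of_eq ?_) (le_iSup₂ (f := fun (y : ell2)
    (_ : (normQuasiNorm ell2).toFun y ≤ 1) => (((fQuasiNorm d ψ₀ ψ₁ 0 hp zero_lt_two).toFun
      ((Submodule.inclusion h ∘ₗ A - L) y) : ℝ≥0) : ℝ≥0∞)) (j x)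
    (show ‖j x‖ ≤ 1 by rw [hjn]; exact hx1))
  have h1 : L (j x) = 0 := LinearMap.mem_ker.1 hx
  rw [coe_fQuasiNorm, LinearMap.sub_apply, h1, sub_zero]
  show fENorm 0 p 2 (T x) = fENorm 0 p 2 (T (τ (j x)))
  rw [hτj]

theorem weylOrder_of_estimates {n₀ : ℕ} {φ : ℕ → ℝ} (h1 : ∃ B, UpperEst d ψ₀ ψ₁ hp₀ t p 1 B)
    (hU : ∃ C, 0 < C ∧ ∀ n, n₀ ≤ n → UpperEst d ψ₀ ψ₁ hp₀ t p n (C * φ n))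
    (hL : ∃ c, 0 < c ∧ ∀ n, n₀ ≤ n → LowerEst d ψ₀ ψ₁ p₀ t p n (c * φ n)) :
    WeylOrder d ψ₀ ψ₁ hp₀ hp t n₀ φ := by
  obtain ⟨B, hB⟩ := h1
  obtain ⟨C, hC, hU⟩ := hU
  obtain ⟨c, hc, hL⟩ := hL
  have hcont : opNorm (bQuasiNorm d ψ₀ ψ₁ t hp₀ hp₀) (fQuasiNorm d ψ₀ ψ₁ 0 hp zero_lt_two)
      (Submodule.inclusion (bSpace_le_fSpace_of_upperEst (hp := hp) hB)) < ∞ := by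
    refine lt_of_le_of_lt (iSup₂_le fun a ha => ?_) (ENNReal.ofReal_lt_top (r := B))
    rw [coe_fQuasiNorm]
    refine fENorm_le_of_upperEst_one hB _ ?_
    rw [← ENNReal.coe_le_coe, coe_bQuasiNorm] at ha
    simpa using ha
  exact ⟨bSpace_le_fSpace_of_upperEst hB, hcont, c, C, hc, hC, fun n hn =>
    ⟨le_weylNumber_of_lowerEst (hL n hn), weylNumber_le_of_upperEst hcont (hU n hn)⟩⟩

end

end MixedWeyl

/-! ### From blocks to whole families: summation of upper estimates. -/

namespace MixedWeyl

/-! ### Monotonicity of the estimates in `p` -/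

section

variable {d : ℕ} {ψ₀ ψ₁ : ℝ → ℂ} [∀ ν : Fin d → ℕ, Fintype (omegaIndex ψ₀ ψ₁ ν)]

theorem blockFun_eq_zero_of_forall (μ : ℕ) {a : SeqFamily d ψ₀ ψ₁} {x : Fin d → ℝ}
    (h : ∀ ν, levelSum ν = μ → ∀ m : omegaIndex ψ₀ ψ₁ ν, a ν m = 0 ∨ x ∉ dyadicCube ν m) :
    blockFun μ a x = 0 := by
  refine Finset.sum_eq_zero fun ν hν => Finset.sum_eq_zero fun m _ => ?_
  rcases h ν (mem_level.1 hν) m with h | h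
  · simp [h]
  · rw [chi_eq_zero h, mul_zero]

theorem measurable_tsum_blockFun (a : SeqFamily d ψ₀ ψ₁) :
    Measurable fun x => ∑' μ, blockFun μ a x :=
  Measurable.tsum fun μ => measurable_blockFun μ a

/-- All rectangles lie in one set of finite measure, so this is Hölder's inequality for `L_p` and
`L_{p'}` on that set. It transfers upper estimates to smaller and lower estimates to larger
exponents. -/
theorem fENorm_mono_exponent {R : ℝ} (hR : IndexGeometry d ψ₀ ψ₁ R) {p p' : ℝ≥0∞} (hp : 0 < p)
    (hpp : p ≤ p') (hp' : p' < ∞) :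
    ∃ C : ℝ, 0 < C ∧ ∀ a : SeqFamily d ψ₀ ψ₁, fENorm 0 p 2 a ≤ ENNReal.ofReal C * fENorm 0 p' 2 a := by
  obtain ⟨S, hS, hSv, hSQ⟩ := hR.exists_box
  have hr : 0 < p.toReal := ENNReal.toReal_pos hp.ne' (hpp.trans_lt hp').ne
  have hrr : p.toReal ≤ p'.toReal := ENNReal.toReal_mono hp'.ne hpp
  have hr' : 0 < p'.toReal := hr.trans_le hrr
  have hR0 : 0 < R := lt_of_lt_of_le one_pos hR.one_le
  have he : 0 ≤ 1 - p.toReal / 2 / (p'.toReal / 2) := by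
    rw [div_div_div_cancel_right₀ (by norm_num), sub_nonneg, div_le_one hr']
    exact hrr
  refine ⟨R ^ ((1 - p.toReal / 2 / (p'.toReal / 2)) * (1 / p.toReal)), by positivity, fun a => ?_⟩
  rw [fENorm_eq hp (hpp.trans_lt hp'), fENorm_eq (hp.trans_le hpp) hp']
  have h1 := lintegral_rpow_le_of_support hS (measurable_tsum_blockFun a)
    (fun x hx => ENNReal.tsum_eq_zero.2 fun μ => blockFun_eq_zero_of_forall μ fun ν _ m =>
      Or.inr fun hxm => hx (hSQ ν m m.2 hxm)) (s := p.toReal / 2) (s' := p'.toReal / 2)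
    (by positivity) (by linarith)
  calc _ ≤ ((∫⁻ x, (∑' μ, blockFun μ a x) ^ (p'.toReal / 2)) ^ (p.toReal / 2 / (p'.toReal / 2)) *
        (ENNReal.ofReal R) ^ (1 - p.toReal / 2 / (p'.toReal / 2))) ^ (1 / p.toReal) := by
        gcongr
        exact h1.trans (by gcongr)
    _ = _ := by
        rw [ENNReal.mul_rpow_of_nonneg _ _ (by positivity), ← ENNReal.rpow_mul, ← ENNReal.rpow_mul,
          ENNReal.ofReal_rpow_of_pos hR0, mul_comm]
        congr 2
        field_simp

theorem UpperEst.of_le {R : ℝ} (hR : IndexGeometry d ψ₀ ψ₁ R) {p₀ : ℝ≥0∞} (hp₀ : 0 < p₀) (t : ℝ)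
    {p p' : ℝ≥0∞} (hp : 0 < p) (hpp : p ≤ p') (hp' : p' < ∞) :
    ∃ C : ℝ, 0 < C ∧ ∀ n B, UpperEst d ψ₀ ψ₁ hp₀ t p' n B → UpperEst d ψ₀ ψ₁ hp₀ t p n (C * B) := by
  obtain ⟨C, hC, h⟩ := fENorm_mono_exponent hR hp hpp hp'
  refine ⟨C, hC, fun n B hU A hA => ?_⟩
  obtain ⟨V, hV, hVn, hVB⟩ := hU A hA
  refine ⟨V, hV, hVn, fun x hx hx1 => (h _).trans ?_⟩
  rw [ENNReal.ofReal_mul hC.le]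
  gcongr
  exact hVB x hx hx1

theorem LowerEst.of_le {R : ℝ} (hR : IndexGeometry d ψ₀ ψ₁ R) (p₀ : ℝ≥0∞) (t : ℝ)
    {p p' : ℝ≥0∞} (hp : 0 < p) (hpp : p ≤ p') (hp' : p' < ∞) :
    ∃ c : ℝ, 0 < c ∧ ∀ n β, LowerEst d ψ₀ ψ₁ p₀ t p n β → LowerEst d ψ₀ ψ₁ p₀ t p' n (c * β) := by
  obtain ⟨C, hC, h⟩ := fENorm_mono_exponent hR hp hpp hp'
  refine ⟨C⁻¹, by positivity, fun n β ⟨k, T, hT, hM⟩ => ⟨k, T, hT, fun M hMn => ?_⟩⟩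
  obtain ⟨x, hx, hx1, hxβ⟩ := hM M hMn
  refine ⟨x, hx, hx1, ?_⟩
  have h1 := hxβ.trans (h _)
  calc ENNReal.ofReal (C⁻¹ * β) = ENNReal.ofReal C⁻¹ * ENNReal.ofReal β :=
        ENNReal.ofReal_mul (by positivity)
    _ ≤ ENNReal.ofReal C⁻¹ * (ENNReal.ofReal C * fENorm 0 p' 2 (T x)) := by gcongr
    _ = _ := by
        rw [← mul_assoc, ← ENNReal.ofReal_mul (by positivity), inv_mul_cancel₀ hC.ne',
          ENNReal.ofReal_one, one_mul]

end

/-! ### Summation over the blocks -/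

theorem tsum_two_rpow_abs_le {ε : ℝ} (hε : 0 < ε) (J : ℕ) :
    ∑' μ : ℕ, (2 : ℝ≥0∞) ^ (-(ε * |(J : ℝ) - μ|)) ≤ ENNReal.ofReal (2 / (1 - 2 ^ (-ε))) := by
  refine ENNReal.tsum_le_of_sum_range_le fun n => ?_
  have h1 := sum_range_rpow_abs_le (x := (2 : ℝ) ^ (-ε)) (by positivity)
    (Real.rpow_lt_one_of_one_lt_of_neg (by norm_num) (by linarith)) J n
  refine le_trans (le_of_eq ?_) (ENNReal.ofReal_le_ofReal h1)
  rw [ENNReal.ofReal_sum_of_nonneg fun _ _ => by positivity]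
  refine Finset.sum_congr rfl fun j _ => ?_
  rw [two_rpow_eq_ofReal, ← Real.rpow_mul (by norm_num), neg_mul]

/-- Each term is at most `2^(-ε|J-μ|)` times the `1/s`-th power of the weighted sum; summing the
geometric series works for `s < 1` and `s ≥ 1` alike and replaces the triangle inequality. -/
theorem tsum_rpow_le_tsum {ε : ℝ} (hε : 0 < ε) {s : ℝ} (hs : 0 < s) :
    ∃ C : ℝ, 0 < C ∧ ∀ (J : ℕ) (S : ℕ → ℝ≥0∞), (∑' μ, S μ) ^ s ≤
      ENNReal.ofReal C * ∑' μ : ℕ, 2 ^ (ε * s * |(J : ℝ) - μ|) * S μ ^ s := by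
  have hx : (2 : ℝ) ^ (-ε) < 1 := Real.rpow_lt_one_of_one_lt_of_neg (by norm_num) (by linarith)
  have hC : 0 < 2 / (1 - (2 : ℝ) ^ (-ε)) := div_pos (by norm_num) (by linarith)
  refine ⟨(2 / (1 - (2 : ℝ) ^ (-ε))) ^ s, by positivity, fun J S => ?_⟩
  set T := ∑' μ : ℕ, 2 ^ (ε * s * |(J : ℝ) - μ|) * S μ ^ s with hT
  have h1 : ∀ μ, S μ ≤ 2 ^ (-(ε * |(J : ℝ) - μ|)) * T ^ (1 / s) := by
    intro μ
    have h2 : 2 ^ (ε * s * |(J : ℝ) - μ|) * S μ ^ s ≤ T :=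
      ENNReal.le_tsum (f := fun μ : ℕ => 2 ^ (ε * s * |(J : ℝ) - μ|) * S μ ^ s) μ
    calc S μ = 2 ^ (-(ε * |(J : ℝ) - μ|)) * (2 ^ (ε * s * |(J : ℝ) - μ|) * S μ ^ s) ^ (1 / s) := by
          rw [ENNReal.mul_rpow_of_nonneg _ _ (by positivity), ← ENNReal.rpow_mul,
            ← ENNReal.rpow_mul, mul_one_div_cancel hs.ne', ENNReal.rpow_one, ← mul_assoc,
            ← two_rpow_add]
          have : -(ε * |(J : ℝ) - μ|) + ε * s * |(J : ℝ) - μ| * (1 / s) = 0 := by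
            field_simp
            ring
          rw [this, ENNReal.rpow_zero, one_mul]
      _ ≤ _ := by gcongr
  calc (∑' μ, S μ) ^ s ≤ (∑' μ : ℕ, 2 ^ (-(ε * |(J : ℝ) - μ|)) * T ^ (1 / s)) ^ s := by
        gcongr with μ
        exact h1 μ
    _ ≤ (ENNReal.ofReal (2 / (1 - 2 ^ (-ε))) * T ^ (1 / s)) ^ s := by
        rw [ENNReal.tsum_mul_right]
        gcongr
        exact tsum_two_rpow_abs_le hε J
    _ = _ := by
        rw [ENNReal.mul_rpow_of_nonneg _ _ hs.le, ← ENNReal.rpow_mul, one_div_mul_cancel hs.ne',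
          ENNReal.rpow_one, ENNReal.ofReal_rpow_of_pos hC]

theorem finrank_finset_sup_le {ι E : Type*} [AddCommGroup E] [Module ℂ E] (s : Finset ι)
    (V : ι → Submodule ℂ E) [∀ i, FiniteDimensional ℂ (V i)] :
    Module.finrank ℂ (s.sup V : Submodule ℂ E) ≤ ∑ i ∈ s, Module.finrank ℂ (V i) := by
  classical
  induction s using Finset.induction_on with
  | empty => simp
  | insert i s hi ih =>
    rw [Finset.sup_insert, Finset.sum_insert hi]
    have : FiniteDimensional ℂ (s.sup V : Submodule ℂ E) := Submodule.finiteDimensional_finset_sup s V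
    exact (Submodule.finrank_add_le_finrank_add_finrank _ _).trans (by omega)

section

variable {d : ℕ} {ψ₀ ψ₁ : ℝ → ℂ} [∀ ν : Fin d → ℕ, Fintype (omegaIndex ψ₀ ψ₁ ν)]

/-- On the unit ball of a subspace of codimension at most `v`, the `s^0_{p,2} f`-quasi-norm of the
`μ`-th block of `A x` is at most `B`. -/
def BlockBound (d : ℕ) (ψ₀ ψ₁ : ℝ → ℂ) [∀ ν : Fin d → ℕ, Fintype (omegaIndex ψ₀ ψ₁ ν)]
    {p₀ : ℝ≥0∞} {hp₀ : 0 < p₀} {t : ℝ} (P : ℝ) (A : ell2 →ₗ[ℂ] bSpace d ψ₀ ψ₁ t hp₀ hp₀)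
    (μ v : ℕ) (B : ℝ) : Prop :=
  ∃ V : Submodule ℂ ell2, FiniteDimensional ℂ V ∧ Module.finrank ℂ V ≤ v ∧
    ∀ x ∈ Vᗮ, ‖x‖ ≤ 1 → ∫⁻ y, blockFun μ (A x).1 y ^ (P / 2) ≤ ENNReal.ofReal (B ^ P)

variable {p₀ p : ℝ≥0∞} {hp₀ : 0 < p₀} {t : ℝ}

theorem BlockBound.mono {P : ℝ} (hP : 0 ≤ P) {A : ell2 →ₗ[ℂ] bSpace d ψ₀ ψ₁ t hp₀ hp₀}
    {μ v v' : ℕ} {B B' : ℝ} (h : BlockBound d ψ₀ ψ₁ P A μ v B) (hv : v ≤ v') (hB : 0 ≤ B)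
    (hBB : B ≤ B') : BlockBound d ψ₀ ψ₁ P A μ v' B' := by
  obtain ⟨V, hV, hVv, hVB⟩ := h
  exact ⟨V, hV, hVv.trans hv, fun x hx hx1 => (hVB x hx hx1).trans
    (ENNReal.ofReal_le_ofReal (Real.rpow_le_rpow hB hBB hP))⟩

/-- The subspaces of the finitely many blocks with nonzero codimension are added up. Half of the
decay of the block bounds is spent on the weights in the summation, the other half on convergence.
-/
theorem upperEst_of_blockBound (hp : 0 < p) (hp' : p < ∞) {ε : ℝ} (hε : 0 < ε) :
    ∃ C : ℝ, 0 < C ∧ ∀ (n J L : ℕ) (v : ℕ → ℕ) (B : ℝ), 0 ≤ B → (∀ μ, L ≤ μ → v μ = 0) →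
      ∑ μ ∈ Finset.range L, v μ < n →
      (∀ A : ell2 →ₗ[ℂ] bSpace d ψ₀ ψ₁ t hp₀ hp₀,
        opNorm (normQuasiNorm ell2) (bQuasiNorm d ψ₀ ψ₁ t hp₀ hp₀) A ≤ 1 →
        ∀ μ, BlockBound d ψ₀ ψ₁ p.toReal A μ (v μ) (B * 2 ^ (-(ε * |(J : ℝ) - μ|)))) →
      UpperEst d ψ₀ ψ₁ hp₀ t p n (C * B) := by
  have hP : 0 < p.toReal := ENNReal.toReal_pos hp.ne' hp'.ne
  obtain ⟨C, hC, hCs⟩ := tsum_rpow_le_tsum hε (half_pos hP)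
  set ε' := ε * (p.toReal / 2) with hε'
  have hε'0 : 0 < ε' := by positivity
  have hx : (2 : ℝ) ^ (-ε') < 1 := Real.rpow_lt_one_of_one_lt_of_neg (by norm_num) (by linarith)
  have hD : 0 < 2 / (1 - (2 : ℝ) ^ (-ε')) := div_pos (by norm_num) (by linarith)
  refine ⟨(C * (2 / (1 - (2 : ℝ) ^ (-ε')))) ^ (1 / p.toReal), by positivity,
    fun n J L v B hB hvL hvn hA A hA1 => ?_⟩
  choose V hV hVv hVB using hA A hA1
  refine ⟨(Finset.range L).sup V, Submodule.finiteDimensional_finset_sup _ _,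
    ((finrank_finset_sup_le _ _).trans (Finset.sum_le_sum fun μ _ => hVv μ)).trans_lt hvn,
    fun x hx hx1 => ?_⟩
  have hxμ : ∀ μ, x ∈ (V μ)ᗮ := by
    intro μ
    by_cases hμ : μ < L
    · exact Submodule.orthogonal_le (Finset.le_sup (Finset.mem_range.2 hμ)) hx
    · have h0 : Module.finrank ℂ (V μ) = 0 := by
        have := hVv μ
        rw [hvL μ (not_lt.1 hμ)] at this
        omega
      rw [Submodule.finrank_eq_zero.1 h0, Submodule.bot_orthogonal_eq_top]
      trivial
  rw [fENorm_eq hp hp']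
  calc (∫⁻ y, (∑' μ, blockFun μ (A x).1 y) ^ (p.toReal / 2)) ^ (1 / p.toReal)
      ≤ (∫⁻ y, ENNReal.ofReal C * ∑' μ : ℕ, 2 ^ (ε' * |(J : ℝ) - μ|) *
          blockFun μ (A x).1 y ^ (p.toReal / 2)) ^ (1 / p.toReal) := by
        gcongr with y
        exact hCs J _
    _ = (ENNReal.ofReal C * ∑' μ : ℕ, 2 ^ (ε' * |(J : ℝ) - μ|) *
          ∫⁻ y, blockFun μ (A x).1 y ^ (p.toReal / 2)) ^ (1 / p.toReal) := by
        rw [lintegral_const_mul' _ _ ENNReal.ofReal_ne_top, lintegral_tsum fun μ =>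
          (((measurable_blockFun μ _).pow_const _).const_mul _).aemeasurable]
        congr 3
        funext μ
        rw [lintegral_const_mul _ ((measurable_blockFun μ _).pow_const _)]
    _ ≤ (ENNReal.ofReal C * (ENNReal.ofReal (2 / (1 - (2 : ℝ) ^ (-ε'))) *
          ENNReal.ofReal (B ^ p.toReal))) ^ (1 / p.toReal) := by
        gcongr
        calc _ ≤ ∑' μ : ℕ, 2 ^ (-(ε' * |(J : ℝ) - μ|)) * ENNReal.ofReal (B ^ p.toReal) := by
              refine ENNReal.tsum_le_tsum fun μ => ?_
              calc _ ≤ 2 ^ (ε' * |(J : ℝ) - μ|) *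
                    ENNReal.ofReal ((B * 2 ^ (-(ε * |(J : ℝ) - μ|))) ^ p.toReal) := by
                    gcongr
                    exact hVB μ x (hxμ μ) hx1
                _ = _ := by
                    rw [Real.mul_rpow hB (by positivity), mul_comm (B ^ _),
                      ENNReal.ofReal_mul (by positivity), ← mul_assoc,
                      ← Real.rpow_mul (by norm_num), ← two_rpow_eq_ofReal, ← two_rpow_add]
                    congr 2
                    rw [hε']
                    ring
          _ ≤ _ := by
              rw [ENNReal.tsum_mul_right]
              gcongr
              exact tsum_two_rpow_abs_le hε'0 J
    _ = _ := by
        rw [← ENNReal.ofReal_mul (by positivity), ← ENNReal.ofReal_mul (by positivity), ← mul_assoc,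
          ENNReal.ofReal_rpow_of_nonneg (by positivity) (by positivity),
          Real.mul_rpow (by positivity) (by positivity), ← Real.rpow_mul hB,
          mul_one_div_cancel hP.ne', Real.rpow_one]

/-- Estimates for the blocks on subspaces of codimension at most `2c`. -/
def BlockEst (d : ℕ) (ψ₀ ψ₁ : ℝ → ℂ) [∀ ν : Fin d → ℕ, Fintype (omegaIndex ψ₀ ψ₁ ν)]
    {p₀ : ℝ≥0∞} (hp₀ : 0 < p₀) (t P α β γ : ℝ) : Prop :=
  ∃ C : ℝ, 0 < C ∧ ∀ A : ell2 →ₗ[ℂ] bSpace d ψ₀ ψ₁ t hp₀ hp₀,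
    opNorm (normQuasiNorm ell2) (bQuasiNorm d ψ₀ ψ₁ t hp₀ hp₀) A ≤ 1 →
    ∀ μ c : ℕ, BlockBound d ψ₀ ψ₁ P A μ (2 * c)
      (C * ((2 : ℝ) ^ (-(μ * α)) * (μ + 1 : ℝ) ^ β * (c + 1 : ℝ) ^ (-γ)))

theorem card_block_le {R : ℝ} (hd : 1 ≤ d) (hR : IndexGeometry d ψ₀ ψ₁ R) (μ : ℕ) :
    ((∑ ν ∈ level d μ, Fintype.card (omegaIndex ψ₀ ψ₁ ν) : ℕ) : ℝ) ≤
      R * (2 ^ μ * ((μ : ℝ) + 1) ^ (d - 1)) := by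
  have h1 : ((level d μ).card : ℝ) ≤ ((μ : ℝ) + 1) ^ (d - 1) := by
    exact_mod_cast card_level_le hd μ
  have hR0 : 0 < R := lt_of_lt_of_le one_pos hR.one_le
  push_cast
  calc _ ≤ ∑ ν ∈ level d μ, R * 2 ^ μ := by
        refine Finset.sum_le_sum fun ν hν => ?_
        have := hR.card_le ν
        rwa [mem_level.1 hν] at this
    _ ≤ _ := by
        rw [Finset.sum_const, nsmul_eq_mul, mul_comm, mul_assoc]
        gcongr

/-- A vector orthogonal to all representing vectors of a block has vanishing coordinates there, at
the price of one dimension per index. -/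
theorem blockBound_zero {P : ℝ} (hP : 0 < P) {A : ell2 →ₗ[ℂ] bSpace d ψ₀ ψ₁ t hp₀ hp₀}
    (hA : opNorm (normQuasiNorm ell2) (bQuasiNorm d ψ₀ ψ₁ t hp₀ hp₀) A ≤ 1) (μ : ℕ) :
    BlockBound d ψ₀ ψ₁ P A μ (∑ ν ∈ level d μ, Fintype.card (omegaIndex ψ₀ ψ₁ ν)) 0 := by
  obtain ⟨r, hr, -⟩ := exists_rows hA
  let r' : (Σ ν : level d μ, omegaIndex ψ₀ ψ₁ ν.1) → ell2 := fun k => r k.1 k.2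
  refine ⟨Submodule.span ℂ (Set.range r'), FiniteDimensional.span_of_finite ℂ (Set.finite_range _),
    ?_, fun x hx _ => ?_⟩
  · refine (finrank_range_le_card r').trans (le_of_eq ?_)
    rw [Fintype.card_sigma]
    exact Finset.sum_coe_sort (level d μ) fun ν => Fintype.card (omegaIndex ψ₀ ψ₁ ν)
  · have h0 : ∀ y, blockFun μ (A x).1 y = 0 := fun y =>
      blockFun_eq_zero_of_forall μ fun ν hν m => Or.inl <| by
        rw [← hr]
        exact (Submodule.mem_orthogonal _ x).1 hx _
          (Submodule.subset_span ⟨⟨⟨ν, mem_level.2 hν⟩, m⟩, rfl⟩)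
    simp [h0, ENNReal.zero_rpow_of_pos (half_pos hP)]

end

end MixedWeyl

namespace MixedWeyl

/-! ### Summation of the block estimates -/

theorem one_add_rpow_le_two_rpow (b : ℝ) {ε : ℝ} (hb : 0 ≤ b) (hε : 0 < ε) :
    ∃ C : ℝ, 0 < C ∧ ∀ x : ℝ, 0 ≤ x → (1 + x) ^ b ≤ C * 2 ^ (ε * x) := by
  have hl : 0 < Real.log 2 := Real.log_pos (by norm_num)
  set δ := ε * Real.log 2 / (b + 1) with hδ
  have hδ0 : 0 < δ := by positivity
  refine ⟨(1 + 1 / δ) ^ b, by positivity, fun x hx => ?_⟩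
  have h1 : 1 + x ≤ (1 + 1 / δ) * Real.exp (δ * x) := by
    have h2 : 1 ≤ Real.exp (δ * x) := Real.one_le_exp (by positivity)
    have h3 : δ * x + 1 ≤ Real.exp (δ * x) := Real.add_one_le_exp _
    have h4 : x ≤ 1 / δ * Real.exp (δ * x) := by
      rw [one_div, le_inv_mul_iff₀ hδ0]
      linarith
    linarith
  calc (1 + x) ^ b ≤ ((1 + 1 / δ) * Real.exp (δ * x)) ^ b := by gcongr
    _ = (1 + 1 / δ) ^ b * Real.exp (δ * x * b) := by
        rw [Real.mul_rpow (by positivity) (Real.exp_pos _).le, ← Real.exp_mul]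
    _ ≤ _ := by
        rw [Real.rpow_def_of_pos (by norm_num : (0 : ℝ) < 2)]
        refine mul_le_mul_of_nonneg_left (Real.exp_le_exp.2 ?_) (by positivity)
        have h5 : δ * (b + 1) = ε * Real.log 2 := by
          rw [hδ]
          field_simp
        have h6 : δ * b ≤ ε * Real.log 2 := by linarith
        nlinarith

/-- Because `μ + 1 ≤ (J + 1)(1 + |J - μ|)`, and symmetrically, the power can be moved to the
critical level at an arbitrarily small exponential cost. -/
theorem add_one_rpow_le_of_dist (β : ℝ) {ε : ℝ} (hε : 0 < ε) :
    ∃ C : ℝ, 0 < C ∧ ∀ J μ : ℕ,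
      (μ + 1 : ℝ) ^ β ≤ C * ((J + 1 : ℝ) ^ β * 2 ^ (ε * |(J : ℝ) - μ|)) := by
  obtain ⟨C, hC, h⟩ := one_add_rpow_le_two_rpow |β| (abs_nonneg β) hε
  have hle : ∀ J μ : ℕ, (μ + 1 : ℝ) ≤ (J + 1) * (1 + |(J : ℝ) - μ|) := by
    intro J μ
    have h1 := neg_abs_le ((J : ℝ) - μ)
    have h2 : 0 ≤ (J : ℝ) * |(J : ℝ) - μ| := by positivity
    nlinarith
  refine ⟨C, hC, fun J μ => ?_⟩
  have h1 : (μ + 1 : ℝ) ^ β ≤ (J + 1 : ℝ) ^ β * (1 + |(J : ℝ) - μ|) ^ |β| := by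
    rcases le_total 0 β with hβ | hβ
    · rw [abs_of_nonneg hβ, ← Real.mul_rpow (by positivity) (by positivity)]
      exact Real.rpow_le_rpow (by positivity) (hle J μ) hβ
    · rw [abs_of_nonpos hβ]
      have h2 : (J + 1 : ℝ) ^ (-β) ≤ (μ + 1 : ℝ) ^ (-β) * (1 + |(J : ℝ) - μ|) ^ (-β) := by
        rw [← Real.mul_rpow (by positivity) (by positivity)]
        refine Real.rpow_le_rpow (by positivity) ?_ (by linarith)
        rw [abs_sub_comm]
        exact hle μ J
      rw [Real.rpow_neg (by positivity) β, Real.rpow_neg (by positivity) β] at h2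
      have h3 : 0 < (J + 1 : ℝ) ^ β := by positivity
      have h4 : 0 < (μ + 1 : ℝ) ^ β := by positivity
      rw [inv_mul_eq_div, inv_le_comm₀ h3 (by positivity), inv_div] at h2
      rwa [div_le_iff₀ (by positivity)] at h2
  refine h1.trans ?_
  calc _ ≤ (J + 1 : ℝ) ^ β * (C * 2 ^ (ε * |(J : ℝ) - μ|)) := by
        gcongr
        exact h _ (abs_nonneg _)
    _ = _ := by ring

/-- The number `⌊κ n 2^{-ε|J-μ|}⌋`. -/
noncomputable def budget (κ ε : ℝ) (n J μ : ℕ) : ℕ := ⌊κ * n * 2 ^ (-(ε * |(J : ℝ) - μ|))⌋₊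

/-- The sign condition says that block `μ` lies on the side of `J` on which `2^(-μα)` decays. Of the
decay `|α|`, one `ε` moves `(μ+1)^β` to level `J`, `εγ` compensates the shrinking codimension, and a
last `ε` is left for summation. -/
theorem block_value_le (α β : ℝ) {γ ε κ : ℝ} (hγ : 0 ≤ γ) (hε : 0 < ε) (hκ : 0 < κ)
    (hα : ε * (2 + γ) ≤ |α|) :
    ∃ C : ℝ, 0 < C ∧ ∀ n J μ : ℕ, 1 ≤ n → 0 ≤ ((μ : ℝ) - J) * α →
      (2 : ℝ) ^ (-(μ * α)) * (μ + 1 : ℝ) ^ β * (budget κ ε n J μ + 1 : ℝ) ^ (-γ) ≤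
        C * ((2 : ℝ) ^ (-(J * α)) * (J + 1 : ℝ) ^ β * (n : ℝ) ^ (-γ)) *
          2 ^ (-(ε * |(J : ℝ) - μ|)) := by
  obtain ⟨C, hC, h⟩ := add_one_rpow_le_of_dist β hε
  refine ⟨C * κ ^ (-γ), by positivity, fun n J μ hn hμ => ?_⟩
  have hn0 : (0 : ℝ) < n := by exact_mod_cast hn
  set u := |(J : ℝ) - μ| with hu
  have h1 : (budget κ ε n J μ + 1 : ℝ) ^ (-γ) ≤ κ ^ (-γ) * (n : ℝ) ^ (-γ) * 2 ^ (ε * γ * u) := by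
    calc _ ≤ (κ * n * 2 ^ (-(ε * u))) ^ (-γ) :=
          Real.rpow_le_rpow_of_nonpos (by positivity) (Nat.lt_floor_add_one _).le (by linarith)
      _ = _ := by
          rw [Real.mul_rpow (by positivity) (by positivity), Real.mul_rpow hκ.le hn0.le,
            ← Real.rpow_mul (by norm_num)]
          congr 2
          ring
  have h2 : ((μ : ℝ) - J) * α = |α| * u := by
    rw [← abs_of_nonneg hμ, abs_mul, hu, abs_sub_comm, mul_comm]
  calc _ ≤ (2 : ℝ) ^ (-(μ * α)) * (C * ((J + 1 : ℝ) ^ β * 2 ^ (ε * u))) *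
        (κ ^ (-γ) * (n : ℝ) ^ (-γ) * 2 ^ (ε * γ * u)) := by
        gcongr
        exact h J μ
    _ = C * κ ^ (-γ) * ((J + 1 : ℝ) ^ β * (n : ℝ) ^ (-γ)) *
        ((2 : ℝ) ^ (-(μ * α)) * 2 ^ (ε * u) * 2 ^ (ε * γ * u)) := by ring
    _ ≤ C * κ ^ (-γ) * ((J + 1 : ℝ) ^ β * (n : ℝ) ^ (-γ)) *
        ((2 : ℝ) ^ (-(J * α)) * 2 ^ (-(ε * u))) := by
        refine mul_le_mul_of_nonneg_left ?_ (by positivity)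
        rw [← Real.rpow_add (by norm_num), ← Real.rpow_add (by norm_num),
          ← Real.rpow_add (by norm_num)]
        refine Real.rpow_le_rpow_of_exponent_le (by norm_num) ?_
        have h3 : ε * (2 + γ) * u ≤ |α| * u := by gcongr
        nlinarith
    _ = _ := by ring

theorem sum_budget_le {κ ε : ℝ} (hε : 0 < ε) (hκ : 0 ≤ κ) (n J L : ℕ) :
    ((∑ μ ∈ Finset.range L, budget κ ε n J μ : ℕ) : ℝ) ≤ κ * n * (2 / (1 - 2 ^ (-ε))) := by
  push_cast
  calc _ ≤ ∑ μ ∈ Finset.range L, κ * n * (2 ^ (-ε)) ^ |(J : ℝ) - μ| := by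
        refine Finset.sum_le_sum fun μ _ => (Nat.floor_le (by positivity)).trans (le_of_eq ?_)
        rw [← Real.rpow_mul (by norm_num), neg_mul]
    _ ≤ _ := by
        rw [← Finset.mul_sum]
        gcongr
        exact sum_range_rpow_abs_le (by positivity)
          (Real.rpow_lt_one_of_one_lt_of_neg (by norm_num) (by linarith)) J L

theorem exists_budget_eq_zero {ε : ℝ} (κ : ℝ) (hε : 0 < ε) (hκ : 0 < κ) (n J : ℕ) :
    ∃ L, J ≤ L ∧ ∀ μ, L ≤ μ → budget κ ε n J μ = 0 := by
  have hx : (2 : ℝ) ^ (-ε) < 1 := Real.rpow_lt_one_of_one_lt_of_neg (by norm_num) (by linarith)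
  obtain ⟨k, hk⟩ := exists_pow_lt_of_lt_one (show (0 : ℝ) < 1 / (κ * n + 1) by positivity) hx
  refine ⟨J + k, by omega, fun μ hμ => Nat.floor_eq_zero.2 ?_⟩
  have h1 : (k : ℝ) ≤ |(J : ℝ) - μ| := by
    have h2 : ((J : ℝ) + k) ≤ μ := by exact_mod_cast hμ
    rw [abs_sub_comm]
    exact le_trans (by linarith) (le_abs_self _)
  have h2 : (2 : ℝ) ^ (-(ε * |(J : ℝ) - μ|)) < 1 / (κ * n + 1) := by
    refine lt_of_le_of_lt ?_ hk
    rw [← Real.rpow_natCast, ← Real.rpow_mul (by norm_num)]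
    refine Real.rpow_le_rpow_of_exponent_le (by norm_num) ?_
    nlinarith
  rw [lt_div_iff₀ (by positivity)] at h2
  have h3 : (0 : ℝ) < 2 ^ (-(ε * |(J : ℝ) - μ|)) := by positivity
  nlinarith

section

variable {d : ℕ} {ψ₀ ψ₁ : ℝ → ℂ} [∀ ν : Fin d → ℕ, Fintype (omegaIndex ψ₀ ψ₁ ν)]
  {p₀ p : ℝ≥0∞} {hp₀ : 0 < p₀} {t : ℝ}

theorem sum_card_block_le {R : ℝ} (hd : 1 ≤ d) (hR : IndexGeometry d ψ₀ ψ₁ R) (J : ℕ) :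
    ((∑ μ ∈ Finset.range J, ∑ ν ∈ level d μ, Fintype.card (omegaIndex ψ₀ ψ₁ ν) : ℕ) : ℝ) ≤
      R * (2 ^ J * ((J : ℝ) + 1) ^ (d - 1)) := by
  have hR0 : 0 < R := lt_of_lt_of_le one_pos hR.one_le
  rw [Nat.cast_sum]
  calc _ ≤ ∑ μ ∈ Finset.range J, R * ((J : ℝ) + 1) ^ (d - 1) * 2 ^ μ := by
        refine Finset.sum_le_sum fun μ hμ => (card_block_le hd hR μ).trans ?_
        have hμ' : (μ : ℝ) ≤ J := by exact_mod_cast (Finset.mem_range.1 hμ).le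
        calc R * (2 ^ μ * ((μ : ℝ) + 1) ^ (d - 1)) ≤ R * (2 ^ μ * ((J : ℝ) + 1) ^ (d - 1)) := by
              gcongr
          _ = _ := by ring
    _ = R * ((J : ℝ) + 1) ^ (d - 1) * (2 ^ J - 1) := by
        rw [← Finset.mul_sum, geom_sum_eq (by norm_num)]
        norm_num
    _ ≤ R * ((J : ℝ) + 1) ^ (d - 1) * 2 ^ J := by
        gcongr
        linarith
    _ = _ := by ring

/-- The value of a block estimate, with decay exponents `α`, `β`, `γ`. -/
noncomputable def blockValue (α β γ : ℝ) (n J : ℕ) : ℝ :=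
  (2 : ℝ) ^ (-(J * α)) * (J + 1 : ℝ) ^ β * (n : ℝ) ^ (-γ)

theorem BlockEst.blockBound_budget {α β γ ε κ : ℝ} (hp : 0 < p) (hp' : p < ∞)
    (h : BlockEst d ψ₀ ψ₁ hp₀ t p.toReal α β γ) (hγ : 0 ≤ γ) (hε : 0 < ε) (hκ : 0 < κ)
    (hα : ε * (2 + γ) ≤ |α|) :
    ∃ C : ℝ, 0 < C ∧ ∀ n J μ : ℕ, 1 ≤ n → 0 ≤ ((μ : ℝ) - J) * α →
      ∀ A : ell2 →ₗ[ℂ] bSpace d ψ₀ ψ₁ t hp₀ hp₀,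
        opNorm (normQuasiNorm ell2) (bQuasiNorm d ψ₀ ψ₁ t hp₀ hp₀) A ≤ 1 →
        BlockBound d ψ₀ ψ₁ p.toReal A μ (2 * budget κ ε n J μ)
          (C * blockValue α β γ n J * 2 ^ (-(ε * |(J : ℝ) - μ|))) := by
  obtain ⟨C, hC, h⟩ := h
  obtain ⟨C', hC', h'⟩ := block_value_le α β hγ hε hκ hα
  have hP : 0 < p.toReal := ENNReal.toReal_pos hp.ne' hp'.ne
  refine ⟨C * C', by positivity, fun n J μ hn hμ A hA =>
    (h A hA μ (budget κ ε n J μ)).mono hP.le le_rfl (by positivity) ?_⟩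
  refine (mul_le_mul_of_nonneg_left (h' n J μ hn hμ) hC.le).trans (le_of_eq ?_)
  rw [blockValue]
  ring

/-- Summation of one block estimate: the blocks below the level `J` are removed completely. -/
theorem upperEst_of_blockEst {R : ℝ} (hd : 1 ≤ d) (hR : IndexGeometry d ψ₀ ψ₁ R) (hp : 0 < p)
    (hp' : p < ∞) {α β γ : ℝ} (h : BlockEst d ψ₀ ψ₁ hp₀ t p.toReal α β γ) (hγ : 0 ≤ γ)
    (hα : 0 < α) :
    ∃ C κ₀ : ℝ, 0 < C ∧ 0 < κ₀ ∧ ∀ n J : ℕ, 1 ≤ n →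
      (J = 0 ∨ (2 : ℝ) ^ J * ((J : ℝ) + 1) ^ (d - 1) ≤ κ₀ * n) →
      UpperEst d ψ₀ ψ₁ hp₀ t p n (C * blockValue α β γ n J) := by
  set ε := α / (2 + γ) with hεdef
  have hε : 0 < ε := by positivity
  have hεα : ε * (2 + γ) ≤ |α| := by
    rw [abs_of_pos hα, hεdef, div_mul_cancel₀ _ (by positivity)]
  have hx : (2 : ℝ) ^ (-ε) < 1 := Real.rpow_lt_one_of_one_lt_of_neg (by norm_num) (by linarith)
  have hx' : 0 < 1 - (2 : ℝ) ^ (-ε) := by linarith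
  -- With this `κ` the codimensions `2 * budget` add up to at most `n/4`.
  set κ := (1 - (2 : ℝ) ^ (-ε)) / 16 with hκdef
  have hκ : 0 < κ := by positivity
  have hκ' : κ * (2 / (1 - 2 ^ (-ε))) = 1 / 8 := by
    rw [hκdef]
    field_simp
    norm_num
  obtain ⟨C₁, hC₁, h₁⟩ := upperEst_of_blockBound (d := d) (ψ₀ := ψ₀) (ψ₁ := ψ₁) (hp₀ := hp₀) (t := t)
    hp hp' hε
  obtain ⟨C₂, hC₂, h₂⟩ := h.blockBound_budget hp hp' hγ hε hκ hεα
  have hP : 0 < p.toReal := ENNReal.toReal_pos hp.ne' hp'.ne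
  have hR0 : 0 < R := lt_of_lt_of_le one_pos hR.one_le
  -- `κ₀ = 1/(4R)` limits the number of indices in the annihilated blocks to `n/4`; together with
  -- the budgets this stays below `n`. For `J = 0` there are no such blocks.
  refine ⟨C₁ * C₂, 1 / (4 * R), by positivity, by positivity, fun n J hn hJ => ?_⟩
  have hn0 : (0 : ℝ) < n := by exact_mod_cast hn
  obtain ⟨L, hJL, hL⟩ := exists_budget_eq_zero κ hε hκ n J
  set D : ℕ → ℕ := fun μ => ∑ ν ∈ level d μ, Fintype.card (omegaIndex ψ₀ ψ₁ ν)
  have hB : 0 ≤ blockValue α β γ n J := by unfold blockValue; positivity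
  have := h₁ n J L (fun μ => if μ < J then D μ else 2 * budget κ ε n J μ)
    (C₂ * blockValue α β γ n J) (by positivity)
    (fun μ hμ => by rw [if_neg (by omega), hL μ hμ]) ?_ ?_
  · rwa [mul_assoc]
  · have h3 : ∑ μ ∈ Finset.range L, (if μ < J then D μ else 2 * budget κ ε n J μ) ≤
        ∑ μ ∈ Finset.range J, D μ + 2 * ∑ μ ∈ Finset.range L, budget κ ε n J μ := by
      calc _ ≤ ∑ μ ∈ Finset.range L, ((if μ < J then D μ else 0) + 2 * budget κ ε n J μ) := by
            refine Finset.sum_le_sum fun μ _ => ?_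
            split_ifs <;> omega
        _ = _ := by
            rw [Finset.sum_add_distrib, ← Finset.mul_sum, ← Finset.sum_filter]
            congr 2
            ext μ
            simp only [Finset.mem_filter, Finset.mem_range]
            omega
    have h4 : ((∑ μ ∈ Finset.range J, D μ : ℕ) : ℝ) ≤ n / 4 := by
      rcases hJ with rfl | hJ
      · simp only [Finset.range_zero, Finset.sum_empty, Nat.cast_zero]
        positivity
      · refine (sum_card_block_le hd hR J).trans ?_
        calc _ ≤ R * (1 / (4 * R) * n) := by gcongr
          _ = _ := by field_simp
    have h5 := sum_budget_le hε hκ.le n J L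
    have h6 : κ * n * (2 / (1 - 2 ^ (-ε))) = n / 8 := by
      rw [mul_right_comm, hκ']
      ring
    rw [h6] at h5
    have h7 : ((∑ μ ∈ Finset.range J, D μ + 2 * ∑ μ ∈ Finset.range L, budget κ ε n J μ : ℕ) : ℝ) < n := by
      rw [Nat.cast_add, Nat.cast_mul, Nat.cast_ofNat]
      linarith
    exact h3.trans_lt (by exact_mod_cast h7)
  · intro A hA μ
    by_cases hμ : μ < J
    · simp only [hμ, if_true]
      exact (blockBound_zero hP hA μ).mono hP.le le_rfl le_rfl (by positivity)
    · simp only [hμ, if_false]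
      refine h₂ n J μ hn (mul_nonneg ?_ hα.le) A hA
      rw [sub_nonneg]
      exact_mod_cast not_lt.1 hμ

/-- Summation of two block estimates, one for the lower and one for the upper blocks. -/
theorem upperEst_of_two_blockEst (hp : 0 < p) (hp' : p < ∞) {α₁ β₁ γ₁ α₂ β₂ γ₂ : ℝ}
    (h₁ : BlockEst d ψ₀ ψ₁ hp₀ t p.toReal α₁ β₁ γ₁) (hγ₁ : 0 ≤ γ₁) (hα₁ : α₁ < 0)
    (h₂ : BlockEst d ψ₀ ψ₁ hp₀ t p.toReal α₂ β₂ γ₂) (hγ₂ : 0 ≤ γ₂) (hα₂ : 0 < α₂) :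
    ∃ C : ℝ, 0 < C ∧ ∀ (n J : ℕ) (B : ℝ), 1 ≤ n → blockValue α₁ β₁ γ₁ n J ≤ B →
      blockValue α₂ β₂ γ₂ n J ≤ B → UpperEst d ψ₀ ψ₁ hp₀ t p n (C * B) := by
  -- Both estimates must use the same budgets, hence the smaller of the two admissible decay rates.
  set ε := min (|α₁| / (2 + γ₁)) (|α₂| / (2 + γ₂)) with hεdef
  have hε : 0 < ε := lt_min (div_pos (abs_pos.2 hα₁.ne) (by linarith))
    (div_pos (abs_pos.2 hα₂.ne') (by linarith))
  have hεα₁ : ε * (2 + γ₁) ≤ |α₁| := by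
    rw [← le_div_iff₀ (by linarith)]
    exact min_le_left _ _
  have hεα₂ : ε * (2 + γ₂) ≤ |α₂| := by
    rw [← le_div_iff₀ (by linarith)]
    exact min_le_right _ _
  have hx : (2 : ℝ) ^ (-ε) < 1 := Real.rpow_lt_one_of_one_lt_of_neg (by norm_num) (by linarith)
  have hx' : 0 < 1 - (2 : ℝ) ^ (-ε) := by linarith
  set κ := (1 - (2 : ℝ) ^ (-ε)) / 16 with hκdef
  have hκ : 0 < κ := by positivity
  have hκ' : κ * (2 / (1 - 2 ^ (-ε))) = 1 / 8 := by
    rw [hκdef]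
    field_simp
    norm_num
  obtain ⟨C, hC, h⟩ := upperEst_of_blockBound (d := d) (ψ₀ := ψ₀) (ψ₁ := ψ₁) (hp₀ := hp₀) (t := t)
    hp hp' hε
  obtain ⟨C₁, hC₁, h₁⟩ := h₁.blockBound_budget hp hp' hγ₁ hε hκ hεα₁
  obtain ⟨C₂, hC₂, h₂⟩ := h₂.blockBound_budget hp hp' hγ₂ hε hκ hεα₂
  have hP : 0 < p.toReal := ENNReal.toReal_pos hp.ne' hp'.ne
  refine ⟨C * (C₁ + C₂), by positivity, fun n J B hn hB₁ hB₂ => ?_⟩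
  have hn0 : (0 : ℝ) < n := by exact_mod_cast hn
  obtain ⟨L, -, hL⟩ := exists_budget_eq_zero κ hε hκ n J
  have hv₁ : 0 ≤ blockValue α₁ β₁ γ₁ n J := by unfold blockValue; positivity
  have hv₂ : 0 ≤ blockValue α₂ β₂ γ₂ n J := by unfold blockValue; positivity
  have hB : 0 ≤ B := hv₁.trans hB₁
  rw [mul_assoc]
  refine h n J L (fun μ => 2 * budget κ ε n J μ) ((C₁ + C₂) * B) (by positivity)
    (fun μ hμ => by rw [hL μ hμ]) ?_ fun A hA μ => ?_
  · rw [← Finset.mul_sum]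
    have h5 := sum_budget_le hε hκ.le n J L
    have h6 : κ * n * (2 / (1 - 2 ^ (-ε))) = n / 8 := by
      rw [mul_right_comm, hκ']
      ring
    rw [h6] at h5
    have h7 : ((2 * ∑ μ ∈ Finset.range L, budget κ ε n J μ : ℕ) : ℝ) < n := by
      rw [Nat.cast_mul, Nat.cast_ofNat]
      linarith
    exact_mod_cast h7
  · rcases le_total μ J with hμ | hμ
    · have hμ' : (μ : ℝ) ≤ J := by exact_mod_cast hμ
      refine (h₁ n J μ hn (mul_nonneg_of_nonpos_of_nonpos (by linarith) hα₁.le) A hA).mono hP.le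
        le_rfl (by positivity) ?_
      gcongr
      linarith
    · have hμ' : (J : ℝ) ≤ μ := by exact_mod_cast hμ
      refine (h₂ n J μ hn (mul_nonneg (by linarith) hα₂.le) A hA).mono hP.le
        le_rfl (by positivity) ?_
      gcongr
      linarith

end

end MixedWeyl

namespace MixedWeyl

/-! ### Estimates of the blocks -/

/-- The monomial `2^{-μa} (μ+1)^b (c+1)^{-g}`. -/
noncomputable def blockMonomial (a b g : ℝ) (μ c : ℕ) : ℝ :=
  (2 : ℝ) ^ (-(μ * a)) * (μ + 1 : ℝ) ^ b * (c + 1 : ℝ) ^ (-g)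

theorem blockMonomial_pos (a b g : ℝ) (μ c : ℕ) : 0 < blockMonomial a b g μ c := by
  unfold blockMonomial
  positivity

theorem blockMonomial_mul (a b g a' b' g' : ℝ) (μ c : ℕ) :
    blockMonomial a b g μ c * blockMonomial a' b' g' μ c =
      blockMonomial (a + a') (b + b') (g + g') μ c := by
  unfold blockMonomial
  rw [mul_add, neg_add, Real.rpow_add (by norm_num), Real.rpow_add (by positivity), neg_add,
    Real.rpow_add (by positivity)]
  ring

theorem blockMonomial_rpow (a b g s : ℝ) (μ c : ℕ) :
    blockMonomial a b g μ c ^ s = blockMonomial (a * s) (b * s) (g * s) μ c := by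
  unfold blockMonomial
  rw [Real.mul_rpow (by positivity) (by positivity), Real.mul_rpow (by positivity) (by positivity),
    ← Real.rpow_mul (by norm_num), ← Real.rpow_mul (by positivity), ← Real.rpow_mul (by positivity)]
  congr 3 <;> ring

theorem ofReal_mul_blockMonomial_rpow {C : ℝ} (hC : 0 < C) (a b g s : ℝ) (μ c : ℕ) :
    ENNReal.ofReal (C * blockMonomial a b g μ c) ^ s =
      ENNReal.ofReal (C ^ s * blockMonomial (a * s) (b * s) (g * s) μ c) := by
  rw [ENNReal.ofReal_rpow_of_pos (mul_pos hC (blockMonomial_pos _ _ _ _ _)),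
    Real.mul_rpow hC.le (blockMonomial_pos _ _ _ _ _).le, blockMonomial_rpow]

theorem ofReal_mul_blockMonomial_mul {C C' : ℝ} (hC : 0 ≤ C) (a b g a' b' g' : ℝ)
    (μ c : ℕ) :
    ENNReal.ofReal (C * blockMonomial a b g μ c) * ENNReal.ofReal (C' * blockMonomial a' b' g' μ c) =
      ENNReal.ofReal (C * C' * blockMonomial (a + a') (b + b') (g + g') μ c) := by
  rw [← ENNReal.ofReal_mul (mul_nonneg hC (blockMonomial_pos _ _ _ _ _).le), ← blockMonomial_mul]
  congr 1
  ring

theorem two_rpow_neg_eq_blockMonomial (a : ℝ) (μ c : ℕ) :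
    (2 : ℝ≥0∞) ^ (-((μ : ℝ) * a)) = ENNReal.ofReal (1 * blockMonomial a 0 0 μ c) := by
  rw [two_rpow_eq_ofReal, blockMonomial]
  simp

theorem two_rpow_neg_natCast_eq_blockMonomial (μ c : ℕ) :
    (2 : ℝ≥0∞) ^ (-(μ : ℝ)) = ENNReal.ofReal (1 * blockMonomial 1 0 0 μ c) := by
  rw [← two_rpow_neg_eq_blockMonomial, mul_one]

section

variable {d : ℕ} {ψ₀ ψ₁ : ℝ → ℂ} [∀ ν : Fin d → ℕ, Fintype (omegaIndex ψ₀ ψ₁ ν)]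

/-- The indices of the `μ`-th block. -/
abbrev BlockIndex (d : ℕ) (ψ₀ ψ₁ : ℝ → ℂ) (μ : ℕ) : Type :=
  Σ ν : level d μ, omegaIndex ψ₀ ψ₁ ν.1

theorem card_blockIndex (μ : ℕ) : Fintype.card (BlockIndex d ψ₀ ψ₁ μ) =
    ∑ ν ∈ level d μ, Fintype.card (omegaIndex ψ₀ ψ₁ ν) := by
  rw [Fintype.card_sigma]
  exact Finset.sum_coe_sort (level d μ) fun ν => Fintype.card (omegaIndex ψ₀ ψ₁ ν)

theorem blockSum_eq_ofReal (μ : ℕ) (a : SeqFamily d ψ₀ ψ₁) {s : ℝ} (hs : 0 ≤ s) :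
    blockSum μ a s = ENNReal.ofReal (∑ k : BlockIndex d ψ₀ ψ₁ μ, ‖a k.1 k.2‖ ^ s) := by
  rw [ENNReal.ofReal_sum_of_nonneg fun _ _ => by positivity, Fintype.sum_sigma, blockSum,
    ← Finset.sum_coe_sort (level d μ) fun ν => layerSum ν a s]
  refine Finset.sum_congr rfl fun ν _ => Finset.sum_congr rfl fun m _ => ?_
  rw [← ofReal_norm, ENNReal.ofReal_rpow_of_nonneg (norm_nonneg _) hs]

theorem blockSum_le_interpolate (μ : ℕ) (x : SeqFamily d ψ₀ ψ₁) {a b s t : ℝ} (ha : 0 < a)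
    (hb : 0 < b) (hab : a + b = 1) (hs : 0 < s) (ht : 0 < t) :
    blockSum μ x (s * a + t * b) ≤ blockSum μ x s ^ a * blockSum μ x t ^ b := by
  have h0 : ∀ s : ℝ, 0 ≤ ∑ k : BlockIndex d ψ₀ ψ₁ μ, ‖x k.1 k.2‖ ^ s := fun s =>
    Finset.sum_nonneg fun _ _ => by positivity
  rw [blockSum_eq_ofReal μ x hs.le, blockSum_eq_ofReal μ x ht.le,
    blockSum_eq_ofReal μ x (by positivity), ENNReal.ofReal_rpow_of_nonneg (h0 _) ha.le,
    ENNReal.ofReal_rpow_of_nonneg (h0 _) hb.le, ← ENNReal.ofReal_mul (Real.rpow_nonneg (h0 _) _)]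
  exact ENNReal.ofReal_le_ofReal
    (sum_rpow_le_interpolate (fun k : BlockIndex d ψ₀ ψ₁ μ => ‖x k.1 k.2‖) (fun _ => norm_nonneg _)
      ha hb hab hs ht)

variable {p₀ : ℝ≥0∞} {hp₀ : 0 < p₀} {t : ℝ}

/-- Estimates are obtained for the `P`-th power of the quasi-norm, where exponents combine linearly;
dividing them by `P` returns to the quasi-norm. -/
theorem BlockEst.of_rpow {P : ℝ} (hP : 0 < P) {a b g : ℝ}
    (h : ∃ C : ℝ, 0 < C ∧ ∀ A : ell2 →ₗ[ℂ] bSpace d ψ₀ ψ₁ t hp₀ hp₀,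
      opNorm (normQuasiNorm ell2) (bQuasiNorm d ψ₀ ψ₁ t hp₀ hp₀) A ≤ 1 → ∀ μ c : ℕ,
      ∃ V : Submodule ℂ ell2, FiniteDimensional ℂ V ∧ Module.finrank ℂ V ≤ 2 * c ∧
        ∀ x ∈ Vᗮ, ‖x‖ ≤ 1 → ∫⁻ y, blockFun μ (A x).1 y ^ (P / 2) ≤
          ENNReal.ofReal (C * blockMonomial a b g μ c)) :
    BlockEst d ψ₀ ψ₁ hp₀ t P (a / P) (b / P) (g / P) := by
  obtain ⟨C, hC, h⟩ := h
  refine ⟨C ^ (1 / P), by positivity, fun A hA μ c => ?_⟩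
  obtain ⟨V, hV, hVc, hVB⟩ := h A hA μ c
  refine ⟨V, hV, hVc, fun x hx hx1 => (hVB x hx hx1).trans (le_of_eq ?_)⟩
  congr 1
  show _ = (C ^ (1 / P) * blockMonomial (a / P) (b / P) (g / P) μ c) ^ P
  rw [Real.mul_rpow (by positivity) (blockMonomial_pos _ _ _ _ _).le, blockMonomial_rpow,
    ← Real.rpow_mul hC.le, one_div_mul_cancel hP.ne', Real.rpow_one, div_mul_cancel₀ _ hP.ne',
    div_mul_cancel₀ _ hP.ne', div_mul_cancel₀ _ hP.ne']

theorem lintegral_blockFun_rpow_le_of_le {R : ℝ} (hR : IndexGeometry d ψ₀ ψ₁ R) {s s' : ℝ}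
    (hs : 0 < s) (hss : s ≤ s') (μ : ℕ) (a : SeqFamily d ψ₀ ψ₁) :
    ∫⁻ y, blockFun μ a y ^ s ≤
      (∫⁻ y, blockFun μ a y ^ s') ^ (s / s') * ENNReal.ofReal (R ^ (1 - s / s')) := by
  obtain ⟨S, hS, hSv, hSQ⟩ := hR.exists_box
  have hR0 : 0 < R := lt_of_lt_of_le one_pos hR.one_le
  have he : s / s' ≤ 1 := (div_le_one (by linarith)).2 hss
  have h1 := lintegral_rpow_le_of_support hS (measurable_blockFun μ a)
    (fun x hx => blockFun_eq_zero_of_forall μ fun ν _ m =>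
      Or.inr fun hxm => hx (hSQ ν m m.2 hxm)) hs hss
  refine h1.trans ?_
  rw [← ENNReal.ofReal_rpow_of_pos hR0]
  gcongr

theorem BlockEst.of_le {R : ℝ} (hR : IndexGeometry d ψ₀ ψ₁ R) {P P' α β γ : ℝ} (hP : 0 < P)
    (hPP : P ≤ P') (h : BlockEst d ψ₀ ψ₁ hp₀ t P' α β γ) : BlockEst d ψ₀ ψ₁ hp₀ t P α β γ := by
  obtain ⟨C, hC, h⟩ := h
  have hR0 : 0 < R := lt_of_lt_of_le one_pos hR.one_le
  have hP' : 0 < P' := hP.trans_le hPP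
  have key := BlockEst.of_rpow (d := d) (ψ₀ := ψ₀) (ψ₁ := ψ₁) (hp₀ := hp₀) (t := t) hP
    (a := α * P) (b := β * P) (g := γ * P) ⟨C ^ P * R ^ (1 - P / 2 / (P' / 2)), by positivity,
      fun A hA μ c => ?_⟩
  · simpa only [mul_div_cancel_right₀ _ hP.ne'] using key
  · obtain ⟨V, hV, hVc, hVB⟩ := h A hA μ c
    refine ⟨V, hV, hVc, fun x hx hx1 =>
      (lintegral_blockFun_rpow_le_of_le hR (s := P / 2) (s' := P' / 2) (by positivity)
        (by linarith) μ _).trans ?_⟩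
    have h2 : P / 2 / (P' / 2) = P / P' := by field_simp
    rw [h2]
    calc _ ≤ ENNReal.ofReal ((C * blockMonomial α β γ μ c) ^ P') ^ (P / P') *
          ENNReal.ofReal (R ^ (1 - P / P')) := by
          gcongr
          exact hVB x hx hx1
      _ = _ := by
          have hm := blockMonomial_pos α β γ μ c
          rw [ENNReal.ofReal_rpow_of_pos (by positivity), ← ENNReal.ofReal_mul (by positivity),
            ← Real.rpow_mul (by positivity), mul_div_cancel₀ _ hP'.ne',
            Real.mul_rpow hC.le hm.le, blockMonomial_rpow]
          congr 1
          ring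

/-! ### Coordinate sums of one block on subspaces of small codimension. -/

section Rows

variable {A : ell2 →ₗ[ℂ] bSpace d ψ₀ ψ₁ t hp₀ hp₀}

/-- The Hilbert–Schmidt count: about `2^μ (μ+1)^(d-1)` representing vectors, each of norm at most
`2^(-μ(t - 1/p₀))`. -/
theorem exists_blockSum_two_le_card {R : ℝ} (hd : 1 ≤ d) (hR : IndexGeometry d ψ₀ ψ₁ R)
    (hA : opNorm (normQuasiNorm ell2) (bQuasiNorm d ψ₀ ψ₁ t hp₀ hp₀) A ≤ 1) (μ c : ℕ) :
    ∃ V : Submodule ℂ ell2, FiniteDimensional ℂ V ∧ Module.finrank ℂ V ≤ 2 * c ∧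
      ∀ x ∈ Vᗮ, ‖x‖ ≤ 1 → blockSum μ (A x).1 2 ≤
        ENNReal.ofReal (R * blockMonomial (2 * (t - recip p₀) - 1) ((d : ℝ) - 1) 1 μ c) := by
  have hR0 : 0 < R := lt_of_lt_of_le one_pos hR.one_le
  obtain ⟨r, hr, hrw⟩ := exists_rows hA
  obtain ⟨V, hV, hVc, hVB⟩ := exists_codim_coeffSq_le_card
    (fun k : BlockIndex d ψ₀ ψ₁ μ => r k.1 k.2) (w := 2 ^ (-((μ : ℝ) * (t - recip p₀))))
    (fun k => by
      have := hrw k.1 k.2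
      rwa [mem_level.1 k.1.2] at this) c
  refine ⟨V, hV, hVc, fun x hx hx1 => ?_⟩
  rw [blockSum_eq_ofReal μ _ zero_le_two]
  refine ENNReal.ofReal_le_ofReal ?_
  have h1 : ∑ k : BlockIndex d ψ₀ ψ₁ μ, ‖(A x).1 k.1 k.2‖ ^ (2 : ℝ) =
      coeffSq (fun k : BlockIndex d ψ₀ ψ₁ μ => r k.1 k.2) x := by
    simp only [coeffSq, hr, Real.rpow_two]
  have h2 : (Fintype.card (BlockIndex d ψ₀ ψ₁ μ) : ℝ) ≤ R * (2 ^ μ * ((μ : ℝ) + 1) ^ (d - 1)) := by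
    rw [card_blockIndex]
    exact card_block_le hd hR μ
  have hd' : ((μ : ℝ) + 1) ^ (d - 1) = ((μ : ℝ) + 1) ^ ((d : ℝ) - 1) := by
    rw [← Real.rpow_natCast, Nat.cast_sub hd, Nat.cast_one]
  rw [h1]
  calc _ ≤ R * (2 ^ μ * ((μ : ℝ) + 1) ^ (d - 1)) / ((c : ℝ) + 1) *
        (2 ^ (-((μ : ℝ) * (t - recip p₀)))) ^ 2 * 1 := by
        refine (hVB x hx).trans ?_
        gcongr
        exact pow_le_one₀ (norm_nonneg _) hx1
    _ = _ := by
        rw [hd', blockMonomial, ← Real.rpow_natCast 2 μ, ← Real.rpow_natCast _ 2,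
          ← Real.rpow_mul (by norm_num), Real.rpow_neg_one,
          show -((μ : ℝ) * (2 * (t - recip p₀) - 1)) =
            μ + -((μ : ℝ) * (t - recip p₀)) * (2 : ℕ) by push_cast; ring,
          Real.rpow_add (by norm_num)]
        ring

theorem blockSum_le_of_norm_le_one (hp₀' : p₀ ≠ ∞)
    (hA : opNorm (normQuasiNorm ell2) (bQuasiNorm d ψ₀ ψ₁ t hp₀ hp₀) A ≤ 1) (μ c : ℕ) {x : ell2}
    (hx : ‖x‖ ≤ 1) : blockSum μ (A x).1 p₀.toReal ≤
      ENNReal.ofReal (1 * blockMonomial ((t - recip p₀) * p₀.toReal) 0 0 μ c) := by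
  refine (blockSum_le_bENorm t hp₀ hp₀' _ μ).trans ?_
  have h1 : bENorm t p₀ p₀ (A x).1 ≤ 1 := (bENorm_le_enorm hA x).trans <| by
    rw [← ofReal_norm, ← ENNReal.ofReal_one]
    exact ENNReal.ofReal_le_ofReal hx
  calc _ ≤ ((2 : ℝ≥0∞) ^ (-((μ : ℝ) * (t - recip p₀))) * 1) ^ p₀.toReal := by gcongr
    _ = _ := by
      rw [mul_one, two_rpow_neg_eq_blockMonomial _ μ c, ofReal_mul_blockMonomial_rpow one_pos]
      simp

/-- For `p₀ = ∞` the coordinates are bounded individually, so `r - 2` powers are taken out; this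
plays the role of interpolation with `ℓ_{p₀}`. -/
theorem blockSum_le_mul_of_top (hp₀' : p₀ = ∞)
    (hA : opNorm (normQuasiNorm ell2) (bQuasiNorm d ψ₀ ψ₁ t hp₀ hp₀) A ≤ 1) (μ c : ℕ) {x : ell2}
    (hx : ‖x‖ ≤ 1) {r : ℝ} (hr : 2 ≤ r) : blockSum μ (A x).1 r ≤
      ENNReal.ofReal (1 * blockMonomial (t * (r - 2)) 0 0 μ c) * blockSum μ (A x).1 2 := by
  have h1 : bENorm t p₀ p₀ (A x).1 ≤ 1 := (bENorm_le_enorm hA x).trans <| by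
    rw [← ofReal_norm, ← ENNReal.ofReal_one]
    exact ENNReal.ofReal_le_ofReal hx
  rw [blockSum, blockSum, Finset.mul_sum]
  refine Finset.sum_le_sum fun ν hν => ?_
  rw [layerSum, layerSum, Finset.mul_sum]
  refine Finset.sum_le_sum fun m _ => ?_
  have h2 := (enorm_coord_le t hp₀ (A x).1 ν m).trans (mul_le_mul' le_rfl h1)
  have h0 : recip p₀ = 0 := by simp [recip, hp₀']
  rw [mul_one, mem_level.1 hν, h0, sub_zero, two_rpow_neg_eq_blockMonomial _ μ c] at h2
  calc ‖(A x).1 ν m‖ₑ ^ r = ‖(A x).1 ν m‖ₑ ^ (r - 2) * ‖(A x).1 ν m‖ₑ ^ (2 : ℝ) := by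
        rw [← ENNReal.rpow_add_of_nonneg _ _ (by linarith) (by norm_num), sub_add_cancel]
    _ ≤ ENNReal.ofReal (1 * blockMonomial t 0 0 μ c) ^ (r - 2) * ‖(A x).1 ν m‖ₑ ^ (2 : ℝ) := by
        gcongr
    _ = _ := by
        rw [ofReal_mul_blockMonomial_rpow one_pos]
        simp

theorem recip_eq_one_div : recip p₀ = 1 / p₀.toReal := by
  rw [recip, ENNReal.toReal_inv, one_div]

/-- The block maps `ℓ₂` into `ℓ_{p₀}` with norm at most `2^(-μ(t - 1/p₀))`, so the Khinchine
argument applies; the dimension of the block does not enter. -/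
theorem exists_blockSum_two_le_rpow (hp₀2 : p₀ ≤ 2)
    (hA : opNorm (normQuasiNorm ell2) (bQuasiNorm d ψ₀ ψ₁ t hp₀ hp₀) A ≤ 1) (μ c : ℕ) :
    ∃ V : Submodule ℂ ell2, FiniteDimensional ℂ V ∧ Module.finrank ℂ V ≤ 2 * c ∧
      ∀ x ∈ Vᗮ, ‖x‖ ≤ 1 → blockSum μ (A x).1 2 ≤ ENNReal.ofReal ((6 ^ (1 / p₀.toReal)) ^ 2 *
        blockMonomial (2 * (t - recip p₀)) 0 (2 * recip p₀ - 1) μ c) := by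
  have hp₀' : p₀ ≠ ∞ := (hp₀2.trans_lt (by simp)).ne
  obtain ⟨r, hr, hrw⟩ := exists_rows hA
  set q := p₀.toReal with hqdef
  have hq : 0 < q := ENNReal.toReal_pos hp₀.ne' hp₀'
  have hq2 : q ≤ 2 := by
    have := ENNReal.toReal_mono (by simp) hp₀2
    simpa using this
  set w : ℝ := 2 ^ (-((μ : ℝ) * (t - recip p₀))) with hw
  have hw0 : 0 < w := by positivity
  obtain ⟨V, hV, hVc, hVB⟩ := exists_codim_coeffSq_le_rpow
    (fun k : BlockIndex d ψ₀ ψ₁ μ => r k.1 k.2) hq hq2 hw0 (fun x => by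
      have h1 := (blockSum_le_bENorm t hp₀ hp₀' (A x).1 μ).trans
        (ENNReal.rpow_le_rpow (mul_le_mul' le_rfl (bENorm_le_enorm hA x)) hq.le)
      rw [blockSum_eq_ofReal μ _ hq.le, two_rpow_eq_ofReal, ← hw, ← ofReal_norm,
        ← ENNReal.ofReal_mul hw0.le, ENNReal.ofReal_rpow_of_nonneg (by positivity) hq.le] at h1
      simpa only [hr] using (ENNReal.ofReal_le_ofReal_iff (by positivity)).1 h1) c
  refine ⟨V, hV, hVc, fun x hx hx1 => ?_⟩
  rw [blockSum_eq_ofReal μ _ zero_le_two]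
  refine ENNReal.ofReal_le_ofReal ?_
  have h1 : ∑ k : BlockIndex d ψ₀ ψ₁ μ, ‖(A x).1 k.1 k.2‖ ^ (2 : ℝ) =
      coeffSq (fun k : BlockIndex d ψ₀ ψ₁ μ => r k.1 k.2) x := by
    simp only [coeffSq, hr, Real.rpow_two]
  rw [h1]
  calc _ ≤ (6 ^ (1 / q) * w * ((c : ℝ) + 1) ^ (1 / 2 - 1 / q)) ^ 2 * 1 := by
        refine (hVB x hx).trans ?_
        gcongr
        exact pow_le_one₀ (norm_nonneg _) hx1
    _ = _ := by
        rw [mul_one, mul_pow, mul_pow, mul_assoc]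
        congr 1
        rw [blockMonomial, hw, ← Real.rpow_natCast _ 2, ← Real.rpow_natCast _ 2,
          ← Real.rpow_mul (by norm_num), ← Real.rpow_mul (by positivity), Real.rpow_zero, mul_one,
          recip_eq_one_div, ← hqdef]
        push_cast
        congr 2 <;> ring

end Rows

/-! #### The four estimates -/

theorem blockEst_of_le_two {P : ℝ} (hP : 2 ≤ P) (hp₀2 : p₀ ≤ 2) :
    BlockEst d ψ₀ ψ₁ hp₀ t P (t - recip p₀ + 1 / P) 0 (recip p₀ - 1 / 2) := by
  have hP0 : 0 < P := by linarith
  have key := BlockEst.of_rpow (d := d) (ψ₀ := ψ₀) (ψ₁ := ψ₁) (hp₀ := hp₀) (t := t) hP0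
    (a := 1 + 2 * (t - recip p₀) * (P / 2)) (b := 0 + 0 * (P / 2))
    (g := 0 + (2 * recip p₀ - 1) * (P / 2))
    ⟨1 * ((6 ^ (1 / p₀.toReal)) ^ 2) ^ (P / 2), by positivity, fun A hA μ c => ?_⟩
  · convert key using 1 <;> field_simp <;> ring
  · obtain ⟨V, hV, hVc, hVB⟩ := exists_blockSum_two_le_rpow hp₀2 hA μ c
    refine ⟨V, hV, hVc, fun x hx hx1 =>
      (lintegral_blockFun_rpow_le_of_two_le μ _ (by linarith)).trans ?_⟩
    rw [← ofReal_mul_blockMonomial_mul zero_le_one, ← ofReal_mul_blockMonomial_rpow (by positivity),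
      two_rpow_neg_natCast_eq_blockMonomial μ c]
    gcongr
    exact hVB x hx hx1

/-- Interpolation of `ℓ_r` between `ℓ₂`, where the Hilbert–Schmidt count gains from the codimension,
and `ℓ_{p₀}`, where only the norm of `A` is used. The fraction in the exponents is the weight of the
`ℓ₂` end. -/
theorem exists_blockSum_rpow_le {R : ℝ} (hd : 1 ≤ d) (hR : IndexGeometry d ψ₀ ψ₁ R)
    (hp₀2 : 2 < p₀) {r : ℝ} (hr : 2 ≤ r) (hrp : recip p₀ < 1 / r) :
    ∃ C : ℝ, 0 < C ∧ ∀ A : ell2 →ₗ[ℂ] bSpace d ψ₀ ψ₁ t hp₀ hp₀,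
      opNorm (normQuasiNorm ell2) (bQuasiNorm d ψ₀ ψ₁ t hp₀ hp₀) A ≤ 1 → ∀ μ c : ℕ,
      ∃ V : Submodule ℂ ell2, FiniteDimensional ℂ V ∧ Module.finrank ℂ V ≤ 2 * c ∧
        ∀ x ∈ Vᗮ, ‖x‖ ≤ 1 → blockSum μ (A x).1 r ≤ ENNReal.ofReal (C *
          blockMonomial (r * (t - recip p₀) - (1 - r * recip p₀) / (1 - 2 * recip p₀))
            (((d : ℝ) - 1) * ((1 - r * recip p₀) / (1 - 2 * recip p₀)))
            ((1 - r * recip p₀) / (1 - 2 * recip p₀)) μ c) := by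
  have hR0 : 0 < R := lt_of_lt_of_le one_pos hR.one_le
  rcases eq_or_ne p₀ ∞ with hp₀' | hp₀'
  · have h0 : recip p₀ = 0 := by simp [recip, hp₀']
    refine ⟨1 * R, by positivity, fun A hA μ c => ?_⟩
    obtain ⟨V, hV, hVc, hVB⟩ := exists_blockSum_two_le_card hd hR hA μ c
    refine ⟨V, hV, hVc, fun x hx hx1 => (blockSum_le_mul_of_top hp₀' hA μ c hx1 hr).trans ?_⟩
    refine (mul_le_mul' le_rfl (hVB x hx hx1)).trans (le_of_eq ?_)
    rw [ofReal_mul_blockMonomial_mul zero_le_one, h0]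
    congr 3 <;> ring
  · set q := p₀.toReal with hq
    have hq2 : 2 < q := by
      have := (ENNReal.toReal_lt_toReal (by simp) hp₀').2 hp₀2
      simpa using this
    have hrec : recip p₀ = 1 / q := recip_eq_one_div
    rw [hrec] at hrp
    have hrq : r < q := (one_div_lt_one_div (by linarith) (by linarith)).1 hrp
    have hη : (1 - r * recip p₀) / (1 - 2 * recip p₀) = (q - r) / (q - 2) := by
      have : q - 2 ≠ 0 := by linarith
      have : 1 - 2 * (1 / q) ≠ 0 := by
        have : (q - 2) / q ≠ 0 := div_ne_zero this (by linarith)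
        field_simp
        exact this
      rw [hrec]
      field_simp
    rw [hη]
    rcases hr.eq_or_lt with rfl | hr2
    · refine ⟨R, hR0, fun A hA μ c => ?_⟩
      obtain ⟨V, hV, hVc, hVB⟩ := exists_blockSum_two_le_card hd hR hA μ c
      refine ⟨V, hV, hVc, fun x hx hx1 => ?_⟩
      rw [div_self (by linarith), mul_one]
      exact hVB x hx hx1
    · set a := (q - r) / (q - 2) with ha
      set b := (r - 2) / (q - 2) with hb
      have ha0 : 0 < a := div_pos (by linarith) (by linarith)
      have hb0 : 0 < b := div_pos (by linarith) (by linarith)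
      have hab : a + b = 1 := by
        rw [ha, hb, ← add_div, div_eq_one_iff_eq (by linarith)]
        ring
      have hr' : 2 * a + q * b = r := by
        have : q - 2 ≠ 0 := by linarith
        rw [ha, hb]
        field_simp
        ring
      refine ⟨R ^ a * 1 ^ b, by positivity, fun A hA μ c => ?_⟩
      obtain ⟨V, hV, hVc, hVB⟩ := exists_blockSum_two_le_card hd hR hA μ c
      refine ⟨V, hV, hVc, fun x hx hx1 => ?_⟩
      have h1 := blockSum_le_interpolate μ (A x).1 ha0 hb0 hab zero_lt_two (show 0 < q by linarith)
      rw [hr'] at h1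
      have h2 := blockSum_le_of_norm_le_one hp₀' hA μ c hx1
      calc _ ≤ _ := h1
        _ ≤ _ := mul_le_mul' (ENNReal.rpow_le_rpow (hVB x hx hx1) ha0.le)
            (ENNReal.rpow_le_rpow h2 hb0.le)
        _ = _ := by
          rw [ofReal_mul_blockMonomial_rpow hR0, ofReal_mul_blockMonomial_rpow one_pos,
            ofReal_mul_blockMonomial_mul (by positivity)]
          congr 3
          · rw [← hq, ← hr']
            ring
          · ring
          · ring

theorem blockSum_le_rpow (μ : ℕ) (a : SeqFamily d ψ₀ ψ₁) {r s : ℝ} (hr : 0 < r) (hrs : r ≤ s) :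
    blockSum μ a s ≤ blockSum μ a r ^ (s / r) := by
  have h1 : 1 ≤ s / r := (one_le_div hr).2 hrs
  have h2 : ∀ ν, ∑ m : omegaIndex ψ₀ ψ₁ ν, ‖a ν m‖ₑ ^ s ≤
      (∑ m : omegaIndex ψ₀ ψ₁ ν, ‖a ν m‖ₑ ^ r) ^ (s / r) := fun ν => by
    refine le_trans (le_of_eq ?_) (finset_sum_rpow_le _ _ h1)
    refine Finset.sum_congr rfl fun m _ => ?_
    rw [← ENNReal.rpow_mul, mul_div_cancel₀ s hr.ne']
  exact (Finset.sum_le_sum fun ν _ => h2 ν).trans (finset_sum_rpow_le _ _ h1)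

theorem exists_lintegral_blockFun_rpow_le {r P : ℝ} (hr : 2 ≤ r) (hrP : r < P) :
    ∃ C : ℝ, 0 < C ∧ ∀ (μ : ℕ) (a : SeqFamily d ψ₀ ψ₁),
      ∫⁻ x, blockFun μ a x ^ (P / 2) ≤
        ENNReal.ofReal C * (2 ^ (-(μ : ℝ)) * blockSum μ a r ^ (P / r)) := by
  have hr0 : 0 < r := by linarith
  -- The embedding of blocks requires `P / 2 ≤ r' < P`; a smaller `r` is first raised to `P / 2` by
  -- `ℓ_r ⊂ ℓ_{r'}`.
  obtain ⟨r', hr', hr'P, hP⟩ : ∃ r', r ≤ r' ∧ r' < P ∧ P ≤ 2 * r' :=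
    ⟨max r (P / 2), le_max_left _ _, max_lt hrP (by linarith), by
      linarith [le_max_right r (P / 2)]⟩
  have hr'0 : 0 < r' := by linarith
  obtain ⟨C, hC, h⟩ := lintegral_blockFun_rpow_le_embedding (d := d) (ψ₀ := ψ₀) (ψ₁ := ψ₁) (r := r')
    (s := P / 2) hr'0 (by linarith) (by linarith)
  refine ⟨C, hC, fun μ a => (h μ a).trans ?_⟩
  rw [mul_div_cancel₀ P (two_ne_zero)]
  gcongr
  calc blockSum μ a r' ^ (P / r') ≤ (blockSum μ a r ^ (r' / r)) ^ (P / r') :=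
        ENNReal.rpow_le_rpow (blockSum_le_rpow μ a hr0 hr') (div_nonneg (by linarith) hr'0.le)
    _ = _ := by
        rw [← ENNReal.rpow_mul]
        congr 1
        field_simp

/-- The exponent `(1/r - 1/p₀)/(1 - 2/p₀)`. -/
noncomputable def largeExponent (p₀ : ℝ≥0∞) (r : ℝ) : ℝ := (1 / r - recip p₀) / (1 - 2 * recip p₀)

/-- `r` is a free parameter: it shifts the same amount between the decay in `μ` and the gain from
the codimension, so the final order does not depend on it and only the sign of the first exponent
matters. The embedding of blocks needs `r < P`; for `r = P = 2` it is an identity of integrals up to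
the factor `2^(-μ)`. -/
theorem blockEst_of_two_lt_large {R : ℝ} (hd : 1 ≤ d) (hR : IndexGeometry d ψ₀ ψ₁ R)
    (hp₀2 : 2 < p₀) {r P : ℝ} (hr : 2 ≤ r) (hrp : recip p₀ < 1 / r)
    (hrP : r < P ∨ r = 2 ∧ P = 2) :
    BlockEst d ψ₀ ψ₁ hp₀ t P (t - recip p₀ + 1 / P - largeExponent p₀ r)
      (((d : ℝ) - 1) * largeExponent p₀ r) (largeExponent p₀ r) := by
  obtain ⟨C, hC, h⟩ := exists_blockSum_rpow_le (t := t) (hp₀ := hp₀) hd hR hp₀2 hr hrp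
  have hP0 : 0 < P := by rcases hrP with h | h <;> linarith
  have hr0 : 0 < r := by linarith
  obtain ⟨C', hC', h'⟩ : ∃ C' : ℝ, 0 < C' ∧ ∀ (μ : ℕ) (a : SeqFamily d ψ₀ ψ₁),
      ∫⁻ x, blockFun μ a x ^ (P / 2) ≤
        ENNReal.ofReal C' * (2 ^ (-(μ : ℝ)) * blockSum μ a r ^ (P / r)) := by
    rcases hrP with h | ⟨rfl, rfl⟩
    · exact exists_lintegral_blockFun_rpow_le hr h
    · refine ⟨1, one_pos, fun μ a => ?_⟩
      have := lintegral_blockFun_rpow_le_of_two_le μ a (s := 1) le_rfl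
      simpa using this
  set e := (1 - r * recip p₀) / (1 - 2 * recip p₀) with he
  have hee : largeExponent p₀ r = e / r := by
    rw [largeExponent, he, div_right_comm]
    congr 1
    field_simp
  have key := BlockEst.of_rpow (d := d) (ψ₀ := ψ₀) (ψ₁ := ψ₁) (hp₀ := hp₀) (t := t) hP0
    (a := 1 + (r * (t - recip p₀) - e) * (P / r)) (b := 0 + (((d : ℝ) - 1) * e) * (P / r))
    (g := 0 + e * (P / r))
    ⟨C' * (1 * C ^ (P / r)), by positivity, fun A hA μ c => ?_⟩
  · rw [hee]
    convert key using 1 <;> field_simp <;> ring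
  · obtain ⟨V, hV, hVc, hVB⟩ := h A hA μ c
    refine ⟨V, hV, hVc, fun x hx hx1 => (h' μ _).trans ?_⟩
    rw [mul_assoc C', ENNReal.ofReal_mul hC'.le,
      ← ofReal_mul_blockMonomial_mul zero_le_one, ← ofReal_mul_blockMonomial_rpow hC,
      two_rpow_neg_natCast_eq_blockMonomial μ c]
    gcongr
    exact hVB x hx hx1

/-- At the exponent `p₀` itself no codimension is used: power means over the layers and the norm of
`A` suffice. Accordingly `c` occurs with exponent zero. -/
theorem lintegral_blockFun_rpow_half_le (hd : 1 ≤ d) (hp₀2 : 2 < p₀) (hp₀' : p₀ ≠ ∞)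
    {A : ell2 →ₗ[ℂ] bSpace d ψ₀ ψ₁ t hp₀ hp₀}
    (hA : opNorm (normQuasiNorm ell2) (bQuasiNorm d ψ₀ ψ₁ t hp₀ hp₀) A ≤ 1) (μ c : ℕ) {x : ell2}
    (hx : ‖x‖ ≤ 1) : ∫⁻ y, blockFun μ (A x).1 y ^ (p₀.toReal / 2) ≤
      ENNReal.ofReal (1 * blockMonomial (t * p₀.toReal) (((d : ℝ) - 1) * (p₀.toReal / 2 - 1)) 0 μ c) := by
  set q := p₀.toReal with hq
  have hq2 : 2 < q := by
    have := (ENNReal.toReal_lt_toReal (by simp) hp₀').2 hp₀2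
    simpa using this
  have h1 : ((level d μ).card : ℝ≥0∞) ^ (q / 2 - 1) ≤
      ENNReal.ofReal (1 * blockMonomial 0 (((d : ℝ) - 1) * (q / 2 - 1)) 0 μ c) := by
    have h2 : ((level d μ).card : ℝ≥0∞) ≤ ENNReal.ofReal (((μ : ℝ) + 1) ^ ((d : ℝ) - 1)) := by
      rw [← ENNReal.ofReal_natCast]
      refine ENNReal.ofReal_le_ofReal ?_
      have : ((level d μ).card : ℝ) ≤ ((μ : ℝ) + 1) ^ (d - 1) := by
        exact_mod_cast card_level_le hd μ
      rwa [← Real.rpow_natCast, Nat.cast_sub hd, Nat.cast_one] at this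
    refine (ENNReal.rpow_le_rpow h2 (by linarith)).trans (le_of_eq ?_)
    rw [ENNReal.ofReal_rpow_of_pos (by positivity), ← Real.rpow_mul (by positivity), blockMonomial]
    simp
  have h2 := lintegral_blockFun_rpow_le_card μ (A x).1 (s := q / 2) (by linarith)
  rw [mul_div_cancel₀ _ (two_ne_zero)] at h2
  refine h2.trans ((mul_le_mul' h1 (mul_le_mul'
    (two_rpow_neg_natCast_eq_blockMonomial μ c).le
    (blockSum_le_of_norm_le_one hp₀' hA μ c hx))).trans (le_of_eq ?_))
  rw [ofReal_mul_blockMonomial_mul zero_le_one, ofReal_mul_blockMonomial_mul zero_le_one,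
    recip_eq_one_div, ← hq]
  congr 3
  · ring
  · field_simp
    ring
  · ring
  · ring

/-- For the high blocks nothing is removed; decay comes from `t` alone, and exponents below `p₀`
follow from the bounded box. -/
theorem blockEst_of_two_lt_small_upper {R : ℝ} (hd : 1 ≤ d) (hR : IndexGeometry d ψ₀ ψ₁ R)
    (hp₀2 : 2 < p₀) (hp₀' : p₀ ≠ ∞) {P : ℝ} (hP : 0 < P) (hPq : P ≤ p₀.toReal) :
    BlockEst d ψ₀ ψ₁ hp₀ t P t (((d : ℝ) - 1) * (1 / 2 - recip p₀)) 0 := by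
  have hq : 0 < p₀.toReal := hP.trans_le hPq
  refine BlockEst.of_le hR hP hPq ?_
  have key := BlockEst.of_rpow (d := d) (ψ₀ := ψ₀) (ψ₁ := ψ₁) (hp₀ := hp₀) (t := t) hq
    (a := t * p₀.toReal) (b := ((d : ℝ) - 1) * (p₀.toReal / 2 - 1)) (g := 0)
    ⟨1, one_pos, fun A hA μ c => ⟨⊥, inferInstance, by simp, fun x _ hx1 =>
      lintegral_blockFun_rpow_half_le hd hp₀2 hp₀' hA μ c hx1⟩⟩
  rw [recip_eq_one_div]
  convert key using 1
  · field_simp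
  · field_simp
  · simp

/-- For the low blocks Lyapunov's inequality is used between the `L₂` norm, controlled by the
Hilbert–Schmidt count, and the `L_{p₀}` norm, controlled by the norm of `A`. Interpolating functions
instead of coefficient sums yields the logarithm that matches the estimate for the high blocks. -/
theorem blockEst_of_two_lt_small_lower {R : ℝ} (hd : 1 ≤ d) (hR : IndexGeometry d ψ₀ ψ₁ R)
    (hp₀2 : 2 < p₀) (hp₀' : p₀ ≠ ∞) {P u v : ℝ} (hP : 0 < P) (hu : 0 ≤ u) (hv : 0 ≤ v)
    (huv : u + v = 1) (hPuv : 2 * u + p₀.toReal * v = P) :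
    BlockEst d ψ₀ ψ₁ hp₀ t P (t - recip p₀ + v / P)
      (((d : ℝ) - 1) * ((u + (p₀.toReal / 2 - 1) * v) / P)) (u / P) := by
  set q := p₀.toReal with hq
  have hq2 : 2 < q := by
    have := (ENNReal.toReal_lt_toReal (by simp) hp₀').2 hp₀2
    simpa using this
  have hR0 : 0 < R := lt_of_lt_of_le one_pos hR.one_le
  have key := BlockEst.of_rpow (d := d) (ψ₀ := ψ₀) (ψ₁ := ψ₁) (hp₀ := hp₀) (t := t) hP
    (a := (1 + (2 * (t - recip p₀) - 1)) * u + t * q * v)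
    (b := (0 + ((d : ℝ) - 1)) * u + ((d : ℝ) - 1) * (q / 2 - 1) * v)
    (g := (0 + 1) * u + 0 * v) ⟨(1 * R) ^ u * 1 ^ v, by positivity, fun A hA μ c => ?_⟩
  · convert key using 1
    · rw [recip_eq_one_div, ← hq, eq_div_iff hP.ne', ← hPuv]
      have hP' : 2 * u + q * v ≠ 0 := by rw [hPuv]; exact hP.ne'
      field_simp
      have hu' : u = 1 - v := by linarith
      rw [hu']
      ring
    · ring
    · ring
  · obtain ⟨V, hV, hVc, hVB⟩ := exists_blockSum_two_le_card hd hR hA μ c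
    refine ⟨V, hV, hVc, fun x hx hx1 => ?_⟩
    have h1 := lintegral_blockFun_rpow_le_interpolate μ (A x).1 hu hv huv (s := q / 2) (by linarith)
    have h2 : u + q / 2 * v = P / 2 := by linarith
    rw [h2, lintegral_blockFun] at h1
    refine h1.trans ?_
    rw [← ofReal_mul_blockMonomial_mul (by positivity), ← ofReal_mul_blockMonomial_rpow (by positivity),
      ← ofReal_mul_blockMonomial_rpow one_pos, ← ofReal_mul_blockMonomial_mul zero_le_one,
      two_rpow_neg_natCast_eq_blockMonomial μ c]
    gcongr
    · exact hVB x hx hx1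
    · exact lintegral_blockFun_rpow_half_le hd hp₀2 hp₀' hA μ c hx1

/-- For `P < 2` the integral is bounded by the `ℓ_P` sum, which is interpolated between `ℓ_{p₀}` and
the small `ℓ₂` norm. No power of `μ + 1` appears, which is why the final order has no logarithm. -/
theorem blockEst_of_lt_of_lt_two (hp₀2 : p₀ < 2) {P : ℝ} (hP : p₀.toReal < P) (hP2 : P < 2) :
    BlockEst d ψ₀ ψ₁ hp₀ t P (t - recip p₀ + 1 / P) 0 (recip p₀ - 1 / P) := by
  have hp₀' : p₀ ≠ ∞ := (hp₀2.trans (by simp)).ne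
  set q := p₀.toReal with hq
  have hq0 : 0 < q := ENNReal.toReal_pos hp₀.ne' hp₀'
  have hP0 : 0 < P := by linarith
  have hq2 : q < 2 := by linarith
  set a := (2 - P) / (2 - q) with ha
  set b := (P - q) / (2 - q) with hb
  have ha0 : 0 < a := div_pos (by linarith) (by linarith)
  have hb0 : 0 < b := div_pos (by linarith) (by linarith)
  have h2q : 2 - q ≠ 0 := by linarith
  have hab : a + b = 1 := by
    rw [ha, hb, ← add_div, div_eq_one_iff_eq (by linarith)]
    ring
  have hr' : q * a + 2 * b = P := by
    rw [ha, hb]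
    field_simp
    ring
  set C : ℝ := (6 ^ (1 / q)) ^ 2 with hC
  have hC0 : 0 < C := by positivity
  have key := BlockEst.of_rpow (d := d) (ψ₀ := ψ₀) (ψ₁ := ψ₁) (hp₀ := hp₀) (t := t) hP0
    (a := 1 + ((t - recip p₀) * q * a + 2 * (t - recip p₀) * b)) (b := 0 + (0 * a + 0 * b))
    (g := 0 + (0 * a + (2 * recip p₀ - 1) * b))
    ⟨1 * (1 ^ a * C ^ b), by positivity, fun A hA μ c => ?_⟩
  · convert key using 1
    · rw [eq_div_iff hP0.ne', show (t - recip p₀) * q * a + 2 * (t - recip p₀) * b =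
        (t - recip p₀) * (q * a + 2 * b) by ring, hr']
      field_simp
      ring
    · ring
    · rw [recip_eq_one_div, ← hq, hb]
      field_simp
      ring
  · obtain ⟨V, hV, hVc, hVB⟩ := exists_blockSum_two_le_rpow hp₀2.le hA μ c
    refine ⟨V, hV, hVc, fun x hx hx1 => ?_⟩
    have h1 := lintegral_blockFun_rpow_le_of_le_two μ (A x).1 (s := P / 2) (by positivity)
      (by linarith)
    rw [mul_div_cancel₀ _ (two_ne_zero)] at h1
    have h2 := blockSum_le_interpolate μ (A x).1 ha0 hb0 hab hq0 zero_lt_two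
    rw [hr'] at h2
    have h3 := blockSum_le_of_norm_le_one hp₀' hA μ c hx1
    refine h1.trans ?_
    rw [← ofReal_mul_blockMonomial_mul zero_le_one, ← ofReal_mul_blockMonomial_mul (by positivity),
      ← ofReal_mul_blockMonomial_rpow one_pos, ← ofReal_mul_blockMonomial_rpow hC0,
      two_rpow_neg_natCast_eq_blockMonomial μ c]
    gcongr
    refine h2.trans ?_
    gcongr
    exact hVB x hx hx1

end

end MixedWeyl

/-! ### Lower estimates: operators into a few layers of one level. -/

namespace MixedWeyl

/-! ### Families supported on finitely many layers of one level -/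

section

variable {d : ℕ} {ψ₀ ψ₁ : ℝ → ℂ}

/-- The indices `(ν, m)` with `ν ∈ Γ`. -/
abbrev LayerIndex (ψ₀ ψ₁ : ℝ → ℂ) (Γ : Finset (Fin d → ℕ)) : Type :=
  Σ ν : Γ, omegaIndex ψ₀ ψ₁ ν.1

open Classical in
/-- Extension by zero of a family on the layers in `Γ`. -/
noncomputable def extendZero (Γ : Finset (Fin d → ℕ)) :
    (LayerIndex ψ₀ ψ₁ Γ → ℂ) →ₗ[ℂ] SeqFamily d ψ₀ ψ₁ where
  toFun y ν m := if h : ν ∈ Γ then y ⟨⟨ν, h⟩, m⟩ else 0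
  map_add' y z := by
    funext ν m
    by_cases h : ν ∈ Γ <;> simp [h]
  map_smul' c y := by
    funext ν m
    by_cases h : ν ∈ Γ <;> simp [h]

variable {Γ : Finset (Fin d → ℕ)} {μ : ℕ}

theorem extendZero_apply (y : LayerIndex ψ₀ ψ₁ Γ → ℂ) (ν : Γ) (m : omegaIndex ψ₀ ψ₁ ν.1) :
    extendZero Γ y ν.1 m = y ⟨ν, m⟩ := by
  simp [extendZero]

theorem extendZero_of_notMem (y : LayerIndex ψ₀ ψ₁ Γ → ℂ) {ν : Fin d → ℕ} (h : ν ∉ Γ) :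
    extendZero Γ y ν = 0 := by
  funext m
  simp [extendZero, h]

theorem extendZero_of_levelSum_ne (hΓ : Γ ⊆ level d μ) (y : LayerIndex ψ₀ ψ₁ Γ → ℂ)
    (ν : Fin d → ℕ) (h : levelSum ν ≠ μ) : extendZero Γ y ν = 0 :=
  extendZero_of_notMem y fun hν => h (mem_level.1 (hΓ hν))

theorem LowerEst.of_extendZero {ι : Type*} [Fintype ι] {t β : ℝ} {p₀ p : ℝ≥0∞} {n : ℕ}
    (L : EuclideanSpace ℂ ι →ₗ[ℂ] (LayerIndex ψ₀ ψ₁ Γ → ℂ))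
    (hL : ∀ x, bENorm t p₀ p₀ (extendZero Γ (L x)) ≤ ‖x‖ₑ)
    (hM : ∀ M : Submodule ℂ (EuclideanSpace ℂ ι), Fintype.card ι < Module.finrank ℂ M + n →
      ∃ x ∈ M, ‖x‖ ≤ 1 ∧ ENNReal.ofReal β ≤ fENorm 0 p 2 (extendZero Γ (L x))) :
    LowerEst d ψ₀ ψ₁ p₀ t p n β := by
  let e : EuclideanSpace ℂ (Fin (Fintype.card ι)) ≃ₗᵢ[ℂ] EuclideanSpace ℂ ι :=
    LinearIsometryEquiv.piLpCongrLeft 2 ℂ ℂ (Fintype.equivFin ι).symm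
  refine ⟨Fintype.card ι, extendZero Γ ∘ₗ L ∘ₗ e.toLinearEquiv.toLinearMap, fun x => ?_, fun M hMn => ?_⟩
  · refine (hL (e x)).trans (le_of_eq ?_)
    rw [← ofReal_norm, ← ofReal_norm, e.norm_map]
  · obtain ⟨x, hx, hx1, hxβ⟩ := hM (M.map e.toLinearEquiv.toLinearMap) <| by
      rwa [LinearEquiv.finrank_map_eq e.toLinearEquiv M]
    obtain ⟨z, hz, rfl⟩ := hx
    exact ⟨z, hz, by rwa [← e.norm_map], hxβ⟩

variable [∀ ν : Fin d → ℕ, Fintype (omegaIndex ψ₀ ψ₁ ν)]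

theorem sum_level_extendZero (hΓ : Γ ⊆ level d μ) (y : LayerIndex ψ₀ ψ₁ Γ → ℂ)
    (F : (ν : Fin d → ℕ) → omegaIndex ψ₀ ψ₁ ν → ℂ → ℝ≥0∞) (hF : ∀ ν m, F ν m 0 = 0) :
    ∑ ν ∈ level d μ, ∑ m, F ν m (extendZero Γ y ν m) =
      ∑ k : LayerIndex ψ₀ ψ₁ Γ, F k.1 k.2 (y k) := by
  rw [Fintype.sum_sigma, ← Finset.sum_subset hΓ fun ν _ hν => by
    simp [extendZero_of_notMem y hν, hF],
    ← Finset.sum_coe_sort Γ fun ν => ∑ m, F ν m (extendZero Γ y ν m)]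
  exact Finset.sum_congr rfl fun ν _ => Finset.sum_congr rfl fun m _ => by rw [extendZero_apply]

theorem blockSum_extendZero (hΓ : Γ ⊆ level d μ) (y : LayerIndex ψ₀ ψ₁ Γ → ℂ) {s : ℝ}
    (hs : 0 < s) : blockSum μ (extendZero Γ y) s = ∑ k, ‖y k‖ₑ ^ s :=
  sum_level_extendZero hΓ y (fun _ _ z => ‖z‖ₑ ^ s) fun _ _ => by simp [hs]

theorem blockFun_extendZero (hΓ : Γ ⊆ level d μ) (y : LayerIndex ψ₀ ψ₁ Γ → ℂ) (x : Fin d → ℝ) :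
    blockFun μ (extendZero Γ y) x = ∑ k, ‖y k‖ₑ ^ (2 : ℝ) * chi k.1.1 k.2.1 x :=
  sum_level_extendZero hΓ y (fun ν m z => ‖z‖ₑ ^ (2 : ℝ) * chi ν m x) fun _ _ => by simp

theorem fENorm_extendZero {p : ℝ≥0∞} (hp : 0 < p) (hp' : p < ∞) (hΓ : Γ ⊆ level d μ)
    (y : LayerIndex ψ₀ ψ₁ Γ → ℂ) : fENorm 0 p 2 (extendZero Γ y) =
      (∫⁻ x, (∑ k, ‖y k‖ₑ ^ (2 : ℝ) * chi k.1.1 k.2.1 x) ^ (p.toReal / 2)) ^ (1 / p.toReal) := by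
  rw [fENorm_eq hp hp']
  congr 2
  funext x
  rw [← blockFun_extendZero hΓ, tsum_eq_single μ fun μ' hμ' => ?_]
  refine blockFun_eq_zero_of_forall μ' fun ν hν m => Or.inl ?_
  rw [extendZero_of_levelSum_ne hΓ y ν (by rw [hν]; exact hμ')]
  rfl

theorem bENorm_extendZero_le_of_two_le (t : ℝ) {p₀ : ℝ≥0∞} (hp₀ : 2 ≤ p₀) (hΓ : Γ ⊆ level d μ)
    (y : LayerIndex ψ₀ ψ₁ Γ → ℂ) : bENorm t p₀ p₀ (extendZero Γ y) ≤
      2 ^ ((μ : ℝ) * (t - recip p₀)) * (∑ k, ‖y k‖ₑ ^ (2 : ℝ)) ^ (1 / 2 : ℝ) := by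
  rw [← blockSum_extendZero hΓ y two_pos]
  exact bENorm_le_of_support_of_two_le t hp₀ _ μ (extendZero_of_levelSum_ne hΓ y)

theorem bENorm_extendZero (t : ℝ) {p₀ : ℝ≥0∞} (hp₀ : 0 < p₀) (hp₀' : p₀ ≠ ∞) (hΓ : Γ ⊆ level d μ)
    (y : LayerIndex ψ₀ ψ₁ Γ → ℂ) : bENorm t p₀ p₀ (extendZero Γ y) =
      2 ^ ((μ : ℝ) * (t - recip p₀)) * (∑ k, ‖y k‖ₑ ^ p₀.toReal) ^ (1 / p₀.toReal) := by
  have hq : 0 < p₀.toReal := ENNReal.toReal_pos hp₀.ne' hp₀'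
  have h1 := bENorm_rpow_of_support t hp₀ hp₀' _ μ (extendZero_of_levelSum_ne hΓ y)
  rw [blockSum_extendZero hΓ y hq] at h1
  have h2 : ∀ z : ℝ≥0∞, (z ^ p₀.toReal) ^ (1 / p₀.toReal) = z := fun z => by
    rw [← ENNReal.rpow_mul, mul_one_div_cancel hq.ne', ENNReal.rpow_one]
  rw [← h2 (bENorm t p₀ p₀ (extendZero Γ y)), h1, ENNReal.mul_rpow_of_nonneg _ _ (by positivity),
    ENNReal.rpow_mul, h2]

/-! ### Lower estimates on subspaces -/

/-- The square function is at least its single term on the rectangle of `k`, whose measure is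
`2^(-μ)`. -/
theorem enorm_mul_le_fENorm_extendZero {p : ℝ≥0∞} (hp : 0 < p) (hp' : p < ∞)
    (hΓ : Γ ⊆ level d μ) (y : LayerIndex ψ₀ ψ₁ Γ → ℂ) (k : LayerIndex ψ₀ ψ₁ Γ) :
    ‖y k‖ₑ * 2 ^ (-((μ : ℝ) / p.toReal)) ≤ fENorm 0 p 2 (extendZero Γ y) := by
  have hr : 0 < p.toReal := ENNReal.toReal_pos hp.ne' hp'.ne
  rw [fENorm_extendZero hp hp' hΓ]
  calc _ = (∫⁻ x, ‖y k‖ₑ ^ p.toReal * chi k.1.1 k.2.1 x) ^ (1 / p.toReal) := by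
        rw [lintegral_const_mul _ (measurable_chi _ _), lintegral_chi,
          mem_level.1 (hΓ k.1.2), ← two_rpow_eq_ofReal,
          ENNReal.mul_rpow_of_nonneg _ _ (by positivity), ← ENNReal.rpow_mul,
          mul_one_div_cancel hr.ne', ENNReal.rpow_one, ← ENNReal.rpow_mul]
        congr 2
        ring
    _ ≤ _ := by
        gcongr with x
        by_cases hx : x ∈ dyadicCube k.1.1 k.2.1
        · calc _ = (‖y k‖ₑ ^ (2 : ℝ) * chi k.1.1 k.2.1 x) ^ (p.toReal / 2) := by
                rw [chi_eq_one hx, mul_one, mul_one, ← ENNReal.rpow_mul,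
                  mul_div_cancel₀ _ (two_ne_zero)]
            _ ≤ _ := by
                gcongr
                exact Finset.single_le_sum (f := fun k : LayerIndex ψ₀ ψ₁ Γ =>
                  ‖y k‖ₑ ^ (2 : ℝ) * chi k.1.1 k.2.1 x) (fun _ _ => zero_le) (Finset.mem_univ k)
        · rw [chi_eq_zero hx, mul_zero]
          exact zero_le

theorem exists_ge_of_sum_signs_ge {m : ℕ} {c : ℝ≥0∞} {f : (Fin m → Bool) → ℝ≥0∞}
    (h : 2 ^ m * c ≤ ∑ σ, f σ) : ∃ σ, c ≤ f σ := by
  obtain ⟨σ, hσ⟩ := Finite.exists_max f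
  refine ⟨σ, ?_⟩
  have h1 : 2 ^ m * c ≤ 2 ^ m * f σ := by
    refine h.trans ((Finset.sum_le_card_nsmul _ _ _ fun τ _ => hσ τ).trans (le_of_eq ?_))
    simp
  exact (ENNReal.mul_le_mul_iff_right (by simp) (by simp)).1 h1

/-- Khinchine's inequality at each point `x`, for the Hilbert space vectors with coordinates `√(χ k
x) · a i k`. Averaging over the signs after integration gives one choice of signs for all points
simultaneously. -/
theorem exists_signs_le_lintegral {α ι : Type*} [MeasurableSpace α] {κ : Measure α} [Fintype ι]
    {m : ℕ} (a : Fin m → ι → ℂ) (χ : ι → α → ℝ≥0∞) (hχ : ∀ k, Measurable (χ k))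
    (hχ1 : ∀ k x, χ k x ≤ 1) {q : ℝ} (hq : 0 < q) (hq2 : q ≤ 2) :
    ∃ σ : Fin m → Bool, ∫⁻ x, (∑ k, (∑ i, ‖a i k‖ₑ ^ (2 : ℝ)) * χ k x) ^ (q / 2) / 3 ∂κ ≤
      ∫⁻ x, (∑ k, ‖(∑ i, (sgn (σ i) : ℂ) • a i) k‖ₑ ^ (2 : ℝ) * χ k x) ^ (q / 2) ∂κ := by
  refine exists_ge_of_sum_signs_ge ?_
  rw [← lintegral_finsetSum _ fun σ _ => by fun_prop, ← lintegral_const_mul' _ _ (by simp)]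
  refine lintegral_mono fun x => ?_
  set c : ι → ℝ := fun k => (χ k x).toReal with hc
  have hcχ : ∀ k, χ k x = ENNReal.ofReal (c k) := fun k =>
    (ENNReal.ofReal_toReal ((hχ1 k x).trans_lt (by simp)).ne).symm
  have hc0 : ∀ k, 0 ≤ c k := fun k => ENNReal.toReal_nonneg
  have he : ∀ z : ℂ, ‖z‖ₑ ^ (2 : ℝ) = ENNReal.ofReal (‖z‖ ^ 2) := fun z => by
    rw [← ofReal_norm, ENNReal.ofReal_rpow_of_nonneg (norm_nonneg _) zero_le_two, Real.rpow_two]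
  let v : Fin m → EuclideanSpace ℂ ι := fun i => WithLp.toLp 2 fun k => (Real.sqrt (c k) : ℂ) * a i k
  have hv : ∀ i, ‖v i‖ ^ 2 = ∑ k, ‖a i k‖ ^ 2 * c k := by
    intro i
    rw [EuclideanSpace.norm_sq_eq]
    refine Finset.sum_congr rfl fun k _ => ?_
    simp only [v, norm_mul, Complex.norm_real, Real.norm_of_nonneg (Real.sqrt_nonneg _), mul_pow,
      Real.sq_sqrt (hc0 k)]
    ring
  have hvσ : ∀ σ, ‖signedSum v σ‖ ^ 2 = ∑ k, ‖(∑ i, (sgn (σ i) : ℂ) • a i) k‖ ^ 2 * c k := by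
    intro σ
    rw [EuclideanSpace.norm_sq_eq]
    refine Finset.sum_congr rfl fun k _ => ?_
    have : (signedSum v σ) k = (Real.sqrt (c k) : ℂ) * (∑ i, (sgn (σ i) : ℂ) • a i) k := by
      simp only [signedSum, v, WithLp.ofLp_sum, WithLp.ofLp_smul, Finset.sum_apply, Pi.smul_apply,
        smul_eq_mul, Finset.mul_sum]
      exact Finset.sum_congr rfl fun i _ => by ring
    rw [this, norm_mul, Complex.norm_real, Real.norm_of_nonneg (Real.sqrt_nonneg _), mul_pow,
      Real.sq_sqrt (hc0 k)]
    ring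
  have h1 : (∑ k, (∑ i, ‖a i k‖ₑ ^ (2 : ℝ)) * χ k x) = ENNReal.ofReal (∑ i, ‖v i‖ ^ 2) := by
    simp only [he, hcχ, hv]
    rw [Finset.sum_comm, ENNReal.ofReal_sum_of_nonneg fun k _ => Finset.sum_nonneg fun i _ =>
      mul_nonneg (by positivity) (hc0 k)]
    refine Finset.sum_congr rfl fun k _ => ?_
    rw [← Finset.sum_mul, ENNReal.ofReal_mul (Finset.sum_nonneg fun i _ => by positivity),
      ENNReal.ofReal_sum_of_nonneg fun i _ => by positivity]
  have h2 : ∀ σ, (∑ k, ‖(∑ i, (sgn (σ i) : ℂ) • a i) k‖ₑ ^ (2 : ℝ) * χ k x) ^ (q / 2) =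
      ENNReal.ofReal (‖signedSum v σ‖ ^ q) := by
    intro σ
    have : (∑ k, ‖(∑ i, (sgn (σ i) : ℂ) • a i) k‖ₑ ^ (2 : ℝ) * χ k x) =
        ENNReal.ofReal (‖signedSum v σ‖ ^ 2) := by
      simp only [he, hcχ, hvσ]
      rw [ENNReal.ofReal_sum_of_nonneg fun k _ => mul_nonneg (by positivity) (hc0 k)]
      exact Finset.sum_congr rfl fun k _ => (ENNReal.ofReal_mul (by positivity)).symm
    rw [this, ENNReal.ofReal_rpow_of_nonneg (by positivity) (by positivity), ← Real.rpow_natCast,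
      ← Real.rpow_mul (norm_nonneg _)]
    congr 2
    push_cast
    ring
  simp only [h1, h2]
  rw [← ENNReal.ofReal_sum_of_nonneg fun σ _ => by positivity,
    ENNReal.ofReal_rpow_of_nonneg (by positivity) (by positivity)]
  have h3 := khinchine_lower v hq hq2
  calc _ = ENNReal.ofReal (2 ^ m * ((∑ i, ‖v i‖ ^ 2) ^ (q / 2) / 3)) := by
        rw [ENNReal.ofReal_mul (by positivity), ENNReal.ofReal_div_of_pos (by norm_num)]
        simp
    _ ≤ _ := ENNReal.ofReal_le_ofReal h3

/-- As `s - 1 ≤ 0`, the bound `G ≤ B` gives `G^(s-1) ≥ B^(s-1)`; a bounded function with large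
integral also has a large `s`-th moment. -/
theorem le_lintegral_rpow_of_le {α : Type*} [MeasurableSpace α] {κ : Measure α} {G : α → ℝ≥0∞}
    {B : ℝ≥0∞} (hG : ∀ x, G x ≤ B) (hB : B ≠ ∞) {s : ℝ} (hs1 : s ≤ 1) :
    B ^ (s - 1) * ∫⁻ x, G x ∂κ ≤ ∫⁻ x, G x ^ s ∂κ := by
  rcases eq_or_ne B 0 with rfl | hB0
  · have : ∀ x, G x = 0 := fun x => le_antisymm (hG x) zero_le
    simp [this]
  rw [← lintegral_const_mul' _ _ (ENNReal.rpow_ne_top_of_ne_zero hB0 hB)]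
  refine lintegral_mono fun x => ?_
  rcases eq_or_ne (G x) 0 with h | h
  · simp [h]
  · calc B ^ (s - 1) * G x ≤ G x ^ (s - 1) * G x := by
          gcongr ?_ * _
          rw [← neg_sub, ENNReal.rpow_neg, ENNReal.rpow_neg]
          exact ENNReal.inv_le_inv.2 (ENNReal.rpow_le_rpow (hG x) (by linarith))
      _ = G x ^ s := by
          nth_rewrite 2 [← ENNReal.rpow_one (G x)]
          rw [← ENNReal.rpow_add _ _ h (ne_top_of_le_ne_top hB (hG x)), sub_add_cancel]

/-- The sums of squares against cubes of one layer are bounded by the number of layers. -/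
theorem sum_mul_chi_le {ρ : ℝ≥0∞} {c : LayerIndex ψ₀ ψ₁ Γ → ℝ≥0∞} (hc : ∀ k, c k ≤ ρ)
    (x : Fin d → ℝ) : ∑ k, c k * chi k.1.1 k.2.1 x ≤ ρ * Γ.card := by
  rw [Fintype.sum_sigma]
  calc _ ≤ ∑ _ν : Γ, ρ := by
        refine Finset.sum_le_sum fun ν _ => ?_
        by_cases h : ∃ m : omegaIndex ψ₀ ψ₁ ν.1, x ∈ dyadicCube ν.1 m.1
        · obtain ⟨m, hm⟩ := h
          rw [Finset.sum_eq_single m]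
          · exact (mul_le_of_le_one_right' (chi_le_one _ _ _)).trans (hc _)
          · intro m' _ hm'
            rw [chi_eq_zero fun h => hm' (Subtype.ext (dyadicCube_disjoint h hm)), mul_zero]
          · simp
        · push Not at h
          rw [Finset.sum_eq_zero fun m _ => by rw [chi_eq_zero (h m), mul_zero]]
          exact zero_le
    _ = _ := by
        simp [mul_comm]

/-- The vector is `m^(-1/2) ∑ ± b i`. After Khinchine its square function may be replaced by `G`,
the square function of the values `∑ i, ‖L (b i) k‖²`. This `G` is at most `ρ` times the number of
layers and has integral at least `2^(-μ) S`, which bounds its power `p/2 ≤ 1` from below. -/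
theorem exists_mem_le_fENorm_of_le_two {ι : Type*} [Fintype ι] {p : ℝ≥0∞} (hp : 0 < p)
    (hp2 : p ≤ 2) (hΓ : Γ ⊆ level d μ)
    (L : EuclideanSpace ℂ ι →ₗ[ℂ] (LayerIndex ψ₀ ψ₁ Γ → ℂ)) (M : Submodule ℂ (EuclideanSpace ℂ ι))
    {m : ℕ} (hm : 0 < m) {b : Fin m → EuclideanSpace ℂ ι} (hb : Orthonormal ℂ b) (hbM : ∀ i, b i ∈ M)
    {ρ S : ℝ} (hρ : 0 < ρ) (hρL : ∀ k, ∑ i, ‖L (b i) k‖ ^ 2 ≤ ρ) (hS : 0 ≤ S)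
    (hSL : S ≤ ∑ k, ∑ i, ‖L (b i) k‖ ^ 2) (hΓ0 : Γ.Nonempty) :
    ∃ x ∈ M, ‖x‖ ≤ 1 ∧ ENNReal.ofReal ((m : ℝ) ^ (-(1 / 2) : ℝ) *
      ((ρ * Γ.card) ^ (p.toReal / 2 - 1) * (2 ^ (-(μ : ℝ)) * S) / 3) ^ (1 / p.toReal)) ≤
        fENorm 0 p 2 (extendZero Γ (L x)) := by
  have hp' : p < ∞ := hp2.trans_lt (by simp)
  have hq : 0 < p.toReal := ENNReal.toReal_pos hp.ne' hp'.ne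
  have hq2 : p.toReal ≤ 2 := by
    have := ENNReal.toReal_mono (by simp) hp2
    simpa using this
  have hm0 : (0 : ℝ) < m := by exact_mod_cast hm
  have hN : (0 : ℝ) < Γ.card := by exact_mod_cast hΓ0.card_pos
  obtain ⟨σ, hσ⟩ := exists_signs_le_lintegral (κ := volume) (fun i => L (b i))
    (fun k : LayerIndex ψ₀ ψ₁ Γ => chi k.1.1 k.2.1) (fun k => measurable_chi _ _)
    (fun k x => chi_le_one _ _ _) hq hq2
  have he : ∀ z : ℂ, ‖z‖ₑ ^ (2 : ℝ) = ENNReal.ofReal (‖z‖ ^ 2) := fun z => by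
    rw [← ofReal_norm, ENNReal.ofReal_rpow_of_nonneg (norm_nonneg _) zero_le_two, Real.rpow_two]
  have hek : ∀ k, ∑ i, ‖L (b i) k‖ₑ ^ (2 : ℝ) = ENNReal.ofReal (∑ i, ‖L (b i) k‖ ^ 2) := fun k => by
    simp only [he]
    rw [ENNReal.ofReal_sum_of_nonneg fun i _ => by positivity]
  set G : (Fin d → ℝ) → ℝ≥0∞ := fun x =>
    ∑ k : LayerIndex ψ₀ ψ₁ Γ, (∑ i, ‖L (b i) k‖ₑ ^ (2 : ℝ)) * chi k.1.1 k.2.1 x with hG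
  have hGle : ∀ x, G x ≤ ENNReal.ofReal (ρ * Γ.card) := fun x => by
    rw [ENNReal.ofReal_mul hρ.le, ENNReal.ofReal_natCast]
    refine sum_mul_chi_le (fun k => ?_) x
    rw [hek]
    exact ENNReal.ofReal_le_ofReal (hρL k)
  have hGint : ENNReal.ofReal (2 ^ (-(μ : ℝ)) * S) ≤ ∫⁻ x, G x := by
    simp only [hG]
    rw [lintegral_finsetSum _ fun k _ => (measurable_chi _ _).const_mul _,
      ENNReal.ofReal_mul (by positivity)]
    calc _ ≤ ENNReal.ofReal (2 ^ (-(μ : ℝ))) *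
          ∑ k : LayerIndex ψ₀ ψ₁ Γ, ∑ i, ‖L (b i) k‖ₑ ^ (2 : ℝ) := by
          gcongr
          simp only [hek]
          rw [← ENNReal.ofReal_sum_of_nonneg fun k _ => Finset.sum_nonneg fun i _ => by positivity]
          exact ENNReal.ofReal_le_ofReal hSL
      _ = _ := by
          rw [Finset.mul_sum]
          refine Finset.sum_congr rfl fun k _ => ?_
          rw [lintegral_const_mul _ (measurable_chi _ _), lintegral_chi, mem_level.1 (hΓ k.1.2),
            mul_comm]
  have h1 : ENNReal.ofReal ((ρ * Γ.card) ^ (p.toReal / 2 - 1) * (2 ^ (-(μ : ℝ)) * S) / 3) ≤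
      ∫⁻ x, G x ^ (p.toReal / 2) / 3 := by
    have h2 := le_lintegral_rpow_of_le (κ := volume) hGle ENNReal.ofReal_ne_top
      (s := p.toReal / 2) (by linarith)
    simp only [div_eq_mul_inv (b := (3 : ℝ≥0∞))]
    rw [lintegral_mul_const' _ _ (by simp), ENNReal.ofReal_div_of_pos (by norm_num),
      ENNReal.ofReal_mul (by positivity), ← ENNReal.ofReal_rpow_of_pos (by positivity), div_eq_mul_inv,
      ENNReal.ofReal_ofNat]
    gcongr
    exact (mul_le_mul' le_rfl hGint).trans h2
  set x₀ := ∑ i, (sgn (σ i) : ℂ) • b i with hx₀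
  have hLx₀ : L x₀ = ∑ i, (sgn (σ i) : ℂ) • L (b i) := by
    rw [hx₀, map_sum]
    simp
  have hx₀n : ‖x₀‖ ^ 2 = m := by
    rw [hx₀, norm_sq_sum_smul hb]
    have : ∀ i, ‖(sgn (σ i) : ℂ)‖ ^ 2 = 1 := fun i => by
      rw [Complex.norm_real, Real.norm_eq_abs, sq_abs, sq, sgn_mul_self]
    rw [Finset.sum_congr rfl fun i _ => this i]
    simp
  set c : ℝ := (m : ℝ) ^ (-(1 / 2) : ℝ) with hc
  have hc0 : 0 < c := by positivity
  have hcn : ‖(c : ℂ)‖ = c := by rw [Complex.norm_real, Real.norm_of_nonneg hc0.le]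
  refine ⟨(c : ℂ) • x₀, M.smul_mem _ (M.sum_mem fun i _ => M.smul_mem _ (hbM i)), ?_, ?_⟩
  · rw [norm_smul, hcn]
    refine le_of_sq_le_sq ?_ zero_le_one
    rw [mul_pow, hx₀n, hc, ← Real.rpow_natCast, ← Real.rpow_mul hm0.le]
    norm_num
    rw [Real.rpow_neg_one, inv_mul_cancel₀ hm0.ne']
  · rw [map_smul, map_smul, fENorm_smul 0 p (by norm_num), ENNReal.ofReal_mul hc0.le,
      ← ofReal_norm, hcn, fENorm_extendZero hp hp' hΓ, hLx₀,
      ← ENNReal.ofReal_rpow_of_nonneg (div_nonneg (mul_nonneg (Real.rpow_nonneg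
        (mul_pos hρ hN).le _) (mul_nonneg (by positivity) hS)) (by norm_num)) (by positivity)]
    exact mul_le_mul' le_rfl (ENNReal.rpow_le_rpow (h1.trans hσ) (by positivity))

end

end MixedWeyl

namespace MixedWeyl

/-! ### Lower estimates by coordinate embeddings -/

section Hilbert

variable {ι : Type*} [Fintype ι]

theorem exists_orthonormal_of_submodule {E : Type*} [NormedAddCommGroup E] [InnerProductSpace ℂ E]
    (M : Submodule ℂ E) [FiniteDimensional ℂ M] :
    ∃ b : Fin (Module.finrank ℂ M) → E, Orthonormal ℂ b ∧ ∀ i, b i ∈ M :=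
  ⟨fun i => stdOrthonormalBasis ℂ M i,
    (stdOrthonormalBasis ℂ M).orthonormal.comp_linearIsometry M.subtypeₗᵢ, fun _ => Subtype.prop _⟩

theorem sum_norm_sq_coord_le_one {m : ℕ} {b : Fin m → EuclideanSpace ℂ ι} (hb : Orthonormal ℂ b)
    (k : ι) : ∑ i, ‖b i k‖ ^ 2 ≤ 1 := by
  classical
  have h := hb.sum_inner_products_le (s := Finset.univ) (EuclideanSpace.single k (1 : ℂ))
  rw [PiLp.norm_single, norm_one, one_pow] at h
  refine le_trans (le_of_eq (Finset.sum_congr rfl fun i _ => ?_)) h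
  rw [EuclideanSpace.inner_single_right, one_mul, RCLike.norm_conj]

theorem sum_sum_norm_sq_coord {m : ℕ} {b : Fin m → EuclideanSpace ℂ ι} (hb : Orthonormal ℂ b) :
    ∑ k, ∑ i, ‖b i k‖ ^ 2 = m := by
  rw [Finset.sum_comm]
  simp_rw [← EuclideanSpace.norm_sq_eq, hb.norm_eq_one]
  simp

/-- A subspace of dimension at least half of the dimension of `ℂ^ι` contains an element of norm at
most one with a coordinate of modulus at least `1/2`. -/
theorem exists_mem_half_le_norm_coord [Nonempty ι] (M : Submodule ℂ (EuclideanSpace ℂ ι))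
    (hM : Fintype.card ι ≤ 2 * Module.finrank ℂ M) :
    ∃ x ∈ M, ‖x‖ ≤ 1 ∧ ∃ k, 1 / 2 ≤ ‖x k‖ := by
  obtain ⟨b, hb, hbM⟩ := exists_orthonormal_of_submodule M
  -- The diagonal entries of the projection onto `M` add up to its dimension, so one is at least the
  -- average, which is at least `1/2`.
  obtain ⟨k, -, hk⟩ : ∃ k ∈ Finset.univ, (1 / 2 : ℝ) ≤ ∑ i, ‖b i k‖ ^ 2 := by
    refine Finset.exists_le_of_sum_le (Finset.univ_nonempty (α := ι)) ?_
    rw [sum_sum_norm_sq_coord hb]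
    have : (Fintype.card ι : ℝ) ≤ 2 * Module.finrank ℂ M := by exact_mod_cast hM
    simp only [Finset.sum_const, Finset.card_univ, nsmul_eq_mul]
    linarith
  have hk1 := sum_norm_sq_coord_le_one hb k
  -- This is the projection of the `k`-th unit vector onto `M`; its `k`-th coordinate is the chosen
  -- diagonal entry.
  refine ⟨∑ i, (starRingEnd ℂ (b i k)) • b i, M.sum_mem fun i _ => M.smul_mem _ (hbM i), ?_, k, ?_⟩
  · refine le_of_sq_le_sq ?_ zero_le_one
    rw [norm_sq_sum_smul hb]
    simpa using hk1
  · have h1 : (∑ i, (starRingEnd ℂ (b i k)) • b i) k = ((∑ i, ‖b i k‖ ^ 2 : ℝ) : ℂ) := by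
      rw [WithLp.ofLp_sum, Finset.sum_apply]
      push_cast
      exact Finset.sum_congr rfl fun i _ => by
        rw [PiLp.smul_apply, smul_eq_mul, Complex.conj_mul']
    rw [h1, Complex.norm_real, Real.norm_of_nonneg (by linarith)]
    exact hk

end Hilbert

theorem sum_rpow_le_card_rpow {ι : Type*} [Fintype ι] (f : ι → ℝ≥0∞) {q : ℝ} (hq : 0 < q)
    (hq2 : q ≤ 2) : (∑ k, f k ^ q) ^ (1 / q) ≤
      (Fintype.card ι : ℝ≥0∞) ^ (1 / q - 1 / 2) * (∑ k, f k ^ (2 : ℝ)) ^ (1 / 2 : ℝ) := by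
  have h := ENNReal.rpow_sum_le_const_mul_sum_rpow Finset.univ (fun k => f k ^ q)
    (p := 2 / q) (by rwa [le_div_iff₀ hq, one_mul])
  have h1 := ENNReal.rpow_le_rpow h (show (0 : ℝ) ≤ 1 / 2 by norm_num)
  simp only [← ENNReal.rpow_mul, mul_div_cancel₀ _ hq.ne'] at h1
  rw [ENNReal.mul_rpow_of_nonneg _ _ (by norm_num), ← ENNReal.rpow_mul] at h1
  convert h1 using 2
  · field_simp
  · rw [Finset.card_univ]
    congr 1
    field_simp

section

variable {d : ℕ} {ψ₀ ψ₁ : ℝ → ℂ}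

theorem LowerEst.mono {p₀ p : ℝ≥0∞} {t : ℝ} {n : ℕ} {β β' : ℝ}
    (h : LowerEst d ψ₀ ψ₁ p₀ t p n β) (hβ : β' ≤ β) : LowerEst d ψ₀ ψ₁ p₀ t p n β' := by
  obtain ⟨k, T, hT, hM⟩ := h
  refine ⟨k, T, hT, fun M hMn => ?_⟩
  obtain ⟨x, hx, hx1, hxβ⟩ := hM M hMn
  exact ⟨x, hx, hx1, (ENNReal.ofReal_le_ofReal hβ).trans hxβ⟩

variable {Γ : Finset (Fin d → ℕ)} {μ : ℕ}

/-- The scaled embedding of `ℂ^Γ` into the sequence families. -/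
noncomputable def scaledEmbedding (ψ₀ ψ₁ : ℝ → ℂ) (Γ : Finset (Fin d → ℕ)) (s : ℝ) :
    EuclideanSpace ℂ (LayerIndex ψ₀ ψ₁ Γ) →ₗ[ℂ] (LayerIndex ψ₀ ψ₁ Γ → ℂ) :=
  (s : ℂ) • (WithLp.linearEquiv 2 ℂ (LayerIndex ψ₀ ψ₁ Γ → ℂ)).toLinearMap

theorem norm_scaledEmbedding_apply {s : ℝ} (hs : 0 ≤ s)
    (x : EuclideanSpace ℂ (LayerIndex ψ₀ ψ₁ Γ)) (k : LayerIndex ψ₀ ψ₁ Γ) :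
    ‖scaledEmbedding ψ₀ ψ₁ Γ s x k‖ = s * ‖x k‖ := by
  show ‖(s : ℂ) * x k‖ = _
  rw [norm_mul, Complex.norm_real, Real.norm_of_nonneg hs]

variable [∀ ν : Fin d → ℕ, Fintype (omegaIndex ψ₀ ψ₁ ν)]

theorem card_layerIndex : Fintype.card (LayerIndex ψ₀ ψ₁ Γ) =
    ∑ ν ∈ Γ, Fintype.card (omegaIndex ψ₀ ψ₁ ν) := by
  rw [Fintype.card_sigma]
  exact Finset.sum_coe_sort Γ fun ν => Fintype.card (omegaIndex ψ₀ ψ₁ ν)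

theorem card_layerIndex_le {R : ℝ} (hR : IndexGeometry d ψ₀ ψ₁ R) (hΓ : Γ ⊆ level d μ) :
    (Fintype.card (LayerIndex ψ₀ ψ₁ Γ) : ℝ) ≤ R * (2 ^ (μ : ℝ) * Γ.card) := by
  rw [card_layerIndex, Nat.cast_sum]
  calc _ ≤ ∑ ν ∈ Γ, R * 2 ^ μ := by
        refine Finset.sum_le_sum fun ν hν => ?_
        have := hR.card_le ν
        rwa [mem_level.1 (hΓ hν)] at this
    _ = _ := by
        rw [Finset.sum_const, nsmul_eq_mul, Real.rpow_natCast]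
        ring

theorem le_card_layerIndex {R : ℝ} (hR : IndexGeometry d ψ₀ ψ₁ R) (hΓ : Γ ⊆ level d μ) :
    2 ^ (μ : ℝ) * Γ.card ≤ R * (Fintype.card (LayerIndex ψ₀ ψ₁ Γ) : ℝ) := by
  rw [card_layerIndex, Nat.cast_sum, Finset.mul_sum]
  calc _ = ∑ ν ∈ Γ, (2 : ℝ) ^ μ := by
        rw [Finset.sum_const, nsmul_eq_mul, Real.rpow_natCast]
        ring
    _ ≤ _ := by
        refine Finset.sum_le_sum fun ν hν => ?_
        have := hR.le_card ν
        rwa [mem_level.1 (hΓ hν)] at this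

/-- The loss in the embedding of `ℓ₂` into `ℓ_{p₀}`. -/
noncomputable def embeddingExponent (p₀ : ℝ≥0∞) : ℝ := max (recip p₀ - 1 / 2) 0

theorem two_le_or_recip_lt {p₀ : ℝ≥0∞} (hp₀ : 0 < p₀) :
    2 ≤ p₀ ∧ recip p₀ ≤ 1 / 2 ∨ p₀ ≠ ∞ ∧ p₀.toReal ≤ 2 ∧ 1 / 2 ≤ recip p₀ := by
  rcases le_total 2 p₀ with h | h
  · left
    refine ⟨h, ?_⟩
    have h1 : p₀⁻¹ ≤ 2⁻¹ := ENNReal.inv_le_inv.2 h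
    have h2 := ENNReal.toReal_mono (by simp) h1
    simpa [recip] using h2
  · right
    have h' : p₀ ≠ ∞ := (h.trans_lt (by simp)).ne
    have hq := ENNReal.toReal_pos hp₀.ne' h'
    have h2 : p₀.toReal ≤ 2 := by
      have := ENNReal.toReal_mono (by simp) h
      simpa using this
    exact ⟨h', h2, by rw [recip_eq_one_div]; exact one_div_le_one_div_of_le hq h2⟩

theorem enorm_euclideanSpace_eq {ι : Type*} [Fintype ι] (x : EuclideanSpace ℂ ι) :
    (∑ k, ‖x k‖ₑ ^ (2 : ℝ)) ^ (1 / 2 : ℝ) = ‖x‖ₑ := by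
  have h1 : ∑ k, ‖x k‖ₑ ^ (2 : ℝ) = ‖x‖ₑ ^ (2 : ℝ) := by
    have he : ∀ {E : Type _} [NormedAddCommGroup E] (z : E),
        ‖z‖ₑ ^ (2 : ℝ) = ENNReal.ofReal (‖z‖ ^ 2) := fun z => by
      rw [← ofReal_norm, ENNReal.ofReal_rpow_of_nonneg (norm_nonneg _) zero_le_two, Real.rpow_two]
    rw [he, EuclideanSpace.norm_sq_eq, ENNReal.ofReal_sum_of_nonneg fun _ _ => by positivity]
    exact Finset.sum_congr rfl fun k _ => by
      rw [← ofReal_norm, ENNReal.ofReal_rpow_of_nonneg (norm_nonneg _) zero_le_two, Real.rpow_two]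
  rw [h1, ← ENNReal.rpow_mul]
  norm_num

/-- The power of two undoes the weight of level `μ`, and the power of the cardinality is the
reciprocal norm of the identity from `ℓ₂` to `ℓ_{p₀}` on the coordinates. -/
theorem bENorm_scaledEmbedding_le (t : ℝ) {p₀ : ℝ≥0∞} (hp₀ : 0 < p₀) (hΓ : Γ ⊆ level d μ)
    [Nonempty (LayerIndex ψ₀ ψ₁ Γ)] (x : EuclideanSpace ℂ (LayerIndex ψ₀ ψ₁ Γ)) :
    bENorm t p₀ p₀ (extendZero Γ (scaledEmbedding ψ₀ ψ₁ Γ ((2 : ℝ) ^ (-((μ : ℝ) * (t - recip p₀))) *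
      (Fintype.card (LayerIndex ψ₀ ψ₁ Γ) : ℝ) ^ (-embeddingExponent p₀)) x)) ≤ ‖x‖ₑ := by
  set h : ℝ := (Fintype.card (LayerIndex ψ₀ ψ₁ Γ) : ℝ) with hh
  have hh0 : 0 < h := by rw [hh]; exact_mod_cast Fintype.card_pos
  set s : ℝ := (2 : ℝ) ^ (-((μ : ℝ) * (t - recip p₀))) * h ^ (-embeddingExponent p₀) with hs
  have hs0 : 0 < s := by positivity
  have hsm : extendZero Γ (scaledEmbedding ψ₀ ψ₁ Γ s x) = (s : ℂ) • extendZero Γ (fun k => x k) := by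
    rw [← map_smul]
    rfl
  have hse : ‖(s : ℂ)‖ₑ = 2 ^ (-((μ : ℝ) * (t - recip p₀))) *
      ENNReal.ofReal (h ^ (-embeddingExponent p₀)) := by
    rw [← ofReal_norm, Complex.norm_real, Real.norm_of_nonneg hs0.le, hs,
      ENNReal.ofReal_mul (by positivity), two_rpow_eq_ofReal]
  have hcancel : (2 : ℝ≥0∞) ^ (-((μ : ℝ) * (t - recip p₀))) * 2 ^ ((μ : ℝ) * (t - recip p₀)) = 1 := by
    rw [← two_rpow_add, neg_add_cancel, ENNReal.rpow_zero]
  rw [hsm, bENorm_smul t hp₀ hp₀, hse]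
  rcases two_le_or_recip_lt hp₀ with ⟨h2, hr⟩ | ⟨hfin, h2, hr⟩
  · have hδ : embeddingExponent p₀ = 0 := max_eq_right (by linarith)
    rw [hδ, neg_zero, Real.rpow_zero, ENNReal.ofReal_one, mul_one]
    refine (mul_le_mul' le_rfl (bENorm_extendZero_le_of_two_le t h2 hΓ _)).trans (le_of_eq ?_)
    rw [← mul_assoc, hcancel, one_mul]
    exact enorm_euclideanSpace_eq x
  · have hq : 0 < p₀.toReal := ENNReal.toReal_pos hp₀.ne' hfin
    have hδ : embeddingExponent p₀ = 1 / p₀.toReal - 1 / 2 := by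
      rw [embeddingExponent, recip_eq_one_div, max_eq_left]
      rw [recip_eq_one_div] at hr
      linarith
    rw [bENorm_extendZero t hp₀ hfin hΓ, mul_mul_mul_comm, hcancel, one_mul]
    calc _ ≤ ENNReal.ofReal (h ^ (-embeddingExponent p₀)) * (ENNReal.ofReal h ^ (embeddingExponent p₀) *
          (∑ k, ‖x k‖ₑ ^ (2 : ℝ)) ^ (1 / 2 : ℝ)) := by
          gcongr
          rw [hδ, hh, ENNReal.ofReal_natCast]
          exact sum_rpow_le_card_rpow (fun k => ‖x k‖ₑ) hq h2
      _ = _ := by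
          rw [enorm_euclideanSpace_eq, ENNReal.ofReal_rpow_of_pos hh0, ← mul_assoc,
            ← ENNReal.ofReal_mul (by positivity), ← Real.rpow_add hh0, neg_add_cancel, Real.rpow_zero,
            ENNReal.ofReal_one, one_mul]

/-- The lower estimate by a single large coordinate. -/
theorem lowerEst_of_card (t : ℝ) {p₀ p : ℝ≥0∞} (hp₀ : 0 < p₀) (hp : 0 < p) (hp' : p < ∞)
    (hΓ : Γ ⊆ level d μ) {n : ℕ} (hn : 1 ≤ n)
    (hcard : 2 * n ≤ Fintype.card (LayerIndex ψ₀ ψ₁ Γ)) :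
    LowerEst d ψ₀ ψ₁ p₀ t p n (1 / 2 * (2 : ℝ) ^ (-((μ : ℝ) * (t - recip p₀ + recip p))) *
      (Fintype.card (LayerIndex ψ₀ ψ₁ Γ) : ℝ) ^ (-embeddingExponent p₀)) := by
  have : Nonempty (LayerIndex ψ₀ ψ₁ Γ) := Fintype.card_pos_iff.1 (by omega)
  refine LowerEst.of_extendZero _ (bENorm_scaledEmbedding_le t hp₀ hΓ) fun M hM => ?_
  obtain ⟨x, hx, hx1, k, hk⟩ := exists_mem_half_le_norm_coord M (by omega)
  refine ⟨x, hx, hx1, le_trans ?_ (enorm_mul_le_fENorm_extendZero hp hp' hΓ _ k)⟩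
  rw [← ofReal_norm, norm_scaledEmbedding_apply (by positivity), two_rpow_eq_ofReal,
    ← ENNReal.ofReal_mul (by positivity)]
  refine ENNReal.ofReal_le_ofReal ?_
  rw [mul_add, neg_add, Real.rpow_add (by norm_num), recip_eq_one_div (p₀ := p),
    mul_one_div (μ : ℝ) p.toReal]
  calc _ = (2 : ℝ) ^ (-((μ : ℝ) * (t - recip p₀))) *
        (Fintype.card (LayerIndex ψ₀ ψ₁ Γ) : ℝ) ^ (-embeddingExponent p₀) * (1 / 2) *
        2 ^ (-((μ : ℝ) / p.toReal)) := by ring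
    _ ≤ _ := by gcongr

/-- The lower estimate for `p ≤ 2` by random signs. -/
theorem lowerEst_of_card_of_le_two {R : ℝ} (hR : IndexGeometry d ψ₀ ψ₁ R) (t : ℝ) {p₀ p : ℝ≥0∞}
    (hp₀ : 0 < p₀) (hp : 0 < p) (hp2 : p ≤ 2) :
    ∃ c : ℝ, 0 < c ∧ ∀ (Γ : Finset (Fin d → ℕ)) (μ n : ℕ), Γ ⊆ level d μ → 1 ≤ n →
      2 * n ≤ Fintype.card (LayerIndex ψ₀ ψ₁ Γ) →
      LowerEst d ψ₀ ψ₁ p₀ t p n (c * (2 : ℝ) ^ (-((μ : ℝ) * (t - recip p₀ + 1 / 2))) *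
        (Fintype.card (LayerIndex ψ₀ ψ₁ Γ) : ℝ) ^ (-embeddingExponent p₀)) := by
  have hp' : p < ∞ := hp2.trans_lt (by simp)
  have hq : 0 < p.toReal := ENNReal.toReal_pos hp.ne' hp'.ne
  have hq2 : p.toReal ≤ 2 := by
    have := ENNReal.toReal_mono (by simp) hp2
    simpa using this
  have hR0 : 0 < R := lt_of_lt_of_le one_pos hR.one_le
  set P := p.toReal with hP
  refine ⟨(2 * R) ^ (-(1 / P - 1 / 2)) * (1 / 3) ^ (1 / P), by positivity,
    fun Γ μ n hΓ hn hcard => ?_⟩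
  have : Nonempty (LayerIndex ψ₀ ψ₁ Γ) := Fintype.card_pos_iff.1 (by omega)
  have hΓ0 : Γ.Nonempty := by
    obtain ⟨k⟩ := this
    exact ⟨k.1, k.1.2⟩
  set h : ℝ := (Fintype.card (LayerIndex ψ₀ ψ₁ Γ) : ℝ) with hh
  have hh0 : 0 < h := by rw [hh]; exact_mod_cast Fintype.card_pos
  refine LowerEst.of_extendZero _ (bENorm_scaledEmbedding_le t hp₀ hΓ) fun M hM => ?_
  rw [← hh]
  set s : ℝ := (2 : ℝ) ^ (-((μ : ℝ) * (t - recip p₀))) * h ^ (-embeddingExponent p₀) with hs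
  have hs0 : 0 < s := by positivity
  obtain ⟨b, hb, hbM⟩ := exists_orthonormal_of_submodule M
  set m := Module.finrank ℂ M with hm
  have hm2 : h / 2 ≤ m := by
    have : Fintype.card (LayerIndex ψ₀ ψ₁ Γ) ≤ 2 * m := by omega
    have : h ≤ 2 * m := by rw [hh]; exact_mod_cast this
    linarith
  have hm0 : (0 : ℝ) < m := by linarith
  -- For a scaled coordinate embedding the square sums are `s²` times the diagonal entries of a
  -- projection: each is at most one, and they add up to the dimension `m`.
  obtain ⟨x, hx, hx1, hxβ⟩ := exists_mem_le_fENorm_of_le_two hp hp2 hΓ (scaledEmbedding ψ₀ ψ₁ Γ s) M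
    (by exact_mod_cast hm0) hb hbM (ρ := s ^ 2) (S := s ^ 2 * m) (by positivity) (fun k => by
      simp only [norm_scaledEmbedding_apply hs0.le, mul_pow]
      rw [← Finset.mul_sum]
      exact mul_le_of_le_one_right (by positivity) (sum_norm_sq_coord_le_one hb k)) (by positivity)
    (by
      simp only [norm_scaledEmbedding_apply hs0.le, mul_pow]
      simp_rw [← Finset.mul_sum]
      rw [sum_sum_norm_sq_coord hb]) hΓ0
  refine ⟨x, hx, hx1, le_trans (ENNReal.ofReal_le_ofReal ?_) hxβ⟩
  rw [← hP]
  set N : ℝ := (Γ.card : ℝ) with hN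
  have hN0 : 0 < N := by rw [hN]; exact_mod_cast hΓ0.card_pos
  -- The dimension is comparable with `2^μ` times the number of layers; inserting this cancels the
  -- powers of both factors that stem from the uniform bound and the measure of the rectangles.
  have hmN : 2 ^ (μ : ℝ) * N / (2 * R) ≤ m := by
    have h1 := le_card_layerIndex hR hΓ
    rw [← hh, ← hN] at h1
    rw [div_le_iff₀ (by positivity)]
    nlinarith
  have hexp : 0 ≤ 1 / P - 1 / 2 := by
    rw [sub_nonneg]
    exact one_div_le_one_div_of_le hq hq2
  have e1 : ((s ^ 2 * N) ^ (P / 2 - 1) * (2 ^ (-(μ : ℝ)) * (s ^ 2 * m)) / 3) ^ (1 / P) =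
      s * N ^ (-(1 / P - 1 / 2)) * 2 ^ (-((μ : ℝ) * (1 / P))) * (m : ℝ) ^ (1 / P) * (1 / 3) ^ (1 / P) := by
    have e2 : (s ^ 2 * N) ^ (P / 2 - 1) * (2 ^ (-(μ : ℝ)) * (s ^ 2 * m)) / 3 =
        s ^ P * N ^ (P / 2 - 1) * 2 ^ (-(μ : ℝ)) * m * (1 / 3) := by
      have e3 : (s ^ 2) ^ (P / 2 - 1) * s ^ 2 = s ^ P := by
        nth_rewrite 2 [← Real.rpow_one (s ^ 2)]
        rw [← Real.rpow_add (by positivity), ← Real.rpow_natCast, ← Real.rpow_mul hs0.le]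
        congr 1
        push_cast
        ring
      rw [Real.mul_rpow (by positivity) hN0.le, ← e3]
      ring
    rw [e2, Real.mul_rpow (by positivity) (by positivity), Real.mul_rpow (by positivity) hm0.le,
      Real.mul_rpow (by positivity) (by positivity), Real.mul_rpow (by positivity) (by positivity),
      ← Real.rpow_mul hs0.le, mul_one_div_cancel hq.ne', Real.rpow_one, ← Real.rpow_mul hN0.le,
      ← Real.rpow_mul (by norm_num)]
    congr 4
    · congr 2
      field_simp
      ring
    · ring
  rw [e1]
  have e4 : (m : ℝ) ^ (-(1 / 2) : ℝ) * (s * N ^ (-(1 / P - 1 / 2)) * 2 ^ (-((μ : ℝ) * (1 / P))) *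
      (m : ℝ) ^ (1 / P) * (1 / 3) ^ (1 / P)) = (m : ℝ) ^ (1 / P - 1 / 2) * (s * N ^ (-(1 / P - 1 / 2)) *
      2 ^ (-((μ : ℝ) * (1 / P))) * (1 / 3) ^ (1 / P)) := by
    rw [sub_eq_add_neg (1 / P) (1 / 2), Real.rpow_add hm0]
    ring
  rw [e4]
  calc _ = (2 ^ (μ : ℝ) * N / (2 * R)) ^ (1 / P - 1 / 2) * (s * N ^ (-(1 / P - 1 / 2)) *
      2 ^ (-((μ : ℝ) * (1 / P))) * (1 / 3) ^ (1 / P)) := by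
        generalize ((1 : ℝ) / 3) ^ (1 / P) = A
        rw [Real.div_rpow (by positivity) (by positivity), Real.mul_rpow (by positivity) hN0.le,
          ← Real.rpow_mul (by norm_num), Real.rpow_neg hN0.le, Real.rpow_neg (by positivity), hs,
          show -((μ : ℝ) * (t - recip p₀ + 1 / 2)) = (μ : ℝ) * (1 / P - 1 / 2) +
            -((μ : ℝ) * (t - recip p₀)) + -((μ : ℝ) * (1 / P)) by ring,
          Real.rpow_add (by norm_num), Real.rpow_add (by norm_num)]
        field_simp
    _ ≤ _ := by gcongr

end

end MixedWeyl

namespace MixedWeyl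

/-! ### Sign matrices of small norm from `ℓ₂` to `ℓ_q` -/

/-- The deviation allowed for the sum of the squares of the column sums over `s` rows. -/
noncomputable def signDeviation (D s : ℕ) : ℝ := s * (Real.log (D / s) + 2)

/-- Since `(D choose s) ≤ (eD/s)^s`, the deviation `s (log (D/s) + 2)` beats the number of sets of
size `s` by `e^(-s)`, which makes the union bound summable over `s`. -/
theorem choose_mul_exp_neg_le {D s : ℕ} (hs : 1 ≤ s) (hsD : s ≤ D) :
    (D.choose s : ℝ) * Real.exp (-signDeviation D s) ≤ Real.exp (-1) ^ s := by
  have hs0 : (0 : ℝ) < s := by exact_mod_cast hs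
  have hD0 : (0 : ℝ) < D := by exact_mod_cast hs.trans hsD
  have h1 : (D.choose s : ℝ) ≤ (D : ℝ) ^ s / s.factorial := Nat.choose_le_pow_div s D
  have h2 := Real.pow_div_factorial_le_exp (s : ℝ) hs0.le s
  have hf : (0 : ℝ) < s.factorial := by exact_mod_cast s.factorial_pos
  have h3 : (D.choose s : ℝ) ≤ ((D : ℝ) / s) ^ s * Real.exp s := by
    refine h1.trans ?_
    rw [div_pow, div_mul_eq_mul_div, div_le_div_iff₀ hf (by positivity), mul_assoc]
    gcongr
    rwa [div_le_iff₀ hf] at h2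
  have h4 : Real.exp (-signDeviation D s) = (((D : ℝ) / s) ^ s)⁻¹ * Real.exp (-(2 * s)) := by
    rw [signDeviation, mul_add, neg_add, Real.exp_add, Real.exp_neg, mul_comm (s : ℝ) (Real.log _),
      mul_comm (s : ℝ) 2, ← Real.rpow_def_of_pos (by positivity), Real.rpow_natCast]
  rw [h4]
  calc _ ≤ ((D : ℝ) / s) ^ s * Real.exp s * ((((D : ℝ) / s) ^ s)⁻¹ * Real.exp (-(2 * s))) := by
        gcongr
    _ = Real.exp s * Real.exp (-(2 * s)) := by
        field_simp
    _ = _ := by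
        rw [← Real.exp_add, ← Real.exp_nat_mul]
        congr 1
        ring

theorem sum_exp_neg_signDeviation_le (D : ℕ) :
    ∑ S ∈ (Finset.univ : Finset (Fin D)).powerset,
      (if S.card = 0 then 0 else Real.exp (-signDeviation D S.card)) ≤ 1 := by
  rw [Finset.sum_powerset_apply_card fun s => (if s = 0 then 0 else Real.exp (-signDeviation D s) : ℝ)]
  have he : Real.exp (-1) ≤ 1 / 2 := by
    rw [Real.exp_neg, one_div]
    have h1 := Real.add_one_le_exp (1 : ℝ)
    have h2 : (2 : ℝ) ≤ Real.exp 1 := by linarith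
    exact inv_anti₀ (by norm_num) h2
  calc _ ≤ ∑ s ∈ Finset.range (D + 1), (if s = 0 then 0 else (1 / 2 : ℝ) ^ s : ℝ) := by
        rw [Finset.card_univ, Fintype.card_fin]
        refine Finset.sum_le_sum fun s hs => ?_
        rw [nsmul_eq_mul]
        split_ifs with h
        · simp
        · refine (choose_mul_exp_neg_le (by omega) ?_).trans (pow_le_pow_left₀ (Real.exp_pos _).le he s)
          have := Finset.mem_range.1 hs
          omega
    _ = ∑ s ∈ Finset.range D, (1 / 2 : ℝ) ^ (s + 1) := by
        rw [Finset.sum_range_succ']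
        simp
    _ ≤ 1 := by
        rw [Finset.sum_congr rfl fun s _ => pow_succ (1 / 2 : ℝ) s, ← Finset.sum_mul,
          geom_sum_eq (by norm_num)]
        have h1 : (0 : ℝ) ≤ (1 / 2) ^ D := by positivity
        have h2 : ((1 / 2 : ℝ) ^ D - 1) / (1 / 2 - 1) * (1 / 2) = 1 - (1 / 2) ^ D := by ring
        linarith

/-- There is a `D × h` matrix of signs such that for all sets `S` of rows the sum over `S` has
controlled Euclidean norm. -/
theorem exists_signs_forall_finset (D h : ℕ) :
    ∃ ε : Fin h → Fin D → Bool, ∀ S : Finset (Fin D), S.Nonempty →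
      ∑ i, (∑ k ∈ S, sgn (ε i k)) ^ 2 ≤ 4 * S.card * (h / 2 + signDeviation D S.card) := by
  classical
  set Z : Finset (Fin D) → (Fin D → Bool) → ℝ := fun S σ => ∑ k ∈ S, sgn (σ k) with hZ
  -- An exponential functional collecting all row sets at once. Its mean over the sign matrices is
  -- at most one; a matrix with `W ≤ 1` has every exponent nonpositive, which is the assertion.
  set W : (Fin h → Fin D → Bool) → ℝ := fun ε =>
    ∑ S ∈ (Finset.univ : Finset (Fin D)).powerset, if S.card = 0 then 0 else
      Real.exp (∑ i, Z S (ε i) ^ 2 / (4 * S.card) - h / 2 - signDeviation D S.card) with hW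
  -- For one column the exponential square moment is at most `exp (1/2)`; the `h` independent
  -- columns give `exp (h/2)`, cancelled by the term `-h/2` in `W`.
  have hcol : ∀ S : Finset (Fin D), S.card ≠ 0 →
      ∑ σ, Real.exp (Z S σ ^ 2 / (4 * S.card)) ≤ 2 ^ D * Real.exp (1 / 2) := by
    intro S hS
    have hs0 : (0 : ℝ) < S.card := by exact_mod_cast Nat.pos_of_ne_zero hS
    have hb : ∑ k, (if k ∈ S then (1 : ℝ) else 0) ^ 2 = S.card := by simp
    have h1 := sum_signs_exp_sq_le (fun k => if k ∈ S then (1 : ℝ) else 0) (a := 4 * S.card)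
      (by rw [hb]; linarith)
    rw [hb] at h1
    have h2 : (S.card : ℝ) / (4 * S.card - 2 * S.card) = 1 / 2 := by
      field_simp
      norm_num
    rw [h2] at h1
    refine le_trans (le_of_eq (Finset.sum_congr rfl fun σ _ => ?_)) h1
    simp [hZ, Finset.sum_ite_mem]
  have hsum : ∑ ε, W ε ≤ ∑ _ε : Fin h → Fin D → Bool, (1 : ℝ) := by
    simp only [hW]
    rw [Finset.sum_comm]
    calc _ ≤ ∑ S ∈ (Finset.univ : Finset (Fin D)).powerset, (2 ^ D) ^ h *
          (if S.card = 0 then 0 else Real.exp (-signDeviation D S.card)) := by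
          refine Finset.sum_le_sum fun S _ => ?_
          split_ifs with hS
          · simp
          · have h1 : ∀ ε : Fin h → Fin D → Bool,
                Real.exp (∑ i, Z S (ε i) ^ 2 / (4 * S.card) - h / 2 - signDeviation D S.card) =
                  (∏ i, Real.exp (Z S (ε i) ^ 2 / (4 * S.card))) *
                    (Real.exp (-(h / 2)) * Real.exp (-signDeviation D S.card)) := by
              intro ε
              rw [← Real.exp_sum, ← Real.exp_add, ← Real.exp_add]
              congr 1
              ring
            simp only [h1]
            rw [← Finset.sum_mul, ← Fintype.sum_pow fun σ => Real.exp (Z S σ ^ 2 / (4 * S.card))]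
            calc _ ≤ (2 ^ D * Real.exp (1 / 2)) ^ h *
                  (Real.exp (-(h / 2)) * Real.exp (-signDeviation D S.card)) := by
                  gcongr
                  exact hcol S hS
              _ = _ := by
                  rw [mul_pow, ← Real.exp_nat_mul, show (2 ^ D : ℝ) ^ h * Real.exp (h * (1 / 2)) *
                    (Real.exp (-(h / 2)) * Real.exp (-signDeviation D S.card)) = (2 ^ D) ^ h * (Real.exp (-(h / 2)) *
                      Real.exp (h * (1 / 2))) * Real.exp (-signDeviation D S.card) by ring,
                    ← Real.exp_add, show -((h : ℝ) / 2) + h * (1 / 2) = 0 by ring, Real.exp_zero,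
                    mul_one]
      _ ≤ (2 ^ D) ^ h * 1 := by
          rw [← Finset.mul_sum]
          gcongr
          exact sum_exp_neg_signDeviation_le D
      _ = _ := by simp
  obtain ⟨ε, -, hε⟩ := Finset.exists_le_of_sum_le Finset.univ_nonempty hsum
  refine ⟨ε, fun S hS => ?_⟩
  have hS0 : S.card ≠ 0 := hS.card_pos.ne'
  have hs0 : (0 : ℝ) < S.card := by exact_mod_cast hS.card_pos
  have h1 : Real.exp (∑ i, Z S (ε i) ^ 2 / (4 * S.card) - h / 2 - signDeviation D S.card) ≤ 1 := by
    refine le_trans ?_ hε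
    have := Finset.single_le_sum (s := (Finset.univ : Finset (Fin D)).powerset)
      (f := fun S => if S.card = 0 then 0 else
        Real.exp (∑ i, Z S (ε i) ^ 2 / (4 * S.card) - h / 2 - signDeviation D S.card))
      (fun S _ => by split_ifs <;> positivity) (Finset.mem_powerset.2 (Finset.subset_univ S))
    simpa only [hS0, if_false] using this
  have h2 := Real.exp_le_one_iff.1 h1
  rw [← Finset.sum_div, sub_sub, sub_nonpos, div_le_iff₀ (by positivity)] at h2
  linarith

/-- A decreasing rearrangement argument without rearrangement. -/
theorem sum_le_sum_range_of_forall_finset {ι : Type*} (f g : ι → ℝ) (F : ℕ → ℝ)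
    (h : ∀ S : Finset ι, ∀ k ∈ S, (∀ j ∈ S, f k ≤ f j) → g k ≤ F S.card) (S : Finset ι) :
    ∑ k ∈ S, g k ≤ ∑ s ∈ Finset.range S.card, F (s + 1) := by
  classical
  induction hn : S.card generalizing S with
  | zero => simp [Finset.card_eq_zero.1 hn]
  | succ n ih =>
    -- The element minimising `f` on `S` is bounded through `F` at the size of `S` and then removed.
    obtain ⟨k, hk, hmin⟩ := S.exists_min_image f (Finset.card_pos.1 (by omega))
    have h1 : (S.erase k).card = n := by rw [Finset.card_erase_of_mem hk, hn]; rfl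
    rw [← Finset.sum_erase_add _ _ hk, Finset.sum_range_succ]
    have h2 := h S k hk hmin
    rw [hn] at h2
    exact add_le_add (ih _ h1) h2

theorem sum_rpow_neg_half_le (D : ℕ) :
    ∑ s ∈ Finset.range D, ((s + 1 : ℕ) : ℝ) ^ (-(1 / 2) : ℝ) ≤ 2 * (D : ℝ) ^ (1 / 2 : ℝ) := by
  induction D with
  | zero => simp
  | succ D ih =>
    rw [Finset.sum_range_succ]
    refine (add_le_add ih le_rfl).trans ?_
    rw [Real.rpow_neg (by positivity), ← Real.sqrt_eq_rpow, ← Real.sqrt_eq_rpow]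
    have h1 : 0 < √((D + 1 : ℕ) : ℝ) := by positivity
    have h2 := Real.sq_sqrt (show (0 : ℝ) ≤ D by positivity)
    have h3 := Real.sq_sqrt (show (0 : ℝ) ≤ ((D + 1 : ℕ) : ℝ) by positivity)
    have h4 : (√((D + 1 : ℕ) : ℝ))⁻¹ * √((D + 1 : ℕ) : ℝ) = 1 := inv_mul_cancel₀ h1.ne'
    have h5 := Real.sqrt_nonneg (D : ℝ)
    push_cast at h1 h3 h4 ⊢
    refine le_of_mul_le_mul_right ?_ h1
    nlinarith [sq_nonneg (√(D : ℝ) - √((D : ℝ) + 1))]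

theorem add_rpow_le_two_rpow_mul {a b r : ℝ} (ha : 0 ≤ a) (hb : 0 ≤ b) (hr : 0 ≤ r) :
    (a + b) ^ r ≤ 2 ^ r * (a ^ r + b ^ r) := by
  have h1 : 0 ≤ a ^ r := Real.rpow_nonneg ha r
  have h2 : 0 ≤ b ^ r := Real.rpow_nonneg hb r
  calc (a + b) ^ r ≤ (2 * max a b) ^ r := by
        gcongr
        linarith [le_max_left a b, le_max_right a b]
    _ = 2 ^ r * max a b ^ r := Real.mul_rpow (by norm_num) (le_max_of_le_left ha)
    _ ≤ _ := by
        gcongr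
        rcases le_total a b with h | h
        · rw [max_eq_right h]; linarith
        · rw [max_eq_left h]; linarith

/-- The logarithm is dominated by `(D/s)^(1/q)`, so its power `q/2` costs only `(D/s)^(1/2)`, which
sums over `s ≤ D` to a multiple of `D`. -/
theorem signDeviation_profile_le {q : ℝ} (hq : 2 < q) :
    ∃ C : ℝ, 0 < C ∧ ∀ D h s : ℕ, 1 ≤ s → s ≤ D →
      (4 * ((h : ℝ) / (2 * s) + (Real.log (D / s) + 2))) ^ (q / 2) ≤
        C * ((h : ℝ) ^ (q / 2) * (s : ℝ) ^ (-(q / 2)) + (D : ℝ) ^ (1 / 2 : ℝ) * (s : ℝ) ^ (-(1 / 2) : ℝ)) := by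
  refine ⟨4 ^ (q / 2) * (2 ^ (q / 2) * (1 + (q + 2) ^ (q / 2))), by positivity,
    fun D h s hs hsD => ?_⟩
  have hs0 : (0 : ℝ) < s := by exact_mod_cast hs
  have hD0 : (0 : ℝ) < D := by exact_mod_cast hs.trans hsD
  have hz : (1 : ℝ) ≤ D / s := by
    rw [le_div_iff₀ hs0, one_mul]
    exact_mod_cast hsD
  have hlog0 : 0 ≤ Real.log (D / s) := Real.log_nonneg hz
  have h1 : (Real.log (D / s) + 2) ^ (q / 2) ≤
      (q + 2) ^ (q / 2) * ((D : ℝ) ^ (1 / 2 : ℝ) * (s : ℝ) ^ (-(1 / 2) : ℝ)) := by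
    have h2 : Real.log (D / s) + 2 ≤ (q + 2) * (D / s : ℝ) ^ (1 / q) := by
      have h3 := Real.log_le_rpow_div (x := (D : ℝ) / s) (by positivity) (ε := 1 / q) (by positivity)
      have h4 : (1 : ℝ) ≤ (D / s : ℝ) ^ (1 / q) := Real.one_le_rpow hz (by positivity)
      rw [div_div_eq_mul_div, div_one] at h3
      nlinarith
    calc _ ≤ ((q + 2) * (D / s : ℝ) ^ (1 / q)) ^ (q / 2) := by gcongr
      _ = _ := by
        rw [Real.mul_rpow (by positivity) (by positivity), ← Real.rpow_mul (by positivity),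
          show 1 / q * (q / 2) = 1 / 2 by field_simp, Real.div_rpow hD0.le hs0.le,
          Real.rpow_neg hs0.le]
        ring
  have h2 : ((h : ℝ) / (2 * s)) ^ (q / 2) ≤ (h : ℝ) ^ (q / 2) * (s : ℝ) ^ (-(q / 2)) := by
    rw [Real.rpow_neg hs0.le, ← div_eq_mul_inv, ← Real.div_rpow (by positivity) hs0.le]
    gcongr
    linarith
  have h3 : (0 : ℝ) ≤ (h : ℝ) ^ (q / 2) * (s : ℝ) ^ (-(q / 2)) := by positivity
  have h4 : (0 : ℝ) ≤ (D : ℝ) ^ (1 / 2 : ℝ) * (s : ℝ) ^ (-(1 / 2) : ℝ) := by positivity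
  have h5 : (0 : ℝ) ≤ (q + 2) ^ (q / 2) := by positivity
  rw [Real.mul_rpow (by norm_num) (by positivity), mul_assoc]
  gcongr
  refine (add_rpow_le_two_rpow_mul (by positivity) (by positivity) (by positivity)).trans ?_
  rw [mul_assoc]
  gcongr
  nlinarith

/-- If `k` realises the minimum of the values over a set `S` of size `s`, then `s` times its value
is at most the sum over `S`. Cauchy–Schwarz against the column sums over `S` bounds this sum, so the
`s`-th largest value is controlled uniformly in `x`. In the sum over `s`, the first part converges
because `q > 2` and is absorbed by `h^(q/2) ≤ D`; the logarithmic part contributes another multiple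
of `D`. -/
theorem exists_signs_sum_posPart_le {q : ℝ} (hq : 2 < q) :
    ∃ C : ℝ, 0 < C ∧ ∀ D h : ℕ, (h : ℝ) ^ (q / 2) ≤ D → ∃ ε : Fin h → Fin D → Bool,
      ∀ x : Fin h → ℝ, ∑ k, max (∑ i, sgn (ε i k) * x i) 0 ^ q ≤
        C * D * (∑ i, x i ^ 2) ^ (q / 2) := by
  obtain ⟨C, hC, hprof⟩ := signDeviation_profile_le hq
  have hsummable : Summable fun s : ℕ => (s : ℝ) ^ (-(q / 2)) :=
    Real.summable_nat_rpow.2 (by linarith)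
  have hK0 : 0 ≤ ∑' s : ℕ, (s : ℝ) ^ (-(q / 2)) := tsum_nonneg fun s => by positivity
  refine ⟨C * (∑' s : ℕ, (s : ℝ) ^ (-(q / 2)) + 2), by positivity, fun D h hhD => ?_⟩
  obtain ⟨ε, hε⟩ := exists_signs_forall_finset D h
  refine ⟨ε, fun x => ?_⟩
  set X := ∑ i, x i ^ 2 with hX
  have hX0 : 0 ≤ X := Finset.sum_nonneg fun i _ => sq_nonneg _
  set y : Fin D → ℝ := fun k => ∑ i, sgn (ε i k) * x i with hy
  set F : ℕ → ℝ := fun s => X ^ (q / 2) * (C * ((h : ℝ) ^ (q / 2) * (s : ℝ) ^ (-(q / 2)) +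
    (D : ℝ) ^ (1 / 2 : ℝ) * (s : ℝ) ^ (-(1 / 2) : ℝ))) with hF
  have hmain := sum_le_sum_range_of_forall_finset y (fun k => max (y k) 0 ^ q) F
    (fun S k hk hmin => ?_) Finset.univ
  · refine hmain.trans ?_
    rw [Finset.card_univ, Fintype.card_fin]
    simp only [hF]
    rw [← Finset.mul_sum, ← Finset.mul_sum, Finset.sum_add_distrib, ← Finset.mul_sum, ← Finset.mul_sum]
    have h1 : ∑ s ∈ Finset.range D, ((s + 1 : ℕ) : ℝ) ^ (-(q / 2)) ≤
        ∑' s : ℕ, (s : ℝ) ^ (-(q / 2)) := by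
      have h2 := hsummable.sum_le_tsum (Finset.range (D + 1)) fun s _ => by positivity
      rw [Finset.sum_range_succ'] at h2
      have : (0 : ℝ) ≤ ((0 : ℕ) : ℝ) ^ (-(q / 2)) := by positivity
      linarith
    calc _ ≤ X ^ (q / 2) * (C * (D * ∑' s : ℕ, (s : ℝ) ^ (-(q / 2)) +
          (D : ℝ) ^ (1 / 2 : ℝ) * (2 * (D : ℝ) ^ (1 / 2 : ℝ)))) := by
          gcongr
          exact sum_rpow_neg_half_le D
      _ = _ := by
          have h3 : (D : ℝ) ^ (1 / 2 : ℝ) * (D : ℝ) ^ (1 / 2 : ℝ) = D := by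
            rw [← Real.sqrt_eq_rpow]
            exact Real.mul_self_sqrt (by positivity)
          rw [show (D : ℝ) ^ (1 / 2 : ℝ) * (2 * (D : ℝ) ^ (1 / 2 : ℝ)) = 2 * D by
            rw [mul_left_comm, h3]]
          ring
  · have hS1 : 1 ≤ S.card := Finset.card_pos.2 ⟨k, hk⟩
    have hSD : S.card ≤ D := by simpa using Finset.card_le_univ S
    have hs0 : (0 : ℝ) < S.card := by exact_mod_cast hS1
    rcases le_total (y k) 0 with h0 | h0
    · rw [max_eq_right h0, Real.zero_rpow (by linarith)]
      positivity
    · rw [max_eq_left h0]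
      have h1 : S.card * y k ≤ ∑ i, x i * ∑ j ∈ S, sgn (ε i j) := by
        calc S.card * y k ≤ ∑ j ∈ S, y j := by
              rw [← nsmul_eq_mul]
              exact Finset.card_nsmul_le_sum _ _ _ hmin
          _ = _ := by
              simp only [hy, Finset.mul_sum]
              rw [Finset.sum_comm]
              exact Finset.sum_congr rfl fun i _ => Finset.sum_congr rfl fun j _ => mul_comm _ _
      have h2 : (S.card * y k) ^ 2 ≤ X * (4 * S.card * (h / 2 + signDeviation D S.card)) :=
        (pow_le_pow_left₀ (by positivity) h1 2).trans
          ((Finset.sum_mul_sq_le_sq_mul_sq _ _ _).trans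
            (mul_le_mul_of_nonneg_left (hε S ⟨k, hk⟩) hX0))
      have h3 : y k ^ 2 ≤ X * (4 * ((h : ℝ) / (2 * S.card) + (Real.log (D / S.card) + 2))) := by
        have h4 : X * (4 * S.card * (h / 2 + signDeviation D S.card)) = (S.card : ℝ) ^ 2 *
            (X * (4 * ((h : ℝ) / (2 * S.card) + (Real.log (D / S.card) + 2)))) := by
          rw [signDeviation]
          field_simp
        rw [h4, mul_pow] at h2
        exact le_of_mul_le_mul_left h2 (by positivity)
      have hz : (1 : ℝ) ≤ D / S.card := by
        rw [le_div_iff₀ hs0, one_mul]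
        exact_mod_cast hSD
      have hlog0 : 0 ≤ Real.log (D / S.card) := Real.log_nonneg hz
      calc y k ^ q = (y k ^ 2) ^ (q / 2) := by
            rw [← Real.rpow_natCast, ← Real.rpow_mul h0]
            congr 1
            push_cast
            ring
        _ ≤ (X * (4 * ((h : ℝ) / (2 * S.card) + (Real.log (D / S.card) + 2)))) ^ (q / 2) := by
            gcongr
        _ = X ^ (q / 2) * (4 * ((h : ℝ) / (2 * S.card) + (Real.log (D / S.card) + 2))) ^ (q / 2) :=
            Real.mul_rpow hX0 (by positivity)
        _ ≤ _ := by
            simp only [hF]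
            gcongr
            exact hprof D h S.card hS1 hSD

/-- Matrices of signs with `D` rows and at most `D^{2/q}` columns whose norm from `ℓ₂` to `ℓ_q`
is bounded by a multiple of `D^{1/q}`. -/
theorem exists_sign_matrix {q : ℝ} (hq : 2 < q) :
    ∃ C : ℝ, 0 < C ∧ ∀ D h : ℕ, (h : ℝ) ^ (q / 2) ≤ D → ∃ ε : Fin h → Fin D → Bool,
      ∀ x : EuclideanSpace ℂ (Fin h),
        ∑ k, ‖∑ i, (sgn (ε i k) : ℂ) * x i‖ ^ q ≤ C * D * ‖x‖ ^ q := by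
  obtain ⟨C, hC, hmat⟩ := exists_signs_sum_posPart_le hq
  refine ⟨2 ^ q * (4 * C), by positivity, fun D h hhD => ?_⟩
  obtain ⟨ε, hε⟩ := hmat D h hhD
  refine ⟨ε, fun x => ?_⟩
  -- Positive parts for `u` and `-u` give absolute values; real and imaginary parts of `x` are
  -- treated separately.
  have hreal : ∀ u : Fin h → ℝ, (∑ i, u i ^ 2 ≤ ‖x‖ ^ 2) →
      ∑ k, |∑ i, sgn (ε i k) * u i| ^ q ≤ 2 * C * D * ‖x‖ ^ q := by
    intro u hu
    have h0 : 0 ≤ ∑ i, u i ^ 2 := Finset.sum_nonneg fun i _ => sq_nonneg _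
    have hpow : (∑ i, u i ^ 2) ^ (q / 2) ≤ ‖x‖ ^ q := by
      calc _ ≤ (‖x‖ ^ 2) ^ (q / 2) := by gcongr
        _ = _ := by
          rw [← Real.rpow_natCast, ← Real.rpow_mul (norm_nonneg _)]
          congr 1
          push_cast
          ring
    have h1 := hε u
    have h2 := hε fun i => -u i
    simp only [neg_sq, mul_neg, Finset.sum_neg_distrib] at h2
    have h3 : ∀ z : ℝ, |z| ^ q ≤ max z 0 ^ q + max (-z) 0 ^ q := by
      intro z
      rcases le_total z 0 with hz | hz
      · rw [abs_of_nonpos hz, max_eq_right hz, max_eq_left (by linarith),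
          Real.zero_rpow (by linarith), zero_add]
      · rw [abs_of_nonneg hz, max_eq_left hz, max_eq_right (by linarith),
          Real.zero_rpow (by linarith), add_zero]
    calc _ ≤ ∑ k, (max (∑ i, sgn (ε i k) * u i) 0 ^ q + max (-∑ i, sgn (ε i k) * u i) 0 ^ q) :=
          Finset.sum_le_sum fun k _ => h3 _
      _ ≤ C * D * (∑ i, u i ^ 2) ^ (q / 2) + C * D * (∑ i, u i ^ 2) ^ (q / 2) := by
          rw [Finset.sum_add_distrib]
          exact add_le_add h1 h2
      _ ≤ C * D * ‖x‖ ^ q + C * D * ‖x‖ ^ q := by gcongr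
      _ = _ := by ring
  have hsq : ‖x‖ ^ 2 = ∑ i, ((x i).re ^ 2 + (x i).im ^ 2) := by
    rw [EuclideanSpace.norm_sq_eq]
    refine Finset.sum_congr rfl fun i _ => ?_
    rw [← Complex.normSq_eq_norm_sq, Complex.normSq_apply]
    ring
  have hre := hreal (fun i => (x i).re) (by
    rw [hsq]
    exact Finset.sum_le_sum fun i _ => le_add_of_nonneg_right (sq_nonneg _))
  have him := hreal (fun i => (x i).im) (by
    rw [hsq]
    exact Finset.sum_le_sum fun i _ => le_add_of_nonneg_left (sq_nonneg _))
  have hk : ∀ k, ‖∑ i, (sgn (ε i k) : ℂ) * x i‖ ^ q ≤ 2 ^ q *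
      (|∑ i, sgn (ε i k) * (x i).re| ^ q + |∑ i, sgn (ε i k) * (x i).im| ^ q) := by
    intro k
    refine le_trans ?_ (add_rpow_le_two_rpow_mul (abs_nonneg _) (abs_nonneg _) (by linarith))
    refine Real.rpow_le_rpow (norm_nonneg _) ((Complex.norm_le_abs_re_add_abs_im _).trans
      (le_of_eq ?_)) (by linarith)
    simp
  calc _ ≤ ∑ k, 2 ^ q *
      (|∑ i, sgn (ε i k) * (x i).re| ^ q + |∑ i, sgn (ε i k) * (x i).im| ^ q) :=
        Finset.sum_le_sum fun k _ => hk k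
    _ ≤ 2 ^ q * (2 * C * D * ‖x‖ ^ q + 2 * C * D * ‖x‖ ^ q) := by
        rw [← Finset.mul_sum, Finset.sum_add_distrib]
        gcongr
    _ = _ := by ring

end MixedWeyl

namespace MixedWeyl

/-! ### Lower estimates by sign matrices -/

theorem exists_orthonormal_pair {E : Type*} [NormedAddCommGroup E] [InnerProductSpace ℂ E]
    [FiniteDimensional ℂ E] (M : Submodule ℂ E) :
    ∃ (b : Fin (Module.finrank ℂ M) → E) (c : Fin (Module.finrank ℂ Mᗮ) → E),
      Orthonormal ℂ b ∧ (∀ i, b i ∈ M) ∧ Orthonormal ℂ c ∧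
      ∀ x, ∑ i, ‖inner ℂ (b i) x‖ ^ 2 + ∑ j, ‖inner ℂ (c j) x‖ ^ 2 = ‖x‖ ^ 2 := by
  have h : ∀ (S : Submodule ℂ E) (x : E), ∑ i, ‖inner ℂ (stdOrthonormalBasis ℂ S i : E) x‖ ^ 2 =
      ‖S.orthogonalProjectionOnto x‖ ^ 2 := fun S x => by
    rw [← (stdOrthonormalBasis ℂ S).sum_sq_norm_inner_right]
    refine Finset.sum_congr rfl fun i _ => ?_
    rw [S.inner_orthogonalProjectionOnto_eq_of_mem_left]
  have ho : ∀ S : Submodule ℂ E, Orthonormal ℂ fun i => (stdOrthonormalBasis ℂ S i : E) := fun S =>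
    (stdOrthonormalBasis ℂ S).orthonormal.comp_linearIsometry S.subtypeₗᵢ
  exact ⟨_, _, ho M, fun i => Subtype.prop _, ho Mᗮ, fun x => by
    rw [h, h, M.norm_sq_eq_add_norm_sq_projection x]⟩

section

variable {κ : Type*} {h : ℕ} (ε : Fin h → κ → Bool)

/-- The rows of a sign matrix as vectors. -/
noncomputable def signRow (k : κ) : EuclideanSpace ℂ (Fin h) := WithLp.toLp 2 fun i => (sgn (ε i k) : ℂ)

theorem norm_sq_signRow (k : κ) : ‖signRow ε k‖ ^ 2 = h := by
  rw [EuclideanSpace.norm_sq_eq]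
  have : ∀ i, ‖(signRow ε k) i‖ ^ 2 = 1 := fun i => by
    show ‖(sgn (ε i k) : ℂ)‖ ^ 2 = 1
    rw [Complex.norm_real, Real.norm_eq_abs, sq_abs, sq, sgn_mul_self]
  rw [Finset.sum_congr rfl fun i _ => this i]
  simp

theorem norm_inner_signRow (k : κ) (x : EuclideanSpace ℂ (Fin h)) :
    ‖inner ℂ x (signRow ε k)‖ = ‖∑ i, (sgn (ε i k) : ℂ) * x i‖ := by
  rw [← norm_inner_symm, PiLp.inner_apply]
  congr 1
  refine Finset.sum_congr rfl fun i _ => ?_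
  show x i * starRingEnd ℂ (sgn (ε i k) : ℂ) = _
  rw [Complex.conj_ofReal, mul_comm]

/-- Hölder's inequality: the `ℓ_q` bound of a sign matrix also bounds the `ℓ₂` norm of each image,
hence the share of the trace lost on a small subspace. -/
theorem sum_sq_le_of_sum_rpow_le [Fintype κ] {q C : ℝ} (hq : 2 < q) (hC : 0 < C) (y : κ → ℂ)
    (hy : ∑ k, ‖y k‖ ^ q ≤ C * Fintype.card κ) :
    ∑ k, ‖y k‖ ^ 2 ≤ C ^ (2 / q) * Fintype.card κ := by
  have hq0 : 0 < q := by linarith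
  have hD : (0 : ℝ) ≤ Fintype.card κ := by positivity
  have h1 := Real.rpow_sum_le_const_mul_sum_rpow_of_nonneg (s := Finset.univ)
    (f := fun k : κ => ‖y k‖ ^ 2) (p := q / 2) (by linarith) fun k _ => by positivity
  have h2 : ∀ k, (‖y k‖ ^ 2) ^ (q / 2) = ‖y k‖ ^ q := fun k => by
    rw [← Real.rpow_natCast, ← Real.rpow_mul (norm_nonneg _)]
    congr 1
    push_cast
    ring
  simp only [h2, Finset.card_univ] at h1
  have h0 : 0 ≤ ∑ k, ‖y k‖ ^ 2 := Finset.sum_nonneg fun k _ => by positivity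
  rcases hD.eq_or_lt with hD0 | hD0
  · have : IsEmpty κ := Fintype.card_eq_zero_iff.1 (by exact_mod_cast hD0.symm)
    simp
  calc ∑ k, ‖y k‖ ^ 2 = ((∑ k, ‖y k‖ ^ 2) ^ (q / 2)) ^ (2 / q) := by
        rw [← Real.rpow_mul h0, show q / 2 * (2 / q) = 1 by field_simp, Real.rpow_one]
    _ ≤ ((Fintype.card κ : ℝ) ^ (q / 2 - 1) * (C * Fintype.card κ)) ^ (2 / q) := by
        gcongr
        exact h1.trans (by gcongr)
    _ = (C * (Fintype.card κ : ℝ) ^ (q / 2)) ^ (2 / q) := by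
        congr 1
        rw [Real.rpow_sub_one hD0.ne']
        field_simp
    _ = _ := by
        rw [Real.mul_rpow hC.le (by positivity), ← Real.rpow_mul hD,
          show q / 2 * (2 / q) = 1 by field_simp, Real.rpow_one]

end

section

variable {d : ℕ} {ψ₀ ψ₁ : ℝ → ℂ} [∀ ν : Fin d → ℕ, Fintype (omegaIndex ψ₀ ψ₁ ν)]

set_option maxHeartbeats 1000000 in
/-- The lower estimate by a sign matrix, in terms of the number `D` of indices of the block. -/
theorem lowerEst_of_sign_matrix {R : ℝ} (hR : IndexGeometry d ψ₀ ψ₁ R) (t : ℝ) {p₀ p : ℝ≥0∞}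
    (hp₀2 : 2 < p₀) (hp₀' : p₀ ≠ ∞) (hp : 0 < p) (hp2 : p ≤ 2) :
    ∃ c κ : ℝ, 0 < c ∧ 0 < κ ∧ ∀ (Γ : Finset (Fin d → ℕ)) (μ n : ℕ), Γ ⊆ level d μ → 1 ≤ n →
      κ * n ≤ (Fintype.card (LayerIndex ψ₀ ψ₁ Γ) : ℝ) ^ (2 / p₀.toReal) →
      LowerEst d ψ₀ ψ₁ p₀ t p n (c * ((2 : ℝ) ^ (-((μ : ℝ) * t)) *
        (Γ.card : ℝ) ^ (1 / 2 - recip p₀))) := by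
  have hp₀ : 0 < p₀ := lt_trans (by norm_num) hp₀2
  have hp' : p < ∞ := hp2.trans_lt (by simp)
  set q := p₀.toReal with hq
  set P := p.toReal with hP
  have hP0 : 0 < P := ENNReal.toReal_pos hp.ne' hp'.ne
  have hP2 : P ≤ 2 := by
    have := ENNReal.toReal_mono (by simp) hp2
    simpa using this
  have hq2 : 2 < q := by
    have := (ENNReal.toReal_lt_toReal (by simp) hp₀').2 hp₀2
    simpa using this
  have hq0 : 0 < q := by linarith
  have hR0 : 0 < R := lt_of_lt_of_le one_pos hR.one_le
  have hrec : recip p₀ = 1 / q := recip_eq_one_div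
  obtain ⟨C, hC, hmat⟩ := exists_sign_matrix hq2
  have hCq : 0 < C ^ (2 / q) := by positivity
  -- The second constant ensures `(2 + 2 C^(2/q)) n ≤ h` even after rounding down the number `h` of
  -- columns, so that a complement of dimension at most `n` carries at most half of the trace.
  refine ⟨C ^ (-(1 / q)) * R ^ (-(1 / q)) * R ^ (-(1 / P)) * (1 / 6) ^ (1 / P),
    2 * (2 + 2 * C ^ (2 / q)), by positivity, by positivity, fun Γ μ n hΓ hn hcard => ?_⟩
  have hn1 : (1 : ℝ) ≤ n := by exact_mod_cast hn
  set Dn := Fintype.card (LayerIndex ψ₀ ψ₁ Γ) with hDn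
  set D : ℝ := (Dn : ℝ) with hD
  have hD1 : 4 ≤ D ^ (2 / q) := by nlinarith
  have hD0 : 0 < D := by
    rcases (Nat.cast_nonneg Dn : (0 : ℝ) ≤ Dn).eq_or_lt with h0 | h0
    · rw [hD, ← h0, Real.zero_rpow (by positivity)] at hD1
      norm_num at hD1
    · exact h0
  have hNe : Nonempty (LayerIndex ψ₀ ψ₁ Γ) :=
    Fintype.card_pos_iff.1 (by rw [← hDn]; exact Nat.cast_pos.1 (hD ▸ hD0))
  have hΓ0 : Γ.Nonempty := by
    obtain ⟨k⟩ := hNe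
    exact ⟨k.1, k.1.2⟩
  set N : ℝ := (Γ.card : ℝ) with hN
  have hN0 : 0 < N := by rw [hN]; exact_mod_cast hΓ0.card_pos
  -- The largest number of columns for which the sign matrix still has norm of order `D^(1/q)`.
  set h := ⌊D ^ (2 / q)⌋₊ with hh
  have hhle : (h : ℝ) ≤ D ^ (2 / q) := Nat.floor_le (by positivity)
  have hhge : D ^ (2 / q) < h + 1 := Nat.lt_floor_add_one _
  have hhn : (2 + 2 * C ^ (2 / q)) * n ≤ h := by nlinarith
  have hh0 : (0 : ℝ) < h := by nlinarith
  obtain ⟨ε₀, hε₀⟩ := hmat Dn h <| by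
    calc (h : ℝ) ^ (q / 2) ≤ (D ^ (2 / q)) ^ (q / 2) := by gcongr
      _ = D := by rw [← Real.rpow_mul hD0.le, show 2 / q * (q / 2) = 1 by field_simp, Real.rpow_one]
  let e := Fintype.equivFin (LayerIndex ψ₀ ψ₁ Γ)
  let ε : Fin h → LayerIndex ψ₀ ψ₁ Γ → Bool := fun i k => ε₀ i (e k)
  have hε : ∀ x : EuclideanSpace ℂ (Fin h), ∑ k, ‖∑ i, (sgn (ε i k) : ℂ) * x i‖ ^ q ≤
      C * D * ‖x‖ ^ q := fun x =>
    le_of_eq_of_le (e.sum_comp fun k => ‖∑ i, (sgn (ε₀ i k) : ℂ) * x i‖ ^ q) (hε₀ x)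
  set s : ℝ := (2 : ℝ) ^ (-((μ : ℝ) * (t - recip p₀))) * (C * D) ^ (-(1 / q)) with hs
  have hs0 : 0 < s := by positivity
  let L : EuclideanSpace ℂ (Fin h) →ₗ[ℂ] (LayerIndex ψ₀ ψ₁ Γ → ℂ) :=
    { toFun := fun x k => (s : ℂ) * ∑ i, (sgn (ε i k) : ℂ) * x i
      map_add' := fun x y => by
        funext k
        simp [mul_add, Finset.sum_add_distrib]
      map_smul' := fun c x => by
        funext k
        simp only [PiLp.smul_apply, smul_eq_mul, RingHom.id_apply, Pi.smul_apply, Finset.mul_sum]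
        exact Finset.sum_congr rfl fun i _ => by ring }
  have hLn : ∀ x k, ‖L x k‖ = s * ‖∑ i, (sgn (ε i k) : ℂ) * x i‖ := fun x k => by
    show ‖(s : ℂ) * _‖ = _
    rw [norm_mul, Complex.norm_real, Real.norm_of_nonneg hs0.le]
  refine LowerEst.of_extendZero L (fun x => ?_) fun M hM => ?_
  · rw [bENorm_extendZero t hp₀ hp₀' hΓ, ← hq]
    have h1 : ∑ k, ‖L x k‖ₑ ^ q ≤
        ENNReal.ofReal (((2 : ℝ) ^ (-((μ : ℝ) * (t - recip p₀))) * ‖x‖) ^ q) := by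
      calc ∑ k, ‖L x k‖ₑ ^ q = ENNReal.ofReal (∑ k, ‖L x k‖ ^ q) := by
            rw [ENNReal.ofReal_sum_of_nonneg fun k _ => by positivity]
            exact Finset.sum_congr rfl fun k _ => by
              rw [← ofReal_norm, ENNReal.ofReal_rpow_of_nonneg (norm_nonneg _) hq0.le]
        _ ≤ _ := by
            refine ENNReal.ofReal_le_ofReal ?_
            simp only [hLn]
            rw [Finset.sum_congr rfl fun k _ => Real.mul_rpow hs0.le (norm_nonneg _), ← Finset.mul_sum]
            calc _ ≤ s ^ q * (C * D * ‖x‖ ^ q) := by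
                  gcongr
                  exact hε x
              _ = _ := by
                  rw [hs, Real.mul_rpow (by positivity) (by positivity),
                    ← Real.rpow_mul (x := C * D) (by positivity),
                    Real.mul_rpow (by positivity) (norm_nonneg _),
                    show -(1 / q) * q = -1 by field_simp, Real.rpow_neg_one]
                  field_simp
    calc _ ≤ (2 : ℝ≥0∞) ^ ((μ : ℝ) * (t - recip p₀)) * ENNReal.ofReal
          (((2 : ℝ) ^ (-((μ : ℝ) * (t - recip p₀))) * ‖x‖) ^ q) ^ (1 / q) := by gcongr
      _ = _ := by
          rw [ENNReal.ofReal_rpow_of_nonneg (by positivity) (by positivity),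
            ← Real.rpow_mul (by positivity), mul_one_div_cancel hq0.ne', Real.rpow_one,
            two_rpow_eq_ofReal, ← ENNReal.ofReal_mul (by positivity), ← mul_assoc,
            ← Real.rpow_add (by norm_num), add_neg_cancel, Real.rpow_zero, one_mul, ofReal_norm]
  · rw [Fintype.card_fin] at hM
    have hfin := M.finrank_add_finrank_orthogonal
    rw [finrank_euclideanSpace, Fintype.card_fin] at hfin
    obtain ⟨b, c, hb, hbM, hc, hbc⟩ := exists_orthonormal_pair M
    revert hM hfin b c
    generalize Module.finrank ℂ M = m
    generalize Module.finrank ℂ Mᗮ = m'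
    intro hM hfin b c hb hbM hc hbc
    have hm'n : (m' : ℝ) ≤ n := by
      have : m' ≤ n := by omega
      exact_mod_cast this
    have hmh : (m : ℝ) ≤ h := by
      have : m ≤ h := by omega
      exact_mod_cast this
    have hm0 : 0 < m := by
      have h1 : (n : ℝ) < h := by nlinarith
      have h2 : n < h := by exact_mod_cast h1
      omega
    have hm0' : (0 : ℝ) < m := by exact_mod_cast hm0
    have hrow : ∀ k, ∑ i, ‖L (b i) k‖ ^ 2 = s ^ 2 * ∑ i, ‖inner ℂ (b i) (signRow ε k)‖ ^ 2 := by
      intro k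
      rw [Finset.mul_sum]
      exact Finset.sum_congr rfl fun i _ => by rw [hLn, norm_inner_signRow, mul_pow]
    have hcol : ∀ j, ∑ k, ‖inner ℂ (c j) (signRow ε k)‖ ^ 2 ≤ C ^ (2 / q) * D := by
      intro j
      simp only [norm_inner_signRow]
      refine sum_sq_le_of_sum_rpow_le hq2 hC _ ?_
      have := hε (c j)
      rwa [hc.norm_eq_one, Real.one_rpow, mul_one] at this
    -- The rows have squared norm `h`, so the full trace is `D h`. Each unit vector of `Mᗮ` accounts
    -- for at most `C^(2/q) D` of it, and there are at most `n` of them.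
    have htr : D * h / 2 ≤ ∑ k, ∑ i, ‖inner ℂ (b i) (signRow ε k)‖ ^ 2 := by
      have h1 : ∑ k, ∑ i, ‖inner ℂ (b i) (signRow ε k)‖ ^ 2 +
          ∑ k, ∑ j, ‖inner ℂ (c j) (signRow ε k)‖ ^ 2 = D * h := by
        rw [← Finset.sum_add_distrib]
        simp only [hbc, norm_sq_signRow]
        rw [Finset.sum_const, nsmul_eq_mul, Finset.card_univ]
      have h2 : ∑ k, ∑ j, ‖inner ℂ (c j) (signRow ε k)‖ ^ 2 ≤ m' * (C ^ (2 / q) * D) := by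
        rw [Finset.sum_comm]
        refine (Finset.sum_le_sum fun j _ => hcol j).trans (le_of_eq ?_)
        simp
      have h3 : m' * (C ^ (2 / q) * D) ≤ D * h / 2 := by
        calc _ ≤ n * (C ^ (2 / q) * D) := by gcongr
          _ = (2 * C ^ (2 / q) * n) * (D / 2) := by ring
          _ ≤ h * (D / 2) := by
            gcongr
            nlinarith
          _ = _ := by ring
      linarith
    -- The uniform bound `ρ` is the squared norm of a scaled row, the total `S` is the part of the
    -- trace kept on `M`.
    obtain ⟨x, hx, hx1, hxβ⟩ := exists_mem_le_fENorm_of_le_two hp hp2 hΓ L M hm0 hb hbM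
      (ρ := s ^ 2 * h) (S := s ^ 2 * (D * h / 2)) (by positivity) (fun k => by
        rw [hrow]
        gcongr
        rw [← norm_sq_signRow ε k, ← hbc (signRow ε k)]
        exact le_add_of_nonneg_right (Finset.sum_nonneg fun j _ => by positivity)) (by positivity)
      (by
        simp only [hrow]
        rw [← Finset.mul_sum]
        gcongr) hΓ0
    refine ⟨x, hx, hx1, le_trans (ENNReal.ofReal_le_ofReal ?_) hxβ⟩
    rw [← hP]
    have e2 : (s ^ 2 * h * N) ^ (P / 2 - 1) * (2 ^ (-(μ : ℝ)) * (s ^ 2 * (D * h / 2))) / 3 =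
        s ^ P * (h : ℝ) ^ (P / 2) * N ^ (P / 2 - 1) * 2 ^ (-(μ : ℝ)) * D * (1 / 6) := by
      have e3 : (s ^ 2 * h) ^ (P / 2 - 1) * (s ^ 2 * h) = s ^ P * (h : ℝ) ^ (P / 2) := by
        nth_rewrite 2 [← Real.rpow_one (s ^ 2 * h)]
        rw [← Real.rpow_add (by positivity), sub_add_cancel, Real.mul_rpow (by positivity) hh0.le,
          ← Real.rpow_natCast, ← Real.rpow_mul hs0.le]
        congr 2
        push_cast
        ring
      rw [Real.mul_rpow (by positivity) hN0.le, ← e3]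
      ring
    have e1 : ((s ^ 2 * h * N) ^ (P / 2 - 1) * (2 ^ (-(μ : ℝ)) * (s ^ 2 * (D * h / 2))) / 3) ^ (1 / P) =
        s * (h : ℝ) ^ (1 / 2 : ℝ) * N ^ (1 / 2 - 1 / P) * 2 ^ (-((μ : ℝ) * (1 / P))) * D ^ (1 / P) *
          (1 / 6) ^ (1 / P) := by
      rw [e2, Real.mul_rpow (by positivity) (by positivity), Real.mul_rpow (by positivity) hD0.le,
        Real.mul_rpow (by positivity) (by positivity), Real.mul_rpow (by positivity) (by positivity),
        Real.mul_rpow (by positivity) (by positivity), ← Real.rpow_mul hs0.le,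
        mul_one_div_cancel hP0.ne', Real.rpow_one, ← Real.rpow_mul hh0.le, ← Real.rpow_mul hN0.le,
        ← Real.rpow_mul (by norm_num)]
      rw [show P / 2 * (1 / P) = 1 / 2 by field_simp,
        show (P / 2 - 1) * (1 / P) = 1 / 2 - 1 / P by field_simp,
        show -(μ : ℝ) * (1 / P) = -((μ : ℝ) * (1 / P)) by ring]
    rw [e1]
    have hmh' : (h : ℝ) ^ (-(1 / 2) : ℝ) ≤ (m : ℝ) ^ (-(1 / 2) : ℝ) :=
      Real.rpow_le_rpow_of_nonpos hm0' hmh (by norm_num)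
    have hDlow : 2 ^ (μ : ℝ) * N / R ≤ D := by
      rw [div_le_iff₀ hR0, mul_comm D]
      exact le_card_layerIndex hR hΓ
    have hDup : D ≤ R * (2 ^ (μ : ℝ) * N) := card_layerIndex_le hR hΓ
    have hslow : (2 : ℝ) ^ (-((μ : ℝ) * (t - recip p₀))) * (C * (R * (2 ^ (μ : ℝ) * N))) ^ (-(1 / q)) ≤ s := by
      rw [hs]
      refine mul_le_mul_of_nonneg_left (Real.rpow_le_rpow_of_nonpos (by positivity) (by gcongr) ?_)
        (by positivity)
      rw [neg_nonpos]
      positivity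
    calc _ = (h : ℝ) ^ (-(1 / 2) : ℝ) * (((2 : ℝ) ^ (-((μ : ℝ) * (t - recip p₀))) *
          (C * (R * (2 ^ (μ : ℝ) * N))) ^ (-(1 / q))) * (h : ℝ) ^ (1 / 2 : ℝ) * N ^ (1 / 2 - 1 / P) *
          2 ^ (-((μ : ℝ) * (1 / P))) * (2 ^ (μ : ℝ) * N / R) ^ (1 / P) * (1 / 6) ^ (1 / P)) := by
          generalize ((1 : ℝ) / 6) ^ (1 / P) = A
          rw [Real.mul_rpow hC.le (by positivity), Real.mul_rpow hR0.le (by positivity),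
            Real.mul_rpow (by positivity) hN0.le, Real.div_rpow (by positivity) hR0.le,
            Real.mul_rpow (by positivity) hN0.le, ← Real.rpow_mul (by norm_num),
            ← Real.rpow_mul (by norm_num), Real.rpow_neg hR0.le (1 / P), hrec,
            show (1 / 2 - 1 / q : ℝ) = (1 / 2 - 1 / P) + -(1 / q) + 1 / P by ring,
            Real.rpow_add hN0, Real.rpow_add hN0,
            show -((μ : ℝ) * t) = -((μ : ℝ) * (t - 1 / q)) + (μ : ℝ) * -(1 / q) by ring,
            Real.rpow_add (by norm_num), Real.rpow_neg hh0.le,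
            Real.rpow_neg (by norm_num) ((μ : ℝ) * (1 / P))]
          have hh2 : (h : ℝ) ^ (1 / 2 : ℝ) ≠ 0 := by positivity
          have h22 : (2 : ℝ) ^ ((μ : ℝ) * (1 / P)) ≠ 0 := by positivity
          have hRR : R ^ (1 / P) ≠ 0 := by positivity
          generalize (h : ℝ) ^ (1 / 2 : ℝ) = a₁ at *
          generalize (2 : ℝ) ^ ((μ : ℝ) * (1 / P)) = a₂ at *
          generalize R ^ (1 / P) = a₃ at *
          generalize R ^ (-(1 / q)) = a₄
          generalize C ^ (-(1 / q)) = a₅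
          generalize N ^ (1 / 2 - 1 / P) = a₆
          generalize N ^ (1 / P) = a₇
          generalize N ^ (-(1 / q)) = a₈
          generalize (2 : ℝ) ^ (-((μ : ℝ) * (t - 1 / q))) = a₉
          generalize (2 : ℝ) ^ ((μ : ℝ) * -(1 / q)) = a₁₀
          rw [div_eq_mul_inv]
          calc _ = a₅ * a₄ * a₃⁻¹ * A * (a₉ * a₁₀ * (a₆ * a₈ * a₇)) * 1 * 1 := by ring
            _ = a₅ * a₄ * a₃⁻¹ * A * (a₉ * a₁₀ * (a₆ * a₈ * a₇)) * (a₁⁻¹ * a₁) * (a₂⁻¹ * a₂) := by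
                rw [inv_mul_cancel₀ hh2, inv_mul_cancel₀ h22]
            _ = _ := by ring
      _ ≤ _ := by gcongr

end

end MixedWeyl

/-! ### Choice of the level and translation into orders in `n`. -/

namespace MixedWeyl

/-! ### Levels of a prescribed size -/

/-- The function `2^μ (μ+1)^D`, which is comparable with the number of indices of a block. -/
noncomputable def levelSize (D : ℝ) (μ : ℕ) : ℝ := (2 : ℝ) ^ (μ : ℝ) * ((μ : ℝ) + 1) ^ D

theorem levelSize_pos (D : ℝ) (μ : ℕ) : 0 < levelSize D μ := by
  unfold levelSize
  positivity

theorem levelSize_zero (D : ℝ) : levelSize D 0 = 1 := by simp [levelSize]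

theorem two_rpow_le_levelSize {D : ℝ} (hD : 0 ≤ D) (μ : ℕ) : (2 : ℝ) ^ (μ : ℝ) ≤ levelSize D μ :=
  le_mul_of_one_le_right (by positivity) (Real.one_le_rpow (by linarith [μ.cast_nonneg (α := ℝ)]) hD)

theorem levelSize_succ_le {D : ℝ} (hD : 0 ≤ D) (μ : ℕ) :
    levelSize D (μ + 1) ≤ 2 ^ (1 + D) * levelSize D μ := by
  unfold levelSize
  have hμ : (0 : ℝ) ≤ μ := μ.cast_nonneg
  have h1 : ((μ + 1 : ℕ) : ℝ) + 1 ≤ 2 * ((μ : ℝ) + 1) := by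
    push_cast
    linarith
  calc (2 : ℝ) ^ ((μ + 1 : ℕ) : ℝ) * (((μ + 1 : ℕ) : ℝ) + 1) ^ D
      ≤ 2 ^ ((μ + 1 : ℕ) : ℝ) * (2 * ((μ : ℝ) + 1)) ^ D :=
        mul_le_mul_of_nonneg_left (Real.rpow_le_rpow (by positivity) h1 hD) (by positivity)
    _ = _ := by
        rw [Real.mul_rpow (by norm_num) (by positivity), Nat.cast_add, Nat.cast_one,
          Real.rpow_add (by norm_num), Real.rpow_add (by norm_num)]
        ring

theorem exists_levelSize_le {D : ℝ} (hD : 0 ≤ D) {y : ℝ} (hy : 1 ≤ y) :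
    ∃ K : ℕ, levelSize D K ≤ y ∧ y ≤ 2 ^ (1 + D) * levelSize D K := by
  have hex : ∃ k : ℕ, y < levelSize D k := by
    obtain ⟨k, hk⟩ := pow_unbounded_of_one_lt y (one_lt_two (α := ℝ))
    refine ⟨k, hk.trans_le ?_⟩
    rw [← Real.rpow_natCast]
    exact two_rpow_le_levelSize hD k
  classical
  have h0 : Nat.find hex ≠ 0 := fun h => by
    have := Nat.find_spec hex
    rw [h, levelSize_zero] at this
    linarith
  obtain ⟨K, hK⟩ := Nat.exists_eq_succ_of_ne_zero h0
  refine ⟨K, not_lt.1 (Nat.find_min hex (by omega)), ?_⟩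
  have := Nat.find_spec hex
  rw [hK] at this
  exact this.le.trans (levelSize_succ_le hD K)

theorem exists_levelSize_ge {D a b : ℝ} (hD : 0 ≤ D) (ha : 0 < a) (hb : 0 < b) :
    ∃ c : ℝ, 0 < c ∧ ∀ n : ℕ, 1 ≤ n → ∃ μ : ℕ,
      a * (n : ℝ) ^ b ≤ levelSize D μ ∧ levelSize D μ ≤ c * (n : ℝ) ^ b := by
  have h2 : (0 : ℝ) < 2 ^ (1 + D) := by positivity
  have h2' : (1 : ℝ) ≤ 2 ^ (1 + D) := Real.one_le_rpow (by norm_num) (by linarith)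
  have hm : 1 ≤ max a 1 := le_max_right _ _
  refine ⟨2 ^ (1 + D) * max a 1, by positivity, fun n hn => ?_⟩
  have hn1 : 1 ≤ (n : ℝ) ^ b := Real.one_le_rpow (by exact_mod_cast hn) hb.le
  obtain ⟨μ, h3, h4⟩ := exists_levelSize_le hD (y := 2 ^ (1 + D) * max a 1 * (n : ℝ) ^ b)
    (one_le_mul_of_one_le_of_one_le (one_le_mul_of_one_le_of_one_le h2' hm) hn1)
  refine ⟨μ, ?_, h3⟩
  rw [mul_assoc] at h4
  exact (mul_le_mul_of_nonneg_right (le_max_left a 1) (by positivity)).trans (le_of_mul_le_mul_left h4 h2)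

/-- When `a n^b < 1` no level is small enough and level zero is taken; then no blocks have to be
annihilated, and comparability with `n^b` still holds. -/
theorem exists_levelSize_le_or_zero {D a b : ℝ} (hD : 0 ≤ D) (ha : 0 < a) (hb : 0 < b) :
    ∃ c₁ c₂ : ℝ, 0 < c₁ ∧ 0 < c₂ ∧ ∀ n : ℕ, 1 ≤ n → ∃ μ : ℕ,
      c₁ * (n : ℝ) ^ b ≤ levelSize D μ ∧ levelSize D μ ≤ c₂ * (n : ℝ) ^ b ∧
        (μ = 0 ∨ levelSize D μ ≤ a * (n : ℝ) ^ b) := by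
  have h2 : (0 : ℝ) < 2 ^ (1 + D) := by positivity
  have h2' : (1 : ℝ) ≤ 2 ^ (1 + D) := Real.one_le_rpow (by norm_num) (by linarith)
  refine ⟨a / 2 ^ (1 + D), max 1 a, by positivity, by positivity, fun n hn => ?_⟩
  have hn1 : 1 ≤ (n : ℝ) ^ b := Real.one_le_rpow (by exact_mod_cast hn) hb.le
  rcases le_or_gt 1 (a * (n : ℝ) ^ b) with h | h
  · obtain ⟨μ, h3, h4⟩ := exists_levelSize_le hD h
    refine ⟨μ, ?_, h3.trans (mul_le_mul_of_nonneg_right (le_max_right _ _) (by positivity)), .inr h3⟩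
    rw [div_mul_eq_mul_div, div_le_iff₀ h2, mul_comm _ ((2 : ℝ) ^ (1 + D))]
    exact h4
  · refine ⟨0, ?_, ?_, .inl rfl⟩ <;> rw [levelSize_zero]
    · rw [div_mul_eq_mul_div, div_le_iff₀ h2]
      linarith
    · exact one_le_mul_of_one_le_of_one_le (le_max_left _ _) hn1

/-- Logarithms of both bounds: the power of two contributes `μ log 2`, and the polynomial factor at
most `D μ`. -/
theorem exists_log_comparable {D b c₁ c₂ : ℝ} (hD : 0 ≤ D) (hb : 0 < b) (hc₁ : 0 < c₁)
    (hc₂ : 0 < c₂) : ∃ k₁ k₂ : ℝ, 0 < k₁ ∧ 0 < k₂ ∧ ∀ n μ : ℕ, 2 ≤ n →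
      c₁ * (n : ℝ) ^ b ≤ levelSize D μ → levelSize D μ ≤ c₂ * (n : ℝ) ^ b →
      k₁ * Real.log n ≤ μ + 1 ∧ (μ : ℝ) + 1 ≤ k₂ * Real.log n := by
  have hl2 : 0 < Real.log 2 := Real.log_pos (by norm_num)
  have hA : 0 < Real.log 2 + D + |Real.log c₁| := by positivity
  refine ⟨b / (Real.log 2 + D + |Real.log c₁|),
    (|Real.log c₂| / Real.log 2 + 1) / Real.log 2 + b / Real.log 2, by positivity, by positivity,
    fun n μ hn h1 h2 => ?_⟩
  have hn2 : (2 : ℝ) ≤ n := by exact_mod_cast hn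
  have hn0 : (0 : ℝ) < n := by linarith
  have hln : Real.log 2 ≤ Real.log n := Real.log_le_log (by norm_num) hn2
  have hμ : (0 : ℝ) ≤ μ := μ.cast_nonneg
  constructor
  · have h3 := Real.log_le_log (by positivity) h1
    rw [levelSize, Real.log_mul hc₁.ne' (by positivity), Real.log_rpow hn0,
      Real.log_mul (by positivity) (by positivity), Real.log_rpow (by norm_num),
      Real.log_rpow (by positivity)] at h3
    have h4 : Real.log ((μ : ℝ) + 1) ≤ μ := by
      have := Real.log_le_sub_one_of_pos (show (0 : ℝ) < μ + 1 by positivity)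
      linarith
    have h5 : D * Real.log ((μ : ℝ) + 1) ≤ D * μ := mul_le_mul_of_nonneg_left h4 hD
    have h6 : |Real.log c₁| ≤ |Real.log c₁| * (μ + 1) :=
      le_mul_of_one_le_right (abs_nonneg _) (by linarith)
    rw [div_mul_eq_mul_div, div_le_iff₀ hA]
    nlinarith [neg_abs_le (Real.log c₁)]
  · have h3 := Real.log_le_log (by positivity) ((two_rpow_le_levelSize hD μ).trans h2)
    rw [Real.log_mul hc₂.ne' (by positivity), Real.log_rpow hn0, Real.log_rpow (by norm_num)] at h3
    have h4 : (μ : ℝ) ≤ |Real.log c₂| / Real.log 2 + b / Real.log 2 * Real.log n := by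
      rw [div_mul_eq_mul_div, ← add_div, le_div_iff₀ hl2]
      linarith [le_abs_self (Real.log c₂)]
    have h5 : |Real.log c₂| / Real.log 2 + 1 ≤
        (|Real.log c₂| / Real.log 2 + 1) / Real.log 2 * Real.log n := by
      rw [div_mul_eq_mul_div, le_div_iff₀ hl2]
      exact mul_le_mul_of_nonneg_left hln (by positivity)
    rw [add_mul]
    linarith

theorem exists_rpow_comparable {k₁ k₂ : ℝ} (hk₁ : 0 < k₁) (hk₂ : 0 < k₂) (e : ℝ) :
    ∃ c C : ℝ, 0 < c ∧ 0 < C ∧ ∀ x y : ℝ, 0 < x → k₁ * x ≤ y → y ≤ k₂ * x →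
      c * x ^ e ≤ y ^ e ∧ y ^ e ≤ C * x ^ e := by
  rcases le_total 0 e with he | he
  · refine ⟨k₁ ^ e, k₂ ^ e, by positivity, by positivity, fun x y hx h1 h2 => ?_⟩
    have hy : 0 < y := lt_of_lt_of_le (by positivity) h1
    rw [← Real.mul_rpow hk₁.le hx.le, ← Real.mul_rpow hk₂.le hx.le]
    exact ⟨Real.rpow_le_rpow (by positivity) h1 he, Real.rpow_le_rpow hy.le h2 he⟩
  · refine ⟨k₂ ^ e, k₁ ^ e, by positivity, by positivity, fun x y hx h1 h2 => ?_⟩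
    have hy : 0 < y := lt_of_lt_of_le (by positivity) h1
    rw [← Real.mul_rpow hk₁.le hx.le, ← Real.mul_rpow hk₂.le hx.le]
    exact ⟨Real.rpow_le_rpow_of_nonpos hy h2 he, Real.rpow_le_rpow_of_nonpos (by positivity) h1 he⟩

/-- If `2^μ (μ+1)^D ≍ n^b`, then `2^{-μα} (μ+1)^{D(e-α)} ≍ n^{-bα} (log n)^{De}`. -/
theorem exists_levelMonomial_comparable {D b c₁ c₂ : ℝ} (hD : 0 ≤ D) (hb : 0 < b) (hc₁ : 0 < c₁)
    (hc₂ : 0 < c₂) (α e : ℝ) : ∃ c C : ℝ, 0 < c ∧ 0 < C ∧ ∀ n μ : ℕ, 1 ≤ n → (2 ≤ n ∨ D = 0) →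
      c₁ * (n : ℝ) ^ b ≤ levelSize D μ → levelSize D μ ≤ c₂ * (n : ℝ) ^ b →
      c * ((n : ℝ) ^ (-(b * α)) * Real.log n ^ (D * e)) ≤
          (2 : ℝ) ^ (-((μ : ℝ) * α)) * ((μ : ℝ) + 1) ^ (D * (e - α)) ∧
        (2 : ℝ) ^ (-((μ : ℝ) * α)) * ((μ : ℝ) + 1) ^ (D * (e - α)) ≤
          C * ((n : ℝ) ^ (-(b * α)) * Real.log n ^ (D * e)) := by
  obtain ⟨k₁, k₂, hk₁, hk₂, hk⟩ := exists_log_comparable hD hb hc₁ hc₂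
  obtain ⟨a, A, ha, hA, h1⟩ := exists_rpow_comparable hc₁ hc₂ (-α)
  obtain ⟨l, L, hl, hL, h2⟩ := exists_rpow_comparable hk₁ hk₂ (D * e)
  refine ⟨a * min l 1, A * max L 1, by positivity, by positivity, fun n μ hn hn2 h3 h4 => ?_⟩
  have hn0 : (0 : ℝ) < n := by exact_mod_cast hn
  have hμ : (0 : ℝ) < (μ : ℝ) + 1 := by positivity
  obtain ⟨h5, h6⟩ := h1 _ _ (by positivity) h3 h4
  have h7 : min l 1 * Real.log n ^ (D * e) ≤ ((μ : ℝ) + 1) ^ (D * e) ∧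
      ((μ : ℝ) + 1) ^ (D * e) ≤ max L 1 * Real.log n ^ (D * e) := by
    rcases hn2 with hn2 | rfl
    · have hlog : 0 < Real.log n := Real.log_pos (by exact_mod_cast hn2)
      obtain ⟨h8, h9⟩ := hk n μ hn2 h3 h4
      obtain ⟨h10, h11⟩ := h2 _ _ hlog h8 h9
      have hp : 0 ≤ Real.log n ^ (D * e) := by positivity
      exact ⟨(mul_le_mul_of_nonneg_right (min_le_left _ _) hp).trans h10,
        h11.trans (mul_le_mul_of_nonneg_right (le_max_left _ _) hp)⟩
    · simp
  have h8 : (2 : ℝ) ^ (-((μ : ℝ) * α)) * ((μ : ℝ) + 1) ^ (D * (e - α)) =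
      levelSize D μ ^ (-α) * ((μ : ℝ) + 1) ^ (D * e) := by
    rw [levelSize, Real.mul_rpow (by positivity) (by positivity), ← Real.rpow_mul (by norm_num),
      ← Real.rpow_mul hμ.le, mul_assoc, ← Real.rpow_add hμ]
    congr 2 <;> ring
  have h9 : (n : ℝ) ^ (-(b * α)) = ((n : ℝ) ^ b) ^ (-α) := by
    rw [← Real.rpow_mul hn0.le, mul_neg]
  have hlog0 : 0 ≤ Real.log n := Real.log_natCast_nonneg n
  have hlp : 0 ≤ Real.log n ^ (D * e) := Real.rpow_nonneg hlog0 _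
  rw [h8, h9]
  constructor
  · calc _ = a * ((n : ℝ) ^ b) ^ (-α) * (min l 1 * Real.log n ^ (D * e)) := by ring
      _ ≤ _ := mul_le_mul h5 h7.1 (by positivity) (Real.rpow_nonneg (levelSize_pos D μ).le _)
  · calc _ ≤ A * ((n : ℝ) ^ b) ^ (-α) * (max L 1 * Real.log n ^ (D * e)) :=
          mul_le_mul h6 h7.2 (by positivity) (by positivity)
      _ = _ := by ring

end MixedWeyl

namespace MixedWeyl

/-! ### Orders of the upper and lower estimates -/

section

variable {d : ℕ} {ψ₀ ψ₁ : ℝ → ℂ}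

theorem UpperEst.mono {p₀ p : ℝ≥0∞} {hp₀ : 0 < p₀} {t : ℝ} {n : ℕ} {B B' : ℝ}
    (h : UpperEst d ψ₀ ψ₁ hp₀ t p n B) (hB : B ≤ B') : UpperEst d ψ₀ ψ₁ hp₀ t p n B' := by
  intro A hA
  obtain ⟨V, hV, hVn, hVB⟩ := h A hA
  exact ⟨V, hV, hVn, fun x hx hx1 => (hVB x hx hx1).trans (ENNReal.ofReal_le_ofReal hB)⟩

/-- The upper estimates of order `n^{-a} (log n)^{De}`. -/
def UpperOrder (d : ℕ) (ψ₀ ψ₁ : ℝ → ℂ) {p₀ : ℝ≥0∞} (hp₀ : 0 < p₀) (t : ℝ) (p : ℝ≥0∞)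
    (D a e : ℝ) : Prop :=
  (∃ B, UpperEst d ψ₀ ψ₁ hp₀ t p 1 B) ∧ ∃ C : ℝ, 0 < C ∧ ∀ n : ℕ, 1 ≤ n → (2 ≤ n ∨ D = 0) →
    UpperEst d ψ₀ ψ₁ hp₀ t p n (C * ((n : ℝ) ^ (-a) * Real.log n ^ (D * e)))

/-- The lower estimates of order `n^{-a} (log n)^{De}`. -/
def LowerOrder (d : ℕ) (ψ₀ ψ₁ : ℝ → ℂ) (p₀ : ℝ≥0∞) (t : ℝ) (p : ℝ≥0∞) (D a e : ℝ) : Prop :=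
  ∃ c : ℝ, 0 < c ∧ ∀ n : ℕ, 1 ≤ n → (2 ≤ n ∨ D = 0) →
    LowerEst d ψ₀ ψ₁ p₀ t p n (c * ((n : ℝ) ^ (-a) * Real.log n ^ (D * e)))

theorem weylOrder_polyLog {p₀ p : ℝ≥0∞} {hp₀ : 0 < p₀} {hp : 0 < p} {t a e : ℝ}
    (hU : UpperOrder d ψ₀ ψ₁ hp₀ t p ((d : ℝ) - 1) a e)
    (hL : LowerOrder d ψ₀ ψ₁ p₀ t p ((d : ℝ) - 1) a e) :
    WeylOrder d ψ₀ ψ₁ hp₀ hp t 2 (polyLog d a e) := by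
  obtain ⟨h1, C, hC, hU⟩ := hU
  obtain ⟨c, hc, hL⟩ := hL
  exact weylOrder_of_estimates h1 ⟨C, hC, fun n hn => hU n (by omega) (.inl hn)⟩
    ⟨c, hc, fun n hn => hL n (by omega) (.inl hn)⟩

/-- With `D = 0` the logarithmic factor is a zeroth power, equal to one also at `n = 1`, where `log
n = 0`. -/
theorem weylOrder_rpow {p₀ p : ℝ≥0∞} {hp₀ : 0 < p₀} {hp : 0 < p} {t a e : ℝ}
    (hU : UpperOrder d ψ₀ ψ₁ hp₀ t p 0 a e) (hL : LowerOrder d ψ₀ ψ₁ p₀ t p 0 a e) :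
    WeylOrder d ψ₀ ψ₁ hp₀ hp t 1 (fun n => (n : ℝ) ^ (-a)) := by
  obtain ⟨h1, C, hC, hU⟩ := hU
  obtain ⟨c, hc, hL⟩ := hL
  refine weylOrder_of_estimates h1 ⟨C, hC, fun n hn => ?_⟩ ⟨c, hc, fun n hn => ?_⟩
  · simpa using hU n hn (.inr rfl)
  · simpa using hL n hn (.inr rfl)

end

section

variable {d : ℕ} {ψ₀ ψ₁ : ℝ → ℂ} [∀ ν : Fin d → ℕ, Fintype (omegaIndex ψ₀ ψ₁ ν)] {R : ℝ}
variable {p₀ : ℝ≥0∞} {hp₀ : 0 < p₀} {t : ℝ}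

theorem UpperOrder.of_le (hR : IndexGeometry d ψ₀ ψ₁ R) {p p' : ℝ≥0∞} (hp : 0 < p) (hpp : p ≤ p')
    (hp' : p' < ∞) {D a e : ℝ} (h : UpperOrder d ψ₀ ψ₁ hp₀ t p' D a e) :
    UpperOrder d ψ₀ ψ₁ hp₀ t p D a e := by
  obtain ⟨K, hK, hle⟩ := UpperEst.of_le hR hp₀ t hp hpp hp'
  obtain ⟨⟨B, hB⟩, C, hC, h⟩ := h
  exact ⟨⟨_, hle 1 B hB⟩, K * C, by positivity, fun n hn hn2 => by
    rw [mul_assoc]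
    exact hle n _ (h n hn hn2)⟩

theorem LowerOrder.of_le (hR : IndexGeometry d ψ₀ ψ₁ R) {p p' : ℝ≥0∞} (hp : 0 < p) (hpp : p ≤ p')
    (hp' : p' < ∞) {D a e : ℝ} (h : LowerOrder d ψ₀ ψ₁ p₀ t p D a e) :
    LowerOrder d ψ₀ ψ₁ p₀ t p' D a e := by
  obtain ⟨K, hK, hle⟩ := LowerEst.of_le hR p₀ t hp hpp hp'
  obtain ⟨c, hc, h⟩ := h
  exact ⟨K * c, by positivity, fun n hn hn2 => by
    rw [mul_assoc]
    exact hle n _ (h n hn hn2)⟩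

/-- At the level with `2^J (J+1)^(d-1)` of order `n` the value of the estimate becomes `n^(-α-γ)`
times the logarithm to the power `(d-1)(α+β)`. -/
theorem upperOrder_of_blockEst (hd : 1 ≤ d) (hR : IndexGeometry d ψ₀ ψ₁ R) {p : ℝ≥0∞} (hp : 0 < p)
    (hp' : p < ∞) {α β γ : ℝ} (h : BlockEst d ψ₀ ψ₁ hp₀ t p.toReal α (((d : ℝ) - 1) * β) γ)
    (hγ : 0 ≤ γ) (hα : 0 < α) :
    UpperOrder d ψ₀ ψ₁ hp₀ t p ((d : ℝ) - 1) (α + γ) (α + β) := by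
  have hD : (0 : ℝ) ≤ (d : ℝ) - 1 := sub_nonneg.2 (by exact_mod_cast hd)
  obtain ⟨C, κ₀, hC, hκ₀, hU⟩ := upperEst_of_blockEst hd hR hp hp' h hγ hα
  obtain ⟨c₁, c₂, hc₁, hc₂, hK⟩ := exists_levelSize_le_or_zero hD hκ₀ one_pos
  obtain ⟨_, K, -, hK0, hm⟩ := exists_levelMonomial_comparable hD one_pos hc₁ hc₂ α (α + β)
  refine ⟨⟨_, hU 1 0 le_rfl (.inl rfl)⟩, C * K, by positivity, fun n hn hn2 => ?_⟩
  have hn0 : (0 : ℝ) < n := by exact_mod_cast hn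
  obtain ⟨J, h1, h2, h3⟩ := hK n hn
  refine (hU n J hn (h3.imp_right fun h => ?_)).mono ?_
  · rw [levelSize, Real.rpow_one, ← Nat.cast_one, ← Nat.cast_sub hd, Real.rpow_natCast,
      Real.rpow_natCast] at h
    simpa using h
  · rw [mul_assoc]
    refine mul_le_mul_of_nonneg_left ?_ hC.le
    have h4 := (hm n J hn hn2 h1 h2).2
    rw [add_sub_cancel_left, one_mul] at h4
    refine (mul_le_mul_of_nonneg_right h4 (by positivity)).trans (le_of_eq ?_)
    rw [neg_add, Real.rpow_add hn0]
    ring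

/-- The last four equations say that both estimates have the same value at the level of size about
`n^b`; the opposite signs of `α₁` and `α₂` make the errors decrease away from it on both sides. -/
theorem upperOrder_of_two_blockEst {p : ℝ≥0∞} (hp : 0 < p) (hp' : p < ∞)
    {D α₁ β₁ γ₁ α₂ β₂ γ₂ a b e : ℝ} (hD : 0 ≤ D) (hb : 0 < b)
    (h₁ : BlockEst d ψ₀ ψ₁ hp₀ t p.toReal α₁ (D * β₁) γ₁) (hγ₁ : 0 ≤ γ₁) (hα₁ : α₁ < 0)
    (h₂ : BlockEst d ψ₀ ψ₁ hp₀ t p.toReal α₂ (D * β₂) γ₂) (hγ₂ : 0 ≤ γ₂) (hα₂ : 0 < α₂)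
    (ha₁ : b * α₁ + γ₁ = a) (ha₂ : b * α₂ + γ₂ = a) (he₁ : α₁ + β₁ = e) (he₂ : α₂ + β₂ = e) :
    UpperOrder d ψ₀ ψ₁ hp₀ t p D a e := by
  obtain ⟨C, hC, hU⟩ := upperEst_of_two_blockEst hp hp' h₁ hγ₁ hα₁ h₂ hγ₂ hα₂
  obtain ⟨c₁, c₂, hc₁, hc₂, hK⟩ := exists_levelSize_le_or_zero hD one_pos hb
  obtain ⟨_, K₁, -, hK₁, hm₁⟩ := exists_levelMonomial_comparable hD hb hc₁ hc₂ α₁ e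
  obtain ⟨_, K₂, -, hK₂, hm₂⟩ := exists_levelMonomial_comparable hD hb hc₁ hc₂ α₂ e
  refine ⟨⟨_, hU 1 0 _ le_rfl (le_max_left _ _) (le_max_right _ _)⟩, C * max K₁ K₂, by positivity,
    fun n hn hn2 => ?_⟩
  have hn0 : (0 : ℝ) < n := by exact_mod_cast hn
  have hlog0 : 0 ≤ Real.log n := Real.log_natCast_nonneg n
  have hlp : 0 ≤ Real.log n ^ (D * e) := Real.rpow_nonneg hlog0 _
  obtain ⟨J, h1, h2, -⟩ := hK n hn
  have aux : ∀ {α β γ K : ℝ}, b * α + γ = a → α + β = e → K ≤ max K₁ K₂ →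
      (2 : ℝ) ^ (-((J : ℝ) * α)) * ((J : ℝ) + 1) ^ (D * (e - α)) ≤
        K * ((n : ℝ) ^ (-(b * α)) * Real.log n ^ (D * e)) →
      blockValue α (D * β) γ n J ≤ max K₁ K₂ * ((n : ℝ) ^ (-a) * Real.log n ^ (D * e)) := by
    intro α β γ K ha he hK h
    rw [← he, add_sub_cancel_left, he] at h
    refine (mul_le_mul_of_nonneg_right h (by positivity)).trans ?_
    rw [← ha, neg_add, Real.rpow_add hn0]
    calc _ = K * ((n : ℝ) ^ (-(b * α)) * (n : ℝ) ^ (-γ) * Real.log n ^ (D * e)) := by ring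
      _ ≤ _ := mul_le_mul_of_nonneg_right hK (by positivity)
  rw [mul_assoc]
  exact hU n J _ hn (aux ha₁ he₁ (le_max_left _ _) (hm₁ n J hn hn2 h1 h2).2)
    (aux ha₂ he₂ (le_max_right _ _) (hm₂ n J hn hn2 h1 h2).2)

/-- The level is chosen with at least `2n`, but only a constant multiple of `n`, indices, so that a
subspace of codimension less than `n` keeps half of the dimension. -/
theorem lowerOrder_of_card {p : ℝ≥0∞} {D K c τ δ : ℝ} (hD : 0 ≤ D) (Γ : ℕ → Finset (Fin d → ℕ))
    (hK : 0 < K) (hΓ₁ : ∀ μ, levelSize D μ ≤ K * Fintype.card (LayerIndex ψ₀ ψ₁ (Γ μ)))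
    (hΓ₂ : ∀ μ, (Fintype.card (LayerIndex ψ₀ ψ₁ (Γ μ)) : ℝ) ≤ K * levelSize D μ) (hc : 0 < c)
    (hδ : 0 ≤ δ)
    (h : ∀ μ n : ℕ, 1 ≤ n → 2 * n ≤ Fintype.card (LayerIndex ψ₀ ψ₁ (Γ μ)) →
      LowerEst d ψ₀ ψ₁ p₀ t p n (c * 2 ^ (-((μ : ℝ) * τ)) *
        (Fintype.card (LayerIndex ψ₀ ψ₁ (Γ μ)) : ℝ) ^ (-δ))) :
    LowerOrder d ψ₀ ψ₁ p₀ t p D (τ + δ) τ := by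
  obtain ⟨c₂, hc₂, hL⟩ := exists_levelSize_ge hD (show 0 < 2 * K by positivity) one_pos
  obtain ⟨k, _, hk, -, hm⟩ := exists_levelMonomial_comparable hD one_pos
    (show 0 < 2 * K by positivity) hc₂ (τ + δ) τ
  refine ⟨c * K ^ (-δ) * k, by positivity, fun n hn hn2 => ?_⟩
  obtain ⟨μ, h1, h2⟩ := hL n hn
  have hn0 : (0 : ℝ) < n := by exact_mod_cast hn
  have h3 := h1.trans (hΓ₁ μ)
  rw [Real.rpow_one, mul_comm 2 K, mul_assoc] at h3
  have h4 : 2 * (n : ℝ) ≤ Fintype.card (LayerIndex ψ₀ ψ₁ (Γ μ)) := le_of_mul_le_mul_left h3 hK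
  refine (h μ n hn (by exact_mod_cast h4)).mono ?_
  have h5 : (K * levelSize D μ) ^ (-δ) ≤
      (Fintype.card (LayerIndex ψ₀ ψ₁ (Γ μ)) : ℝ) ^ (-δ) :=
    Real.rpow_le_rpow_of_nonpos (by linarith) (hΓ₂ μ) (by linarith)
  have h6 := (hm n μ hn hn2 h1 h2).1
  rw [one_mul] at h6
  have h7 : (2 : ℝ) ^ (-((μ : ℝ) * (τ + δ))) * ((μ : ℝ) + 1) ^ (D * (τ - (τ + δ))) =
      2 ^ (-((μ : ℝ) * τ)) * levelSize D μ ^ (-δ) := by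
    rw [levelSize, Real.mul_rpow (by positivity) (by positivity), ← Real.rpow_mul (by norm_num),
      ← Real.rpow_mul (by positivity), ← mul_assoc, ← Real.rpow_add (by norm_num)]
    congr 2 <;> ring
  rw [h7] at h6
  calc _ ≤ c * K ^ (-δ) * (2 ^ (-((μ : ℝ) * τ)) * levelSize D μ ^ (-δ)) := by
        rw [mul_assoc (c * K ^ (-δ))]
        exact mul_le_mul_of_nonneg_left h6 (by positivity)
    _ = c * 2 ^ (-((μ : ℝ) * τ)) * (K * levelSize D μ) ^ (-δ) := by
        rw [Real.mul_rpow hK.le (levelSize_pos D μ).le]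
        ring
    _ ≤ _ := mul_le_mul_of_nonneg_left h5 (by positivity)

theorem exists_levelSize_le_card_level (hd : 1 ≤ d) (hR : IndexGeometry d ψ₀ ψ₁ R) :
    ∃ K : ℝ, 0 < K ∧
      (∀ μ, levelSize ((d : ℝ) - 1) μ ≤ K * Fintype.card (LayerIndex ψ₀ ψ₁ (level d μ))) ∧
      (∀ μ, (Fintype.card (LayerIndex ψ₀ ψ₁ (level d μ)) : ℝ) ≤ K * levelSize ((d : ℝ) - 1) μ) ∧
      ∀ μ : ℕ, ((μ : ℝ) + 1) ^ ((d : ℝ) - 1) ≤ K * (level d μ).card := by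
  have hR1 := hR.one_le
  have hR0 : 0 < R := by linarith
  have hd1 : (1 : ℝ) ≤ d := by exact_mod_cast hd
  have hdd : (1 : ℝ) ≤ (d : ℝ) ^ (d - 1) := one_le_pow₀ hd1
  have e : ∀ μ : ℕ, ((μ : ℝ) + 1) ^ ((d : ℝ) - 1) = ((μ : ℝ) + 1) ^ (d - 1) := fun μ => by
    rw [← Real.rpow_natCast, Nat.cast_sub hd, Nat.cast_one]
  have h1 : ∀ μ : ℕ, ((level d μ).card : ℝ) ≤ ((μ : ℝ) + 1) ^ ((d : ℝ) - 1) := fun μ => by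
    rw [e]
    exact_mod_cast card_level_le hd μ
  have h2 : ∀ μ : ℕ, ((μ : ℝ) + 1) ^ ((d : ℝ) - 1) ≤ (d : ℝ) ^ (d - 1) * (level d μ).card :=
    fun μ => by
      rw [e]
      exact_mod_cast le_card_level hd μ
  refine ⟨(d : ℝ) ^ (d - 1) * R, by positivity, fun μ => ?_, fun μ => ?_, fun μ => ?_⟩
  · calc levelSize ((d : ℝ) - 1) μ ≤ 2 ^ (μ : ℝ) * ((d : ℝ) ^ (d - 1) * (level d μ).card) :=
          mul_le_mul_of_nonneg_left (h2 μ) (by positivity)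
      _ = (d : ℝ) ^ (d - 1) * (2 ^ (μ : ℝ) * (level d μ).card) := by ring
      _ ≤ (d : ℝ) ^ (d - 1) * (R * Fintype.card (LayerIndex ψ₀ ψ₁ (level d μ))) :=
          mul_le_mul_of_nonneg_left (le_card_layerIndex hR subset_rfl) (by positivity)
      _ = _ := by ring
  · calc _ ≤ R * (2 ^ (μ : ℝ) * (level d μ).card) := card_layerIndex_le hR subset_rfl
      _ ≤ R * levelSize ((d : ℝ) - 1) μ := mul_le_mul_of_nonneg_left
          (mul_le_mul_of_nonneg_left (h1 μ) (by positivity)) hR0.le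
      _ ≤ _ := mul_le_mul_of_nonneg_right (le_mul_of_one_le_left hR0.le hdd) (levelSize_pos _ _).le
  · refine (h2 μ).trans (mul_le_mul_of_nonneg_right (le_mul_of_one_le_right (by positivity) hR1)
      (by positivity))

theorem embeddingExponent_nonneg (p₀ : ℝ≥0∞) : 0 ≤ embeddingExponent p₀ := le_max_right _ _

theorem lowerOrder_level (hd : 1 ≤ d) (hR : IndexGeometry d ψ₀ ψ₁ R) (t : ℝ) (hp₀ : 0 < p₀)
    {p : ℝ≥0∞} (hp : 0 < p) (hp' : p < ∞) :
    LowerOrder d ψ₀ ψ₁ p₀ t p ((d : ℝ) - 1) (t - recip p₀ + recip p + embeddingExponent p₀)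
      (t - recip p₀ + recip p) := by
  have hD : (0 : ℝ) ≤ (d : ℝ) - 1 := sub_nonneg.2 (by exact_mod_cast hd)
  obtain ⟨K, hK, h1, h2, -⟩ := exists_levelSize_le_card_level (ψ₀ := ψ₀) (ψ₁ := ψ₁) hd hR
  exact lowerOrder_of_card hD (level d) hK h1 h2 (by norm_num) (embeddingExponent_nonneg p₀)
    fun μ n hn hcard => lowerEst_of_card t hp₀ hp hp' subset_rfl hn hcard

theorem lowerOrder_level_of_le_two (hd : 1 ≤ d) (hR : IndexGeometry d ψ₀ ψ₁ R) (t : ℝ)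
    (hp₀ : 0 < p₀) {p : ℝ≥0∞} (hp : 0 < p) (hp2 : p ≤ 2) :
    LowerOrder d ψ₀ ψ₁ p₀ t p ((d : ℝ) - 1) (t - recip p₀ + 1 / 2 + embeddingExponent p₀)
      (t - recip p₀ + 1 / 2) := by
  have hD : (0 : ℝ) ≤ (d : ℝ) - 1 := sub_nonneg.2 (by exact_mod_cast hd)
  obtain ⟨K, hK, h1, h2, -⟩ := exists_levelSize_le_card_level (ψ₀ := ψ₀) (ψ₁ := ψ₁) hd hR
  obtain ⟨c, hc, h⟩ := lowerEst_of_card_of_le_two (ψ₀ := ψ₀) (ψ₁ := ψ₁) hR t hp₀ hp hp2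
  exact lowerOrder_of_card hD (level d) hK h1 h2 hc (embeddingExponent_nonneg p₀)
    fun μ n hn hcard => h _ μ n subset_rfl hn hcard

/-- A single layer `ν = (μ, 0, …, 0)` has about `2^μ` indices. Using it instead of the whole level
avoids the logarithmic factor, which would be a loss when its exponent is negative. -/
theorem lowerOrder_single_of_le_two (hd : 1 ≤ d) (hR : IndexGeometry d ψ₀ ψ₁ R) (t : ℝ)
    (hp₀ : 0 < p₀) {p : ℝ≥0∞} (hp : 0 < p) (hp2 : p ≤ 2) :
    LowerOrder d ψ₀ ψ₁ p₀ t p 0 (t - recip p₀ + 1 / 2 + embeddingExponent p₀)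
      (t - recip p₀ + 1 / 2) := by
  have hR0 : 0 < R := lt_of_lt_of_le one_pos hR.one_le
  obtain ⟨c, hc, h⟩ := lowerEst_of_card_of_le_two (ψ₀ := ψ₀) (ψ₁ := ψ₁) hR t hp₀ hp hp2
  let Γ : ℕ → Finset (Fin d → ℕ) := fun μ => {Pi.single ⟨0, hd⟩ μ}
  have hΓ : ∀ μ, Γ μ ⊆ level d μ := fun μ => by
    rw [Finset.singleton_subset_iff, mem_level, levelSum]
    simp
  have e : ∀ μ, levelSize 0 μ = 2 ^ (μ : ℝ) * (Γ μ).card := fun μ => by simp [levelSize, Γ]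
  refine lowerOrder_of_card le_rfl Γ hR0 (fun μ => ?_) (fun μ => ?_) hc
    (embeddingExponent_nonneg p₀) fun μ n hn hcard => h _ μ n (hΓ μ) hn hcard
  · rw [e]
    exact le_card_layerIndex hR (hΓ μ)
  · rw [e]
    exact card_layerIndex_le hR (hΓ μ)

/-- The sign matrix has about `D^(2/p₀)` columns, and a multiple of `n` of them is needed; hence the
level has about `n^(p₀/2)` indices. -/
theorem lowerOrder_small_of_le_two (hd : 1 ≤ d) (hR : IndexGeometry d ψ₀ ψ₁ R) (t : ℝ)
    (hp₀2 : 2 < p₀) (hp₀' : p₀ ≠ ∞) {p : ℝ≥0∞} (hp : 0 < p) (hp2 : p ≤ 2) :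
    LowerOrder d ψ₀ ψ₁ p₀ t p ((d : ℝ) - 1) (t * p₀.toReal / 2) (t + 1 / 2 - recip p₀) := by
  have hD : (0 : ℝ) ≤ (d : ℝ) - 1 := sub_nonneg.2 (by exact_mod_cast hd)
  set q := p₀.toReal with hq
  have hq2 : 2 < q := by
    have := (ENNReal.toReal_lt_toReal (by simp) hp₀').2 hp₀2
    simpa using this
  have hrec : recip p₀ = 1 / q := recip_eq_one_div
  have hr : 0 ≤ 1 / 2 - recip p₀ := by
    rw [hrec, sub_nonneg]
    exact one_div_le_one_div_of_le two_pos hq2.le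
  obtain ⟨K, hK, h1, h2, h3⟩ := exists_levelSize_le_card_level (ψ₀ := ψ₀) (ψ₁ := ψ₁) hd hR
  obtain ⟨c, κ, hc, hκ, h⟩ := lowerEst_of_sign_matrix (ψ₀ := ψ₀) (ψ₁ := ψ₁) hR t hp₀2 hp₀' hp hp2
  rw [← hq] at h
  have ha : 0 < K * κ ^ (q / 2) := by positivity
  have hb : 0 < q / 2 := by linarith
  obtain ⟨c₂, hc₂, hL⟩ := exists_levelSize_ge hD ha hb
  obtain ⟨k, _, hk, -, hm⟩ := exists_levelMonomial_comparable hD hb ha hc₂ t (t + 1 / 2 - recip p₀)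
  refine ⟨c * K ^ (-(1 / 2 - recip p₀)) * k, by positivity, fun n hn hn2 => ?_⟩
  have hn0 : (0 : ℝ) < n := by exact_mod_cast hn
  obtain ⟨μ, h4, h5⟩ := hL n hn
  refine (h (level d μ) μ n subset_rfl hn ?_).mono ?_
  · have h6 := h4.trans (h1 μ)
    rw [mul_assoc, ← Real.mul_rpow hκ.le hn0.le] at h6
    have h7 := le_of_mul_le_mul_left h6 hK
    calc κ * n = ((κ * n) ^ (q / 2)) ^ (2 / q) := by
          rw [← Real.rpow_mul (by positivity), show q / 2 * (2 / q) = 1 by field_simp, Real.rpow_one]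
      _ ≤ _ := Real.rpow_le_rpow (by positivity) h7 (by positivity)
  · have h6 := (hm n μ hn hn2 h4 h5).1
    rw [show q / 2 * t = t * q / 2 by ring,
      show t + 1 / 2 - recip p₀ - t = 1 / 2 - recip p₀ by ring] at h6
    have h7 : (((μ : ℝ) + 1) ^ ((d : ℝ) - 1)) ^ (1 / 2 - recip p₀) ≤
        K ^ (1 / 2 - recip p₀) * ((level d μ).card : ℝ) ^ (1 / 2 - recip p₀) := by
      rw [← Real.mul_rpow hK.le (by positivity)]
      exact Real.rpow_le_rpow (by positivity) (h3 μ) hr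
    rw [← Real.rpow_mul (by positivity)] at h7
    calc _ ≤ c * K ^ (-(1 / 2 - recip p₀)) * (2 ^ (-((μ : ℝ) * t)) *
          ((μ : ℝ) + 1) ^ (((d : ℝ) - 1) * (1 / 2 - recip p₀))) := by
          rw [mul_assoc (c * _)]
          exact mul_le_mul_of_nonneg_left h6 (by positivity)
      _ ≤ c * K ^ (-(1 / 2 - recip p₀)) * (2 ^ (-((μ : ℝ) * t)) *
          (K ^ (1 / 2 - recip p₀) * ((level d μ).card : ℝ) ^ (1 / 2 - recip p₀))) :=
          mul_le_mul_of_nonneg_left (mul_le_mul_of_nonneg_left h7 (by positivity)) (by positivity)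
      _ = _ := by
          have : K ^ (1 / 2 - recip p₀) ≠ 0 := by positivity
          rw [Real.rpow_neg hK.le]
          field_simp

end

end MixedWeyl

namespace MixedWeyl

/-! ### The upper estimates in the individual ranges of the parameters -/

theorem recip_le_recip {p p' : ℝ≥0∞} (hp : 0 < p) (h : p ≤ p') : recip p' ≤ recip p :=
  ENNReal.toReal_mono (ENNReal.inv_ne_top.2 hp.ne') (ENNReal.inv_le_inv.2 h)

theorem recip_lt_recip {p p' : ℝ≥0∞} (hp : 0 < p) (h : p < p') : recip p' < recip p :=
  ENNReal.toReal_strict_mono (ENNReal.inv_ne_top.2 hp.ne') (ENNReal.inv_lt_inv.2 h)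

theorem recip_two : recip 2 = 1 / 2 := by simp [recip]

theorem recip_nonneg (p : ℝ≥0∞) : 0 ≤ recip p := ENNReal.toReal_nonneg

theorem recip_le_half {p : ℝ≥0∞} (h : 2 ≤ p) : recip p ≤ 1 / 2 :=
  recip_two ▸ recip_le_recip two_pos h

theorem recip_lt_half {p : ℝ≥0∞} (h : 2 < p) : recip p < 1 / 2 :=
  recip_two ▸ recip_lt_recip two_pos h

theorem half_le_recip {p : ℝ≥0∞} (hp : 0 < p) (h : p ≤ 2) : 1 / 2 ≤ recip p :=
  recip_two ▸ recip_le_recip hp h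

section

variable {d : ℕ} {ψ₀ ψ₁ : ℝ → ℂ} [∀ ν : Fin d → ℕ, Fintype (omegaIndex ψ₀ ψ₁ ν)] {R : ℝ}
variable {p₀ : ℝ≥0∞} {hp₀ : 0 < p₀} {t : ℝ} {p : ℝ≥0∞}

theorem upperOrder_of_le_two (hd : 1 ≤ d) (hR : IndexGeometry d ψ₀ ψ₁ R) (hp₀2 : p₀ ≤ 2)
    (hp2 : 2 ≤ p) (hp' : p < ∞) (ht : recip p₀ - recip p < t) :
    UpperOrder d ψ₀ ψ₁ hp₀ t p ((d : ℝ) - 1) (t - 1 / 2 + recip p) (t + recip p - recip p₀) := by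
  have hp : 0 < p := two_pos.trans_le hp2
  have hP : 2 ≤ p.toReal := by simpa using ENNReal.toReal_mono hp'.ne hp2
  have hx := half_le_recip hp₀ hp₀2
  have h := blockEst_of_le_two (d := d) (ψ₀ := ψ₀) (ψ₁ := ψ₁) (hp₀ := hp₀) (t := t) hP hp₀2
  rw [← mul_zero ((d : ℝ) - 1), ← recip_eq_one_div] at h
  convert upperOrder_of_blockEst hd hR hp hp' h (by linarith) (by linarith) using 1 <;> ring

/-- The auxiliary `1/r` has to exceed `1/p₀` and `1/p` strictly, while the hypothesis holds with
`1/r` equal to their maximum; by strictness a slightly larger value is admissible. For `p = 2` the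
value `r = 2` is taken directly. -/
theorem upperOrder_of_two_lt (hd : 1 ≤ d) (hR : IndexGeometry d ψ₀ ψ₁ R) (hp₀2 : 2 < p₀)
    (hp2 : 2 ≤ p) (hp' : p < ∞)
    (ht : (max (recip p₀) (recip p) - recip p₀) / (1 - 2 * recip p₀) < t - recip p₀ + recip p) :
    UpperOrder d ψ₀ ψ₁ hp₀ t p ((d : ℝ) - 1) (t - recip p₀ + recip p)
      (t + recip p - recip p₀) := by
  have hp : 0 < p := two_pos.trans_le hp2
  have hx := recip_lt_half hp₀2
  have hx' : 0 < 1 - 2 * recip p₀ := by linarith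
  suffices h : ∃ r : ℝ, 2 ≤ r ∧ recip p₀ < 1 / r ∧ (r < p.toReal ∨ r = 2 ∧ p.toReal = 2) ∧
      largeExponent p₀ r < t - recip p₀ + recip p by
    obtain ⟨r, hr, hrp, hrP, hα⟩ := h
    have h := blockEst_of_two_lt_large (t := t) (hp₀ := hp₀) hd hR hp₀2 hr hrp hrP
    rw [← recip_eq_one_div] at h
    have hγ : 0 ≤ largeExponent p₀ r := div_nonneg (by linarith) hx'.le
    convert upperOrder_of_blockEst hd hR hp hp' h hγ (by linarith) using 1 <;> ring
  rcases hp2.eq_or_lt with rfl | hp2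
  · refine ⟨2, le_rfl, hx, .inr ⟨rfl, by simp⟩, ?_⟩
    rw [recip_two] at ht ⊢
    rwa [max_eq_right hx.le] at ht
  · have hy := recip_lt_half hp2
    set M := max (recip p₀) (recip p) with hM
    have hM2 : M < 1 / 2 := max_lt hx hy
    -- Half of the slack in the hypothesis, rescaled by the denominator of `largeExponent`.
    set δ := (t - recip p₀ + recip p - (M - recip p₀) / (1 - 2 * recip p₀)) *
      (1 - 2 * recip p₀) / 2 with hδ
    have hδ0 : 0 < δ := by
      have : 0 < t - recip p₀ + recip p - (M - recip p₀) / (1 - 2 * recip p₀) := by linarith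
      positivity
    set s := M + min (1 / 2 - M) δ with hs
    have hη : 0 < min (1 / 2 - M) δ := lt_min (by linarith) hδ0
    have hs1 : recip p₀ < s := by linarith [le_max_left (recip p₀) (recip p)]
    have hs2 : recip p < s := by linarith [le_max_right (recip p₀) (recip p)]
    have hs0 : 0 < s := (recip_nonneg p).trans_lt hs2
    have hs3 : s ≤ 1 / 2 := by linarith [min_le_left (1 / 2 - M) δ]
    refine ⟨1 / s, ?_, by rwa [one_div_one_div], .inl ?_, ?_⟩
    · rw [le_div_iff₀ hs0]
      linarith
    · rw [recip_eq_one_div] at hs2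
      have hP : 0 < p.toReal := ENNReal.toReal_pos hp.ne' hp'.ne
      rw [div_lt_iff₀ hP] at hs2
      rw [div_lt_iff₀ hs0]
      linarith
    · rw [largeExponent, one_div_one_div, div_lt_iff₀ hx']
      have h1 : s ≤ M + δ := by linarith [min_le_right (1 / 2 - M) δ]
      have h2 : (M - recip p₀) / (1 - 2 * recip p₀) * (1 - 2 * recip p₀) = M - recip p₀ :=
        div_mul_cancel₀ _ hx'.ne'
      have h3 := mul_lt_mul_of_pos_right ht hx'
      rw [h2] at h3
      have h4 : δ = ((t - recip p₀ + recip p) * (1 - 2 * recip p₀) - (M - recip p₀)) / 2 := by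
        rw [hδ, sub_mul, h2]
      linarith

/-- In reciprocal form the threshold is exactly the condition for summing the large-smoothness
estimate, and the value zero for `p₀ = ∞` needs no separate treatment. -/
theorem smoothnessThreshold_eq (hp₀2 : 2 < p₀) :
    smoothnessThreshold p₀ p =
      (recip p - recip p₀) / (1 - 2 * recip p₀) - (recip p - recip p₀) := by
  unfold smoothnessThreshold
  split_ifs with h
  · simp [recip, h]
  · have hq : 2 < p₀.toReal := by
      simpa using (ENNReal.toReal_lt_toReal (by simp) h).2 hp₀2
    have h1 : p₀.toReal - 2 ≠ 0 := by linarith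
    have h2 : p₀.toReal / 2 - 1 ≠ 0 := by linarith
    have h0 : p₀.toReal ≠ 0 := by linarith
    have h3 : 1 - 2 * (1 / p₀.toReal) = (p₀.toReal - 2) / p₀.toReal := by field_simp
    rw [recip_eq_one_div (p₀ := p₀), h3]
    generalize recip p = y
    field_simp
    ring

theorem upperOrder_small (hd : 1 ≤ d) (hR : IndexGeometry d ψ₀ ψ₁ R) (hp₀2 : 2 < p₀)
    (hp₀' : p₀ < ∞) (hp2 : 2 ≤ p) (hpp : p < p₀) (ht0 : 0 < t)
    (ht : t < smoothnessThreshold p₀ p) :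
    UpperOrder d ψ₀ ψ₁ hp₀ t p ((d : ℝ) - 1) (t * p₀.toReal / 2) (t + 1 / 2 - recip p₀) := by
  have hp : 0 < p := two_pos.trans_le hp2
  have hp' : p < ∞ := hpp.trans hp₀'
  have hD : (0 : ℝ) ≤ (d : ℝ) - 1 := sub_nonneg.2 (by exact_mod_cast hd)
  have hP : 2 ≤ p.toReal := by simpa using ENNReal.toReal_mono hp'.ne hp2
  have hPq : p.toReal < p₀.toReal := (ENNReal.toReal_lt_toReal hp'.ne hp₀'.ne).2 hpp
  have hx : recip p₀ = 1 / p₀.toReal := recip_eq_one_div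
  have hy : recip p = 1 / p.toReal := recip_eq_one_div
  rw [smoothnessThreshold, if_neg hp₀'.ne, hx, hy] at ht
  have h₂ := blockEst_of_two_lt_small_upper (hp₀ := hp₀) (t := t) hd hR hp₀2 hp₀'.ne
    (P := p.toReal) (by linarith) hPq.le
  have h₁ := fun u v hu hv huv hPuv => blockEst_of_two_lt_small_lower (hp₀ := hp₀) (t := t) hd hR
    hp₀2 hp₀'.ne (P := p.toReal) (by linarith) (u := u) (v := v) hu hv huv hPuv
  rw [hx] at h₂ h₁ ⊢
  set q := p₀.toReal
  set P := p.toReal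
  have hq2 : q - 2 ≠ 0 := by linarith
  have hq0 : q ≠ 0 := by linarith
  have hP0 : P ≠ 0 := by linarith
  -- The weights `u` and `v` are those of Lyapunov's inequality for `L_p` between `L₂` and `L_{p₀}`;
  -- the balance takes place at size `n^(p₀/2)`.
  refine upperOrder_of_two_blockEst hp hp' hD (b := q / 2) (by linarith)
    (h₁ ((q - P) / (q - 2)) ((P - 2) / (q - 2)) (div_nonneg (by linarith) (by linarith))
      (div_nonneg (by linarith) (by linarith)) (by field_simp; ring) (by field_simp; ring))
    (div_nonneg (div_nonneg (by linarith) (by linarith)) (by linarith)) ?_ h₂ le_rfl ht0 ?_ ?_ ?_ ?_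
  -- The upper bound on `t` is precisely the negativity of the first exponent of the estimate for
  -- the low blocks.
  · have : (1 / P - 1 / q) / (q / 2 - 1) = 1 / q - (P - 2) / (q - 2) / P := by
      have : q / 2 - 1 ≠ 0 := by linarith
      field_simp
      ring
    linarith
  · field_simp
    ring
  · ring
  · field_simp
    ring
  · ring

/-- The low blocks use the estimate at exponent `2`, which grows with `μ` because `t < 1/p₀ - 1/2`.
The high blocks use an exponent `1/z < 2`, where it decays. Both exponent sums equal `t`, and
neither estimate contains a power of `μ + 1`. -/
theorem upperOrder_rpow (hR : IndexGeometry d ψ₀ ψ₁ R) (hp₀2 : p₀ ≤ 2) (hp : 0 < p) (e : ℝ)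
    (ht : max (recip p₀ - recip p) 0 < t) (ht' : t < recip p₀ - 1 / 2) :
    UpperOrder d ψ₀ ψ₁ hp₀ t p 0 t e := by
  have ht1 := (le_max_left _ _).trans_lt ht
  have ht0 := (le_max_right _ _).trans_lt ht
  have hp₀' : p₀ ≠ ∞ := (hp₀2.trans_lt (by simp)).ne
  have hm1 := min_le_left (recip p₀) (recip p)
  have hm2 := min_le_right (recip p₀) (recip p)
  have hm : recip p₀ - t < min (recip p₀) (recip p) := lt_min (by linarith) (by linarith)
  -- Midpoint between `1/p₀ - t`, beyond which the high blocks decay, and the minimum of `1/p₀` and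
  -- `1/p`, which keeps `1/z` above `p₀` and not below `p`.
  set z := (recip p₀ - t + min (recip p₀) (recip p)) / 2 with hz
  have hz2 : 1 / 2 < z := by linarith
  have hz0 : 0 < z := by linarith
  have hzx : z < recip p₀ := by linarith
  have hzy : z ≤ recip p := by linarith
  have hzt : 0 < t - recip p₀ + z := by linarith
  have hP2 : 1 / z < 2 := by
    rw [div_lt_iff₀ hz0]
    linarith
  have hPr : (ENNReal.ofReal (1 / z)).toReal = 1 / z := ENNReal.toReal_ofReal (by positivity)
  have hq : 0 < p₀.toReal := ENNReal.toReal_pos hp₀.ne' hp₀'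
  have hqP : p₀.toReal < 1 / z := by
    rw [recip_eq_one_div, lt_div_iff₀ hq] at hzx
    rw [lt_div_iff₀ hz0]
    linarith
  have hple : p ≤ ENNReal.ofReal (1 / z) := by
    have hpt : p ≠ ∞ := by
      rintro rfl
      simp [recip] at hzy
      linarith
    have hP : 0 < p.toReal := ENNReal.toReal_pos hp.ne' hpt
    rw [ENNReal.le_ofReal_iff_toReal_le hpt (by positivity), le_div_iff₀ hz0]
    rw [recip_eq_one_div, le_div_iff₀ hP] at hzy
    linarith
  refine UpperOrder.of_le hR hp hple ENNReal.ofReal_lt_top ?_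
  have h₁ := (blockEst_of_le_two (d := d) (ψ₀ := ψ₀) (ψ₁ := ψ₁) (hp₀ := hp₀) (t := t) le_rfl
    hp₀2).of_le hR (P := 1 / z) (by positivity) hP2.le
  have hp₀2' : p₀ < 2 := hp₀2.lt_of_ne fun h => by
    rw [h, recip_two] at ht'
    linarith
  have h₂ := blockEst_of_lt_of_lt_two (d := d) (ψ₀ := ψ₀) (ψ₁ := ψ₁) (hp₀ := hp₀) (t := t) hp₀2'
    hqP hP2
  rw [one_div_one_div] at h₂
  rw [← hPr] at h₁ h₂
  -- The parameters `β₁` and `β₂` are multiplied by `D = 0` and only serve to satisfy the balance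
  -- equations.
  exact upperOrder_of_two_blockEst (α₁ := t - recip p₀ + 1 / 2) (α₂ := t - recip p₀ + z)
    (γ₁ := recip p₀ - 1 / 2) (γ₂ := recip p₀ - z) (β₁ := e - (t - recip p₀ + 1 / 2))
    (β₂ := e - (t - recip p₀ + z)) (hple.trans_lt' hp) ENNReal.ofReal_lt_top le_rfl one_pos
    (by rwa [zero_mul]) (by linarith) (by linarith) (by rwa [zero_mul]) (by linarith) hzt
    (by ring) (by ring) (by ring) (by ring)

end

end MixedWeyl

/-! ### Assembly of the eight ranges of parameters. -/

theorem mainTheorem8 (d : ℕ) (hd : 1 ≤ d) (N : ℕ) (ψ₀ ψ₁ : ℝ → ℂ)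
    (hψ : MixedWeyl.IsWaveletPair N ψ₀ ψ₁)
    (p₀ p : ℝ≥0∞) (hp₀ : 0 < p₀) (hp : 0 < p) (hp_fin : p < ∞) (t : ℝ) :
    -- the case `0 < p₀ ≤ 2 ≤ p < ∞`
    (p₀ ≤ 2 → 2 ≤ p → MixedWeyl.recip p₀ - MixedWeyl.recip p < t →
      MixedWeyl.WeylOrder d ψ₀ ψ₁ hp₀ hp t 2
        (MixedWeyl.polyLog d (t - 1 / 2 + MixedWeyl.recip p)
          (t + MixedWeyl.recip p - MixedWeyl.recip p₀))) ∧
    -- the case `2 ≤ p₀ ≤ p < ∞`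
    (2 ≤ p₀ → p₀ ≤ p → MixedWeyl.recip p₀ - MixedWeyl.recip p < t →
      MixedWeyl.WeylOrder d ψ₀ ψ₁ hp₀ hp t 2
        (MixedWeyl.polyLog d (t - MixedWeyl.recip p₀ + MixedWeyl.recip p)
          (t + MixedWeyl.recip p - MixedWeyl.recip p₀))) ∧
    -- the case `2 ≤ p < p₀ ≤ ∞`, large smoothness
    (2 ≤ p → p < p₀ → MixedWeyl.smoothnessThreshold p₀ p < t →
      MixedWeyl.WeylOrder d ψ₀ ψ₁ hp₀ hp t 2
        (MixedWeyl.polyLog d (t - MixedWeyl.recip p₀ + MixedWeyl.recip p)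
          (t + MixedWeyl.recip p - MixedWeyl.recip p₀))) ∧
    -- the case `2 ≤ p < p₀ < ∞`, small smoothness
    (2 ≤ p → p < p₀ → p₀ < ∞ → 0 < t → t < MixedWeyl.smoothnessThreshold p₀ p →
      MixedWeyl.WeylOrder d ψ₀ ψ₁ hp₀ hp t 2
        (MixedWeyl.polyLog d (t * p₀.toReal / 2) (t + 1 / 2 - MixedWeyl.recip p₀))) ∧
    -- the case `0 < p₀, p ≤ 2`, large smoothness
    (p₀ ≤ 2 → p ≤ 2 → max (MixedWeyl.recip p₀ - MixedWeyl.recip p) 0 < t →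
      MixedWeyl.recip p₀ - 1 / 2 < t →
      MixedWeyl.WeylOrder d ψ₀ ψ₁ hp₀ hp t 2
        (MixedWeyl.polyLog d t (t + 1 / 2 - MixedWeyl.recip p₀))) ∧
    -- the case `0 < p₀, p ≤ 2`, small smoothness
    (p₀ ≤ 2 → p ≤ 2 → max (MixedWeyl.recip p₀ - MixedWeyl.recip p) 0 < t →
      t < MixedWeyl.recip p₀ - 1 / 2 →
      MixedWeyl.WeylOrder d ψ₀ ψ₁ hp₀ hp t 1 (fun n => (n : ℝ) ^ (-t))) ∧
    -- the case `0 < p ≤ 2 < p₀ ≤ ∞`, large smoothness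
    (p ≤ 2 → 2 < p₀ → MixedWeyl.recip p₀ < t →
      MixedWeyl.WeylOrder d ψ₀ ψ₁ hp₀ hp t 2
        (MixedWeyl.polyLog d (t - MixedWeyl.recip p₀ + 1 / 2)
          (t + 1 / 2 - MixedWeyl.recip p₀))) ∧
    -- the case `0 < p ≤ 2 < p₀ < ∞`, small smoothness
    (p ≤ 2 → 2 < p₀ → p₀ < ∞ → 0 < t → t < MixedWeyl.recip p₀ →
      MixedWeyl.WeylOrder d ψ₀ ψ₁ hp₀ hp t 2
        (MixedWeyl.polyLog d (t * p₀.toReal / 2) (t + 1 / 2 - MixedWeyl.recip p₀))) := by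
  have : ∀ ν : Fin d → ℕ, Fintype (MixedWeyl.omegaIndex ψ₀ ψ₁ ν) := fun ν =>
    (MixedWeyl.finite_omegaIndex hψ ν).fintype
  obtain ⟨R, hR⟩ := MixedWeyl.exists_indexGeometry (d := d) hψ
  refine ⟨fun h0 h2 ht => ?_, fun h0 h2 ht => ?_, fun h2 h0 ht => ?_, fun h2 h0 h' ht0 ht => ?_,
    fun h0 h2 ht ht' => ?_, fun h0 h2 ht ht' => ?_, fun h2 h0 ht => ?_,
    fun h2 h0 h' ht0 ht => ?_⟩
  · have hx := MixedWeyl.half_le_recip hp₀ h0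
    refine MixedWeyl.weylOrder_polyLog (MixedWeyl.upperOrder_of_le_two hd hR h0 h2 hp_fin ht) ?_
    convert MixedWeyl.lowerOrder_level hd hR t hp₀ hp hp_fin using 1
    · rw [MixedWeyl.embeddingExponent, max_eq_left (by linarith)]
      ring
    · ring
  · have hx := MixedWeyl.recip_le_half h0
    refine MixedWeyl.weylOrder_polyLog ?_ ?_
    -- At `p₀ = 2` the two kinds of block estimates meet and the one for `p₀ ≤ 2` is used.
    · rcases h0.eq_or_lt with rfl | h02
      · convert MixedWeyl.upperOrder_of_le_two hd hR le_rfl h2 hp_fin ht using 2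
        rw [MixedWeyl.recip_two]
      · refine MixedWeyl.upperOrder_of_two_lt hd hR h02 (h0.trans h2) hp_fin ?_
        rw [max_eq_left (MixedWeyl.recip_le_recip hp₀ h2), sub_self, zero_div]
        linarith
    · convert MixedWeyl.lowerOrder_level hd hR t hp₀ hp hp_fin using 1
      · rw [MixedWeyl.embeddingExponent, max_eq_right (by linarith), add_zero]
      · ring
  · have h02 := h2.trans_lt h0
    have hx := MixedWeyl.recip_lt_half h02
    rw [MixedWeyl.smoothnessThreshold_eq h02] at ht
    refine MixedWeyl.weylOrder_polyLog (MixedWeyl.upperOrder_of_two_lt hd hR h02 h2 hp_fin ?_) ?_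
    · rw [max_eq_right (MixedWeyl.recip_lt_recip hp h0).le]
      linarith
    · convert MixedWeyl.lowerOrder_level hd hR t hp₀ hp hp_fin using 1
      · rw [MixedWeyl.embeddingExponent, max_eq_right (by linarith), add_zero]
      · ring
  · have h02 := h2.trans_lt h0
    -- The lower bound does not depend on `p` and is inherited from `p = 2`.
    exact MixedWeyl.weylOrder_polyLog (MixedWeyl.upperOrder_small hd hR h02 h' h2 h0 ht0 ht)
      ((MixedWeyl.lowerOrder_small_of_le_two hd hR t h02 h'.ne two_pos le_rfl).of_le hR two_pos h2
        hp_fin)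
  · have hx := MixedWeyl.half_le_recip hp₀ h0
    -- For `p ≤ 2` the upper bound at `p = 2` is already sharp in this range of `t`.
    have hU := MixedWeyl.upperOrder_of_le_two (hp₀ := hp₀) (t := t) hd hR h0 le_rfl (by simp)
      (by rwa [MixedWeyl.recip_two])
    rw [MixedWeyl.recip_two, sub_add_cancel] at hU
    refine MixedWeyl.weylOrder_polyLog (hU.of_le hR hp h2 (by simp)) ?_
    convert MixedWeyl.lowerOrder_level_of_le_two hd hR t hp₀ hp h2 using 1
    · rw [MixedWeyl.embeddingExponent, max_eq_left (by linarith)]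
      ring
    · ring
  · have hx := MixedWeyl.half_le_recip hp₀ h0
    refine MixedWeyl.weylOrder_rpow (MixedWeyl.upperOrder_rpow hR h0 hp _ ht ht')
      (e := t - MixedWeyl.recip p₀ + 1 / 2) ?_
    convert MixedWeyl.lowerOrder_single_of_le_two hd hR t hp₀ hp h2 using 1
    rw [MixedWeyl.embeddingExponent, max_eq_left (by linarith)]
    ring
  · have hx := MixedWeyl.recip_lt_half h0
    -- At `p = 2` the fraction in the summability condition equals `1/2`, so the condition reads `t
    -- > 1/p₀`.
    have hU := MixedWeyl.upperOrder_of_two_lt (hp₀ := hp₀) (t := t) hd hR h0 le_rfl (by simp) <| by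
      have h1 : 1 - 2 * MixedWeyl.recip p₀ ≠ 0 := by linarith
      have h3 : (1 / 2 - MixedWeyl.recip p₀) / (1 - 2 * MixedWeyl.recip p₀) = 1 / 2 := by
        rw [div_eq_iff h1]
        ring
      rw [MixedWeyl.recip_two, max_eq_right hx.le, h3]
      linarith
    rw [MixedWeyl.recip_two] at hU
    refine MixedWeyl.weylOrder_polyLog (hU.of_le hR hp h2 (by simp)) ?_
    convert MixedWeyl.lowerOrder_level_of_le_two hd hR t hp₀ hp h2 using 1
    · rw [MixedWeyl.embeddingExponent, max_eq_right (by linarith), add_zero]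
    · ring
  · have hx := MixedWeyl.recip_lt_half h0
    -- The upper bound is taken at `p = 2`, where the smoothness threshold equals `1/p₀`.
    refine MixedWeyl.weylOrder_polyLog ((MixedWeyl.upperOrder_small hd hR h0 h' le_rfl h0 ht0
      ?_).of_le hR hp h2 (by simp))
      (MixedWeyl.lowerOrder_small_of_le_two hd hR t h0 h'.ne hp h2)
    have h1 : 1 - 2 * MixedWeyl.recip p₀ ≠ 0 := by linarith
    have h3 : (1 / 2 - MixedWeyl.recip p₀) / (1 - 2 * MixedWeyl.recip p₀) = 1 / 2 := by
      rw [div_eq_iff h1]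
      ring
    rw [MixedWeyl.smoothnessThreshold_eq h0, MixedWeyl.recip_two, h3]
    linarith
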